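/- Let $k$ be a field, let $G$ be an affine algebraic group over $k$ (an affine group scheme of finite type), and let $X$ be a normal, proper, integral scheme over $k$ with $\mathcal O_X(X)^\times=k^\times$ (automatic if $k$ is algebraically closed, or if $X$ is geometrically integral), on which $G$ acts. For a $k$-scheme $T$, let $L_T$ denote the pullback of $L$ to $T\times X$. Consider: - $\mathrm{Hom}_{\mathrm{GpSch}}(G,k^\times)$, the group of homomorphisms of $k$-group schemes $\chi\colon G\to\mathbb G_m$; - $\mathrm{Pic}^G(X)$, the set of isomorphism classes of $G$-linearized line bundles on $X$, that is, of line bundles $L$ with an action of $G$ on the total space of $L$ which lifts the action on $X$ and commutes with the multiplication by scalars on the fibres; and $\mathrm{Pic}(X)$, the set of isomorphism classes of line bundles on $X$; - $\mathrm{Pic}(X)^G\subseteq\mathrm{Pic}(X)$, the set of classes of the $G$-invariant line bundles $L$: for all $k$-schemes $T$ and $g\in G(T)$, the line bundles $g^*L_T$ and $L_T$ on $T\times X$ are isomorphic locally on $T$; - $\mathrm{Ext}^1_{\mathrm{GpSch}}(G,k^\times)$, the set of isomorphism classes of extensions $1\to\mathbb G_m\to E\to G\to1$ of affine $k$-group schemes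 ($E\to G$ faithfully flat with kernel $\mathbb G_m$) in which $G$ acts trivially on $\mathbb G_m$ by conjugation. The tensor product makes $\mathrm{Pic}^G(X)$ and $\mathrm{Pic}(X)$ abelian groups, the Baer sum makes $\mathrm{Ext}^1_{\mathrm{GpSch}}(G,k^\times)$ an abelian group, $\mathrm{Pic}(X)^G$ is a subgroup of $\mathrm{Pic}(X)$, and there is an exact sequence of abelian groups $$0\to\mathrm{Hom}_{\mathrm{GpSch}}(G,k^\times)\to\mathrm{Pic}^G(X)\to\mathrm{Pic}(X)^G\xrightarrow{\ \epsilon\ }\mathrm{Ext}^1_{\mathrm{GpSch}}(G,k^\times).$$ The first map sends $\chi$ to the trivial bundle $X\times\mathbb A^1$ with the linearization $g\cdot(x,a)=(gx,\chi(g)a)$, and the second map forgets the linearization. For a $G$-invariant line bundle $L$, the functor that sends a $k$-scheme $T$ to the group of pairs $(g,\varphi)$, where $g\in G(T)$ and $\varphi$ is an automorphism of the total space of $L_T$ which lies over the automorphism $g$ of $T\times X$ and commutes with the multiplication by scalars, is represented by a group scheme $\mathcal G(L)$ (the lifting group), which is an extension of $G$ by the group $\mathbb G_m$ of scalars; and $\epsilon(L)$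 is the class of this extension. -/

import Mathlib

open CategoryTheory Limits MonoidalCategory CartesianMonoidalCategory AlgebraicGeometry
open scoped MonObj LaurentPolynomial

universe u

noncomputable section

namespace EquivPic

/-! All schemes are schemes over a field `k`, that is, objects of `Over (Spec (.of k))`, a category
with its cartesian monoidal structure given by the fibre product over `k`. For `T`-valued points
`g : T ⟶ G` and `x : T ⟶ X` of a group object `G` acting on `X` (`ModObj G X`), the `T`-valued point
`g • x : T ⟶ X` is Mathlib's; `lift x y : T ⟶ X ⊗ Y` is the pair `(x, y)`. -/

variable {k : Type u} [Field k]

variable (k) in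
/-- The multiplicative group `𝔾ₘ = Spec k[T, T⁻¹]`. Its group structure is the instance which
Mathlib derives from the Hopf algebra structure of `k[T, T⁻¹]`, in which `T` is group-like. -/
abbrev Gm : Over (Spec (.of k)) :=
  (Spec (.of k[T;T⁻¹])).asOver (Spec (.of k))

variable (k) in
/-- The affine line over `k`. -/
abbrev A1 : Over (Spec (.of k)) :=
  Over.mk (𝔸(PUnit.{u + 1}; Spec (.of k)) ↘ Spec (.of k))

/-- The function on `T` which a `T`-valued point of the affine line is. -/
def A1.coord {T : Over (Spec (.of k))} (a : T ⟶ A1 k) : Γ(T.left, ⊤) :=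
  a.left.appTop (AffineSpace.coord (Spec (.of k)) PUnit.unit)

/-- The `T`-valued point of the affine line which a function on `T` is. -/
def A1.ofFun {T : Over (Spec (.of k))} (f : Γ(T.left, ⊤)) : T ⟶ A1 k :=
  Over.homMk (AffineSpace.homOfVector T.hom fun _ ↦ f) (AffineSpace.homOfVector_over _ _)

/-- The product of two `T`-valued points of the affine line. -/
def A1.mul {T : Over (Spec (.of k))} (a b : T ⟶ A1 k) : T ⟶ A1 k :=
  A1.ofFun (A1.coord a * A1.coord b)

/-- The (invertible) function on `T` which a `T`-valued point of `𝔾ₘ` is. -/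
def Gm.coord {T : Over (Spec (.of k))} (t : T ⟶ Gm k) : Γ(T.left, ⊤) :=
  t.left.appTop ((Scheme.ΓSpecIso (.of k[T;T⁻¹])).inv (LaurentPolynomial.T 1 : k[T;T⁻¹]))

/-- The scalar multiplication of `𝔾ₘ` on the affine line, on `T`-valued points. -/
def A1.scale {T : Over (Spec (.of k))} (t : T ⟶ Gm k) (a : T ⟶ A1 k) : T ⟶ A1 k :=
  A1.ofFun (Gm.coord t * A1.coord a)

/-- An open subscheme `U` of `X`, as a scheme over `k`. -/
abbrev opn (X : Over (Spec (.of k))) (U : X.left.Opens) : Over (Spec (.of k)) :=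
  Over.mk (U.ι ≫ X.hom)

/-- The inclusion of an open subscheme. -/
abbrev opnι (X : Over (Spec (.of k))) (U : X.left.Opens) : opn X U ⟶ X :=
  Over.homMk U.ι

/-! ### Line bundles -/

/-- A trivialization over the open subscheme `U` of `X` of a scheme `p : L ⟶ X` over `X` with a
`𝔾ₘ`-action: a `𝔾ₘ`-equivariant isomorphism of `U × 𝔸¹` with the part of `L` over `U`. -/
structure Trivialization {X L : Over (Spec (.of k))} [ModObj (Gm k) L] (p : L ⟶ X)
    (U : X.left.Opens) where
  /-- The isomorphism onto the part over `U`, as a morphism to `L`. -/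
  hom : opn X U ⊗ A1 k ⟶ L
  isPullback : IsPullback hom (fst _ _) p (opnι X U)
  smul : ∀ {T : Over (Spec (.of k))} (t : T ⟶ Gm k) (x : T ⟶ opn X U) (a : T ⟶ A1 k),
    lift x (A1.scale t a) ≫ hom = t • (lift x a ≫ hom)

/-- A (geometric) line bundle `L ⟶ X`, with the action of `𝔾ₘ` by multiplication on the fibres:
Zariski locally on `X` it is `U × 𝔸¹`, with `𝔾ₘ` acting on `𝔸¹` by multiplication. (The
`𝔾ₘ`-equivariant automorphisms of `U × 𝔸¹` over `U` are the multiplications by units of `U`, so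
this determines the linear structure of the fibres.) -/
structure LineBundle (X : Over (Spec (.of k))) where
  /-- The total space. -/
  tot : Over (Spec (.of k))
  /-- The projection. -/
  proj : tot ⟶ X
  /-- The multiplication by scalars. -/
  [scalar : ModObj (Gm k) tot]
  smul_proj : ∀ {T : Over (Spec (.of k))} (t : T ⟶ Gm k) (l : T ⟶ tot), (t • l) ≫ proj = l ≫ proj
  locTriv : ∀ x : X.left, ∃ U : X.left.Opens, x ∈ U ∧ Nonempty (Trivialization proj U)

attribute [instance] LineBundle.scalar

namespace LineBundle

variable {X : Over (Spec (.of k))}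

/-- `f` is an isomorphism of line bundles over `X`. -/
structure IsBundleIso (L M : LineBundle X) (f : L.tot ≅ M.tot) : Prop where
  proj : f.hom ≫ M.proj = L.proj
  smul : ∀ {T : Over (Spec (.of k))} (t : T ⟶ Gm k) (l : T ⟶ L.tot),
    (t • l) ≫ f.hom = t • (l ≫ f.hom)

lemma IsBundleIso.refl (L : LineBundle X) : IsBundleIso L L (Iso.refl _) :=
  ⟨by simp, by simp⟩

lemma IsBundleIso.symm {L M : LineBundle X} {f : L.tot ≅ M.tot} (h : IsBundleIso L M f) :
    IsBundleIso M L f.symm :=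
  ⟨by simp [← h.proj], fun t l ↦ by
    rw [← cancel_mono f.hom]
    simp [h.smul]⟩

lemma IsBundleIso.trans {L M N : LineBundle X} {f : L.tot ≅ M.tot} {g : M.tot ≅ N.tot}
    (h : IsBundleIso L M f) (h' : IsBundleIso M N g) : IsBundleIso L N (f ≪≫ g) :=
  ⟨by simp [← h.proj, ← h'.proj], fun t l ↦ by
    simp only [Iso.trans_hom, ← Category.assoc, h.smul, h'.smul]⟩

instance setoid (X : Over (Spec (.of k))) : Setoid (LineBundle X) where
  r L M := ∃ f : L.tot ≅ M.tot, IsBundleIso L M f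
  iseqv :=
    ⟨fun L ↦ ⟨_, .refl L⟩, fun ⟨_, h⟩ ↦ ⟨_, h.symm⟩, fun ⟨_, h⟩ ⟨_, h'⟩ ↦ ⟨_, h.trans h'⟩⟩

/-- `β : L ×_X M ⟶ N`, `(l, m) ↦ l ⊗ m`, makes `N` the tensor product of the line bundles `L` and
`M`: locally on `X` there are trivializations of `L`, `M` and `N` in which `β` is the
multiplication `𝔸¹ × 𝔸¹ ⟶ 𝔸¹`. -/
def IsTensorMap (L M N : LineBundle X) (β : pullback L.proj M.proj ⟶ N.tot) : Prop :=
  ∀ x : X.left, ∃ U : X.left.Opens, x ∈ U ∧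
    ∃ (eL : Trivialization L.proj U) (eM : Trivialization M.proj U) (eN : Trivialization N.proj U),
      ∀ {T : Over (Spec (.of k))} (y : T ⟶ opn X U) (a b : T ⟶ A1 k),
        pullback.lift (lift y a ≫ eL.hom) (lift y b ≫ eM.hom)
            (by rw [Category.assoc, Category.assoc, eL.isPullback.w, eM.isPullback.w,
              lift_fst_assoc, lift_fst_assoc]) ≫ β =
          lift y (A1.mul a b) ≫ eN.hom

/-- `N` is a tensor product of the line bundles `L` and `M`. -/
def IsTensor (L M N : LineBundle X) : Prop :=
  ∃ β : pullback L.proj M.proj ⟶ N.tot, IsTensorMap L M N β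

end LineBundle

/-- The Picard group of `X`, as the set of isomorphism classes of line bundles. -/
def Pic (X : Over (Spec (.of k))) : Type (u + 1) :=
  Quotient (LineBundle.setoid X)

/-- The class of a line bundle. -/
def Pic.mk {X : Over (Spec (.of k))} (L : LineBundle X) : Pic X :=
  Quotient.mk _ L

/-! ### Linearized line bundles -/

/-- A `G`-linearized line bundle on a scheme `X` with an action of `G`: a line bundle with an
action of `G` on its total space which lifts the action on `X` and is linear on the fibres. -/
structure LinLineBundle (G X : Over (Spec (.of k))) [GrpObj G] [ModObj G X] extends
    LineBundle X where
  /-- The action on the total space. -/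
  [action : ModObj G tot]
  equivariant : ∀ {T : Over (Spec (.of k))} (g : T ⟶ G) (l : T ⟶ tot),
    (g • l) ≫ proj = g • (l ≫ proj)
  linear : ∀ {T : Over (Spec (.of k))} (g : T ⟶ G) (t : T ⟶ Gm k) (l : T ⟶ tot),
    g • (t • l) = t • (g • l)

attribute [instance] LinLineBundle.action

namespace LinLineBundle

variable {G X : Over (Spec (.of k))} [GrpObj G] [ModObj G X]

/-- `f` is an isomorphism of `G`-linearized line bundles over `X`. -/
structure IsLinIso (L M : LinLineBundle G X) (f : L.tot ≅ M.tot) : Prop where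
  bundle : LineBundle.IsBundleIso L.toLineBundle M.toLineBundle f
  action : ∀ {T : Over (Spec (.of k))} (g : T ⟶ G) (l : T ⟶ L.tot),
    (g • l) ≫ f.hom = g • (l ≫ f.hom)

variable (G X) in
instance setoid : Setoid (LinLineBundle G X) where
  r L M := ∃ f : L.tot ≅ M.tot, IsLinIso L M f
  iseqv :=
    ⟨fun L ↦ ⟨_, .refl L.toLineBundle, by simp⟩,
      fun ⟨f, h⟩ ↦ ⟨_, h.bundle.symm, fun g l ↦ by
        rw [← cancel_mono f.hom]
        simp [h.action]⟩,
      fun ⟨f, h⟩ ⟨f', h'⟩ ↦ ⟨_, h.bundle.trans h'.bundle, fun g l ↦ by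
        simp only [Iso.trans_hom, ← Category.assoc, h.action, h'.action]⟩⟩

/-- `N` is a tensor product of the `G`-linearized line bundles `L` and `M`: a tensor product of
line bundles, with `g • (l ⊗ m) = (g • l) ⊗ (g • m)`. -/
def IsTensor (L M N : LinLineBundle G X) : Prop :=
  ∃ β : pullback L.proj M.proj ⟶ N.tot,
    LineBundle.IsTensorMap L.toLineBundle M.toLineBundle N.toLineBundle β ∧
    ∀ {T : Over (Spec (.of k))} (g : T ⟶ G) (l : T ⟶ L.tot) (m : T ⟶ M.tot)
      (h : l ≫ L.proj = m ≫ M.proj),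
      pullback.lift (g • l) (g • m) (by rw [L.equivariant, M.equivariant, h]) ≫ β =
        g • (pullback.lift l m h ≫ β)

/-- `L` is isomorphic to the trivial line bundle `X × 𝔸¹` on which `G` acts by
`g • (x, a) = (g • x, χ(g) a)`. -/
def IsTrivialTwist (χ : G ⟶ Gm k) (L : LinLineBundle G X) : Prop :=
  ∃ f : X ⊗ A1 k ≅ L.tot, f.hom ≫ L.proj = fst _ _ ∧
    (∀ {T : Over (Spec (.of k))} (t : T ⟶ Gm k) (x : T ⟶ X) (a : T ⟶ A1 k),
      lift x (A1.scale t a) ≫ f.hom = t • (lift x a ≫ f.hom)) ∧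
    ∀ {T : Over (Spec (.of k))} (g : T ⟶ G) (x : T ⟶ X) (a : T ⟶ A1 k),
      lift (g • x) (A1.scale (g ≫ χ) a) ≫ f.hom = g • (lift x a ≫ f.hom)

end LinLineBundle

/-- The equivariant Picard group of `X`, as the set of isomorphism classes of `G`-linearized line
bundles. -/
def PicG (G X : Over (Spec (.of k))) [GrpObj G] [ModObj G X] : Type (u + 1) :=
  Quotient (LinLineBundle.setoid G X)

/-- The class of a linearized line bundle. -/
def PicG.mk {G X : Over (Spec (.of k))} [GrpObj G] [ModObj G X] (L : LinLineBundle G X) :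
    PicG G X :=
  Quotient.mk _ L

/-! ### Invariant line bundles -/

/-- For a `T`-valued point `g` of `G`, with automorphism `g` of `T × X` over `T`: the morphism
`(s, l) ↦ φ(s, l)` defines an automorphism `(s, l) ↦ (s, φ(s, l))` of the total space `T × L` of
the pullback of `L` to `T × X` which lies over `g` and commutes with the multiplication by scalars.
Such automorphisms of `T × L` correspond to the isomorphisms of line bundles `L_T ≅ g^* L_T` on
`T × X`. -/
structure IsLift {G X : Over (Spec (.of k))} [GrpObj G] [ModObj G X] (L : LineBundle X)
    {T : Over (Spec (.of k))} (g : T ⟶ G) (φ : T ⊗ L.tot ⟶ L.tot) : Prop where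
  covers : φ ≫ L.proj = (fst T L.tot ≫ g) • (snd T L.tot ≫ L.proj)
  smul : ∀ {Z : Over (Spec (.of k))} (s : Z ⟶ T) (t : Z ⟶ Gm k) (l : Z ⟶ L.tot),
    lift s (t • l) ≫ φ = t • (lift s l ≫ φ)
  isIso : IsIso (lift (fst T L.tot) φ)

/-- The line bundle `L` is `G`-invariant: the homomorphism from `G` to the automorphism group
functor of `X` has its image in the stabilizer of `L`, that is, for every scheme `T` over `k` and
`g ∈ G(T)`, locally on `T`, the line bundles `L_T` and `g^* L_T` on `T × X` are isomorphic. -/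
def IsInvariant (G : Over (Spec (.of k))) [GrpObj G] {X : Over (Spec (.of k))} [ModObj G X]
    (L : LineBundle X) : Prop :=
  ∀ (T : Over (Spec (.of k))) (g : T ⟶ G) (s : T.left),
    ∃ U : T.left.Opens, s ∈ U ∧ ∃ φ : opn T U ⊗ L.tot ⟶ L.tot, IsLift L (opnι T U ≫ g) φ

/-! ### Extensions of group schemes -/

/-- An extension `1 → 𝔾ₘ → E → G → 1` of affine group schemes over `k` in which the action of `G`
on `𝔾ₘ` by conjugation is trivial: `quot` is faithfully flat, with kernel `incl`. -/
structure GmExt (G : Over (Spec (.of k))) [GrpObj G] where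
  /-- The middle term. -/
  E : Over (Spec (.of k))
  [grp : GrpObj E]
  [affine : IsAffine E.left]
  /-- The inclusion of the kernel. -/
  incl : Gm k ⟶ E
  [incl_hom : IsMonHom incl]
  /-- The quotient map. -/
  quot : E ⟶ G
  [quot_hom : IsMonHom quot]
  central : ∀ {T : Over (Spec (.of k))} (t : T ⟶ Gm k) (e : T ⟶ E), (t ≫ incl) * e = e * (t ≫ incl)
  isKernel : IsPullback incl (toUnit (Gm k)) quot η[G]
  flat : Flat quot.left
  surjective : Surjective quot.left

attribute [instance] GmExt.grp GmExt.affine GmExt.incl_hom GmExt.quot_hom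

namespace GmExt

variable {G : Over (Spec (.of k))} [GrpObj G]

/-- Isomorphism of extensions: an isomorphism of the middle terms which induces the identity on
`𝔾ₘ` and on `G`. -/
instance setoid (G : Over (Spec (.of k))) [GrpObj G] : Setoid (GmExt G) where
  r A B := ∃ f : A.E ≅ B.E, IsMonHom f.hom ∧ A.incl ≫ f.hom = B.incl ∧ f.hom ≫ B.quot = A.quot
  iseqv :=
    ⟨fun _ ↦ ⟨Iso.refl _, by dsimp; infer_instance, by simp, by simp⟩,
      fun ⟨f, h, hi, hq⟩ ↦ ⟨f.symm, by dsimp; infer_instance, by simp [← hi], by simp [← hq]⟩,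
      fun ⟨f, h, hi, hq⟩ ⟨f', h', hi', hq'⟩ ↦ ⟨f ≪≫ f', by dsimp; infer_instance,
        by simp [← hi', ← hi], by simp [← hq', ← hq]⟩⟩

/-- `C` is a Baer sum of the extensions `A` and `B`: there is a homomorphism of group schemes
`A ×_G B ⟶ C` over `G` which is the multiplication `𝔾ₘ × 𝔾ₘ ⟶ 𝔾ₘ` on the kernels, so that `C` is
the pushout of the extension `A ×_G B` of `G` by `𝔾ₘ × 𝔾ₘ` along that multiplication. -/
def IsBaerSum (A B C : GmExt G) : Prop :=
  ∃ β : pullback A.quot B.quot ⟶ C.E,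
    β ≫ C.quot = pullback.fst A.quot B.quot ≫ A.quot ∧
    (∀ {T : Over (Spec (.of k))} (a a' : T ⟶ A.E) (b b' : T ⟶ B.E) (h : a ≫ A.quot = b ≫ B.quot)
      (h' : a' ≫ A.quot = b' ≫ B.quot),
      pullback.lift (a * a') (b * b')
          (by rw [MonObj.mul_comp, MonObj.mul_comp, h, h']) ≫ β =
        (pullback.lift a b h ≫ β) * (pullback.lift a' b' h' ≫ β)) ∧
    ∀ {T : Over (Spec (.of k))} (s t : T ⟶ Gm k),
      pullback.lift (s ≫ A.incl) (t ≫ B.incl)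
          (by simp [A.isKernel.w, B.isKernel.w]) ≫ β =
        (s * t) ≫ C.incl

/-- The extension `E` is the lifting group of the line bundle `L` on `X`: the group scheme `E` acts
on the total space of `L`, the subgroup `𝔾ₘ` by scalars, and this action identifies, for every
`T`, the group `E(T)` with the group of the pairs of `g ∈ G(T)` and an automorphism of the line
bundle `T × L` over `g` which commutes with the multiplication by scalars. -/
def IsLiftingGroup {X : Over (Spec (.of k))} [ModObj G X] (L : LineBundle X) (A : GmExt G) : Prop :=
  ∃ _ : ModObj A.E L.tot,
    (∀ {T : Over (Spec (.of k))} (t : T ⟶ Gm k) (l : T ⟶ L.tot), (t ≫ A.incl) • l = t • l) ∧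
    (∀ {T : Over (Spec (.of k))} (e : T ⟶ A.E),
      IsLift L (e ≫ A.quot) ((fst T L.tot ≫ e) • snd T L.tot)) ∧
    ∀ {T : Over (Spec (.of k))} (g : T ⟶ G) (φ : T ⊗ L.tot ⟶ L.tot), IsLift L g φ →
      ∃! e : T ⟶ A.E, e ≫ A.quot = g ∧ (fst T L.tot ≫ e) • snd T L.tot = φ

end GmExt

/-- `Ext¹(G, 𝔾ₘ)` in group schemes, as the set of isomorphism classes of extensions. -/
def Ext1 (G : Over (Spec (.of k))) [GrpObj G] : Type (u + 1) :=
  Quotient (GmExt.setoid G)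

/-- The class of an extension. -/
def Ext1.mk {G : Over (Spec (.of k))} [GrpObj G] (A : GmExt G) : Ext1 G :=
  Quotient.mk _ A

/-- `Hom(G, 𝔾ₘ)` in group schemes, a commutative group under the multiplication of `𝔾ₘ`. -/
abbrev GrpHom (G : Over (Spec (.of k))) [GrpObj G] : Type u :=
  (⟨G⟩ : Grp (Over (Spec (.of k)))) ⟶ ⟨Gm k⟩

end EquivPic

end

noncomputable section

namespace EquivPic

variable {k : Type u} [Field k]

section

/-! ### Local properties of morphisms of schemes over `k` -/

/-! The argument works with points valued in arbitrary test schemes `T`. Since `𝔾ₘ` is schematically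
dense in `𝔸¹`, a `𝔾ₘ`-equivariant map between lines is multiplication by a function
(`A1.linear_of_equivariant`). It is therefore determined by its value at a generator (`IsGen`), and
two generators over the same point differ by a unique unit. Isomorphisms, pairings and lifts are
accordingly prescribed as relations between generators; they are found locally and glued
(`exists_glue`, `exists_eqFam`).

The geometric input is `𝒪(X) = k`, which properness, integrality and the condition on units provide
(`isIso_appTop_of_units`). By flat base change and descent every function on `T × X` comes from `T`
(`exists_const`), so two lifts of `g ∈ G(T)` to `L` differ by a unit of `T` (`IsLift.exists_unit`).
If `L` is invariant, lifts exist locally. They then form a Zariski `𝔾ₘ`-torsor over `G`, which is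
representable (`exists_torsor`), and composition of lifts makes it a central extension, the lifting
group (`exists_isLiftingGroup`).

Exactness follows. If `σ` is a generating section of a linearized bundle, then `g • σ(x) = c(g, x)
σ(g x)` with a unit `c` on `G × X`. This unit comes from `G` and is a character, so the
linearizations of the trivial bundle are those given by characters. An isomorphism of two of them
changes `σ` by a unit of `X`, a constant, which leaves the character unchanged; this is injectivity
of the first map. A linearization of `L` is a homomorphic section of the lifting group, equivalently
a retraction onto `𝔾ₘ` (`GmExt.IsSplit`), and the trivial classes of extensions are the split ones.
The connecting map is a homomorphism because the action of pairs of lifts on products `l ⊗ m`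
exhibits the lifting group of a tensor product as a Baer sum (`GmExt.IsLiftingGroup.isBaerSum`).

For the group structures, quotients come before products. `Hom(L, M)` is glued from charts `U × 𝔸¹`
(`exists_representing`, `exists_div`), and `L ⊗ M` is then `Hom(Hom(L, 𝒪), M)`. Likewise `B - A`,
for extensions, is the torsor of equivariant maps from the fibres of `A` to those of `B`
(`GmExt.exists_sub`), and sums follow by negation. This needs extensions to be trivial Zariski
locally, not only flat locally: the functions on the affine scheme `E` are graded by their weights
under `𝔾ₘ`, and a function of weight one which does not vanish gives a section
(`IsPseudoTorsor.loc_section`). The group axioms are checked on relations up to isomorphism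
(`exists_commGroup`). -/

instance (X : Over (Spec (.of k))) (U : X.left.Opens) : Mono (opnι X U) :=
  Over.mono_of_mono_left _

/-- A property of morphisms to `T` holds for the inclusions of the members of an open cover. -/
def Loc (T : Over (Spec (.of k))) (P : ∀ ⦃T' : Over (Spec (.of k))⦄, (T' ⟶ T) → Prop) : Prop :=
  ∀ s : T.left, ∃ U : T.left.Opens, s ∈ U ∧ P (opnι T U)

/-- A property of morphisms to `T` is stable under composition on the left. -/
def Stab {T : Over (Spec (.of k))} (P : ∀ ⦃T' : Over (Spec (.of k))⦄, (T' ⟶ T) → Prop) : Prop :=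
  ∀ ⦃T' T'' : Over (Spec (.of k))⦄ (j : T' ⟶ T) (i : T'' ⟶ T'), P j → P (i ≫ j)

/-- The factorization of a morphism through an open subscheme. -/
def opnLift {T X : Over (Spec (.of k))} (x : T ⟶ X) (U : X.left.Opens)
    (h : ∀ s, x.left s ∈ U) : T ⟶ opn X U :=
  have h' : Set.range x.left ⊆ Set.range U.ι := by
    rw [Scheme.Opens.range_ι]
    exact Set.range_subset_iff.2 h
  Over.homMk (IsOpenImmersion.lift U.ι x.left h')
    ((IsOpenImmersion.lift_fac_assoc U.ι x.left h' X.hom).trans (Over.w x))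

@[simp]
lemma opnLift_ι {T X : Over (Spec (.of k))} (x : T ⟶ X) (U : X.left.Opens)
    (h : ∀ s, x.left s ∈ U) : opnLift x U h ≫ opnι X U = x := by
  ext1
  exact IsOpenImmersion.lift_fac _ _ _

@[simp]
lemma opnLift_ι_assoc {T X Z : Over (Spec (.of k))} (x : T ⟶ X) (U : X.left.Opens)
    (h : ∀ s, x.left s ∈ U) (f : X ⟶ Z) : opnLift x U h ≫ opnι X U ≫ f = x ≫ f := by
  rw [← Category.assoc, opnLift_ι]

lemma opnι_mem {X : Over (Spec (.of k))} (U : X.left.Opens) (s : (opn X U).left) :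
    (opnι X U).left s ∈ U := by
  exact s.2

lemma comp_opnι_mem {T X : Over (Spec (.of k))} (U : X.left.Opens) (x : T ⟶ opn X U)
    (s : T.left) : (x ≫ opnι X U).left s ∈ U :=
  (x.left s).2

lemma exists_preimage_lift {T T' : Over (Spec (.of k))} (f : T' ⟶ T) (U : T.left.Opens) :
    ∃ y : opn T' (f.left ⁻¹ᵁ U) ⟶ opn T U, y ≫ opnι T U = opnι T' (f.left ⁻¹ᵁ U) ≫ f :=
  ⟨opnLift (opnι T' (f.left ⁻¹ᵁ U) ≫ f) U (fun s : ↥(f.left ⁻¹ᵁ U) ↦ s.2), opnLift_ι _ _ _⟩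

lemma Loc.and {T : Over (Spec (.of k))}
    {P Q : ∀ ⦃T' : Over (Spec (.of k))⦄, (T' ⟶ T) → Prop} (hP : Loc T P) (hQ : Loc T Q)
    (sP : Stab P) (sQ : Stab Q) : Loc T fun _ j ↦ P j ∧ Q j := by
  intro s
  obtain ⟨U, hU, hPU⟩ := hP s
  obtain ⟨V, hV, hQV⟩ := hQ s
  refine ⟨U ⊓ V, ⟨hU, hV⟩, ?_, ?_⟩
  · rw [← opnLift_ι (opnι T (U ⊓ V)) U fun s ↦ (opnι_mem _ s).1]
    exact sP _ _ hPU
  · rw [← opnLift_ι (opnι T (U ⊓ V)) V fun s ↦ (opnι_mem _ s).2]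
    exact sQ _ _ hQV

lemma Loc.mono {T : Over (Spec (.of k))}
    {P Q : ∀ ⦃T' : Over (Spec (.of k))⦄, (T' ⟶ T) → Prop} (hP : Loc T P)
    (h : ∀ ⦃T'⦄ (j : T' ⟶ T), P j → Q j) : Loc T Q := fun s ↦ by
  obtain ⟨U, hU, hPU⟩ := hP s
  exact ⟨U, hU, h _ hPU⟩

lemma Loc.pullback {T T' : Over (Spec (.of k))}
    {P : ∀ ⦃T' : Over (Spec (.of k))⦄, (T' ⟶ T) → Prop} (hP : Loc T P) (sP : Stab P)
    (f : T' ⟶ T) : Loc T' fun _ j ↦ P (j ≫ f) := fun s ↦ by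
  obtain ⟨U, hU, hPU⟩ := hP (f.left s)
  refine ⟨f.left ⁻¹ᵁ U, hU, ?_⟩
  obtain ⟨y, hy⟩ := exists_preimage_lift f U
  rw [← hy]
  exact sP _ _ hPU

/-- The image of an open subscheme of an open subscheme. -/
lemma exists_opn_opn {T : Over (Spec (.of k))} (U : T.left.Opens) (V : (opn T U).left.Opens) :
    ∃ i : opn T (U.ι ''ᵁ V) ⟶ opn (opn T U) V, i ≫ opnι _ V ≫ opnι T U = opnι T (U.ι ''ᵁ V) := by
  have h : ∀ s, (opnι T (U.ι ''ᵁ V)).left s ∈ U := fun s ↦ by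
    obtain ⟨x, -, hx⟩ := opnι_mem _ s
    rw [← hx]
    exact x.2
  refine ⟨opnLift (opnLift (opnι T _) U h) V fun s ↦ ?_, by simp⟩
  obtain ⟨x, hx, hx'⟩ := opnι_mem _ s
  have : (opnLift (opnι T _) U h).left s = x := by
    apply U.ι.isOpenEmbedding.injective
    refine Eq.trans ?_ hx'.symm
    exact congr($(congr(($(opnLift_ι (opnι T (U.ι ''ᵁ V)) U h)).left)) s)
  rwa [this]

lemma Loc.trans {T : Over (Spec (.of k))}
    {P Q : ∀ ⦃T' : Over (Spec (.of k))⦄, (T' ⟶ T) → Prop} (hP : Loc T P) (sQ : Stab Q)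
    (h : ∀ ⦃T'⦄ (j : T' ⟶ T), P j → Loc T' fun _ i ↦ Q (i ≫ j)) : Loc T Q := fun s ↦ by
  obtain ⟨U, hU, hPU⟩ := hP s
  obtain ⟨V, hV, hQ⟩ := h _ hPU ⟨s, hU⟩
  obtain ⟨i, hi⟩ := exists_opn_opn U V
  refine ⟨U.ι ''ᵁ V, ⟨_, hV, rfl⟩, ?_⟩
  rw [← hi]
  exact sQ _ _ hQ

lemma Loc.of_forall {T : Over (Spec (.of k))}
    {P : ∀ ⦃T' : Over (Spec (.of k))⦄, (T' ⟶ T) → Prop} (h : P (𝟙 T)) (sP : Stab P) :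
    Loc T P := fun s ↦ ⟨⊤, trivial, by simpa using sP _ (opnι T ⊤) h⟩

/-- The open cover of `T` given by an open neighbourhood of each point. -/
abbrev nhdCover {T : Over (Spec (.of k))} (U : T.left → T.left.Opens) (hU : ∀ s, s ∈ U s) :
    T.left.OpenCover :=
  T.left.openCoverOfIsOpenCover U (by
    rw [TopologicalSpace.IsOpenCover, eq_top_iff]
    exact fun s _ ↦ TopologicalSpace.Opens.mem_iSup.2 ⟨s, hU s⟩)

lemma hom_ext_loc {T Z : Over (Spec (.of k))} {f g : T ⟶ Z}
    (h : Loc T fun _ j ↦ j ≫ f = j ≫ g) : f = g := by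
  choose U hU hfg using h
  ext1
  refine (nhdCover U hU).hom_ext _ _ fun s ↦ ?_
  exact congr(($(hfg s)).left)

/-- A locally defined functional relation between points of `T` and of `Z` is a morphism. -/
theorem exists_glue {T Z : Over (Spec (.of k))}
    (R : ∀ ⦃T' : Over (Spec (.of k))⦄, (T' ⟶ T) → (T' ⟶ Z) → Prop)
    (stab : ∀ ⦃T' T'' : Over (Spec (.of k))⦄ (f : T' ⟶ T) (h : T' ⟶ Z) (g : T'' ⟶ T'),
      R f h → R (g ≫ f) (g ≫ h))
    (uniq : ∀ ⦃T' : Over (Spec (.of k))⦄ (f : T' ⟶ T) (h h' : T' ⟶ Z), R f h → R f h' → h = h')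
    (ex : Loc T fun _ j ↦ ∃ h, R j h) :
    ∃ h : T ⟶ Z, ∀ ⦃T' : Over (Spec (.of k))⦄ (f : T' ⟶ T) (h' : T' ⟶ Z),
      R f h' → f ≫ h = h' := by
  choose U hU h hR using ex
  -- Any scheme mapping compatibly to two members of the cover satisfies the relation with both
  -- local values, so uniqueness makes them agree there, in particular on the overlap.
  have comp (s t : T.left) {W : Over (Spec (.of k))} (a : W ⟶ opn T (U s)) (b : W ⟶ opn T (U t))
      (hab : a ≫ opnι T _ = b ≫ opnι T _) : a ≫ h s = b ≫ h t :=
    uniq _ _ _ (stab _ _ a (hR s)) (hab ▸ stab _ _ b (hR t))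
  let g : T.left ⟶ Z.left := (nhdCover U hU).glueMorphisms (fun s ↦ (h s).left) fun s t ↦ by
    let W : Over (Spec (.of k)) :=
      Over.mk (pullback.fst ((nhdCover U hU).f s) ((nhdCover U hU).f t) ≫ (opn T (U s)).hom)
    let a : W ⟶ opn T (U s) := Over.homMk (pullback.fst _ _)
    let b : W ⟶ opn T (U t) := Over.homMk (pullback.snd _ _) (by
      have := congr($(pullback.condition (f := (nhdCover U hU).f s)
        (g := (nhdCover U hU).f t)) ≫ T.hom)
      simp only [Category.assoc] at this
      exact this.symm)
    refine congr(($(comp s t a b ?_)).left)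
    ext1
    exact pullback.condition (f := (nhdCover U hU).f s) (g := (nhdCover U hU).f t)
  have hg (s : T.left) : (U s).ι ≫ g = (h s).left :=
    (nhdCover U hU).ι_glueMorphisms _ _ s
  let h₀ : T ⟶ Z := Over.homMk g ((nhdCover U hU).hom_ext _ _ fun s ↦ by
    rw [← Category.assoc]
    exact congr($(hg s) ≫ Z.hom).trans (Over.w (h s)))
  have hh (s : T.left) : opnι T (U s) ≫ h₀ = h s := by
    ext1
    exact hg s
  refine ⟨h₀, fun T' f h' hf ↦ hom_ext_loc fun s ↦
    ⟨f.left ⁻¹ᵁ (U (f.left s)), hU _, ?_⟩⟩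
  refine uniq _ _ _ ?_ (stab _ _ _ hf)
  obtain ⟨y, hy⟩ := exists_preimage_lift f (U (f.left s))
  rw [← reassoc_of% hy, ← hy, hh]
  exact stab _ _ _ (hR _)

/-- A morphism which is injective on points and which has local sections is an isomorphism. -/
theorem isIso_of_loc {Y Z : Over (Spec (.of k))} (f : Y ⟶ Z)
    (inj : ∀ ⦃T : Over (Spec (.of k))⦄ (a b : T ⟶ Y), a ≫ f = b ≫ f → a = b)
    (sur : Loc Z fun _ j ↦ ∃ y, y ≫ f = j) : IsIso f := by
  obtain ⟨g, hg⟩ := exists_glue (T := Z) (Z := Y) (fun _ z y ↦ y ≫ f = z)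
    (fun _ _ _ _ _ h ↦ by simp [← h]) (fun _ _ _ _ h h' ↦ inj _ _ (h.trans h'.symm)) sur
  have : f ≫ g = 𝟙 _ := hg _ _ (by simp)
  exact ⟨g, this, hom_ext_loc (sur.mono fun T j ⟨y, hy⟩ ↦ by simp [← hy, reassoc_of% this])⟩

section Descent

variable {P Y Z : Over (Spec (.of k))} (q : P ⟶ Y) [Flat q.left] [Surjective q.left]
  [QuasiCompact q.left]

include q in
lemma epi_of_flat : Epi q :=
  Over.epi_of_epi_left q

/-- Faithfully flat quasi-compact morphisms are effective epimorphisms of schemes. Testing only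
pairs of morphisms over `k` suffices: a pair of morphisms of schemes equalized by `q` becomes one
over `k` when its source receives the structure morphism of the first. -/
theorem exists_desc (c : P ⟶ Z)
    (h : ∀ ⦃T : Over (Spec (.of k))⦄ (a b : T ⟶ P), a ≫ q = b ≫ q → a ≫ c = b ≫ c) :
    ∃ f : Y ⟶ Z, q ≫ f = c := by
  have h' {T : Scheme.{u}} (a b : T ⟶ P.left) (hab : a ≫ q.left = b ≫ q.left) :
      a ≫ c.left = b ≫ c.left := by
    let T' : Over (Spec (.of k)) := Over.mk (a ≫ P.hom)
    let a' : T' ⟶ P := Over.homMk a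
    let b' : T' ⟶ P := Over.homMk b (by
      have := Over.w q
      dsimp [T'] at this ⊢
      rw [← this, reassoc_of% hab])
    refine congr(($(h a' b' ?_)).left)
    ext1
    exact hab
  refine ⟨Over.homMk (EffectiveEpi.desc q.left c.left (@h')) ?_, ?_⟩
  · rw [← cancel_epi q.left, EffectiveEpi.fac_assoc q.left c.left (@h')]
    simp
  · ext1
    exact EffectiveEpi.fac q.left c.left (@h')

end Descent

end

section

/-! ### Points of the affine line and of the multiplicative group -/

section SpecFun

variable {Y : Scheme.{u}} {R S : Type u} [CommRing R] [CommRing S]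

/-- The pullback of a function along a morphism to an affine scheme. -/
def specFun (g : Y ⟶ Spec (.of R)) (a : R) : Γ(Y, ⊤) :=
  g.appTop ((Scheme.ΓSpecIso (.of R)).inv a)

lemma specFun_comp_map (e : Y ⟶ Spec (.of R)) (f : S →+* R) (a : S) :
    specFun (e ≫ Spec.map (CommRingCat.ofHom f)) a = specFun e (f a) := by
  rw [specFun, Scheme.Hom.comp_appTop]
  exact congr(e.appTop $(congr($(Scheme.ΓSpecIso_inv_naturality (CommRingCat.ofHom f)) a))).symm

lemma specFun_map_mul (g : Y ⟶ Spec (.of R)) (a b : R) :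
    specFun g (a * b) = specFun g a * specFun g b := by
  simp [specFun]

lemma specFun_toSpecΓ (Y : Scheme.{u}) (a : Γ(Y, ⊤)) :
    specFun (R := Γ(Y, ⊤)) Y.toSpecΓ a = a := by
  have : (Scheme.ΓSpecIso Γ(Y, ⊤)).inv ≫ Y.toSpecΓ.appTop = 𝟙 _ := by
    rw [Scheme.toSpecΓ_appTop, Iso.inv_hom_id]
  exact congr($this a)

end SpecFun

section Coord

variable {T T' : Over (Spec (.of k))}

@[simp]
lemma A1.coord_ofFun (f : Γ(T.left, ⊤)) : A1.coord (A1.ofFun f) = f :=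
  AffineSpace.homOfVector_appTop_coord _ _ _

@[simp]
lemma A1.ofFun_coord (a : T ⟶ A1 k) : A1.ofFun (A1.coord a) = a := by
  ext1
  refine AffineSpace.hom_ext ?_ fun i ↦ ?_
  · exact (AffineSpace.homOfVector_over _ _).trans (Over.w a).symm
  · exact AffineSpace.homOfVector_appTop_coord _ _ _

/-- The points of the affine line are the functions. -/
def A1.equiv (T : Over (Spec (.of k))) : (T ⟶ A1 k) ≃ Γ(T.left, ⊤) :=
  ⟨A1.coord, A1.ofFun, A1.ofFun_coord, A1.coord_ofFun⟩

/-- With this structure functions are computed with as morphisms, and their pullback is plain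
composition. -/
instance : CommRing (T ⟶ A1 k) := (A1.equiv T).commRing

/-- The points of the affine line form the ring of functions. -/
def A1.ringEquiv (T : Over (Spec (.of k))) : (T ⟶ A1 k) ≃+* Γ(T.left, ⊤) :=
  (A1.equiv T).ringEquiv

lemma A1.ringEquiv_apply (a : T ⟶ A1 k) : A1.ringEquiv T a = A1.coord a := rfl

lemma A1.mul_eq (a b : T ⟶ A1 k) : A1.mul a b = a * b := rfl

lemma A1.coord_comp (f : T' ⟶ T) (a : T ⟶ A1 k) :
    A1.coord (f ≫ a) = f.left.appTop (A1.coord a) := by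
  rw [A1.coord, Over.comp_left, Scheme.Hom.comp_appTop]
  rfl

/-- Pulling back functions. -/
def A1.pullback (f : T' ⟶ T) : (T ⟶ A1 k) →+* (T' ⟶ A1 k) :=
  ((A1.ringEquiv T').symm.toRingHom.comp f.left.appTop.hom).comp (A1.ringEquiv T).toRingHom

lemma A1.pullback_apply (f : T' ⟶ T) (a : T ⟶ A1 k) : A1.pullback f a = f ≫ a := by
  apply (A1.ringEquiv T').injective
  simp [A1.pullback, A1.ringEquiv_apply, A1.coord_comp]

lemma A1.comp_mul (f : T' ⟶ T) (a b : T ⟶ A1 k) : f ≫ (a * b) = (f ≫ a) * (f ≫ b) := by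
  simp only [← A1.pullback_apply, map_mul]

lemma A1.comp_add (f : T' ⟶ T) (a b : T ⟶ A1 k) : f ≫ (a + b) = (f ≫ a) + (f ≫ b) := by
  simp only [← A1.pullback_apply, map_add]

@[simp]
lemma A1.comp_one (f : T' ⟶ T) : f ≫ (1 : T ⟶ A1 k) = 1 := by
  simp only [← A1.pullback_apply, map_one]

@[simp]
lemma A1.comp_zero (f : T' ⟶ T) : f ≫ (0 : T ⟶ A1 k) = 0 := by
  simp only [← A1.pullback_apply, map_zero]

lemma Gm.coord_comp (f : T' ⟶ T) (a : T ⟶ Gm k) :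
    Gm.coord (f ≫ a) = f.left.appTop (Gm.coord a) := by
  rw [Gm.coord, Over.comp_left, Scheme.Hom.comp_appTop]
  rfl

variable (k) in
/-- The inclusion of the multiplicative group into the affine line. -/
def Gm.toA1 : Gm k ⟶ A1 k := A1.ofFun (Gm.coord (𝟙 _))

/-- The invertible function which a point of the multiplicative group is. -/
def Gm.val (t : T ⟶ Gm k) : T ⟶ A1 k := t ≫ Gm.toA1 k

lemma Gm.coord_val (t : T ⟶ Gm k) : A1.coord (Gm.val t) = Gm.coord t := by
  rw [Gm.val, A1.coord_comp, Gm.toA1, A1.coord_ofFun, ← Gm.coord_comp, Category.comp_id]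

lemma Gm.comp_val (f : T' ⟶ T) (t : T ⟶ Gm k) : f ≫ Gm.val t = Gm.val (f ≫ t) := by
  simp [Gm.val]

lemma A1.scale_eq (t : T ⟶ Gm k) (a : T ⟶ A1 k) : A1.scale t a = Gm.val t * a := by
  apply (A1.ringEquiv T).injective
  simp [A1.ringEquiv_apply, A1.scale, ← Gm.coord_val, A1.coord_ofFun]
  simp only [← A1.ringEquiv_apply, map_mul]

/-- The homomorphism of rings given by a morphism to `𝔾ₘ`. -/
def Gm.ringHom (t : T ⟶ Gm k) : k[T;T⁻¹] →+* Γ(T.left, ⊤) :=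
  ((Scheme.ΓSpecIso (.of k[T;T⁻¹])).inv ≫ t.left.appTop).hom

lemma Gm.ringHom_T (t : T ⟶ Gm k) : Gm.ringHom t (LaurentPolynomial.T 1) = Gm.coord t := rfl

lemma Gm.ringHom_algebraMap (t : T ⟶ Gm k) (c : k) :
    Gm.ringHom t (algebraMap k _ c) = T.hom.appTop ((Scheme.ΓSpecIso (.of k)).inv c) := by
  have h := congr(($(congr(($(Over.w t)).appTop))) ((Scheme.ΓSpecIso (.of k)).inv c))
  rw [← h, Scheme.Hom.comp_appTop]
  have h' := congr($(Scheme.ΓSpecIso_inv_naturality (CommRingCat.ofHom (algebraMap k k[T;T⁻¹]))) c)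
  exact congr(t.left.appTop $h')

/-- A homomorphism from `k[T, T⁻¹]` is determined by its restriction to `k`, which the structure
morphism fixes, and by the image of `T`. -/
lemma Gm.hom_ext {s t : T ⟶ Gm k} (h : Gm.coord s = Gm.coord t) : s = t := by
  have h' : Gm.ringHom s = Gm.ringHom t := by
    refine IsLocalization.ringHom_ext (Submonoid.powers (Polynomial.X : Polynomial k)) ?_
    refine Polynomial.ringHom_ext (fun c ↦ ?_) ?_
    · have (t : T ⟶ Gm k) := Gm.ringHom_algebraMap t c
      simp only [LaurentPolynomial.algebraMap_eq_toLaurent, RingHom.comp_apply,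
        Polynomial.toLaurent_C, LaurentPolynomial.C_eq_algebraMap, this]
    · simp only [LaurentPolynomial.algebraMap_eq_toLaurent, RingHom.comp_apply,
        Polynomial.toLaurent_X, Gm.ringHom_T, h]
  ext1
  have : IsAffine (Gm k).left := inferInstanceAs (IsAffine (Spec _))
  refine ext_of_isAffine ?_
  refine (cancel_epi (Scheme.ΓSpecIso (.of k[T;T⁻¹])).inv).1 ?_
  ext1
  exact h'

lemma Gm.isUnit_coord (t : T ⟶ Gm k) : IsUnit (Gm.coord t) :=
  (LaurentPolynomial.isUnit_T (R := k) 1).map (Gm.ringHom t)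

lemma Gm.exists_coord_eq (f : Γ(T.left, ⊤)) (hf : IsUnit f) : ∃ t : T ⟶ Gm k, Gm.coord t = f := by
  let φ : k[T;T⁻¹] →+* Γ(T.left, ⊤) :=
    LaurentPolynomial.eval₂ ((Scheme.ΓSpecIso (.of k)).inv ≫ T.hom.appTop).hom hf.unit
  have h : (T.left.toSpecΓ ≫ Spec.map (CommRingCat.ofHom φ)) ≫ (Gm k).hom = T.hom := by
    have h₁ : CommRingCat.ofHom (algebraMap k k[T;T⁻¹]) ≫ CommRingCat.ofHom φ =
        (Scheme.ΓSpecIso (.of k)).inv ≫ T.hom.appTop := by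
      ext c
      simp [φ]
    change (T.left.toSpecΓ ≫ Spec.map _) ≫ Spec.map _ = _
    rw [Category.assoc, ← Spec.map_comp, h₁, Spec.map_comp, ← Scheme.toSpecΓ_naturality_assoc]
    simp
  refine ⟨Over.homMk (T.left.toSpecΓ ≫ Spec.map (CommRingCat.ofHom φ)) h, ?_⟩
  refine (specFun_comp_map (R := Γ(T.left, ⊤)) _ _ _).trans ?_
  rw [specFun_toSpecΓ]
  simp [φ]

lemma Gm.val_injective : Function.Injective (Gm.val (T := T) (k := k)) := fun s t h ↦
  Gm.hom_ext (by rw [← Gm.coord_val, h, Gm.coord_val])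

lemma Gm.isUnit_val (t : T ⟶ Gm k) : IsUnit (Gm.val t) := by
  have := (Gm.isUnit_coord t).map (A1.ringEquiv T).symm
  rwa [← Gm.coord_val, ← A1.ringEquiv_apply, RingEquiv.symm_apply_apply] at this

lemma Gm.exists_val_eq {a : T ⟶ A1 k} (h : IsUnit a) : ∃ t : T ⟶ Gm k, Gm.val t = a := by
  obtain ⟨t, ht⟩ := Gm.exists_coord_eq _ (h.map (A1.ringEquiv T))
  exact ⟨t, (A1.ringEquiv T).injective ((Gm.coord_val t).trans ht)⟩

/-- This is where the group law of `𝔾ₘ` enters: `T` is group-like, so the comultiplication sends it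
to `T ⊗ T`, here read through the isomorphism of the product with the spectrum of the tensor
product. -/
lemma specFun_mul : specFun (μ[Gm k]).left (LaurentPolynomial.T 1 : k[T;T⁻¹]) =
    specFun (fst (Gm k) (Gm k)).left (LaurentPolynomial.T 1 : k[T;T⁻¹]) *
      specFun (snd (Gm k) (Gm k)).left (LaurentPolynomial.T 1 : k[T;T⁻¹]) := by
  let e := (pullbackSpecIso k k[T;T⁻¹] k[T;T⁻¹]).hom
  have h₁ : (fst (Gm k) (Gm k)).left = e ≫ Spec.map (CommRingCat.ofHom
        Algebra.TensorProduct.includeLeftRingHom) := (pullbackSpecIso_hom_fst ..).symm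
  have h₂ : (snd (Gm k) (Gm k)).left = e ≫ Spec.map (CommRingCat.ofHom
        (Algebra.TensorProduct.includeRight : k[T;T⁻¹] →ₐ[k] _).toRingHom) :=
    (pullbackSpecIso_hom_snd ..).symm
  have h₃ : (μ[Gm k]).left = e ≫ Spec.map (CommRingCat.ofHom
      (Bialgebra.comulAlgHom k k[T;T⁻¹]).toRingHom) := mul_spec_asOver_spec_left
  refine (congrArg (specFun · (LaurentPolynomial.T 1 : k[T;T⁻¹])) h₃).trans ?_
  refine Eq.trans ?_ (congrArg₂ (fun a b ↦ specFun a (LaurentPolynomial.T 1 : k[T;T⁻¹]) *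
    specFun b (LaurentPolynomial.T 1 : k[T;T⁻¹])) h₁ h₂).symm
  refine (specFun_comp_map _ _ _).trans ?_
  refine Eq.trans ?_ (congrArg₂ (· * ·) (specFun_comp_map _ _ _) (specFun_comp_map _ _ _)).symm
  refine Eq.trans (congrArg (specFun e) ?_) (specFun_map_mul e _ _)
  simp

lemma Gm.coord_mul (s t : T ⟶ Gm k) : Gm.coord (s * t) = Gm.coord s * Gm.coord t := by
  have h : Gm.coord μ[Gm k] = Gm.coord (fst (Gm k) (Gm k)) * Gm.coord (snd (Gm k) (Gm k)) :=
    specFun_mul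
  rw [Hom.mul_def, Gm.coord_comp, h, map_mul, ← Gm.coord_comp, ← Gm.coord_comp, lift_fst, lift_snd]

lemma Gm.val_mul (s t : T ⟶ Gm k) : Gm.val (s * t) = Gm.val s * Gm.val t := by
  apply (A1.ringEquiv T).injective
  simp only [map_mul, A1.ringEquiv_apply, Gm.coord_val, Gm.coord_mul]

lemma Gm.val_one : Gm.val (1 : T ⟶ Gm k) = 1 := by
  have := Gm.val_mul (1 : T ⟶ Gm k) 1
  rw [mul_one] at this
  -- A unit which is idempotent is equal to one.
  exact (Gm.isUnit_val _).mul_eq_left.1 this.symm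

end Coord

end

section

instance (X : Over (Spec (.of k))) : Flat X.hom := inferInstance

instance flat_snd (Y Z : Over (Spec (.of k))) : Flat (snd Y Z).left :=
  inferInstanceAs (Flat (pullback.snd Y.hom Z.hom))

instance flat_fst (Y Z : Over (Spec (.of k))) : Flat (fst Y Z).left :=
  inferInstanceAs (Flat (pullback.fst Y.hom Z.hom))

/-! ### Schematic density of `𝔾ₘ` in the affine line -/

/-- On an affine target the kernel ideal sheaf is read off from global sections, where up to
`ΓSpecIso` it is the kernel of the ring homomorphism. -/
lemma isSchemeTheoreticallyDominant_Spec_map {R S : CommRingCat.{u}} (φ : R ⟶ S)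
    (h : Function.Injective φ) : IsSchemeTheoreticallyDominant (Spec.map φ) := by
  rw [isSchemeTheoreticallyDominant_iff, Scheme.ker_of_isAffine]
  have : RingHom.ker (Spec.map φ).appTop.hom = ⊥ := by
    rw [← RingHom.injective_iff_ker_eq_bot]
    have h₁ : (Spec.map φ).appTop =
        (Scheme.ΓSpecIso R).hom ≫ φ ≫ (Scheme.ΓSpecIso S).inv := by
      rw [Scheme.ΓSpecIso_inv_naturality, Iso.hom_inv_id_assoc]
    rw [h₁]
    exact ((ConcreteCategory.bijective_of_isIso (Scheme.ΓSpecIso S).inv).1.comp h).comp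
      (ConcreteCategory.bijective_of_isIso (Scheme.ΓSpecIso R).hom).1
  rw [this]
  refine Scheme.IdealSheafData.ext_of_isAffine ?_
  simp

/-- The homomorphism `k[X] ⟶ k[T, T⁻¹]`. -/
def polyToLaurent (k : Type u) [Field k] : MvPolynomial PUnit.{u + 1} k →ₐ[k] k[T;T⁻¹] :=
  MvPolynomial.aeval fun _ ↦ LaurentPolynomial.T 1

lemma polyToLaurent_injective : Function.Injective (polyToLaurent k) := by
  have : polyToLaurent k =
      (Polynomial.toLaurentAlg (R := k)).comp (MvPolynomial.uniqueAlgEquiv k PUnit).toAlgHom := by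
    ext
    simp [polyToLaurent]
  rw [this]
  exact Polynomial.toLaurent_injective.comp (MvPolynomial.uniqueAlgEquiv k PUnit).injective

variable (k) in
/-- The morphism `Gm.toA1` in terms of rings. -/
def laurentToAffine : Spec (.of k[T;T⁻¹]) ⟶ 𝔸(PUnit.{u + 1}; Spec (.of k)) :=
  Spec.map (CommRingCat.ofHom (polyToLaurent k).toRingHom) ≫
    (AffineSpace.SpecIso PUnit.{u + 1} (.of k)).inv

lemma laurentToAffine_over : laurentToAffine k ≫ 𝔸(PUnit.{u + 1}; Spec (.of k)) ↘ Spec (.of k) =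
    Spec.map (CommRingCat.ofHom (algebraMap k k[T;T⁻¹])) := by
  rw [laurentToAffine, Category.assoc, AffineSpace.SpecIso_inv_over, ← Spec.map_comp,
    ← CommRingCat.ofHom_comp]
  congr 2
  ext
  simp [polyToLaurent]

lemma laurentToAffine_coord (i : PUnit.{u + 1}) : (laurentToAffine k).appTop
    (AffineSpace.coord _ i) = (Scheme.ΓSpecIso (.of k[T;T⁻¹])).inv (LaurentPolynomial.T 1) := by
  rw [laurentToAffine, Scheme.Hom.comp_appTop, CommRingCat.comp_apply,
    AffineSpace.SpecIso_inv_appTop_coord]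
  have := specFun_comp_map (𝟙 (Spec (.of k[T;T⁻¹]))) (polyToLaurent k).toRingHom (.X i)
  rw [Category.id_comp] at this
  refine Eq.trans this ?_
  simp [polyToLaurent, specFun]

instance : IsSchemeTheoreticallyDominant (laurentToAffine k) := by
  have := isSchemeTheoreticallyDominant_Spec_map
    (CommRingCat.ofHom (polyToLaurent k).toRingHom) polyToLaurent_injective
  rw [laurentToAffine]
  infer_instance

instance : QuasiCompact (laurentToAffine k) := by
  rw [laurentToAffine]
  infer_instance

lemma toA1_left : (Gm.toA1 k).left = laurentToAffine k := by
  refine AffineSpace.hom_ext ?_ fun i ↦ ?_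
  · exact (Over.w (Gm.toA1 k)).trans laurentToAffine_over.symm
  · refine (A1.coord_ofFun _).trans (Eq.trans ?_ (laurentToAffine_coord i).symm)
    rw [Gm.coord, Over.id_left, Scheme.Hom.id_appTop]
    rfl

instance : IsSchemeTheoreticallyDominant (Gm.toA1 k).left :=
  toA1_left (k := k) ▸ inferInstanceAs (IsSchemeTheoreticallyDominant (laurentToAffine k))

instance : QuasiCompact (Gm.toA1 k).left :=
  toA1_left (k := k) ▸ inferInstanceAs (QuasiCompact (laurentToAffine k))

lemma Gm.lift_val {Y T : Over (Spec (.of k))} (y : T ⟶ Y) (t : T ⟶ Gm k) :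
    lift y (Gm.val t) = lift y t ≫ Y ◁ Gm.toA1 k := by
  simp [Gm.val]

/-- A function on `Y × 𝔸¹` is determined by its restriction to `Y × 𝔾ₘ`. -/
lemma A1.hom_ext_of_Gm {Y : Over (Spec (.of k))} {f g : Y ⊗ A1 k ⟶ A1 k}
    (h : Y ◁ Gm.toA1 k ≫ f = Y ◁ Gm.toA1 k ≫ g) : f = g := by
  have hp : IsPullback (Y ◁ Gm.toA1 k) (snd _ _) (snd _ _) (Gm.toA1 k) := by
    refine ⟨⟨by simp⟩, ⟨PullbackCone.IsLimit.mk _ (fun s ↦ lift (s.fst ≫ fst _ _) s.snd)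
      (fun s ↦ ?_) (fun s ↦ by simp) fun s m h₁ h₂ ↦ ?_⟩⟩
    · have := s.condition
      ext1 <;> simp [this]
    · ext1
      · simp [← h₁]
      · simp [← h₂]
  have hp' : IsPullback (Y ◁ Gm.toA1 k).left (snd Y (Gm k)).left (snd Y (A1 k)).left
      (Gm.toA1 k).left :=
    hp.map (Over.forget _)
  -- The projection `Y × 𝔸¹ ⟶ 𝔸¹` is flat, and flat base change preserves schematic dominance of the
  -- quasi-compact morphism `Gm.toA1`.
  have : IsSchemeTheoreticallyDominant (Y ◁ Gm.toA1 k).left := .of_isPullback hp'.flip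
  have : QuasiCompact (Y ◁ Gm.toA1 k).left :=
    MorphismProperty.of_isPullback (P := @QuasiCompact) hp'.flip
      (inferInstanceAs (QuasiCompact (Gm.toA1 k).left))
  apply (A1.ringEquiv _).injective
  apply (Y ◁ Gm.toA1 k).left.app_injective ⊤
  exact (A1.coord_comp _ _).symm.trans (congr(A1.coord $h).trans (A1.coord_comp _ _))

/-- A homogeneous function of degree one on `Y × 𝔸¹` is linear. -/
lemma A1.linear_of_equivariant {Y : Over (Spec (.of k))} (f : Y ⊗ A1 k ⟶ A1 k)
    (h : ∀ ⦃T⦄ (t : T ⟶ Gm k) (y : T ⟶ Y) (a : T ⟶ A1 k),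
      lift y (Gm.val t * a) ≫ f = Gm.val t * (lift y a ≫ f))
    {T : Over (Spec (.of k))} (y : T ⟶ Y) (a : T ⟶ A1 k) :
    lift y a ≫ f = a * (lift y 1 ≫ f) := by
  -- On `Y × 𝔾ₘ` the coordinate is itself a scalar `t`, so homogeneity gives `f(y, t) = t f(y, 1)`;
  -- density extends this to `Y × 𝔸¹`.
  have : f = snd _ _ * (lift (fst _ _) 1 ≫ f) := A1.hom_ext_of_Gm (by
    have := h (snd Y (Gm k)) (fst _ _) 1
    rw [mul_one, Gm.lift_val, lift_fst_snd, Category.id_comp] at this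
    rw [this, A1.comp_mul, comp_lift_assoc]
    simp [Gm.val])
  conv_lhs => rw [this, A1.comp_mul, comp_lift_assoc]
  simp

end

section

/-! ### Functions on `T × X` for `X` proper -/

instance surjective_fst (Y Z : Over (Spec (.of k))) [Surjective Z.hom] : Surjective (fst Y Z).left :=
  inferInstanceAs (Surjective (pullback.fst Y.hom Z.hom))

instance quasiCompact_fst (Y Z : Over (Spec (.of k))) [QuasiCompact Z.hom] :
    QuasiCompact (fst Y Z).left :=
  inferInstanceAs (QuasiCompact (pullback.fst Y.hom Z.hom))

lemma surjective_of_nonempty (X : Over (Spec (.of k))) [Nonempty X.left] : Surjective X.hom := by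
  have : Subsingleton (Spec (.of k) : Scheme.{u}) :=
    inferInstanceAs (Subsingleton (PrimeSpectrum k))
  exact ⟨fun y ↦ ⟨Classical.arbitrary X.left, Subsingleton.elim _ _⟩⟩

/-- By flat base change `Γ(T × X)` is the tensor product of `Γ(T)` and `Γ(X)` over `k`. As `k ⟶
Γ(X)` is an isomorphism, so is its pushout `Γ(T) ⟶ Γ(T × X)`. -/
lemma exists_const_of_isAffine {X : Over (Spec (.of k))} [QuasiCompact X.hom]
    [QuasiSeparated X.hom] [IsIso X.hom.appTop] (T : Over (Spec (.of k))) [IsAffine T.left]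
    (f : T ⊗ X ⟶ A1 k) : ∃ g : T ⟶ A1 k, fst T X ≫ g = f := by
  have hp : IsPullback (fst T X).left (snd T X).left T.hom X.hom := IsPullback.of_hasPullback _ _
  have : CompactSpace X.left := (quasiCompact_iff_compactSpace X.hom).1 ‹_›
  have : QuasiSeparatedSpace X.left := (quasiSeparated_iff_quasiSeparatedSpace X.hom).1 ‹_›
  have := isIso_pushoutSection_of_isQuasiSeparated_of_flat_right hp.flip
    (US := ⊤) (UT := ⊤) (UX := ⊤) (UY := ⊤) le_top le_top (by simp) (isAffineOpen_top _)
    (isAffineOpen_top _) isCompact_univ isQuasiSeparated_univ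
  have h := (isIso_pushoutSection_iff hp.flip
    (US := ⊤) (UT := ⊤) (UX := ⊤) (UY := ⊤) le_top le_top (by simp)).1 this
  have h₁ : IsIso (X.hom.appLE ⊤ ⊤ le_top) := by
    have e : X.hom.appTop = X.hom.appLE ⊤ ⊤ le_top := Scheme.Hom.app_eq_appLE X.hom
    exact e ▸ inferInstance
  have h₂ := h.isIso_inr_of_isIso
  obtain ⟨g, hg⟩ := (ConcreteCategory.bijective_of_isIso ((fst T X).left.appLE ⊤ ⊤ le_top)).2
    (A1.coord f)
  refine ⟨A1.ofFun g, (A1.ringEquiv _).injective ?_⟩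
  rw [A1.ringEquiv_apply, A1.ringEquiv_apply, A1.coord_comp, A1.coord_ofFun, ← hg]
  exact congr($(Scheme.Hom.app_eq_appLE (fst T X).left) g)

/-- If `𝒪(X) = k`, then the functions on `T × X` are the functions on `T`. -/
lemma exists_const {X : Over (Spec (.of k))} [QuasiCompact X.hom] [Nonempty X.left]
    [QuasiSeparated X.hom] [IsIso X.hom.appTop] (T : Over (Spec (.of k)))
    (f : T ⊗ X ⟶ A1 k) : ∃ g : T ⟶ A1 k, fst T X ≫ g = f := by
  have := surjective_of_nonempty X
  -- Descent along `T × X ⟶ T` asks that two points with the same first coordinate have equal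
  -- values. This is local on the test scheme, which may thus be taken affine; there the function
  -- pulled back to the product with `X` depends only on the first coordinate.
  refine exists_desc (fst T X) f fun T' a b hab ↦ ?_
  have hT : Loc T' fun T'' j ↦ j ≫ a ≫ f = j ≫ b ≫ f := by
    intro s
    obtain ⟨U, hU, hs, -⟩ := exists_isAffineOpen_mem_and_subset (x := s) (U := ⊤) trivial
    refine ⟨U, hs, ?_⟩
    have : IsAffine (opn T' U).left := hU
    obtain ⟨g, hg⟩ := exists_const_of_isAffine (X := X) (opn T' U)
      (((opnι T' U ≫ a ≫ fst _ _) ▷ X) ≫ f)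
    have key (c : T' ⟶ T ⊗ X) (hc : c ≫ fst _ _ = a ≫ fst _ _) : opnι T' U ≫ c ≫ f = g := by
      have : opnι T' U ≫ c = lift (𝟙 _) (opnι T' U ≫ c ≫ snd _ _) ≫
          ((opnι T' U ≫ a ≫ fst _ _) ▷ X) := by
        ext1 <;> simp [hc]
      rw [reassoc_of% this, ← hg]
      simp
    exact (key a rfl).trans (key b hab.symm).symm
  exact hom_ext_loc hT

/-- The functions on a proper integral scheme over a field form a field. Hence a nonzero function is
a unit, and the assumption on units places it in `k`. -/
lemma isIso_appTop_of_units {X : Over (Spec (.of k))} [IsIntegral X.left] [IsProper X.hom]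
    (hunits : ∀ f : Γ(X.left, ⊤), IsUnit f →
      ∃ c : k, f = X.hom.appTop ((Scheme.ΓSpecIso (.of k)).inv c)) : IsIso X.hom.appTop := by
  have hF := isField_of_universallyClosed k X.hom
  let _ := hF.toField
  have hk : IsField Γ(Spec (.of k), ⊤) :=
    (Scheme.ΓSpecIso (.of k)).commRingCatIsoToRingEquiv.toMulEquiv.isField (Field.toIsField k)
  let _ := hk.toField
  refine (ConcreteCategory.isIso_iff_bijective _).2 ⟨X.hom.appTop.hom.injective, fun f ↦ ?_⟩
  by_cases hf : f = 0
  · exact ⟨0, by rw [hf]; exact map_zero X.hom.appTop.hom⟩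
  · obtain ⟨c, hc⟩ := hunits f (isUnit_iff_ne_zero.2 hf)
    exact ⟨_, hc.symm⟩

end

section

/-! ### Representability of Zariski sheaves -/

/-- `F` is a sheaf for the Zariski topology: locally defined functional relations between points
of `T` and elements of `F` come from unique elements of `F(T)`. -/
def IsZariskiSheaf (F : (Over (Spec (.of k)))ᵒᵖ ⥤ Type u) : Prop :=
  ∀ (T : Over (Spec (.of k))) (R : ∀ ⦃T' : Over (Spec (.of k))⦄, (T' ⟶ T) → F.obj (.op T') → Prop),
    (∀ ⦃T' T'' : Over (Spec (.of k))⦄ (f : T' ⟶ T) (x : F.obj (.op T')) (g : T'' ⟶ T'),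
      R f x → R (g ≫ f) (F.map g.op x)) →
    (∀ ⦃T' : Over (Spec (.of k))⦄ (f : T' ⟶ T) (x y : F.obj (.op T')), R f x → R f y → x = y) →
    Loc T (fun _ j ↦ ∃ x, R j x) →
    ∃! x : F.obj (.op T), ∀ ⦃T' : Over (Spec (.of k))⦄ (f : T' ⟶ T) (y : F.obj (.op T')),
      R f y → F.map f.op x = y

/-- A structure over `k` on the scheme `T` together with an element of `F` there. -/
structure TotPt (F : (Over (Spec (.of k)))ᵒᵖ ⥤ Type u) (T : Scheme.{u}) where
  /-- The structure morphism. -/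
  str : T ⟶ Spec (.of k)
  /-- The element. -/
  pt : F.obj (.op (Over.mk str))

namespace TotPt

variable {F : (Over (Spec (.of k)))ᵒᵖ ⥤ Type u}

lemma ext' {T : Scheme.{u}} {x y : TotPt F T} (h : x.str = y.str)
    (h' : F.map (Over.homMk (𝟙 T) (by simp [h]) : Over.mk x.str ⟶ Over.mk y.str).op y.pt = x.pt) :
    x = y := by
  obtain ⟨s, x⟩ := x
  obtain ⟨t, y⟩ := y
  obtain rfl : s = t := h
  have : y = x := congr($(F.map_id (.op (Over.mk s))) y).symm.trans h'
  rw [this]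

lemma exists_mk {T : Scheme.{u}} (x : TotPt F T) (s : T ⟶ Spec (.of k)) (h : x.str = s) :
    ∃ z, x = ⟨s, z⟩ := by
  subst h
  exact ⟨_, rfl⟩

lemma mk_injective {T : Scheme.{u}} {s : T ⟶ Spec (.of k)} {z z' : F.obj (.op (Over.mk s))}
    (h : (⟨s, z⟩ : TotPt F T) = ⟨s, z'⟩) : z = z' := by
  simpa using h

/-- The restriction of an element along a morphism of schemes. -/
def res {T T' : Scheme.{u}} (f : T' ⟶ T) (x : TotPt F T) : TotPt F T' :=
  ⟨f ≫ x.str, F.map (Over.homMk f rfl : Over.mk (f ≫ x.str) ⟶ Over.mk x.str).op x.pt⟩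

lemma map_map {T T' T'' : Over (Spec (.of k))} (f : T' ⟶ T) (g : T'' ⟶ T') (x : F.obj (.op T)) :
    F.map g.op (F.map f.op x) = F.map (g ≫ f).op x :=
  (F.map_comp_apply f.op g.op x).symm

lemma res_id {T : Scheme.{u}} (x : TotPt F T) : res (𝟙 T) x = x :=
  ext' (by simp [res]) rfl

lemma res_mk {T T' : Over (Spec (.of k))} (g : T' ⟶ T) (z : F.obj (.op T)) :
    res g.left (⟨T.hom, z⟩ : TotPt F T.left) = (⟨T'.hom, F.map g.op z⟩ : TotPt F T'.left) :=
  ext' (Over.w g) (map_map _ _ _)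

lemma res_comp {T T' T'' : Scheme.{u}} (f : T' ⟶ T) (g : T'' ⟶ T') (x : TotPt F T) :
    res (g ≫ f) x = res g (res f x) := by
  refine ext' (Category.assoc _ _ _) ?_
  exact (congrArg _ (map_map _ _ _)).trans (map_map _ _ _)

variable (F) in
/-- The functor on schemes (instead of schemes over `k`). -/
def functor : Scheme.{u}ᵒᵖ ⥤ Type u where
  obj T := TotPt F T.unop
  map f := ↾res f.unop
  map_id T := by
    ext x
    exact res_id x
  map_comp f g := by
    ext x
    exact res_comp _ _ x

/-- The criterion of local representability concerns sheaves on all schemes, which is why the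
structure morphism to `Spec k` is part of a `TotPt`. That morphism is glued first; the element is
then glued over it. -/
lemma isSheaf_functor (hF : IsZariskiSheaf F) :
    Presieve.IsSheaf Scheme.zariskiTopology (functor F) := by
  rw [Precoverage.isSheaf_toGrothendieck_iff_of_isStableUnderBaseChange]
  rintro T S hS x hx
  obtain ⟨(𝓤 : T.OpenCover), rfl⟩ := Scheme.exists_cover_of_mem_pretopology hS
  let y (i : 𝓤.I₀) : TotPt F (𝓤.X i) := x (𝓤.f i) (.mk i)
  have hy {W : Scheme.{u}} {i j : 𝓤.I₀} (a : W ⟶ 𝓤.X i) (b : W ⟶ 𝓤.X j)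
      (h : a ≫ 𝓤.f i = b ≫ 𝓤.f j) :
      res a (y i) = res b (y j) := hx _ _ _ _ h
  let s : T ⟶ Spec (.of k) := 𝓤.glueMorphisms (fun i ↦ (y i).str) fun i j ↦
    congr(TotPt.str $(hy _ _ pullback.condition))
  have hs (i : 𝓤.I₀) : 𝓤.f i ≫ s = (y i).str := 𝓤.ι_glueMorphisms _ _ i
  -- The relation says that the element is a restriction of one of the given local data.
  -- Compatibility of the data on overlaps makes it functional.
  obtain ⟨z, hz, hz'⟩ := hF (Over.mk s) (fun T' f z ↦ ∃ (i : 𝓤.I₀) (a : T'.left ⟶ 𝓤.X i),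
      a ≫ 𝓤.f i = f.left ∧ res a (y i) = (⟨T'.hom, z⟩ : TotPt F T'.left))
    (by
      rintro T' T'' f z g ⟨i, a, ha, h⟩
      refine ⟨i, g.left ≫ a, by simp [ha], ?_⟩
      rw [res_comp, h, res_mk])
    (by
      rintro T' f z z' ⟨i, a, ha, h⟩ ⟨j, b, hb, h'⟩
      exact mk_injective (h.symm.trans ((hy _ _ (ha.trans hb.symm)).trans h')))
    (by
      intro t
      refine ⟨(𝓤.f (𝓤.idx t)).opensRange, 𝓤.covers t, ?_⟩
      let a := IsOpenImmersion.lift (𝓤.f (𝓤.idx t)) (𝓤.f (𝓤.idx t)).opensRange.ι (by simp)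
      have ha : a ≫ 𝓤.f (𝓤.idx t) = (𝓤.f (𝓤.idx t)).opensRange.ι :=
        IsOpenImmersion.lift_fac _ _ _
      obtain ⟨z, hz⟩ := exists_mk (res a (y (𝓤.idx t)))
        (opn (Over.mk s) (𝓤.f (𝓤.idx t)).opensRange).hom (by
          dsimp [res]
          rw [← hs, reassoc_of% ha])
      exact ⟨z, _, a, ha, hz⟩)
  have key (i : 𝓤.I₀) (z' : F.obj (.op (Over.mk s)))
      (h : ∀ ⦃T' : Over (Spec (.of k))⦄ (f : T' ⟶ Over.mk s) (w : F.obj (.op T')),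
        (∃ (i : 𝓤.I₀) (a : T'.left ⟶ 𝓤.X i), a ≫ 𝓤.f i = f.left ∧
          res a (y i) = (⟨T'.hom, w⟩ : TotPt F T'.left)) → F.map f.op z' = w) :
      res (𝓤.f i) (⟨s, z'⟩ : TotPt F T) = y i := by
    obtain ⟨w, hw⟩ := exists_mk (y i) (𝓤.f i ≫ s) (hs i).symm
    have := h (Over.homMk (𝓤.f i) : Over.mk (𝓤.f i ≫ s) ⟶ Over.mk s) w
      ⟨i, 𝟙 _, by simp, (res_id _).trans hw⟩
    rw [hw, ← this]
    rfl
  refine ⟨(⟨s, z⟩ : TotPt F T), ?_, ?_⟩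
  · rintro W f ⟨i⟩
    exact key i z hz
  · intro z₁ hz₁
    replace hz₁ (i : 𝓤.I₀) : res (𝓤.f i) z₁ = y i := hz₁ _ (.mk i)
    obtain ⟨w, rfl⟩ := exists_mk z₁ s (𝓤.hom_ext _ _ fun i ↦ by
      rw [hs, ← hz₁]
      rfl)
    have : w = z := hz' w (by
      rintro T' f v ⟨i, a, ha, h⟩
      rw [← hz₁, ← res_comp, ha] at h
      exact mk_injective ((res_mk f w).symm.trans h))
    rw [this]

end TotPt

end

/-! ### Gluing a representing scheme from charts -/

section

/-- The point `y` represents the part over `U` of the functor `F` over `B`. -/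
def IsChart (F : (Over (Spec (.of k)))ᵒᵖ ⥤ Type u) {B : Over (Spec (.of k))}
    (π : ∀ ⦃T : Over (Spec (.of k))⦄, F.obj (.op T) → (T ⟶ B)) (U : B.left.Opens)
    {Y : Over (Spec (.of k))} (y : F.obj (.op Y)) : Prop :=
  (∀ s, (π y).left s ∈ U) ∧ ∀ ⦃T : Over (Spec (.of k))⦄ (x : F.obj (.op T)),
    (∀ s, (π x).left s ∈ U) → ∃! f : T ⟶ Y, F.map f.op y = x

section

variable {F : (Over (Spec (.of k)))ᵒᵖ ⥤ Type u} {B : Over (Spec (.of k))}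
    {π : ∀ ⦃T : Over (Spec (.of k))⦄, F.obj (.op T) → (T ⟶ B)}
    (hπ : ∀ ⦃T T' : Over (Spec (.of k))⦄ (f : T' ⟶ T) (x : F.obj (.op T)),
      π (F.map f.op x) = f ≫ π x)

namespace TotPt

/-- The morphism from a scheme to `functor F` defined by a point of `F`. -/
def toMap {Y : Scheme.{u}} (x : TotPt F Y) : yoneda.obj Y ⟶ functor F :=
  yonedaEquiv.symm x

lemma exists_toMap {Y : Scheme.{u}} (g : yoneda.obj Y ⟶ functor F) : ∃ x, g = toMap x :=
  ⟨yonedaEquiv g, (yonedaEquiv.symm_apply_apply g).symm⟩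

include hπ in
-- The fibre product of the chart with `T` is the open part of `T` lying over `U`: where `x` comes
-- from `y`, naturality of `π` forces the image into `U`, and uniqueness in the chart identifies the
-- factorization with `ψ`.
lemma isPullback_chart {U : B.left.Opens} {Y : Over (Spec (.of k))} {y : F.obj (.op Y)}
    (hy : IsChart F π U y) {T : Over (Spec (.of k))} (x : F.obj (.op T))
    (ψ : opn T ((π x).left ⁻¹ᵁ U) ⟶ Y) (hψ : F.map ψ.op y = F.map (opnι T _).op x) :
    IsPullback (yoneda.map ψ.left) (yoneda.map (opnι T ((π x).left ⁻¹ᵁ U)).left)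
      (toMap (⟨Y.hom, y⟩ : TotPt F Y.left)) (toMap (⟨T.hom, x⟩ : TotPt F T.left)) := by
  refine .of_forall_isPullback_app fun W ↦ (Types.isPullback_iff ..).2 ⟨?_, ?_, ?_⟩
  · ext w
    change res (w ≫ ψ.left) (⟨Y.hom, y⟩ : TotPt F Y.left) =
      res (w ≫ (opnι T ((π x).left ⁻¹ᵁ U)).left) (⟨T.hom, x⟩ : TotPt F T.left)
    rw [res_comp, res_comp]
    refine congrArg _ ?_
    refine (res_mk ψ y).trans (Eq.trans ?_ (res_mk (opnι T ((π x).left ⁻¹ᵁ U)) x).symm)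
    rw [hψ]
  · rintro a b ⟨-, h⟩
    exact (cancel_mono ((π x).left ⁻¹ᵁ U).ι).1 h
  · intro c a h
    replace h : res c (⟨Y.hom, y⟩ : TotPt F Y.left) = res a (⟨T.hom, x⟩ : TotPt F T.left) := h
    have hs : c ≫ Y.hom = a ≫ T.hom := congrArg str h
    let W' : Over (Spec (.of k)) := Over.mk (a ≫ T.hom)
    let a' : W' ⟶ T := Over.homMk a
    let c' : W' ⟶ Y := Over.homMk c hs
    have h' : F.map c'.op y = F.map a'.op x :=
      mk_injective ((res_mk c' y).symm.trans (h.trans (res_mk a' x)))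
    have hm (s : W'.left) : a'.left s ∈ (π x).left ⁻¹ᵁ U := by
      change (a' ≫ π x).left s ∈ U
      rw [← hπ, ← h', hπ]
      exact hy.1 _
    have hw : opnLift a' _ hm ≫ ψ = c' := by
      refine (hy.2 (F.map c'.op y) fun s ↦ ?_).unique ?_ rfl
      · rw [hπ]
        exact hy.1 _
      · rw [← map_map, hψ, map_map, opnLift_ι, h']
    exact ⟨(opnLift a' _ hm).left, congr(($hw).left), congr(($(opnLift_ι a' _ hm)).left)⟩

include hπ in
lemma presheaf_chart {U : B.left.Opens} {Y : Over (Spec (.of k))} {y : F.obj (.op Y)}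
    (hy : IsChart F π U y) :
    IsOpenImmersion.presheaf (toMap (⟨Y.hom, y⟩ : TotPt F Y.left)) := by
  refine MorphismProperty.relative.of_exists fun T g ↦ ?_
  obtain ⟨⟨s, x⟩, rfl⟩ := exists_toMap g
  obtain ⟨ψ, hψ, -⟩ := hy.2 (F.map (opnι (Over.mk s) ((π x).left ⁻¹ᵁ U)).op x) fun s ↦ by
    rw [hπ]
    exact opnι_mem ((π x).left ⁻¹ᵁ U) s
  exact ⟨_, _, _, isPullback_chart hπ hy x ψ hψ,
    inferInstanceAs (IsOpenImmersion ((π x).left ⁻¹ᵁ U).ι)⟩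

end TotPt

open TotPt in
include hπ in
/-- A Zariski sheaf over `B` which is representable locally on `B` is representable. -/
theorem exists_representing (hF : IsZariskiSheaf F)
    (charts : ∀ b : B.left, ∃ U : B.left.Opens, b ∈ U ∧
      ∃ (Y : Over (Spec (.of k))) (y : F.obj (.op Y)), IsChart F π U y) :
    ∃ (E : Over (Spec (.of k))) (e : F.obj (.op E)), ∀ ⦃T : Over (Spec (.of k))⦄
      (x : F.obj (.op T)), ∃! f : T ⟶ E, F.map f.op e = x := by
  choose U hU C y hy using charts
  let S : Sheaf Scheme.zariskiTopology.{u} (Type u) :=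
    ⟨functor F, (isSheaf_iff_isSheaf_of_type _ _).2 (isSheaf_functor hF)⟩
  let f (b : B.left) : yoneda.obj (C b).left ⟶ S.1 := toMap (⟨(C b).hom, y b⟩ : TotPt F (C b).left)
  have hf (b : B.left) : IsOpenImmersion.presheaf (f b) := presheaf_chart hπ (hy b)
  -- The preimages of the opens `U b` under `π x` cover `T`, and over each of them `x` comes from
  -- the corresponding chart.
  have : Presheaf.IsLocallySurjective Scheme.zariskiTopology (Sigma.desc f) := by
    refine ⟨fun {T} x ↦ ?_⟩
    obtain ⟨s, x⟩ := (x : TotPt F T)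
    refine Scheme.zariskiTopology.superset_covering ?_
      (nhdCover (T := Over.mk s) (fun t ↦ (π x).left ⁻¹ᵁ U ((π x).left t))
        (fun t ↦ hU _)).mem_grothendieckTopology
    refine (Sieve.generate_le_iff _ _).2 ?_
    rintro - - ⟨t⟩
    obtain ⟨ψ, hψ, -⟩ := (hy ((π x).left t)).2
      (F.map (opnι (Over.mk s) ((π x).left ⁻¹ᵁ U ((π x).left t))).op x) fun r ↦ by
        rw [hπ]
        exact opnι_mem ((π x).left ⁻¹ᵁ U ((π x).left t)) r
    refine ⟨(Sigma.ι (fun b ↦ yoneda.obj (C b).left) ((π x).left t)).app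
      (.op (opn (Over.mk s) ((π x).left ⁻¹ᵁ U ((π x).left t))).left) ψ.left, ?_⟩
    have h1 := congr(($(Sigma.ι_desc f ((π x).left t))).app
      (.op (opn (Over.mk s) ((π x).left ⁻¹ᵁ U ((π x).left t))).left) ψ.left)
    refine Eq.trans h1 ?_
    refine (res_mk ψ (y ((π x).left t))).trans ?_
    rw [hψ]
    exact (res_mk (opnι (Over.mk s) ((π x).left ⁻¹ᵁ U ((π x).left t))) x).symm
  have r := Scheme.LocalRepresentability.representableBy hf
  obtain ⟨⟨s, e⟩, he⟩ : ∃ e : TotPt F _, r.homEquiv (𝟙 _) = e := ⟨_, rfl⟩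
  -- By the Yoneda lemma the bijection is restriction of the element which corresponds to the
  -- identity.
  have key {T : Scheme.{u}} (a : T ⟶ _) : r.homEquiv a = res a (⟨s, e⟩ : TotPt F _) := by
    have := r.homEquiv_comp a (𝟙 _)
    rw [Category.comp_id] at this
    rw [this, he]
    rfl
  refine ⟨Over.mk s, e, fun T x ↦ ?_⟩
  obtain ⟨a, ha⟩ := r.homEquiv.surjective (⟨T.hom, x⟩ : TotPt F T.left)
  rw [key] at ha
  refine ⟨Over.homMk a (congrArg str ha), ?_, fun g hg ↦ ?_⟩
  · exact mk_injective
      ((res_mk (F := F) (Over.homMk a (congrArg str ha) : T ⟶ Over.mk s) e).symm.trans ha)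
  · ext1
    refine r.homEquiv.injective ?_
    refine (key _).trans (Eq.trans ?_ (key _).symm)
    refine (res_mk g e).trans ?_
    rw [hg]
    exact ha.symm

end

end

section

/-! ### Equivariant maps between schemes with a `𝔾ₘ`-action -/

/-- The value of a morphism on a fibre product at a pair of points. -/
def app {P Q B Z : Over (Spec (.of k))} {p : P ⟶ B} {q : Q ⟶ B} (β : pullback p q ⟶ Z)
    {T : Over (Spec (.of k))} (x : T ⟶ P) (y : T ⟶ Q) (h : x ≫ p = y ≫ q) : T ⟶ Z :=
  pullback.lift x y h ≫ β

section app

variable {P Q B Z : Over (Spec (.of k))} {p : P ⟶ B} {q : Q ⟶ B}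

lemma app_congr (β : pullback p q ⟶ Z) {T : Over (Spec (.of k))} {x x' : T ⟶ P} {y y' : T ⟶ Q}
    (hx : x = x') (hy : y = y') (h : x ≫ p = y ≫ q) :
    app β x y h = app β x' y' (by rw [← hx, ← hy, h]) := by
  subst hx hy
  rfl

lemma comp_app (β : pullback p q ⟶ Z) {T T' : Over (Spec (.of k))} (f : T' ⟶ T) (x : T ⟶ P)
    (y : T ⟶ Q) (h : x ≫ p = y ≫ q) :
    f ≫ app β x y h = app β (f ≫ x) (f ≫ y) (by simp [h]) := by
  rw [app, app, ← Category.assoc]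
  congr 1
  apply pullback.hom_ext <;> simp [pullback.lift_fst, pullback.lift_snd]

lemma app_hom_ext {β β' : pullback p q ⟶ Z}
    (h : ∀ ⦃T : Over (Spec (.of k))⦄ (x : T ⟶ P) (y : T ⟶ Q) (h : x ≫ p = y ≫ q),
      app β x y h = app β' x y h) : β = β' := by
  have := h _ _ (pullback.condition (f := p) (g := q))
  simpa [app] using this

lemma app_baseChange {Q' : Over (Spec (.of k))} {f : Q' ⟶ P} (β : pullback p q ⟶ Z)
    (h : (pullback.fst (f ≫ p) q ≫ f) ≫ p = pullback.snd (f ≫ p) q ≫ q)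
    {T : Over (Spec (.of k))} (x : T ⟶ Q') (y : T ⟶ Q) (h' : x ≫ f ≫ p = y ≫ q) :
    app (app β (pullback.fst (f ≫ p) q ≫ f) (pullback.snd (f ≫ p) q) h) x y h' =
      app β (x ≫ f) y (by simpa using h') := by
  simp only [app, ← Category.assoc]
  congr 1
  apply pullback.hom_ext <;> simp [pullback.lift_fst_assoc, pullback.lift_snd, pullback.lift_fst]

/-- A natural operation on pairs of points over the same point of the base is given by a
morphism. -/
lemma exists_app (φ : ∀ ⦃T : Over (Spec (.of k))⦄ (x : T ⟶ P) (y : T ⟶ Q),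
      x ≫ p = y ≫ q → (T ⟶ Z))
    (hφ : ∀ ⦃T T' : Over (Spec (.of k))⦄ (f : T' ⟶ T) (x : T ⟶ P) (y : T ⟶ Q)
      (h : x ≫ p = y ≫ q), f ≫ φ x y h = φ (f ≫ x) (f ≫ y) (by simp [h])) :
    ∃ β : pullback p q ⟶ Z, ∀ ⦃T : Over (Spec (.of k))⦄ (x : T ⟶ P) (y : T ⟶ Q)
      (h : x ≫ p = y ≫ q), app β x y h = φ x y h := by
  refine ⟨φ (pullback.fst p q) (pullback.snd p q) pullback.condition, fun T x y h ↦ ?_⟩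
  rw [app, hφ]
  simp only [pullback.lift_fst, pullback.lift_snd]

end app

variable {B P Z : Over (Spec (.of k))} [ModObj (Gm k) P] [ModObj (Gm k) Z] (p : P ⟶ B)
  (hp : ∀ ⦃T : Over (Spec (.of k))⦄ (t : T ⟶ Gm k) (q : T ⟶ P), (t • q) ≫ p = q ≫ p)
  (K : ∀ ⦃T : Over (Spec (.of k))⦄, (T ⟶ P) → (T ⟶ Z) → Prop)

/-- For a point `b` of `B`, an equivariant morphism to `Z` from the base change of `P` along `b`
whose graph satisfies the relation `K`. -/
structure EquivPt (T : Over (Spec (.of k))) where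
  /-- The point of the base. -/
  base : T ⟶ B
  /-- The equivariant morphism. -/
  map : pullback base p ⟶ Z
  smul : ∀ ⦃T' : Over (Spec (.of k))⦄ (s : T' ⟶ T) (q : T' ⟶ P) (t : T' ⟶ Gm k)
    (h : s ≫ base = q ≫ p), app map s (t • q) (h.trans (hp t q).symm) = t • app map s q h
  rel : ∀ ⦃T' : Over (Spec (.of k))⦄ (s : T' ⟶ T) (q : T' ⟶ P) (h : s ≫ base = q ≫ p),
    K q (app map s q h)

namespace EquivPt

variable {p hp K}

lemma ext' {T : Over (Spec (.of k))} {x y : EquivPt p hp K T} (hb : x.base = y.base)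
    (h : ∀ ⦃T' : Over (Spec (.of k))⦄ (s : T' ⟶ T) (q : T' ⟶ P) (h : s ≫ x.base = q ≫ p),
      app x.map s q h = app y.map s q (by rw [← hb, h])) : x = y := by
  obtain ⟨b, m, _, _⟩ := x
  obtain ⟨b', m', _, _⟩ := y
  obtain rfl : b = b' := hb
  obtain rfl : m = m' := app_hom_ext h
  rfl

/-- The base change of an equivariant morphism. -/
def res {T T' : Over (Spec (.of k))} (f : T' ⟶ T) (x : EquivPt p hp K T) :
    EquivPt p hp K T' where
  base := f ≫ x.base
  map := app x.map (pullback.fst _ _ ≫ f) (pullback.snd _ _)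
    (by rw [Category.assoc, pullback.condition])
  smul T' s q t h := by
    rw [app_baseChange, app_baseChange]
    exact x.smul (s ≫ f) q t _
  rel T' s q h := by
    rw [app_baseChange]
    exact x.rel (s ≫ f) q _

lemma app_res {T T' T'' : Over (Spec (.of k))} (f : T' ⟶ T) (x : EquivPt p hp K T)
    (s : T'' ⟶ T') (q : T'' ⟶ P) (h : s ≫ f ≫ x.base = q ≫ p) :
    app (x.res f).map s q h = app x.map (s ≫ f) q (by simpa using h) :=
  app_baseChange _ _ _ _ _

variable (p hp K) in
/-- The functor of equivariant morphisms. -/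
def functor : (Over (Spec (.of k)))ᵒᵖ ⥤ Type u where
  obj T := EquivPt p hp K T.unop
  map f := ↾res f.unop
  map_id T := by
    ext x
    refine ext' (Category.id_comp _) fun T' s q h ↦ ?_
    refine (app_res _ _ _ _ _).trans (app_congr _ (Category.comp_id s) rfl _)
  map_comp f g := by
    ext x
    refine ext' (Category.assoc _ _ _) fun T' s q h ↦ ?_
    refine (app_res _ _ _ _ _).trans ((app_congr _ (Category.assoc s _ _).symm rfl _).trans ?_)
    exact ((app_res _ _ _ _ _).trans (app_res _ _ _ _ _)).symm

/-- The base point and the map are morphisms and hence glue. Equivariance is an equality of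
morphisms, so it is local; the relation `K` is local by the hypothesis `hK`. -/
lemma isZariskiSheaf_functor
    (hK : ∀ ⦃T : Over (Spec (.of k))⦄ (q : T ⟶ P) (z : T ⟶ Z),
      Loc T (fun _ j ↦ K (j ≫ q) (j ≫ z)) → K q z) :
    IsZariskiSheaf (functor p hp K) := by
  intro T R stab uniq ex
  replace stab : ∀ ⦃T' T'' : Over (Spec (.of k))⦄ (f : T' ⟶ T) (x : EquivPt p hp K T')
    (g : T'' ⟶ T'), R f x → R (g ≫ f) (x.res g) := stab
  replace uniq : ∀ ⦃T' : Over (Spec (.of k))⦄ (f : T' ⟶ T) (x y : EquivPt p hp K T'),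
    R f x → R f y → x = y := uniq
  have sR : Stab fun _ j ↦ ∃ x, R j x := fun _ _ j i ⟨x, hx⟩ ↦ ⟨_, stab _ x i hx⟩
  obtain ⟨b, hb⟩ := exists_glue (Z := B) (fun T' f c ↦ ∃ x : EquivPt p hp K T', R f x ∧ x.base = c)
    (by
      rintro T' T'' f _ g ⟨x, hx, rfl⟩
      exact ⟨_, stab f x g hx, rfl⟩)
    (by
      rintro T' f _ _ ⟨x, hx, rfl⟩ ⟨y, hy, rfl⟩
      rw [uniq f x y hx hy])
    (ex.mono fun _ j ⟨x, hx⟩ ↦ ⟨_, x, hx, rfl⟩)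
  replace hb {T' : Over (Spec (.of k))} (f : T' ⟶ T) (x : EquivPt p hp K T') (hx : R f x) :
    f ≫ b = x.base := hb f _ ⟨x, hx, rfl⟩
  -- The glued map takes at a point of the fibre product the value of any local datum available
  -- there; evaluation at the identity avoids carrying a further base change.
  obtain ⟨m, hm⟩ := exists_glue (T := pullback b p) (Z := Z)
    (fun T' f h ↦ ∃ x : EquivPt p hp K T', ∃ hw : 𝟙 _ ≫ x.base = (f ≫ pullback.snd _ _) ≫ p,
      R (f ≫ pullback.fst _ _) x ∧ h = app x.map (𝟙 _) (f ≫ pullback.snd _ _) hw)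
    (by
      rintro T' T'' f _ g ⟨x, hw, hx, rfl⟩
      have := stab _ x g hx
      rw [← Category.assoc] at this
      rw [Category.id_comp] at hw
      refine ⟨x.res g, ?_, this, ?_⟩
      · change 𝟙 _ ≫ g ≫ x.base = _
        rw [hw]
        simp
      · refine (comp_app _ _ _ _ _).trans (Eq.trans ?_ (app_res _ _ _ _ _).symm)
        exact app_congr _ (by simp) (by simp) _)
    (by
      rintro T' f _ _ ⟨x, hw, hx, rfl⟩ ⟨y, hw', hy, rfl⟩
      obtain rfl := uniq _ x y hx hy
      rfl)
    ((Loc.pullback ex sR (pullback.fst b p)).mono fun T' j ⟨x, hx⟩ ↦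
      ⟨_, x, by
        rw [Category.id_comp, Category.assoc, ← pullback.condition, ← hb _ x hx, Category.assoc],
        hx, rfl⟩)
  replace hm {T' T'' : Over (Spec (.of k))} (f : T' ⟶ T) (x : EquivPt p hp K T') (hx : R f x)
      (s : T'' ⟶ T') (q : T'' ⟶ P) (h : s ≫ x.base = q ≫ p)
      (h' : (s ≫ f) ≫ b = q ≫ p) :
      app m (s ≫ f) q h' = app x.map s q h := by
    refine hm (pullback.lift (s ≫ f) q h') _ ⟨x.res s, ?_, ?_, ?_⟩
    · change 𝟙 _ ≫ s ≫ x.base = _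
      simpa [pullback.lift_snd_assoc] using h
    · rw [pullback.lift_fst]
      exact stab _ x s hx
    · refine Eq.trans ?_ (app_res _ _ _ _ _).symm
      exact app_congr _ (by simp) (by simp [pullback.lift_snd]) _
  let x₀ : EquivPt p hp K T := ⟨b, m, fun T' s q t h ↦ by
      refine hom_ext_loc ((Loc.pullback ex sR s).mono fun T'' j ⟨x, hx⟩ ↦ ?_)
      have e : 𝟙 _ ≫ x.base = (j ≫ q) ≫ p := by
        rw [← hb _ x hx, Category.id_comp, Category.assoc, Category.assoc, h]
      rw [comp_app, ModObj.comp_smul (X := Z), comp_app]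
      have e1 := hm _ x hx (𝟙 _) (j ≫ q) e
        (by rw [Category.id_comp, Category.assoc, Category.assoc, h])
      have e2 := hm _ x hx (𝟙 _) ((j ≫ t) • (j ≫ q)) (e.trans (hp _ _).symm)
        (by rw [hp, Category.id_comp, Category.assoc, Category.assoc, h])
      simp only [Category.id_comp] at e1 e2
      refine (app_congr m rfl (ModObj.comp_smul j t q) _).trans (e2.trans ?_)
      rw [e1]
      exact x.smul _ _ _ _,
    fun T' s q h ↦ by
      refine hK _ _ ((Loc.pullback ex sR s).mono fun T'' j ⟨x, hx⟩ ↦ ?_)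
      have e : 𝟙 _ ≫ x.base = (j ≫ q) ≫ p := by
        rw [← hb _ x hx, Category.id_comp, Category.assoc, Category.assoc, h]
      have e1 := hm _ x hx (𝟙 _) (j ≫ q) e
        (by rw [Category.id_comp, Category.assoc, Category.assoc, h])
      simp only [Category.id_comp] at e1
      rw [comp_app, e1]
      exact x.rel _ _ _⟩
  refine ⟨x₀, fun T' f y hy ↦ ?_, fun x' hx' ↦ ?_⟩
  · refine ext' (hb f y hy) fun T'' s q h ↦ ?_
    refine (app_res f x₀ s q h).trans ?_
    exact hm f y hy _ _ _ _
  · replace hx' {T' : Over (Spec (.of k))} (f : T' ⟶ T) (y : EquivPt p hp K T') (hy : R f y) :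
      res f x' = y := hx' f y hy
    have hbb : base x' = b := hom_ext_loc (ex.mono fun _ j ⟨x, hx⟩ ↦ by
      rw [hb _ x hx, ← hx' _ x hx]
      rfl)
    refine ext' hbb fun T'' s q h ↦ ?_
    refine hom_ext_loc ((Loc.pullback ex sR s).mono fun T'' j ⟨x, hx⟩ ↦ ?_)
    rw [comp_app, comp_app]
    have e : 𝟙 _ ≫ x.base = (j ≫ q) ≫ p := by
      rw [← hb _ x hx, Category.id_comp, Category.assoc, Category.assoc, ← hbb]
      exact congr(j ≫ $h)
    have e1 := hm _ x hx (𝟙 _) (j ≫ q) e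
        (by
          rw [Category.id_comp, Category.assoc, Category.assoc, ← hbb]
          exact congr(j ≫ $h))
    simp only [Category.id_comp] at e1
    refine Eq.trans ?_ e1.symm
    obtain rfl := hx' _ x hx
    refine Eq.trans ?_ (app_res _ _ _ _ _).symm
    exact app_congr _ (by simp) rfl _

end EquivPt

end

/-! ### Universal equivariant maps -/

section

section

variable {B P Z : Over (Spec (.of k))} [ModObj (Gm k) P] [ModObj (Gm k) Z] {p : P ⟶ B}
  {hp : ∀ ⦃T : Over (Spec (.of k))⦄ (t : T ⟶ Gm k) (q : T ⟶ P), (t • q) ≫ p = q ≫ p}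
  {K : ∀ ⦃T : Over (Spec (.of k))⦄, (T ⟶ P) → (T ⟶ Z) → Prop}

/-- An equivariant morphism given by its values on points. -/
lemma EquivPt.exists_of_values {T : Over (Spec (.of k))} (b : T ⟶ B)
    (φ : ∀ ⦃T' : Over (Spec (.of k))⦄ (s : T' ⟶ T) (q : T' ⟶ P), s ≫ b = q ≫ p → (T' ⟶ Z))
    (nat : ∀ ⦃T' T'' : Over (Spec (.of k))⦄ (f : T'' ⟶ T') (s : T' ⟶ T) (q : T' ⟶ P)
      (h : s ≫ b = q ≫ p), f ≫ φ s q h = φ (f ≫ s) (f ≫ q) (by simp [h]))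
    (smul : ∀ ⦃T' : Over (Spec (.of k))⦄ (s : T' ⟶ T) (q : T' ⟶ P) (t : T' ⟶ Gm k)
      (h : s ≫ b = q ≫ p), φ s (t • q) (h.trans (hp t q).symm) = t • φ s q h)
    (rel : ∀ ⦃T' : Over (Spec (.of k))⦄ (s : T' ⟶ T) (q : T' ⟶ P)
      (h : s ≫ b = q ≫ p), K q (φ s q h)) :
    ∃ x : EquivPt p hp K T, x.base = b ∧ ∀ ⦃T' : Over (Spec (.of k))⦄ (s : T' ⟶ T) (q : T' ⟶ P)
      (h : s ≫ b = q ≫ p) (h' : s ≫ x.base = q ≫ p), app x.map s q h' = φ s q h := by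
  obtain ⟨m, hm⟩ := exists_app φ fun T T' f s q h ↦ nat f s q h
  exact ⟨⟨b, m, fun T' s q t h ↦ by rw [hm, hm, smul], fun T' s q h ↦ by
    rw [hm]
    exact rel _ _ _⟩, rfl, fun T' s q h h' ↦ hm _ _ _⟩

/-- If equivariant morphisms are representable locally on `B`, then there is a universal one. -/
theorem exists_universal
    (hK : ∀ ⦃T : Over (Spec (.of k))⦄ (q : T ⟶ P) (z : T ⟶ Z),
      Loc T (fun _ j ↦ K (j ≫ q) (j ≫ z)) → K q z)
    (charts : ∀ b : B.left, ∃ U : B.left.Opens, b ∈ U ∧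
      ∃ (Y : Over (Spec (.of k))) (r : Y ⟶ opn B U) (y : EquivPt p hp K Y), y.base = r ≫ opnι B U ∧
        ∀ ⦃T : Over (Spec (.of k))⦄ (x : EquivPt p hp K T) (u : T ⟶ opn B U),
          x.base = u ≫ opnι B U → ∃! f : T ⟶ Y, f ≫ r = u ∧
            ∀ ⦃T' : Over (Spec (.of k))⦄ (s : T' ⟶ T) (q : T' ⟶ P) (h : s ≫ x.base = q ≫ p)
              (h' : (s ≫ f) ≫ y.base = q ≫ p), app y.map (s ≫ f) q h' = app x.map s q h) :
    ∃ (E : Over (Spec (.of k))) (e : EquivPt p hp K E), ∀ ⦃T : Over (Spec (.of k))⦄ (b : T ⟶ B)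
      (φ : ∀ ⦃T' : Over (Spec (.of k))⦄ (s : T' ⟶ T) (q : T' ⟶ P), s ≫ b = q ≫ p → (T' ⟶ Z))
      (_ : ∀ ⦃T' T'' : Over (Spec (.of k))⦄ (f : T'' ⟶ T') (s : T' ⟶ T) (q : T' ⟶ P)
        (h : s ≫ b = q ≫ p), f ≫ φ s q h = φ (f ≫ s) (f ≫ q) (by simp [h]))
      (_ : ∀ ⦃T' : Over (Spec (.of k))⦄ (s : T' ⟶ T) (q : T' ⟶ P) (t : T' ⟶ Gm k)
        (h : s ≫ b = q ≫ p), φ s (t • q) (h.trans (hp t q).symm) = t • φ s q h)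
      (_ : ∀ ⦃T' : Over (Spec (.of k))⦄ (s : T' ⟶ T) (q : T' ⟶ P)
        (h : s ≫ b = q ≫ p), K q (φ s q h)),
      ∃! f : T ⟶ E, f ≫ e.base = b ∧ ∀ ⦃T' : Over (Spec (.of k))⦄ (s : T' ⟶ T) (q : T' ⟶ P)
        (h : s ≫ b = q ≫ p) (h' : (s ≫ f) ≫ e.base = q ≫ p), app e.map (s ≫ f) q h' = φ s q h := by
  obtain ⟨E, (e : EquivPt p hp K E), he⟩ := exists_representing (F := EquivPt.functor p hp K) (B := B)
    (π := fun T (x : EquivPt p hp K T) ↦ x.base) (fun T T' f x ↦ rfl)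
    (EquivPt.isZariskiSheaf_functor hK) (fun b ↦ by
      obtain ⟨U, hU, Y, r, y, hy, H⟩ := charts b
      refine ⟨U, hU, Y, y, fun s ↦ ?_, fun T (x : EquivPt p hp K T) hx ↦ ?_⟩
      · have h := comp_opnι_mem U r s
        rw [← hy] at h
        exact h
      · obtain ⟨f, ⟨hf, hf'⟩, hu⟩ := H x (opnLift x.base U hx) (by simp)
        refine ⟨f, EquivPt.ext' ?_ fun T' s q h ↦ ?_, fun g hg ↦ hu g ⟨?_, fun T' s q h h' ↦ ?_⟩⟩
        · exact congr(f ≫ $hy).trans (by rw [← Category.assoc, hf, opnLift_ι])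
        · exact (EquivPt.app_res f y s q h).trans (hf' _ _ _ _)
        · rw [← cancel_mono (opnι B U), opnLift_ι, Category.assoc, ← hy]
          exact congrArg EquivPt.base hg
        · obtain rfl : EquivPt.res g y = x := hg
          exact (EquivPt.app_res g y s q h).symm)
  refine ⟨E, e, fun T b φ nat smul rel ↦ ?_⟩
  obtain ⟨x, rfl, hx⟩ := EquivPt.exists_of_values (hp := hp) (K := K) b φ nat smul rel
  obtain ⟨f, hf, hu⟩ := he (T := T) x
  obtain rfl : EquivPt.res f e = x := hf
  refine ⟨f, ⟨rfl, fun T' s q h h' ↦ ?_⟩, fun g ⟨hg, hg'⟩ ↦ hu g (EquivPt.ext' hg fun T' s q h ↦ ?_)⟩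
  · rw [← hx s q h h]
    exact (EquivPt.app_res f e s q h).symm
  · have h2 : s ≫ EquivPt.base (EquivPt.res f e) = q ≫ p := hg ▸ h
    refine (EquivPt.app_res g e s q h).trans ((hg' s q h2 ?_).trans (hx s q h2 h2).symm)
    rw [Category.assoc]
    exact h

end

end

section

open LineBundle

/-! ### Frames -/

/-- A trivialization over the point `x : T ⟶ X` of the scheme with `𝔾ₘ`-action `p : L ⟶ X`. -/
structure IsFrame {X L T : Over (Spec (.of k))} [ModObj (Gm k) L] (p : L ⟶ X) (x : T ⟶ X)
    (ψ : T ⊗ A1 k ⟶ L) : Prop where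
  proj : ψ ≫ p = fst _ _ ≫ x
  smul : ∀ ⦃T' : Over (Spec (.of k))⦄ (t : T' ⟶ Gm k) (s : T' ⟶ T) (a : T' ⟶ A1 k),
    lift s (Gm.val t * a) ≫ ψ = t • (lift s a ≫ ψ)
  bij : ∀ ⦃T' : Over (Spec (.of k))⦄ (s : T' ⟶ T) (l : T' ⟶ L), l ≫ p = s ≫ x →
    ∃! a : T' ⟶ A1 k, lift s a ≫ ψ = l

section

variable {X L : Over (Spec (.of k))} [ModObj (Gm k) L] {p : L ⟶ X}

lemma Trivialization.isFrame {U : X.left.Opens} (e : Trivialization p U) :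
    IsFrame p (opnι X U) e.hom where
  proj := e.isPullback.w
  smul T' t s a := by
    rw [← A1.scale_eq]
    exact e.smul _ _ _
  bij T' s l h := by
    refine ⟨e.isPullback.lift l s h ≫ snd _ _, ?_, fun a ha ↦ ?_⟩
    · dsimp only
      conv_rhs => rw [← e.isPullback.lift_fst l s h]
      congr 1
      ext1
      · simp
      · simp
    · have : e.isPullback.lift l s h = lift s a :=
        e.isPullback.hom_ext (by simp [ha]) (by simp)
      rw [this, lift_snd]

/-- The trivialization given by a frame. -/
def IsFrame.trivialization {U : X.left.Opens} {ψ : opn X U ⊗ A1 k ⟶ L}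
    (h : IsFrame p (opnι X U) ψ) : Trivialization p U where
  hom := ψ
  isPullback := by
    refine ⟨⟨h.proj⟩, ⟨PullbackCone.IsLimit.mk _
      (fun c ↦ lift c.snd (h.bij c.snd c.fst c.condition).choose)
      (fun c ↦ (h.bij c.snd c.fst c.condition).choose_spec.1) (fun c ↦ lift_fst _ _)
      fun c m h₁ h₂ ↦ ?_⟩⟩
    refine CartesianMonoidalCategory.hom_ext _ _ (by rw [h₂, lift_fst]) ?_
    rw [lift_snd]
    refine (h.bij c.snd c.fst c.condition).choose_spec.2 _ ?_
    dsimp only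
    rw [← h₁, ← h₂]
    congr 1
    ext1 <;> simp
  smul t x a := by
    rw [A1.scale_eq]
    exact h.smul _ _ _

lemma IsFrame.comp {T T' : Over (Spec (.of k))} {x : T ⟶ X} {ψ : T ⊗ A1 k ⟶ L}
    (h : IsFrame p x ψ) (f : T' ⟶ T) : IsFrame p (f ≫ x) (f ▷ A1 k ≫ ψ) where
  proj := by simp [h.proj]
  smul T'' t s a := by simp only [lift_whiskerRight_assoc, h.smul]
  bij T'' s l hl := by
    simp only [lift_whiskerRight_assoc]
    exact h.bij _ _ (by simpa using hl)

lemma IsFrame.lift_proj {T T' : Over (Spec (.of k))} {x : T ⟶ X} {ψ : T ⊗ A1 k ⟶ L}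
    (h : IsFrame p x ψ) (s : T' ⟶ T) (a : T' ⟶ A1 k) : (lift s a ≫ ψ) ≫ p = s ≫ x := by
  rw [Category.assoc, h.proj, lift_fst_assoc]

end

/-- A family of equivariant maps, natural in `s`, from the points of `p : L ⟶ X` over `s ≫ x` to
the points of `q : M ⟶ Y` over `s ≫ y`. -/
structure EqFam {X Y L M T : Over (Spec (.of k))} [ModObj (Gm k) L] [ModObj (Gm k) M]
    (p : L ⟶ X) (q : M ⟶ Y) (x : T ⟶ X) (y : T ⟶ Y) where
  /-- The value at a point. -/
  val : ∀ ⦃T' : Over (Spec (.of k))⦄ (s : T' ⟶ T) (l : T' ⟶ L), l ≫ p = s ≫ x → (T' ⟶ M)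
  nat : ∀ ⦃T' T'' : Over (Spec (.of k))⦄ (f : T'' ⟶ T') (s : T' ⟶ T) (l : T' ⟶ L)
    (h : l ≫ p = s ≫ x), f ≫ val s l h = val (f ≫ s) (f ≫ l) (by simp [h])
  proj : ∀ ⦃T' : Over (Spec (.of k))⦄ (s : T' ⟶ T) (l : T' ⟶ L) (h : l ≫ p = s ≫ x),
    val s l h ≫ q = s ≫ y
  smul : ∀ ⦃T' : Over (Spec (.of k))⦄ (s : T' ⟶ T) (t : T' ⟶ Gm k) (l : T' ⟶ L)
    (h : l ≫ p = s ≫ x) (h' : (t • l) ≫ p = s ≫ x), val s (t • l) h' = t • val s l h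

namespace EqFam

variable {X Y L M T : Over (Spec (.of k))} [ModObj (Gm k) L] [ModObj (Gm k) M]
  {p : L ⟶ X} {q : M ⟶ Y} {x : T ⟶ X} {y : T ⟶ Y} (φ : EqFam p q x y)

lemma val_congr {T' : Over (Spec (.of k))} {s s' : T' ⟶ T} {l l' : T' ⟶ L} (hs : s = s')
    (hl : l = l') (h : l ≫ p = s ≫ x) : φ.val s l h = φ.val s' l' (by rw [← hs, ← hl, h]) := by
  subst hs hl
  rfl

/-- In frames, equivariant maps are multiplications by functions. -/
lemma exists_coeff {ψ : T ⊗ A1 k ⟶ L} (hψ : IsFrame p x ψ) {ψ' : T ⊗ A1 k ⟶ M}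
    (hψ' : IsFrame q y ψ') :
    ∃ u : T ⟶ A1 k, ∀ ⦃T' : Over (Spec (.of k))⦄ (s : T' ⟶ T) (a : T' ⟶ A1 k),
      φ.val s (lift s a ≫ ψ) (hψ.lift_proj s a) = lift s (a * (s ≫ u)) ≫ ψ' := by
  -- `F` is the coordinate, in the second frame, of the image of the tautological point of the first
  -- frame. It inherits homogeneity of degree one, so it is linear in the coordinate, and its value
  -- at `1` is the coefficient.
  obtain ⟨F, hF, -⟩ := hψ'.bij (fst T (A1 k)) (φ.val (fst T (A1 k)) ψ hψ.proj) (φ.proj _ _ _)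
  have hF' {T' : Over (Spec (.of k))} (s : T' ⟶ T) (a : T' ⟶ A1 k) :
      φ.val s (lift s a ≫ ψ) (hψ.lift_proj s a) = lift s (lift s a ≫ F) ≫ ψ' := by
    have := congr(lift s a ≫ $hF)
    rw [φ.nat] at this
    rw [φ.val_congr (lift_fst s a).symm rfl, ← this, comp_lift_assoc, lift_fst]
  have key : ∀ ⦃T' : Over (Spec (.of k))⦄ (t : T' ⟶ Gm k) (s : T' ⟶ T) (a : T' ⟶ A1 k),
      lift s (Gm.val t * a) ≫ F = Gm.val t * (lift s a ≫ F) := by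
    intro T' t s a
    refine (hψ'.bij s _ ((hψ'.lift_proj s (lift s (Gm.val t * a) ≫ F)))).unique rfl ?_
    have h := hψ.smul t s a
    rw [hψ'.smul, ← hF', ← hF', ← φ.smul s t _ (hψ.lift_proj s a) (h ▸ hψ.lift_proj _ _)]
    exact (φ.val_congr rfl h _).symm
  refine ⟨lift (𝟙 T) 1 ≫ F, fun T' s a ↦ ?_⟩
  rw [hF', A1.linear_of_equivariant F key]
  congr 3
  rw [comp_lift_assoc, Category.comp_id, A1.comp_one]

/-- The identity. -/
def id (p : L ⟶ X) (x : T ⟶ X) : EqFam p p x x where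
  val _ _ l _ := l
  nat _ _ _ _ _ _ := rfl
  proj _ _ _ h := h
  smul _ _ _ _ _ _ := rfl

/-- The base change of a family. -/
def res {T' : Over (Spec (.of k))} (f : T' ⟶ T) : EqFam p q (f ≫ x) (f ≫ y) where
  val T'' s l h := φ.val (s ≫ f) l (by simpa using h)
  nat T₁ T₂ g s l h := by
    rw [φ.nat]
    exact φ.val_congr (Category.assoc _ _ _).symm rfl _
  proj T'' s l h := by simp [φ.proj]
  smul T'' s t l h h' := φ.smul _ _ _ _ _

end EqFam

/-! ### The action of the affine line on a line bundle -/

namespace LineBundle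

variable {X T : Over (Spec (.of k))} (L : LineBundle X)

lemma loc_frame (x : T ⟶ X) : Loc T fun T' j ↦ ∃ ψ : T' ⊗ A1 k ⟶ L.tot, IsFrame L.proj (j ≫ x) ψ := by
  intro s
  obtain ⟨U, hU, ⟨e⟩⟩ := L.locTriv (x.left s)
  refine ⟨x.left ⁻¹ᵁ U, hU, ?_⟩
  obtain ⟨y, hy⟩ := exists_preimage_lift x U
  rw [← hy]
  exact ⟨_, e.isFrame.comp y⟩

lemma stab_frame (x : T ⟶ X) :
    Stab fun T' (j : T' ⟶ T) ↦ ∃ ψ : T' ⊗ A1 k ⟶ L.tot, IsFrame L.proj (j ≫ x) ψ := by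
  rintro T' T'' j i ⟨ψ, hψ⟩
  rw [Category.assoc]
  exact ⟨_, hψ.comp i⟩

/-- In a frame the action multiplies the coordinate. A change of frame multiplies coordinates by a
function (`EqFam.exists_coeff` for the identity), so the local definitions agree. -/
lemma exists_scMap : ∃ m : A1 k ⊗ L.tot ⟶ L.tot, ∀ ⦃T T' : Over (Spec (.of k))⦄ (x : T ⟶ X)
    (ψ : T ⊗ A1 k ⟶ L.tot) (_ : IsFrame L.proj x ψ) (s : T' ⟶ T) (a b : T' ⟶ A1 k),
    lift a (lift s b ≫ ψ) ≫ m = lift s (a * b) ≫ ψ := by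
  obtain ⟨m, hm⟩ := exists_glue (T := A1 k ⊗ L.tot) (Z := L.tot)
    (fun T f h ↦ ∃ ψ : T ⊗ A1 k ⟶ L.tot, IsFrame L.proj (f ≫ snd _ _ ≫ L.proj) ψ ∧
      ∃ b : T ⟶ A1 k, lift (𝟙 T) b ≫ ψ = f ≫ snd _ _ ∧
        h = lift (𝟙 T) ((f ≫ fst _ _) * b) ≫ ψ)
    (by
      rintro T' T'' f _ g ⟨ψ, hψ, b, hb, rfl⟩
      rw [Category.assoc]
      refine ⟨_, hψ.comp g, g ≫ b, ?_, ?_⟩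
      · simp [← hb, comp_lift_assoc]
      · rw [Category.assoc, ← A1.comp_mul]
        simp [comp_lift_assoc])
    (by
      rintro T' f _ _ ⟨ψ, hψ, b, hb, rfl⟩ ⟨ψ', hψ', b', hb', rfl⟩
      obtain ⟨u, hu⟩ := (EqFam.id _ _).exists_coeff hψ hψ'
      replace hu (a : T' ⟶ A1 k) : lift (𝟙 _) a ≫ ψ = lift (𝟙 _) (a * u) ≫ ψ' := by
        simpa [EqFam.id] using hu (𝟙 _) a
      obtain rfl : b' = b * u := (hψ'.bij (𝟙 _) _ (hψ'.lift_proj _ _)).unique rfl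
        ((hu b).symm.trans (hb.trans hb'.symm))
      rw [hu, mul_assoc])
    ((L.loc_frame (snd _ _ ≫ L.proj)).mono fun T j ⟨ψ, hψ⟩ ↦ by
      obtain ⟨b, hb, -⟩ := hψ.bij (𝟙 _) (j ≫ snd _ _) (by simp)
      exact ⟨_, ψ, hψ, b, hb, rfl⟩)
  refine ⟨m, fun T T' x ψ hψ s a b ↦ hm _ _ ⟨s ▷ _ ≫ ψ, ?_, b, ?_, ?_⟩⟩
  · have := hψ.comp s
    rwa [lift_snd_assoc, hψ.lift_proj]
  · simp
  · simp

/-- The action of the affine line on a line bundle. -/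
def sc (a : T ⟶ A1 k) (l : T ⟶ L.tot) : T ⟶ L.tot :=
  lift a l ≫ L.exists_scMap.choose

variable {L}

lemma comp_sc {T' : Over (Spec (.of k))} (f : T' ⟶ T) (a : T ⟶ A1 k) (l : T ⟶ L.tot) :
    f ≫ L.sc a l = L.sc (f ≫ a) (f ≫ l) := by
  rw [sc, sc, comp_lift_assoc]

lemma sc_frame {T' : Over (Spec (.of k))} {x : T ⟶ X} {ψ : T ⊗ A1 k ⟶ L.tot}
    (hψ : IsFrame L.proj x ψ) (s : T' ⟶ T) (a b : T' ⟶ A1 k) :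
    L.sc a (lift s b ≫ ψ) = lift s (a * b) ≫ ψ :=
  L.exists_scMap.choose_spec x ψ hψ s a b

/-- A local property of a point of a line bundle may be checked for points of frames. -/
lemma loc_frame_induction (l : T ⟶ L.tot) {Q : ∀ ⦃T' : Over (Spec (.of k))⦄, (T' ⟶ T) → Prop}
    (h : ∀ ⦃T' : Over (Spec (.of k))⦄ (j : T' ⟶ T) (ψ : T' ⊗ A1 k ⟶ L.tot)
      (_ : IsFrame L.proj (j ≫ l ≫ L.proj) ψ) (b : T' ⟶ A1 k), j ≫ l = lift (𝟙 _) b ≫ ψ → Q j) :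
    Loc T Q :=
  (L.loc_frame (l ≫ L.proj)).mono fun T' j ⟨ψ, hψ⟩ ↦ by
    obtain ⟨b, hb, -⟩ := hψ.bij (𝟙 _) (j ≫ l) (by simp)
    exact h j ψ hψ b hb.symm

lemma sc_one (l : T ⟶ L.tot) : L.sc 1 l = l :=
  hom_ext_loc (loc_frame_induction l fun T' j ψ hψ b hb ↦ by
    rw [comp_sc, hb, A1.comp_one, sc_frame hψ, one_mul])

lemma sc_sc (a b : T ⟶ A1 k) (l : T ⟶ L.tot) : L.sc a (L.sc b l) = L.sc (a * b) l :=
  hom_ext_loc (loc_frame_induction l fun T' j ψ hψ c hc ↦ by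
    rw [comp_sc, comp_sc, comp_sc, hc, A1.comp_mul, sc_frame hψ, sc_frame hψ, sc_frame hψ,
      mul_assoc])

lemma sc_val (t : T ⟶ Gm k) (l : T ⟶ L.tot) : L.sc (Gm.val t) l = t • l :=
  hom_ext_loc (loc_frame_induction l fun T' j ψ hψ c hc ↦ by
    rw [comp_sc, ModObj.comp_smul, hc, Gm.comp_val, sc_frame hψ, hψ.smul])

lemma sc_proj (a : T ⟶ A1 k) (l : T ⟶ L.tot) : L.sc a l ≫ L.proj = l ≫ L.proj :=
  hom_ext_loc (loc_frame_induction l fun T' j ψ hψ c hc ↦ by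
    rw [← Category.assoc, ← Category.assoc, comp_sc, hc, sc_frame hψ, hψ.lift_proj, hψ.lift_proj])

/-- A point of a line bundle which is a basis of the line over its image. -/
def IsGen (l : T ⟶ L.tot) : Prop :=
  ∀ ⦃T' : Over (Spec (.of k))⦄ (f : T' ⟶ T) (l' : T' ⟶ L.tot), l' ≫ L.proj = f ≫ l ≫ L.proj →
    ∃! a : T' ⟶ A1 k, L.sc a (f ≫ l) = l'

lemma IsGen.comp {l : T ⟶ L.tot} (h : IsGen l) {T' : Over (Spec (.of k))} (f : T' ⟶ T) :
    IsGen (f ≫ l) := fun T'' g l' hl' ↦ by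
  have := h (g ≫ f) l' (by simpa using hl')
  rwa [Category.assoc] at this

lemma IsGen.exists_sc {l l' : T ⟶ L.tot} (h : IsGen l) (hl : l' ≫ L.proj = l ≫ L.proj) :
    ∃! a : T ⟶ A1 k, L.sc a l = l' := by
  have := h (𝟙 T) l' (by rw [Category.id_comp, hl])
  rwa [Category.id_comp] at this

lemma IsGen.sc_injective {l : T ⟶ L.tot} (h : IsGen l) {a b : T ⟶ A1 k}
    (hab : L.sc a l = L.sc b l) : a = b :=
  (h.exists_sc (sc_proj b l)).unique hab rfl

lemma isGen_of_isFrame {x : T ⟶ X} {ψ : T ⊗ A1 k ⟶ L.tot} (hψ : IsFrame L.proj x ψ) :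
    IsGen (lift (𝟙 T) 1 ≫ ψ) := fun T' f l' hl' ↦ by
  rw [hψ.lift_proj, Category.id_comp] at hl'
  convert hψ.bij f l' hl' using 2 with a
  rw [comp_lift_assoc, A1.comp_one, sc_frame hψ, Category.comp_id, mul_one]

/-- Together with `isGen_of_isFrame` this exchanges frames for generators, the form in which all
later constructions use local triviality. -/
lemma IsGen.isFrame {l : T ⟶ L.tot} (h : IsGen l) :
    IsFrame L.proj (l ≫ L.proj) (L.sc (snd T (A1 k)) (fst T (A1 k) ≫ l)) where
  proj := by rw [sc_proj, Category.assoc]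
  smul T' t s a := by
    rw [comp_sc, comp_sc, lift_snd, lift_snd, lift_fst_assoc, lift_fst_assoc, ← sc_sc, sc_val]
  bij T' s l' hl' := by
    convert h s l' hl' using 2 with a
    rw [comp_sc, lift_snd, lift_fst_assoc]

lemma loc_gen (x : T ⟶ X) : Loc T fun T' j ↦ ∃ l : T' ⟶ L.tot, l ≫ L.proj = j ≫ x ∧ IsGen l :=
  (L.loc_frame x).mono fun T' j ⟨ψ, hψ⟩ ↦
    ⟨lift (𝟙 _) 1 ≫ ψ, by rw [hψ.lift_proj, Category.id_comp], isGen_of_isFrame hψ⟩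

lemma stab_gen (x : T ⟶ X) :
    Stab fun T' (j : T' ⟶ T) ↦ ∃ l : T' ⟶ L.tot, l ≫ L.proj = j ≫ x ∧ IsGen l := by
  rintro T' T'' j i ⟨l, hl, h⟩
  exact ⟨i ≫ l, by simp [hl], h.comp i⟩

lemma isGen_sc_iff {l : T ⟶ L.tot} (h : IsGen l) (a : T ⟶ A1 k) : IsGen (L.sc a l) ↔ IsUnit a := by
  refine ⟨fun h' ↦ ?_, fun ha ↦ ?_⟩
  · obtain ⟨b, hb, -⟩ := h'.exists_sc (l' := l) (sc_proj _ _).symm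
    refine IsUnit.of_mul_eq_one_right b (h.sc_injective ?_)
    rw [← sc_sc, hb, sc_one]
  · obtain ⟨u, rfl⟩ := ha
    intro T' f l' hl'
    rw [sc_proj] at hl'
    obtain ⟨c, rfl, hc⟩ := h f l' hl'
    have e : f ≫ (u : T ⟶ A1 k) * f ≫ ((u⁻¹ : (T ⟶ A1 k)ˣ) : T ⟶ A1 k) = 1 := by
      rw [← A1.comp_mul, Units.mul_inv, A1.comp_one]
    refine ⟨c * f ≫ ((u⁻¹ : (T ⟶ A1 k)ˣ) : T ⟶ A1 k), ?_, fun d hd ↦ ?_⟩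
    · dsimp only
      rw [comp_sc, sc_sc, mul_assoc, mul_comm (f ≫ _), e, mul_one]
    · dsimp only at hd
      rw [comp_sc, sc_sc] at hd
      rw [← hc _ hd, mul_assoc, e, mul_one]

lemma IsGen.smul {l : T ⟶ L.tot} (h : IsGen l) (t : T ⟶ Gm k) : IsGen (t • l) := by
  rw [← sc_val, isGen_sc_iff h]
  exact Gm.isUnit_val t

/-- Two generators over the same point differ by a unit. -/
lemma IsGen.exists_smul {l l' : T ⟶ L.tot} (h : IsGen l) (h' : IsGen l')
    (hl : l' ≫ L.proj = l ≫ L.proj) : ∃! t : T ⟶ Gm k, t • l = l' := by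
  obtain ⟨a, rfl, ha⟩ := h.exists_sc hl
  obtain ⟨t, rfl⟩ := Gm.exists_val_eq ((isGen_sc_iff h a).1 h')
  refine ⟨t, (sc_val _ _).symm, fun s hs ↦ Gm.val_injective (ha _ ?_)⟩
  dsimp only at hs ⊢
  rw [sc_val, hs]

/-- Coefficients with respect to a generator are unique, so those found on a cover glue. -/
lemma isGen_of_loc {l : T ⟶ L.tot} (h : Loc T fun _ j ↦ IsGen (j ≫ l)) : IsGen l := by
  intro T' f l' hl'
  have h' := Loc.pullback h (fun _ _ j i hj ↦ by
    have := hj.comp i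
    rwa [← Category.assoc] at this) f
  obtain ⟨a, ha⟩ := exists_glue (T := T') (Z := A1 k)
    (fun T'' j a ↦ IsGen ((j ≫ f) ≫ l) ∧ L.sc a ((j ≫ f) ≫ l) = j ≫ l')
    (fun T₁ T₂ j a g ⟨h₁, h₂⟩ ↦ ⟨by simpa using h₁.comp g, by
      rw [Category.assoc g j l', ← h₂, comp_sc]
      simp⟩)
    (fun T'' j a b ⟨h₁, h₂⟩ ⟨_, h₃⟩ ↦ h₁.sc_injective (h₂.trans h₃.symm))
    (h'.mono fun T'' j hj ↦ by
      obtain ⟨a, ha, -⟩ := hj.exists_sc (l' := j ≫ l') (by simp [hl'])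
      exact ⟨a, hj, ha⟩)
  refine ⟨a, hom_ext_loc (h'.mono fun T'' j hj ↦ ?_), fun b hb ↦
    hom_ext_loc (h'.mono fun T'' j hj ↦ (ha j (j ≫ b) ⟨hj, ?_⟩).symm)⟩
  · obtain ⟨b, hb, -⟩ := hj.exists_sc (l' := j ≫ l') (by simp [hl'])
    rw [comp_sc, ha j b ⟨hj, hb⟩, ← hb, Category.assoc]
  · rw [← hb, comp_sc, Category.assoc]

end LineBundle

namespace EqFam

variable {X Y T : Over (Spec (.of k))} {L : LineBundle X} {M : LineBundle Y} {x : T ⟶ X}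
  {y : T ⟶ Y} (φ : EqFam L.proj M.proj x y)

/-- Equivariant maps are linear. -/
lemma map_sc {T' : Over (Spec (.of k))} (s : T' ⟶ T) (a : T' ⟶ A1 k) (l : T' ⟶ L.tot)
    (h : l ≫ L.proj = s ≫ x) :
    φ.val s (L.sc a l) ((sc_proj a l).trans h) = M.sc a (φ.val s l h) := by
  refine hom_ext_loc (((L.loc_frame (s ≫ x)).and (M.loc_frame (s ≫ y)) (L.stab_frame _)
    (M.stab_frame _)).mono fun T'' j ⟨⟨ψ, hψ⟩, ⟨ψ', hψ'⟩⟩ ↦ ?_)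
  rw [← Category.assoc] at hψ hψ'
  -- In frames of both bundles the map is multiplication by `u`, which commutes with the
  -- multiplication by `a`.
  obtain ⟨u, hu⟩ := (φ.res (j ≫ s)).exists_coeff hψ hψ'
  replace hu (b : T'' ⟶ A1 k) : φ.val (j ≫ s) (lift (𝟙 _) b ≫ ψ) (by
      rw [hψ.lift_proj, Category.id_comp]) = lift (𝟙 _) (b * u) ≫ ψ' := by
    have := hu (𝟙 _) b
    rw [Category.id_comp] at this
    rw [← this]
    exact φ.val_congr (Category.id_comp _).symm rfl _
  obtain ⟨b, hb, -⟩ := hψ.bij (𝟙 _) (j ≫ l) (by simp [h])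
  have hb' : j ≫ L.sc a l = lift (𝟙 _) ((j ≫ a) * b) ≫ ψ := by
    rw [comp_sc, ← hb, sc_frame hψ]
  refine (φ.nat _ _ _ _).trans ((φ.val_congr rfl hb' _).trans ((hu _).trans ?_))
  rw [comp_sc, φ.nat]
  refine Eq.trans ?_ congr(M.sc _ $(((φ.val_congr rfl hb.symm _).trans (hu b)).symm))
  rw [sc_frame hψ', ← mul_assoc]

/-- Generators over one point differ by a unit, which an equivariant map carries along. Preservation
of generators can thus be tested on a single one. -/
lemma isGen_of_isGen {T' : Over (Spec (.of k))} (s : T' ⟶ T) {l l' : T' ⟶ L.tot}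
    (h : l ≫ L.proj = s ≫ x) (h' : l' ≫ L.proj = s ≫ x) (hl : IsGen l) (hl' : IsGen l')
    (hg : IsGen (φ.val s l h)) : IsGen (φ.val s l' h') := by
  obtain ⟨t, rfl, -⟩ := hl.exists_smul hl' (h'.trans h.symm)
  rw [φ.smul s t l h]
  exact hg.smul t

/-- An equivariant map which sends a generator to a generator is bijective. -/
lemma existsUnique_val_eq {T' : Over (Spec (.of k))} (s : T' ⟶ T) {l : T' ⟶ L.tot}
    (h : l ≫ L.proj = s ≫ x) (hl : IsGen l) (hg : IsGen (φ.val s l h)) (m : T' ⟶ M.tot)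
    (hm : m ≫ M.proj = s ≫ y) :
    ∃ l' : T' ⟶ L.tot, ∃ h' : l' ≫ L.proj = s ≫ x, φ.val s l' h' = m ∧
      ∀ (l'' : T' ⟶ L.tot) (h'' : l'' ≫ L.proj = s ≫ x), φ.val s l'' h'' = m → l'' = l' := by
  obtain ⟨a, ha, hu⟩ := hg.exists_sc (hm.trans (φ.proj s l h).symm)
  refine ⟨L.sc a l, (sc_proj _ _).trans h, by rw [φ.map_sc s a l h, ha], fun l'' h'' e ↦ ?_⟩
  obtain ⟨b, rfl, -⟩ := hl.exists_sc (h''.trans h.symm)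
  rw [φ.map_sc s b l h] at e
  rw [hu b e]

end EqFam

end

/-! ### Actions, equivariant maps and pairings given on generators -/

section

open LineBundle

/-- An action given on points. -/
lemma exists_modObj {M E : Over (Spec (.of k))} [MonObj M]
    (act : ∀ ⦃T : Over (Spec (.of k))⦄, (T ⟶ M) → (T ⟶ E) → (T ⟶ E))
    (nat : ∀ ⦃T T' : Over (Spec (.of k))⦄ (f : T' ⟶ T) (m : T ⟶ M) (x : T ⟶ E),
      f ≫ act m x = act (f ≫ m) (f ≫ x))
    (one : ∀ ⦃T : Over (Spec (.of k))⦄ (x : T ⟶ E), act 1 x = x)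
    (mul : ∀ ⦃T : Over (Spec (.of k))⦄ (m n : T ⟶ M) (x : T ⟶ E),
      act (m * n) x = act m (act n x)) :
    ∃ _ : ModObj M E, ∀ ⦃T : Over (Spec (.of k))⦄ (m : T ⟶ M) (x : T ⟶ E), m • x = act m x := by
  let a : M ⊗ E ⟶ E := act (fst M E) (snd M E)
  have ha {T : Over (Spec (.of k))} (m : T ⟶ M) (x : T ⟶ E) : lift m x ≫ a = act m x := by
    rw [nat, lift_fst, lift_snd]
  let i : ModObj M E :=
    { smul := a
      one_smul := by
        change η[M] ▷ E ≫ a = (λ_ E).hom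
        have h1 : η[M] ▷ E = lift 1 (snd _ _) := by
          ext1
          · rw [whiskerRight_fst, lift_fst, Hom.one_def]
            congr 1
          · simp
        rw [h1, ha, one, leftUnitor_hom]
      mul_smul := by
        change μ[M] ▷ E ≫ a = (α_ M M E).hom ≫ M ◁ a ≫ a
        have h1 : μ[M] ▷ E = lift (fst _ _ ≫ fst _ _ * fst _ _ ≫ snd _ _) (snd _ _) := by
          ext1
          · rw [whiskerRight_fst, lift_fst, ← MonObj.comp_mul, MonObj.mul_eq_mul]
          · simp
        have h2 : (α_ M M E).hom ≫ M ◁ a =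
            lift (fst _ _ ≫ fst _ _) (act (fst _ _ ≫ snd _ _) (snd _ _)) := by
          ext1
          · simp
          · rw [Category.assoc, whiskerLeft_snd, lift_snd, nat, nat]
            simp
        rw [h1, ha, mul, ← Category.assoc, h2, ha] }
  exact ⟨i, fun T m x ↦ ha m x⟩

/-- Equivariant maps may be defined on generators, locally. -/
theorem exists_eqFam {X Y T : Over (Spec (.of k))} {L : LineBundle X} {M : LineBundle Y}
    (x : T ⟶ X) (y : T ⟶ Y)
    (R : ∀ ⦃T' : Over (Spec (.of k))⦄, (T' ⟶ T) → (T' ⟶ L.tot) → (T' ⟶ M.tot) → Prop)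
    (gen : ∀ ⦃T' : Over (Spec (.of k))⦄ (s : T' ⟶ T) (l : T' ⟶ L.tot) (m : T' ⟶ M.tot),
      R s l m → IsGen l ∧ l ≫ L.proj = s ≫ x ∧ m ≫ M.proj = s ≫ y)
    (stab : ∀ ⦃T' T'' : Over (Spec (.of k))⦄ (s : T' ⟶ T) (l : T' ⟶ L.tot) (m : T' ⟶ M.tot)
      (f : T'' ⟶ T'), R s l m → R (f ≫ s) (f ≫ l) (f ≫ m))
    (uniq : ∀ ⦃T' : Over (Spec (.of k))⦄ (s : T' ⟶ T) (l l' : T' ⟶ L.tot) (m m' : T' ⟶ M.tot),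
      R s l m → R s l' m' → ∃ t : T' ⟶ Gm k, l' = t • l ∧ m' = t • m)
    (ex : Loc T fun _ j ↦ ∃ l m, R j l m) :
    ∃ φ : EqFam L.proj M.proj x y, ∀ ⦃T' : Over (Spec (.of k))⦄ (s : T' ⟶ T) (l : T' ⟶ L.tot)
      (m : T' ⟶ M.tot) (h : l ≫ L.proj = s ≫ x), R s l m → φ.val s l h = m := by
  have sR : Stab fun _ j ↦ ∃ l m, R j l m := fun _ _ j i ⟨l, m, h⟩ ↦ ⟨_, _, stab _ _ _ i h⟩
  -- Locally a point is `a • l` with `l` related to some `m`, and it is sent to `a • m`. Another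
  -- related pair is `(t • l, t • m)` with a unit `t`; the coefficient then absorbs `t`, so the
  -- value does not change.
  obtain ⟨F, hF⟩ := exists_glue (T := pullback x L.proj) (Z := M.tot)
    (fun T' f h ↦ ∃ (l : T' ⟶ L.tot) (m : T' ⟶ M.tot) (a : T' ⟶ A1 k),
      R (f ≫ pullback.fst _ _) l m ∧ f ≫ pullback.snd _ _ = L.sc a l ∧ h = M.sc a m)
    (by
      rintro T₁ T₂ f _ g ⟨l, m, a, h, hf, rfl⟩
      refine ⟨g ≫ l, g ≫ m, g ≫ a, ?_, ?_, comp_sc g a m⟩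
      · rw [Category.assoc]
        exact stab _ _ _ g h
      · rw [← comp_sc, ← hf, Category.assoc])
    (by
      rintro T₁ f _ _ ⟨l, m, a, h, hf, rfl⟩ ⟨l', m', a', h', hf', rfl⟩
      obtain ⟨t, rfl, rfl⟩ := uniq _ _ _ _ _ h h'
      rw [← sc_val, sc_sc] at hf'
      obtain rfl := (gen _ _ _ h).1.sc_injective (hf.symm.trans hf')
      rw [← sc_val, sc_sc])
    ((Loc.pullback ex sR (pullback.fst _ _)).mono fun T' j ⟨l, m, h⟩ ↦ by
      obtain ⟨a, ha, -⟩ := (gen _ _ _ h).1.exists_sc (l' := j ≫ pullback.snd _ _) (by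
        rw [(gen _ _ _ h).2.1, Category.assoc, Category.assoc, pullback.condition])
      exact ⟨_, l, m, a, h, ha.symm, rfl⟩)
  have hF' {T' : Over (Spec (.of k))} (s : T' ⟶ T) (l : T' ⟶ L.tot) (m : T' ⟶ M.tot)
      (a : T' ⟶ A1 k) (h : R s l m) (h' : s ≫ x = L.sc a l ≫ L.proj) :
      app F s (L.sc a l) h' = M.sc a m :=
    hF _ _ ⟨l, m, a, by rwa [pullback.lift_fst], by rw [pullback.lift_snd], rfl⟩
  have key {T' : Over (Spec (.of k))} (s : T' ⟶ T) (l : T' ⟶ L.tot) (h : l ≫ L.proj = s ≫ x) :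
      Loc T' fun T'' j ↦ ∃ l' m' a, R (j ≫ s) l' m' ∧ j ≫ l = L.sc a l' :=
    (Loc.pullback ex sR s).mono fun T'' j ⟨l', m', h'⟩ ↦ by
      obtain ⟨a, ha, -⟩ := (gen _ _ _ h').1.exists_sc (l' := j ≫ l) (by
        rw [(gen _ _ _ h').2.1, Category.assoc, Category.assoc, h])
      exact ⟨l', m', a, h', ha.symm⟩
  refine ⟨⟨fun T' s l h ↦ app F s l h.symm, fun T₁ T₂ f s l h ↦ comp_app _ _ _ _ _,
    fun T' s l h ↦ ?_, fun T' s t l h h' ↦ ?_⟩, fun T' s l m h hR ↦ ?_⟩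
  · refine hom_ext_loc ((key s l h).mono fun T'' j ⟨l', m', a, h', e⟩ ↦ ?_)
    rw [← Category.assoc, comp_app, app_congr F rfl e, hF' _ _ _ _ h', sc_proj,
      (gen _ _ _ h').2.2, Category.assoc]
  · refine hom_ext_loc ((key s l h).mono fun T'' j ⟨l', m', a, h₁, e⟩ ↦ ?_)
    have e' : j ≫ (t • l) = L.sc (Gm.val (j ≫ t) * a) l' := by
      rw [ModObj.comp_smul, e, ← sc_val, sc_sc]
    rw [comp_app, app_congr F rfl e', hF' _ _ _ _ h₁, ModObj.comp_smul, comp_app,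
      app_congr F rfl e, hF' _ _ _ _ h₁, ← sc_val, sc_sc]
  · have := hF' s l m 1 hR (by rw [sc_one, h])
    exact (app_congr F rfl (sc_one l).symm _).trans (this.trans (sc_one m))

namespace LineBundle

variable {X : Over (Spec (.of k))} {L M N : LineBundle X}

/-- The pairing `β` is linear in each variable, and sends generators to generators. -/
structure IsPairing (L M N : LineBundle X) (β : pullback L.proj M.proj ⟶ N.tot) : Prop where
  proj : ∀ ⦃T : Over (Spec (.of k))⦄ (l : T ⟶ L.tot) (m : T ⟶ M.tot)
    (h : l ≫ L.proj = m ≫ M.proj), app β l m h ≫ N.proj = l ≫ L.proj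
  smul_left : ∀ ⦃T : Over (Spec (.of k))⦄ (t : T ⟶ Gm k) (l : T ⟶ L.tot) (m : T ⟶ M.tot)
    (h : l ≫ L.proj = m ≫ M.proj), app β (t • l) m ((L.smul_proj t l).trans h) = t • app β l m h
  smul_right : ∀ ⦃T : Over (Spec (.of k))⦄ (t : T ⟶ Gm k) (l : T ⟶ L.tot) (m : T ⟶ M.tot)
    (h : l ≫ L.proj = m ≫ M.proj),
    app β l (t • m) (h.trans (M.smul_proj t m).symm) = t • app β l m h
  gen : ∀ ⦃T : Over (Spec (.of k))⦄ (l : T ⟶ L.tot) (m : T ⟶ M.tot)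
    (h : l ≫ L.proj = m ≫ M.proj), IsGen l → IsGen m → IsGen (app β l m h)

/-- The pairing with the factors exchanged. -/
def swap (β : pullback L.proj M.proj ⟶ N.tot) : pullback M.proj L.proj ⟶ N.tot :=
  app β (pullback.snd _ _) (pullback.fst _ _) pullback.condition.symm

lemma app_swap (β : pullback L.proj M.proj ⟶ N.tot) {T : Over (Spec (.of k))} (m : T ⟶ M.tot)
    (l : T ⟶ L.tot) (h : m ≫ M.proj = l ≫ L.proj) : app (swap β) m l h = app β l m h.symm := by
  rw [app, swap, comp_app]
  exact app_congr _ (pullback.lift_snd _ _ _) (pullback.lift_fst _ _ _) _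

namespace IsPairing

variable {β : pullback L.proj M.proj ⟶ N.tot} (hβ : IsPairing L M N β)
include hβ

lemma swap : IsPairing M L N (swap β) where
  proj T m l h := by rw [app_swap, hβ.proj, h]
  smul_left T t m l h := by rw [app_swap, app_swap, hβ.smul_right]
  smul_right T t m l h := by rw [app_swap, app_swap, hβ.smul_left]
  gen T m l h hm hl := by
    rw [app_swap]
    exact hβ.gen _ _ _ hl hm

/-- For fixed `m` the pairing is an equivariant family in `l`, hence linear by `EqFam.map_sc`. -/
lemma sc_left {T : Over (Spec (.of k))} (a : T ⟶ A1 k) (l : T ⟶ L.tot) (m : T ⟶ M.tot)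
    (h : l ≫ L.proj = m ≫ M.proj) :
    app β (L.sc a l) m ((sc_proj a l).trans h) = N.sc a (app β l m h) := by
  let φ : EqFam L.proj N.proj (m ≫ M.proj) (m ≫ M.proj) :=
    { val := fun T' s l h ↦ app β l (s ≫ m) (by simpa using h)
      nat := fun T₁ T₂ f s l h ↦ (comp_app _ _ _ _ _).trans
        (app_congr _ rfl (Category.assoc _ _ _).symm _)
      proj := fun T' s l h ↦ (hβ.proj _ _ _).trans h
      smul := fun T' s t l h h' ↦ hβ.smul_left _ _ _ _ }
  have := φ.map_sc (𝟙 T) a l (by simpa using h)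
  dsimp [φ] at this
  simpa only [Category.id_comp] using this

lemma sc_right {T : Over (Spec (.of k))} (a : T ⟶ A1 k) (l : T ⟶ L.tot) (m : T ⟶ M.tot)
    (h : l ≫ L.proj = m ≫ M.proj) :
    app β l (M.sc a m) (h.trans (sc_proj a m).symm) = N.sc a (app β l m h) := by
  have := hβ.swap.sc_left a m l h.symm
  rwa [app_swap, app_swap] at this

/-- Local generators `l`, `m` and their product `β(l, m)` yield frames in which bilinearity turns
`β` into the multiplication of coordinates. -/
lemma isTensorMap : IsTensorMap L M N β := by
  intro x
  obtain ⟨U, hU, ⟨l, hl, gl⟩, m, hm, gm⟩ :=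
    (L.loc_gen (𝟙 X)).and (M.loc_gen (𝟙 X)) (L.stab_gen _) (M.stab_gen _) x
  rw [Category.comp_id] at hl hm
  have h : l ≫ L.proj = m ≫ M.proj := hl.trans hm.symm
  have gn := hβ.gen l m h gl gm
  have fl := gl.isFrame
  have fm := gm.isFrame
  have fn := gn.isFrame
  rw [hl] at fl
  rw [hm] at fm
  rw [hβ.proj, hl] at fn
  refine ⟨U, hU, fl.trivialization, fm.trivialization, fn.trivialization, fun {T} y a b ↦ ?_⟩
  have e1 : lift y a ≫ L.sc (snd _ _) (fst _ _ ≫ l) = L.sc a (y ≫ l) := by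
    rw [comp_sc, lift_snd, lift_fst_assoc]
  have e2 : lift y b ≫ M.sc (snd _ _) (fst _ _ ≫ m) = M.sc b (y ≫ m) := by
    rw [comp_sc, lift_snd, lift_fst_assoc]
  have e3 : lift y (A1.mul a b) ≫ N.sc (snd _ _) (fst _ _ ≫ app β l m h) =
      N.sc (a * b) (y ≫ app β l m h) := by
    rw [comp_sc, lift_snd, lift_fst_assoc, A1.mul_eq]
  refine (app_congr β e1 e2 _).trans (Eq.trans ?_ e3.symm)
  have h' : (y ≫ l) ≫ L.proj = (y ≫ m) ≫ M.proj := by simp [h]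
  refine (hβ.sc_left a _ _ (h'.trans (sc_proj _ _).symm)).trans ?_
  rw [hβ.sc_right b _ _ h', sc_sc, comp_app]

end IsPairing

lemma IsTensorMap.isPairing {β : pullback L.proj M.proj ⟶ N.tot} (hβ : IsTensorMap L M N β) :
    IsPairing L M N β := by
  -- Locally both points have coordinates `a`, `b` in frames where `β` is multiplication. Each
  -- property of a pairing then becomes an identity between functions.
  have key {T : Over (Spec (.of k))} (l : T ⟶ L.tot) (m : T ⟶ M.tot)
      (h : l ≫ L.proj = m ≫ M.proj) : Loc T fun T' j ↦ ∃ (x : T' ⟶ X) (ψ : T' ⊗ A1 k ⟶ L.tot)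
        (ψ' : T' ⊗ A1 k ⟶ M.tot) (ψ'' : T' ⊗ A1 k ⟶ N.tot) (hψ : IsFrame L.proj x ψ)
        (hψ' : IsFrame M.proj x ψ') (_ : IsFrame N.proj x ψ'') (a b : T' ⟶ A1 k),
        j ≫ l = lift (𝟙 _) a ≫ ψ ∧ j ≫ m = lift (𝟙 _) b ≫ ψ' ∧
        ∀ c d, app β (lift (𝟙 _) c ≫ ψ) (lift (𝟙 _) d ≫ ψ')
          ((hψ.lift_proj _ _).trans (hψ'.lift_proj _ _).symm) = lift (𝟙 _) (c * d) ≫ ψ'' := by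
    intro s
    obtain ⟨U, hU, eL, eM, eN, H⟩ := hβ ((l ≫ L.proj).left s)
    refine ⟨(l ≫ L.proj).left ⁻¹ᵁ U, hU, ?_⟩
    obtain ⟨y, hy⟩ := exists_preimage_lift (l ≫ L.proj) U
    have fL := eL.isFrame.comp y
    have fM := eM.isFrame.comp y
    have fN := eN.isFrame.comp y
    obtain ⟨a, ha, -⟩ := fL.bij (𝟙 _) (opnι T _ ≫ l) (by
      rw [Category.id_comp, hy, Category.assoc])
    obtain ⟨b, hb, -⟩ := fM.bij (𝟙 _) (opnι T _ ≫ m) (by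
      rw [Category.id_comp, hy, Category.assoc, h])
    refine ⟨_, _, _, _, fL, fM, fN, a, b, ha.symm, hb.symm, fun c d ↦ ?_⟩
    have := H y c d
    rw [A1.mul_eq] at this
    simp only [lift_whiskerRight_assoc, Category.id_comp]
    exact this
  refine ⟨fun T l m h ↦ ?_, fun T t l m h ↦ ?_, fun T t l m h ↦ ?_, fun T l m h hl hm ↦ ?_⟩
  · refine hom_ext_loc ((key l m h).mono fun T' j ⟨x, ψ, ψ', ψ'', hψ, hψ', hψ'', a, b, ha, hb, H⟩ ↦ ?_)
    rw [← Category.assoc, ← Category.assoc, comp_app, app_congr β ha hb, H, ha, hψ.lift_proj,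
      hψ''.lift_proj]
  · refine hom_ext_loc ((key l m h).mono fun T' j ⟨x, ψ, ψ', ψ'', hψ, hψ', hψ'', a, b, ha, hb, H⟩ ↦ ?_)
    have ha' : j ≫ (t • l) = lift (𝟙 _) (Gm.val (j ≫ t) * a) ≫ ψ := by
      rw [ModObj.comp_smul, ha, hψ.smul]
    rw [comp_app, ModObj.comp_smul (X := N.tot), comp_app, app_congr β ha hb, app_congr β ha' hb, H, H,
      mul_assoc, hψ''.smul]
  · refine hom_ext_loc ((key l m h).mono fun T' j ⟨x, ψ, ψ', ψ'', hψ, hψ', hψ'', a, b, ha, hb, H⟩ ↦ ?_)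
    have hb' : j ≫ (t • m) = lift (𝟙 _) (Gm.val (j ≫ t) * b) ≫ ψ' := by
      rw [ModObj.comp_smul, hb, hψ'.smul]
    rw [comp_app, ModObj.comp_smul (X := N.tot), comp_app, app_congr β ha hb, app_congr β ha hb', H, H,
      mul_left_comm, hψ''.smul]
  · refine isGen_of_loc ((key l m h).mono
      fun T' j ⟨x, ψ, ψ', ψ'', hψ, hψ', hψ'', a, b, ha, hb, H⟩ ↦ ?_)
    have ua : IsUnit a := by
      rw [← isGen_sc_iff (isGen_of_isFrame hψ), sc_frame hψ, mul_one, ← ha]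
      exact hl.comp j
    have ub : IsUnit b := by
      rw [← isGen_sc_iff (isGen_of_isFrame hψ'), sc_frame hψ', mul_one, ← hb]
      exact hm.comp j
    rw [comp_app, app_congr β ha hb, H]
    have := (isGen_sc_iff (isGen_of_isFrame hψ'') (a * b)).2 (ua.mul ub)
    rwa [sc_frame hψ'', mul_one] at this

end LineBundle

end

/-! ### Group laws up to equivalence; bijectivity of maps and pairings on generators -/

section

open LineBundle

/-- A ternary relation which is a commutative group law up to equivalence. -/
theorem exists_commGroup {α : Type*} (S : Setoid α) (R : α → α → α → Prop)
    (ex : ∀ a b, ∃ c, R a b c)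
    (uniq : ∀ a a' b b' c c', S a a' → S b b' → R a b c → R a' b' c' → S c c')
    (comm : ∀ a b c, R a b c → R b a c)
    (assoc : ∀ a b c p q r s, R a b p → R p c q → R b c r → R a r s → S q s)
    (one : α) (one_mul : ∀ a b, R one a b → S b a)
    (inv : ∀ a, ∃ b, R b a one) :
    ∃ _ : CommGroup (Quotient S),
      (∀ a b c, R a b c → (Quotient.mk S a * Quotient.mk S b = Quotient.mk S c)) ∧
      (1 : Quotient S) = Quotient.mk S one := by
  choose m hm using ex
  choose i hi using inv
  let M : Mul (Quotient S) := ⟨Quotient.map₂ m fun a a' h b b' h' ↦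
    uniq _ _ _ _ _ _ h h' (hm a b) (hm a' b')⟩
  have hM (a b c : α) (h : R a b c) : Quotient.mk S a * Quotient.mk S b = Quotient.mk S c :=
    Quotient.sound (uniq _ _ _ _ _ _ (S.refl _) (S.refl _) (hm a b) h)
  have hc (a b : Quotient S) : a * b = b * a := by
    induction a using Quotient.inductionOn
    induction b using Quotient.inductionOn
    rw [hM _ _ _ (hm _ _), hM _ _ _ (comm _ _ _ (hm _ _))]
  have h1 (a : Quotient S) : Quotient.mk S one * a = a := by
    induction a using Quotient.inductionOn
    rw [hM _ _ _ (hm _ _)]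
    exact Quotient.sound (one_mul _ _ (hm _ _))
  -- Inverses respect equivalence: for equivalent `a` and `a'`, both bracketings of the product of
  -- `i a`, `a` and `i a'` are computed, one giving the class of `i a'` and the other that of `i a`.
  let I : Quotient S → Quotient S := Quotient.map i fun a a' h ↦ by
    have e1 := hM _ _ _ (hi a)
    have e2 := hM _ _ _ (hi a')
    have e : Quotient.mk S a = Quotient.mk S a' := Quotient.sound h
    rw [← e] at e2
    have ha (x y z : α) : Quotient.mk S x * Quotient.mk S y * Quotient.mk S z =
        Quotient.mk S x * (Quotient.mk S y * Quotient.mk S z) := by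
      rw [hM _ _ _ (hm x y), hM _ _ _ (hm _ z), hM _ _ _ (hm y z), hM _ _ _ (hm x _)]
      exact Quotient.sound (assoc _ _ _ _ _ _ _ (hm x y) (hm _ z) (hm y z) (hm x _))
    refine Quotient.exact (s := S) ?_
    have := ha (i a) a (i a')
    rwa [e1, h1, hc (Quotient.mk S a), e2, hc _ (Quotient.mk S one), h1, eq_comm] at this
  refine ⟨{ M with
    mul_assoc := fun a b c ↦ ?_
    one := Quotient.mk S one
    one_mul := h1
    mul_one := fun a ↦ (hc _ _).trans (h1 a)
    inv := I
    inv_mul_cancel := fun a ↦ ?_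
    mul_comm := hc }, hM, rfl⟩
  · induction a using Quotient.inductionOn
    induction b using Quotient.inductionOn
    induction c using Quotient.inductionOn
    rw [hM _ _ _ (hm _ _), hM _ _ _ (hm _ _), hM _ _ _ (hm _ _), hM _ _ _ (hm _ _)]
    exact Quotient.sound (assoc _ _ _ _ _ _ _ (hm _ _) (hm _ _) (hm _ _) (hm _ _))
  · induction a using Quotient.inductionOn
    exact hM _ _ _ (hi _)

namespace EqFam

variable {X Y T : Over (Spec (.of k))} {L : LineBundle X} {M : LineBundle Y} {x : T ⟶ X}
  {y : T ⟶ Y} (φ : EqFam L.proj M.proj x y)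

/-- Where one generator goes to a generator, the map multiplies coordinates by a unit and is
bijective; equality of points may be checked on such a cover. -/
lemma injective {T' : Over (Spec (.of k))} (s : T' ⟶ T)
    (H : Loc T' fun _ j ↦ ∃ l, ∃ h : l ≫ L.proj = (j ≫ s) ≫ x, IsGen l ∧ IsGen (φ.val (j ≫ s) l h))
    {l l' : T' ⟶ L.tot} (h : l ≫ L.proj = s ≫ x) (h' : l' ≫ L.proj = s ≫ x)
    (e : φ.val s l h = φ.val s l' h') : l = l' := by
  refine hom_ext_loc (H.mono fun T'' j ⟨l₀, h₀, g₀, g₁⟩ ↦ ?_)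
  obtain ⟨l₁, h₁, e₁, hu⟩ := φ.existsUnique_val_eq (j ≫ s) h₀ g₀ g₁ (j ≫ φ.val s l h) (by
    rw [Category.assoc, φ.proj, Category.assoc])
  rw [hu (j ≫ l) (by simp [h]) (φ.nat _ _ _ _).symm, hu (j ≫ l') (by simp [h'])]
  rw [e]
  exact (φ.nat _ _ _ _).symm

/-- An equivariant map which locally sends some generator to a generator is bijective. -/
lemma exists_val_eq {T' : Over (Spec (.of k))} (s : T' ⟶ T)
    (H : Loc T' fun _ j ↦ ∃ l, ∃ h : l ≫ L.proj = (j ≫ s) ≫ x, IsGen l ∧ IsGen (φ.val (j ≫ s) l h))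
    (m : T' ⟶ M.tot) (hm : m ≫ M.proj = s ≫ y) :
    ∃ l : T' ⟶ L.tot, ∃ h : l ≫ L.proj = s ≫ x, φ.val s l h = m := by
  have sH : Stab fun T'' (j : T'' ⟶ T') ↦ ∃ l, ∃ h : l ≫ L.proj = (j ≫ s) ≫ x,
      IsGen l ∧ IsGen (φ.val (j ≫ s) l h) := by
    rintro T₁ T₂ j i ⟨l, h, g, g'⟩
    refine ⟨i ≫ l, by simp [h], g.comp i, ?_⟩
    have := g'.comp i
    rw [φ.nat] at this
    convert this using 1
    exact φ.val_congr (Category.assoc _ _ _) rfl _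
  obtain ⟨l, hl⟩ := exists_glue (T := T') (Z := L.tot)
    (fun T'' j l ↦ ∃ h : l ≫ L.proj = (j ≫ s) ≫ x, φ.val (j ≫ s) l h = j ≫ m)
    (by
      rintro T₁ T₂ f l g ⟨h, e⟩
      refine ⟨by simp [h], ?_⟩
      rw [Category.assoc g f m, ← e, φ.nat]
      exact φ.val_congr (Category.assoc _ _ _) rfl _)
    (by
      rintro T₁ f l l' ⟨h, e⟩ ⟨h', e'⟩
      have := Loc.pullback H sH f
      exact φ.injective (f ≫ s) (by simpa only [Category.assoc] using this) h h' (e.trans e'.symm))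
    (H.mono fun T'' j ⟨l₀, h₀, g₀, g₁⟩ ↦ by
      obtain ⟨l₁, h₁, e₁, -⟩ := φ.existsUnique_val_eq (j ≫ s) h₀ g₀ g₁ (j ≫ m) (by
        rw [Category.assoc, hm, Category.assoc])
      exact ⟨l₁, h₁, e₁⟩)
  have hl' : Loc T' fun T'' j ↦ ∃ h : (j ≫ l) ≫ L.proj = (j ≫ s) ≫ x,
      φ.val (j ≫ s) (j ≫ l) h = j ≫ m := H.mono fun T'' j ⟨l₀, h₀, g₀, g₁⟩ ↦ by
    obtain ⟨l₁, h₁, e₁, -⟩ := φ.existsUnique_val_eq (j ≫ s) h₀ g₀ g₁ (j ≫ m) (by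
        rw [Category.assoc, hm, Category.assoc])
    have := hl j l₁ ⟨h₁, e₁⟩
    exact ⟨by rw [this, h₁], (φ.val_congr rfl this _).trans e₁⟩
  have h : l ≫ L.proj = s ≫ x := hom_ext_loc (hl'.mono fun T'' j ⟨h, _⟩ ↦ by
    simpa only [Category.assoc] using h)
  exact ⟨l, h, hom_ext_loc (hl'.mono fun T'' j ⟨_, e⟩ ↦ (φ.nat _ _ _ _).trans e)⟩

end EqFam

namespace LineBundle

variable {X : Over (Spec (.of k))} {L M N : LineBundle X}

/-- An isomorphism of line bundles as a family of maps. -/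
def IsBundleIso.eqFam {f : L.tot ≅ M.tot} (hf : IsBundleIso L M f) :
    EqFam L.proj M.proj (𝟙 X) (𝟙 X) where
  val _ _ l _ := l ≫ f.hom
  nat _ _ g s l h := (Category.assoc _ _ _).symm
  proj _ s l h := by rw [Category.assoc, hf.proj, h]
  smul _ s t l h h' := hf.smul _ _

lemma IsBundleIso.sc {f : L.tot ≅ M.tot} (hf : IsBundleIso L M f) {T : Over (Spec (.of k))}
    (a : T ⟶ A1 k) (l : T ⟶ L.tot) : L.sc a l ≫ f.hom = M.sc a (l ≫ f.hom) :=
  hf.eqFam.map_sc (l ≫ L.proj) a l (by simp)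

lemma IsBundleIso.comp_proj {f : L.tot ≅ M.tot} (hf : IsBundleIso L M f) {T : Over (Spec (.of k))}
    (l : T ⟶ L.tot) : (l ≫ f.hom) ≫ M.proj = l ≫ L.proj := by
  rw [Category.assoc, hf.proj]

lemma IsBundleIso.gen {f : L.tot ≅ M.tot} (hf : IsBundleIso L M f) {T : Over (Spec (.of k))}
    {l : T ⟶ L.tot} (hl : IsGen l) : IsGen (l ≫ f.hom) := by
  intro T' g m hm
  obtain ⟨a, ha, hu⟩ := hl g (m ≫ f.inv) (by
    rw [hf.comp_proj] at hm
    rw [← hm, Category.assoc, ← hf.proj, f.inv_hom_id_assoc])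
  refine ⟨a, ?_, fun b hb ↦ hu b ?_⟩
  · dsimp only
    rw [← Category.assoc, ← hf.sc, ha, Category.assoc, f.inv_hom_id, Category.comp_id]
  · dsimp only at hb
    rw [← hb, ← Category.assoc, ← hf.sc, Category.assoc, f.hom_inv_id, Category.comp_id]

/-- Isomorphisms of line bundles may be defined on generators, locally. -/
theorem exists_bundleIso (R : ∀ ⦃T : Over (Spec (.of k))⦄, (T ⟶ L.tot) → (T ⟶ M.tot) → Prop)
    (gen : ∀ ⦃T : Over (Spec (.of k))⦄ (l : T ⟶ L.tot) (m : T ⟶ M.tot),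
      R l m → IsGen l ∧ IsGen m ∧ m ≫ M.proj = l ≫ L.proj)
    (stab : ∀ ⦃T T' : Over (Spec (.of k))⦄ (l : T ⟶ L.tot) (m : T ⟶ M.tot)
      (f : T' ⟶ T), R l m → R (f ≫ l) (f ≫ m))
    (uniq : ∀ ⦃T : Over (Spec (.of k))⦄ (l l' : T ⟶ L.tot) (m m' : T ⟶ M.tot),
      R l m → R l' m' → l' ≫ L.proj = l ≫ L.proj → ∃ t : T ⟶ Gm k, l' = t • l ∧ m' = t • m)
    (ex : Loc X fun _ j ↦ ∃ l m, R l m ∧ l ≫ L.proj = j) :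
    ∃ f : L.tot ≅ M.tot, IsBundleIso L M f ∧ ∀ ⦃T : Over (Spec (.of k))⦄ (l : T ⟶ L.tot)
      (m : T ⟶ M.tot), R l m → l ≫ f.hom = m := by
  obtain ⟨φ, hφ⟩ := exists_eqFam (𝟙 X) (𝟙 X) (fun T s l m ↦ R l m ∧ l ≫ L.proj = s)
    (fun T s l m ⟨h, e⟩ ↦ ⟨(gen l m h).1, by simp [e], by simp [(gen l m h).2.2, e]⟩)
    (fun T₁ T₂ s l m f ⟨h, e⟩ ↦ ⟨stab _ _ _ h, by simp [e]⟩)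
    (fun T s l l' m m' ⟨h, e⟩ ⟨h', e'⟩ ↦ uniq _ _ _ _ h h' (by rw [e, e'])) ex
  have sR : Stab fun T (j : T ⟶ X) ↦ ∃ l m, R l m ∧ l ≫ L.proj = j := fun _ _ j i ⟨l, m, h, e⟩ ↦
    ⟨i ≫ l, i ≫ m, stab _ _ _ h, by simp [e]⟩
  have H {T : Over (Spec (.of k))} (s : T ⟶ X) :
      Loc T fun _ j ↦ ∃ l, ∃ h : l ≫ L.proj = (j ≫ s) ≫ 𝟙 X,
        IsGen l ∧ IsGen (φ.val (j ≫ s) l h) :=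
    (Loc.pullback ex sR s).mono fun _ j ⟨l, m, h, e⟩ ↦
      ⟨l, by simp [e], (gen _ _ h).1, by
        rw [hφ _ l m (by simp [e]) ⟨h, e⟩]
        exact (gen _ _ h).2.1⟩
  -- The family becomes a morphism through its value at the tautological point of the total space.
  let f := φ.val L.proj (𝟙 _) (by simp)
  have hf {T : Over (Spec (.of k))} (l : T ⟶ L.tot) :
      l ≫ f = φ.val (l ≫ L.proj) l (by simp) :=
    (φ.nat _ _ _ _).trans (φ.val_congr rfl (Category.comp_id _) _)
  have hp {T : Over (Spec (.of k))} (l : T ⟶ L.tot) : (l ≫ f) ≫ M.proj = l ≫ L.proj := by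
    rw [hf, φ.proj, Category.comp_id]
  have : IsIso f := isIso_of_loc f
    (fun T a b hab ↦ by
      have e : a ≫ L.proj = b ≫ L.proj := by rw [← hp, hab, hp]
      rw [hf, hf] at hab
      refine φ.injective (a ≫ L.proj) (H _) (by simp) (by simp [e]) (hab.trans ?_)
      exact φ.val_congr e.symm rfl _)
    (Loc.of_forall (by
      obtain ⟨l, h, e⟩ := φ.exists_val_eq M.proj (H _) (𝟙 _) (by simp)
      refine ⟨l, ?_⟩
      rw [hf, ← e]
      exact φ.val_congr (by simpa using h) rfl _) (fun T T' j i ⟨y, hy⟩ ↦ ⟨i ≫ y, by simp [hy]⟩))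
  refine ⟨asIso f, ⟨by simpa using hp (𝟙 _), fun {T} t l ↦ ?_⟩, fun T l m h ↦ ?_⟩
  · dsimp only [asIso_hom]
    rw [hf, hf, ← φ.smul _ _ _ _ (by rw [L.smul_proj, Category.comp_id])]
    exact φ.val_congr (L.smul_proj _ _) rfl _
  · dsimp only [asIso_hom]
    rw [hf, hφ _ l m _ ⟨h, rfl⟩]

namespace IsPairing

variable {β : pullback L.proj M.proj ⟶ N.tot} (hβ : IsPairing L M N β)
include hβ

/-- The pairing with a point of the second line bundle. -/
def eqFam {T : Over (Spec (.of k))} (m : T ⟶ M.tot) :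
    EqFam L.proj N.proj (m ≫ M.proj) (m ≫ M.proj) where
  val T' s l h := app β l (s ≫ m) (by simpa using h)
  nat T₁ T₂ f s l h := (comp_app _ _ _ _ _).trans
    (app_congr _ rfl (Category.assoc _ _ _).symm _)
  proj T' s l h := (hβ.proj _ _ _).trans h
  smul T' s t l h h' := hβ.smul_left _ _ _ _

lemma loc_eqFam {T : Over (Spec (.of k))} (m : T ⟶ M.tot) (hm : IsGen m) :
    Loc T fun _ j ↦ ∃ l, ∃ h : l ≫ L.proj = (j ≫ 𝟙 T) ≫ m ≫ M.proj,
      IsGen l ∧ IsGen ((hβ.eqFam m).val (j ≫ 𝟙 T) l h) :=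
  (L.loc_gen (m ≫ M.proj)).mono fun T' j ⟨l, h, g⟩ ↦ ⟨l, by simpa using h, g, hβ.gen _ _ _ g
    (hm.comp (j ≫ 𝟙 T))⟩

/-- Pairing with a generator `m` takes generators to generators, so on points over the image of `m`
it is a bijection. This and the next three lemmas are the means of dividing by a generator. -/
lemma left_injective {T : Over (Spec (.of k))} {m : T ⟶ M.tot} (hm : IsGen m) {l l' : T ⟶ L.tot}
    (h : l ≫ L.proj = m ≫ M.proj) (h' : l' ≫ L.proj = m ≫ M.proj)
    (e : app β l m h = app β l' m h') : l = l' :=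
  (hβ.eqFam m).injective (𝟙 T) (hβ.loc_eqFam m hm) (by simpa using h) (by simpa using h')
    ((app_congr β rfl (Category.id_comp _) _).trans
      (e.trans (app_congr β rfl (Category.id_comp _).symm _)))

lemma left_surjective {T : Over (Spec (.of k))} {m : T ⟶ M.tot} (hm : IsGen m) (n : T ⟶ N.tot)
    (hn : n ≫ N.proj = m ≫ M.proj) : ∃ l, ∃ h : l ≫ L.proj = m ≫ M.proj, app β l m h = n := by
  obtain ⟨l, h, e⟩ := (hβ.eqFam m).exists_val_eq (𝟙 T) (hβ.loc_eqFam m hm) n (by simpa using hn)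
  exact ⟨l, by simpa using h, (app_congr β rfl (Category.id_comp _).symm _).trans e⟩

lemma right_injective {T : Over (Spec (.of k))} {l : T ⟶ L.tot} (hl : IsGen l) {m m' : T ⟶ M.tot}
    (h : l ≫ L.proj = m ≫ M.proj) (h' : l ≫ L.proj = m' ≫ M.proj)
    (e : app β l m h = app β l m' h') : m = m' :=
  hβ.swap.left_injective hl h.symm h'.symm (by rw [app_swap, app_swap, e])

lemma right_surjective {T : Over (Spec (.of k))} {l : T ⟶ L.tot} (hl : IsGen l) (n : T ⟶ N.tot)
    (hn : n ≫ N.proj = l ≫ L.proj) : ∃ m, ∃ h : l ≫ L.proj = m ≫ M.proj, app β l m h = n := by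
  obtain ⟨m, h, e⟩ := hβ.swap.left_surjective hl n hn
  exact ⟨m, h.symm, by rw [← e, app_swap]⟩

/-- Locally `m` is a multiple `a • m₀` of a generator, and `β(l, m) = a • β(l, m₀)`. As `β(l, m₀)`
is a generator, generation of either `m` or the product means that `a` is a unit. -/
lemma isGen_of_isGen_app {T : Over (Spec (.of k))} {l : T ⟶ L.tot} {m : T ⟶ M.tot}
    (h : l ≫ L.proj = m ≫ M.proj) (g : IsGen (app β l m h)) (hl : IsGen l) : IsGen m := by
  refine isGen_of_loc ((M.loc_gen (m ≫ M.proj)).mono fun T' j ⟨m₀, h₀, g₀⟩ ↦ ?_)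
  obtain ⟨a, ha, -⟩ := g₀.exists_sc (l' := j ≫ m) (by rw [h₀, Category.assoc])
  rw [← ha, isGen_sc_iff g₀]
  have h₁ : (j ≫ l) ≫ L.proj = m₀ ≫ M.proj := by rw [h₀, Category.assoc, h]
  rw [← isGen_sc_iff (hβ.gen _ _ h₁ (hl.comp j) g₀), ← hβ.sc_right]
  have := g.comp j
  rw [comp_app] at this
  convert this using 1
  exact app_congr β rfl ha _

end IsPairing

end LineBundle

end

section

namespace LineBundle

variable {X : Over (Spec (.of k))} (L M : LineBundle X)

/-! ### The line bundle of homomorphisms -/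

/-- Homomorphisms from `L` to `M` at the points of a scheme over `X`. -/
abbrev HomPt (T : Over (Spec (.of k))) : Type u :=
  EquivPt L.proj (fun _ t l ↦ L.smul_proj t l)
    (fun _ (l : _ ⟶ L.tot) (m : _ ⟶ M.tot) ↦ m ≫ M.proj = l ≫ L.proj) T

variable {L M}

/-- A homomorphism as a family of maps. -/
def HomPt.eqFam {T : Over (Spec (.of k))} (x : HomPt L M T) :
    EqFam L.proj M.proj x.base x.base where
  val T' s l h := app x.map s l h.symm
  nat T₁ T₂ f s l h := comp_app _ _ _ _ _
  proj T' s l h := (x.rel _ _ _).trans h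
  smul T' s t l h h' := x.smul _ _ _ _

lemma HomPt.exists_of_eqFam {T : Over (Spec (.of k))} {b : T ⟶ X} (φ : EqFam L.proj M.proj b b) :
    ∃ x : HomPt L M T, x.base = b ∧ ∀ ⦃T' : Over (Spec (.of k))⦄ (s : T' ⟶ T) (l : T' ⟶ L.tot)
      (h : l ≫ L.proj = s ≫ b) (h' : s ≫ x.base = l ≫ L.proj), app x.map s l h' = φ.val s l h := by
  obtain ⟨x, hx, H⟩ := EquivPt.exists_of_values (hp := fun _ t l ↦ L.smul_proj t l)
    (K := fun _ (l : _ ⟶ L.tot) (m : _ ⟶ M.tot) ↦ m ≫ M.proj = l ≫ L.proj) b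
    (fun T' s l h ↦ φ.val s l h.symm) (fun T₁ T₂ f s l h ↦ φ.nat _ _ _ _)
    (fun T' s l t h ↦ φ.smul _ _ _ _ _) (fun T' s l h ↦ (φ.proj _ _ _).trans h)
  exact ⟨x, hx, fun T' s l h h' ↦ H s l h.symm h'⟩

/-- With generators of `L` and `M` over `U`, the points of `U × 𝔸¹` are homomorphisms. -/
lemma exists_homPt {U : Over (Spec (.of k))} {i : U ⟶ X} {l : U ⟶ L.tot} {m : U ⟶ M.tot}
    (hl : l ≫ L.proj = i) (hm : m ≫ M.proj = i) (gl : IsGen l) :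
    ∃ x : HomPt L M (U ⊗ A1 k), x.base = fst _ _ ≫ i ∧
      ∀ ⦃T : Over (Spec (.of k))⦄ (u : T ⟶ U) (a : T ⟶ A1 k)
        (h : lift u a ≫ x.base = (u ≫ l) ≫ L.proj), app x.map (lift u a) (u ≫ l) h =
          M.sc a (u ≫ m) := by
  obtain ⟨φ, hφ⟩ := exists_eqFam (T := U ⊗ A1 k) (fst _ _ ≫ i) (fst _ _ ≫ i)
    (fun T s (l' : T ⟶ L.tot) (m' : T ⟶ M.tot) ↦ l' = s ≫ fst _ _ ≫ l ∧
      m' = M.sc (s ≫ snd _ _) (s ≫ fst _ _ ≫ m))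
    (by
      rintro T s _ _ ⟨rfl, rfl⟩
      rw [sc_proj]
      refine ⟨?_, by simp [hl], by simp [hm]⟩
      rw [← Category.assoc]
      exact gl.comp _)
    (by
      rintro T T' s _ _ f ⟨rfl, rfl⟩
      rw [comp_sc]
      simp)
    (by
      rintro T s _ _ _ _ ⟨rfl, rfl⟩ ⟨rfl, rfl⟩
      exact ⟨1, by simp, by simp⟩)
    (Loc.of_forall ⟨_, _, rfl, rfl⟩ (by
      rintro T T' j f ⟨_, _, rfl, rfl⟩
      exact ⟨_, _, rfl, rfl⟩))
  obtain ⟨x, hx, H⟩ := HomPt.exists_of_eqFam φ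
  refine ⟨x, hx, fun T u a h ↦ ?_⟩
  rw [H _ _ (h.symm.trans (by rw [hx]))]
  refine hφ _ _ _ _ ⟨?_, ?_⟩ <;> simp

/-- There is a universal homomorphism from `L` to `M`. -/
lemma exists_universal_homPt (L M : LineBundle X) :
    ∃ (E : Over (Spec (.of k))) (e : HomPt L M E), ∀ ⦃T : Over (Spec (.of k))⦄ (b : T ⟶ X)
      (φ : EqFam L.proj M.proj b b), ∃! f : T ⟶ E, f ≫ e.base = b ∧
        ∀ ⦃T' : Over (Spec (.of k))⦄ (s : T' ⟶ T) (l : T' ⟶ L.tot) (h : l ≫ L.proj = s ≫ b)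
          (h' : (s ≫ f) ≫ e.base = l ≫ L.proj), app e.map (s ≫ f) l h' = φ.val s l h := by
  obtain ⟨E, e, H⟩ := exists_universal (p := L.proj) (hp := fun _ t l ↦ L.smul_proj t l)
    (K := fun _ (l : _ ⟶ L.tot) (m : _ ⟶ M.tot) ↦ m ≫ M.proj = l ≫ L.proj)
    (fun T l m h ↦ hom_ext_loc (h.mono fun _ j hj ↦ by simpa using hj))
    (fun b ↦ by
      obtain ⟨U, hU, ⟨l, hl, gl⟩, m, hm, gm⟩ :=
        (L.loc_gen (𝟙 X)).and (M.loc_gen (𝟙 X)) (L.stab_gen _) (M.stab_gen _) b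
      rw [Category.comp_id] at hl hm
      obtain ⟨y, hy, Hy⟩ := exists_homPt hl hm gl
      refine ⟨U, hU, _, fst _ _, y, hy, fun T x u hx ↦ ?_⟩
      have hx1 : (u ≫ l) ≫ L.proj = 𝟙 _ ≫ x.base := by simp [hl, hx]
      -- The second coordinate of the point of the chart `U × 𝔸¹` is the coefficient of the image of
      -- the chosen generator `l` with respect to `m`. It determines the homomorphism by linearity.
      obtain ⟨a, ha, hau⟩ := (gm.comp u).exists_sc (l' := HomPt.eqFam x |>.val (𝟙 _) (u ≫ l) hx1)
        (by rw [EqFam.proj, ← hx1, Category.assoc, Category.assoc, hl, hm])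
      refine ⟨lift u a, ⟨by simp, fun T' s q h h' ↦ ?_⟩, ?_⟩
      · obtain ⟨c, rfl, -⟩ := (gl.comp (s ≫ u)).exists_sc (l' := q) (by
          rw [← h, hx, ← hl]
          simp)
        have h1 : ((s ≫ u) ≫ l) ≫ L.proj = s ≫ x.base := by rw [h, sc_proj]
        have h2 : ((s ≫ u) ≫ l) ≫ L.proj = (s ≫ lift u a) ≫ y.base := by rw [h', sc_proj]
        have e1 := (HomPt.eqFam x).map_sc s c ((s ≫ u) ≫ l) h1
        have e2 := (HomPt.eqFam y).map_sc (s ≫ lift u a) c ((s ≫ u) ≫ l) h2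
        refine e2.trans (Eq.trans ?_ e1.symm)
        congr 1
        have e3 := Hy (s ≫ u) (s ≫ a) (by rw [← comp_lift]; exact h2.symm)
        refine (app_congr y.map (comp_lift s u a) rfl _).trans (e3.trans ?_)
        have e4 := congr(s ≫ $ha)
        rw [comp_sc, EqFam.nat] at e4
        rw [Category.assoc, e4]
        exact EqFam.val_congr _ (Category.comp_id _) (Category.assoc _ _ _).symm _
      · rintro f ⟨hf, hf'⟩
        refine CartesianMonoidalCategory.hom_ext _ _ (by simpa using hf) ?_
        rw [lift_snd]
        refine hau _ ?_
        have hfe : f = lift u (f ≫ snd _ _) :=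
          CartesianMonoidalCategory.hom_ext _ _ (by simpa using hf) (by simp)
        have h1 : lift u (f ≫ snd _ _) ≫ y.base = (u ≫ l) ≫ L.proj := by
          rw [hy, lift_fst_assoc, Category.assoc, hl]
        dsimp only
        rw [← Hy u (f ≫ snd _ _) h1]
        have h2 : (𝟙 _ ≫ f) ≫ y.base = (u ≫ l) ≫ L.proj := by
          rw [Category.id_comp, hfe, h1]
        refine Eq.trans ?_ (hf' (𝟙 _) (u ≫ l) hx1.symm h2)
        exact app_congr _ (by rw [Category.id_comp, ← hfe]) rfl _)
  refine ⟨E, e, fun T b φ ↦ ?_⟩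
  obtain ⟨f, ⟨hf, hf'⟩, hu⟩ := H b (fun T' s l h ↦ φ.val s l h.symm) (fun _ _ f s l h ↦ φ.nat _ _ _ _)
    (fun T' s l t h ↦ φ.smul _ _ _ _ _) (fun T' s l h ↦ (φ.proj _ _ _).trans h)
  exact ⟨f, ⟨hf, fun T' s l h h' ↦ hf' s l h.symm h'⟩, fun g ⟨hg, hg'⟩ ↦ hu g ⟨hg, fun T' s l h h' ↦
    hg' s l h.symm h'⟩⟩

lemma hom_mul_smul {A Z T : Over (Spec (.of k))} [MonObj A] [ModObj A Z] (t r : T ⟶ A)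
    (z : T ⟶ Z) : (t * r) • z = t • r • z :=
  mul_smul _ _ _

lemma smul_smul_comm {Z T : Over (Spec (.of k))} [ModObj (Gm k) Z] (t r : T ⟶ Gm k) (z : T ⟶ Z) :
    t • r • z = r • t • z := by
  rw [← hom_mul_smul, mul_comm, hom_mul_smul]

/-- The quotient of two line bundles, the line bundle of the homomorphisms from `L` to `M`. -/
theorem exists_div (L M : LineBundle X) :
    ∃ (D : LineBundle X) (β : pullback D.proj L.proj ⟶ M.tot), IsPairing D L M β ∧
      ∀ ⦃T : Over (Spec (.of k))⦄ (b : T ⟶ X) (φ : EqFam L.proj M.proj b b),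
        ∃! f : T ⟶ D.tot, f ≫ D.proj = b ∧ ∀ ⦃T' : Over (Spec (.of k))⦄ (s : T' ⟶ T)
          (l : T' ⟶ L.tot) (h : l ≫ L.proj = s ≫ b) (h' : (s ≫ f) ≫ D.proj = l ≫ L.proj),
          app β (s ≫ f) l h' = φ.val s l h := by
  obtain ⟨E, e, H⟩ := exists_universal_homPt L M
  -- Both `f` and `g` represent the family of values of `g`, so uniqueness in the universal property
  -- identifies them.
  have ext {T : Over (Spec (.of k))} (f g : T ⟶ E) (hb : f ≫ e.base = g ≫ e.base)
      (h : ∀ ⦃T' : Over (Spec (.of k))⦄ (s : T' ⟶ T) (l : T' ⟶ L.tot)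
        (h₁ : (s ≫ f) ≫ e.base = l ≫ L.proj) (h₂ : (s ≫ g) ≫ e.base = l ≫ L.proj),
        app e.map (s ≫ f) l h₁ = app e.map (s ≫ g) l h₂) : f = g := by
    refine (H (g ≫ e.base) ⟨fun T' s l h ↦ app e.map (s ≫ g) l (by simp [h]),
      fun T₁ T₂ f s l h ↦ (comp_app _ _ _ _ _).trans (app_congr _ (Category.assoc _ _ _).symm rfl _),
      fun T' s l h ↦ (e.rel _ _ _).trans h, fun T' s t l h h' ↦ e.smul _ _ _ _⟩).unique
      ⟨hb, fun T' s l h₁ h₂ ↦ ?_⟩ ⟨rfl, fun T' s l h₁ h₂ ↦ rfl⟩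
    exact h s l h₂ _
  -- the action of scalars
  have act {T : Over (Spec (.of k))} (t : T ⟶ Gm k) (f : T ⟶ E) :=
    H (f ≫ e.base) ⟨fun T' s l h ↦ (s ≫ t) • app e.map (s ≫ f) l (by simp [h]),
      fun T₁ T₂ f s l h ↦ by
        rw [ModObj.comp_smul (X := M.tot), comp_app, ← Category.assoc]
        exact congrArg _ (app_congr _ (Category.assoc _ _ _).symm rfl _),
      fun T' s l h ↦ by
        rw [M.smul_proj]
        exact (e.rel _ _ _).trans h, fun T' s r l h h' ↦ by
        refine (congrArg _ (e.smul (s ≫ f) l r ((Category.assoc _ _ _).trans h.symm))).trans ?_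
        exact smul_smul_comm _ _ _⟩
  choose a ha hau using fun (T : Over (Spec (.of k))) (t : T ⟶ Gm k) (f : T ⟶ E) ↦ act t f
  have hab {T : Over (Spec (.of k))} (t : T ⟶ Gm k) (f : T ⟶ E) :
      a T t f ≫ e.base = f ≫ e.base := (ha T t f).1
  have hav {T : Over (Spec (.of k))} (t : T ⟶ Gm k) (f : T ⟶ E) (l : T ⟶ L.tot)
      (h : f ≫ e.base = l ≫ L.proj) (h' : a T t f ≫ e.base = l ≫ L.proj) :
      app e.map (a T t f) l h' = t • app e.map f l h := by
    have := (ha T t f).2 (𝟙 T) l (by simp [h]) (by simp [h'])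
    dsimp only at this
    refine (app_congr _ (Category.id_comp _).symm rfl _).trans (this.trans ?_)
    rw [Category.id_comp]
    exact congrArg _ (app_congr _ (Category.id_comp _) rfl _)
  have hn {T T' : Over (Spec (.of k))} (f : T' ⟶ T) (t : T ⟶ Gm k) (x : T ⟶ E) :
      f ≫ a T t x = a T' (f ≫ t) (f ≫ x) :=
    hau T' (f ≫ t) (f ≫ x) _ ⟨by rw [Category.assoc, hab, Category.assoc], fun T'' s l h h' ↦ by
      refine (app_congr e.map (Category.assoc s f (a T t x)).symm rfl _).trans
        (((ha T t x).2 (s ≫ f) l (by simpa using h) (by simpa using h')).trans ?_)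
      dsimp only
      rw [Category.assoc]
      exact congrArg _ (app_congr _ (Category.assoc _ _ _) rfl _)⟩
  obtain ⟨i, hi⟩ := exists_modObj (M := Gm k) (E := E) a (fun T T' f t x ↦ hn _ _ _)
    (fun T x ↦ (hau T 1 x x ⟨rfl, fun T' s l h₁ h₂ ↦ by
      dsimp only
      rw [MonObj.comp_one, one_smul]⟩).symm)
    (fun T t r x ↦ (hau T (t * r) x _ ⟨by rw [hab, hab], fun T' s l h₁ h₂ ↦ by
      have h₃ : (s ≫ x) ≫ e.base = l ≫ L.proj := by rw [h₁, Category.assoc]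
      have h₄ : a T' (s ≫ r) (s ≫ x) ≫ e.base = l ≫ L.proj := by rw [hab, h₃]
      have h₅ : a T' (s ≫ t) (a T' (s ≫ r) (s ≫ x)) ≫ e.base = l ≫ L.proj := by rw [hab, h₄]
      have h₆ : s ≫ a T t (a T r x) = a T' (s ≫ t) (a T' (s ≫ r) (s ≫ x)) := by rw [hn, hn]
      refine (app_congr e.map h₆ rfl _).trans ((hav _ _ l h₄ h₅).trans ?_)
      dsimp only
      rw [hav _ _ l h₃ h₄, ← hom_mul_smul, MonObj.comp_mul]⟩).symm)
  have sp {T : Over (Spec (.of k))} (t : T ⟶ Gm k) (f : T ⟶ E) : (t • f) ≫ e.base = f ≫ e.base := by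
    rw [hi, hab]
  have sv {T : Over (Spec (.of k))} (t : T ⟶ Gm k) (f : T ⟶ E) (l : T ⟶ L.tot)
      (h : f ≫ e.base = l ≫ L.proj) (h' : (t • f) ≫ e.base = l ≫ L.proj) :
      app e.map (t • f) l h' = t • app e.map f l h := by
    rw [← hav t f l h (by rw [← h', hi])]
    exact app_congr _ (hi t f) rfl _
  -- frames
  have frame {U : Over (Spec (.of k))} {i : U ⟶ X} {l : U ⟶ L.tot} {m : U ⟶ M.tot}
      (hl : l ≫ L.proj = i) (hm : m ≫ M.proj = i) (gl : IsGen l) (gm : IsGen m) :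
      ∃ ψ : U ⊗ A1 k ⟶ E, IsFrame e.base i ψ ∧
      ∀ ⦃T : Over (Spec (.of k))⦄ (u : T ⟶ U) (a : T ⟶ A1 k)
        (h : (lift u a ≫ ψ) ≫ e.base = (u ≫ l) ≫ L.proj), app e.map (lift u a ≫ ψ) (u ≫ l) h =
          M.sc a (u ≫ m) := by
    obtain ⟨y, hy, Hy⟩ := exists_homPt hl hm gl
    obtain ⟨ψ, ⟨hψ, hψ'⟩, -⟩ := H y.base (HomPt.eqFam y)
    have key ⦃T : Over (Spec (.of k))⦄ (u : T ⟶ U) (a : T ⟶ A1 k)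
        (h : (lift u a ≫ ψ) ≫ e.base = (u ≫ l) ≫ L.proj) :
        app e.map (lift u a ≫ ψ) (u ≫ l) h = M.sc a (u ≫ m) := by
      rw [← Hy u a (by rw [← h, Category.assoc, hψ])]
      exact hψ' _ _ (by rw [← h, Category.assoc, hψ]) _
    have bb {T : Over (Spec (.of k))} (u : T ⟶ U) (a : T ⟶ A1 k) :
        (lift u a ≫ ψ) ≫ e.base = u ≫ i := by
      rw [Category.assoc, hψ, hy, lift_fst_assoc]
    have ext' {T : Over (Spec (.of k))} (u : T ⟶ U) (f g : T ⟶ E) (hf : f ≫ e.base = u ≫ i)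
        (hg : g ≫ e.base = u ≫ i)
        (h : app e.map f (u ≫ l) (by rw [hf, Category.assoc, hl]) =
          app e.map g (u ≫ l) (by rw [hg, Category.assoc, hl])) : f = g := by
      refine ext _ _ (hf.trans hg.symm) fun T' s q h₁ h₂ ↦ ?_
      obtain ⟨c, rfl, -⟩ := (gl.comp (s ≫ u)).exists_sc (l' := q) (by
        rw [← h₁, Category.assoc, hf, Category.assoc, Category.assoc, hl])
      rw [sc_proj] at h₁ h₂
      refine ((HomPt.eqFam e).map_sc (s ≫ f) c _ h₁.symm).trans
        (Eq.trans ?_ ((HomPt.eqFam e).map_sc (s ≫ g) c _ h₂.symm).symm)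
      congr 1
      have := congr(s ≫ $h)
      rw [comp_app, comp_app] at this
      exact (app_congr _ rfl (Category.assoc _ _ _) _).trans
        (this.trans (app_congr _ rfl (Category.assoc _ _ _).symm _))
    refine ⟨ψ, ⟨by rw [hψ, hy], fun T' t s a ↦ ?_, fun T' s f hf ↦ ?_⟩, key⟩
    · refine ext' s _ _ (bb _ _) (by rw [sp, bb]) ?_
      rw [key, sv t _ _ (by rw [bb, Category.assoc, hl]), key, ← sc_val, sc_sc]
    · have hf' : f ≫ e.base = (s ≫ l) ≫ L.proj := by rw [hf, Category.assoc, hl]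
      obtain ⟨a, ha, hau⟩ := (gm.comp s).exists_sc (l' := app e.map f (s ≫ l) hf')
        (by rw [e.rel, Category.assoc, Category.assoc, hl, hm])
      refine ⟨a, ext' s _ _ (bb _ _) hf ?_, fun b hb ↦ hau b ?_⟩
      · rw [key, ha]
      · dsimp only at hb ⊢
        rw [← key s b (by rw [bb, Category.assoc, hl])]
        exact app_congr _ hb rfl _
  let D : LineBundle X :=
    { tot := E
      proj := e.base
      scalar := i
      smul_proj := fun {T} t f ↦ sp t f
      locTriv := fun x ↦ by
        obtain ⟨U, hU, ⟨l, hl, gl⟩, m, hm, gm⟩ :=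
          (L.loc_gen (𝟙 X)).and (M.loc_gen (𝟙 X)) (L.stab_gen _) (M.stab_gen _) x
        rw [Category.comp_id] at hl hm
        obtain ⟨ψ, hψ, -⟩ := frame hl hm gl gm
        exact ⟨U, hU, ⟨hψ.trivialization⟩⟩ }
  refine ⟨D, e.map, ⟨fun T f l h ↦ (e.rel _ _ _).trans h.symm, fun T t f l h ↦ sv _ _ _ _ _,
    fun T t f l h ↦ e.smul _ _ _ _, fun T f l h gf gl ↦ ?_⟩, H⟩
  -- With a local generator `m` of the target, `f` is the multiple by some `a` of the homomorphism
  -- sending `l` to `m`. As `f` is a generator, `a` is a unit, and so `f(l) = a • m` is a generator.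
  refine isGen_of_loc ((M.loc_gen (l ≫ L.proj)).mono fun T' j ⟨m, hm, gm⟩ ↦ ?_)
  rw [comp_app]
  obtain ⟨ψ, hψ, key⟩ := frame (l := j ≫ l) (m := m) (i := j ≫ l ≫ L.proj) (by simp) hm
    (gl.comp j) gm
  obtain ⟨a, ha, -⟩ := hψ.bij (𝟙 _) (j ≫ f) (by
    rw [Category.assoc, Category.id_comp]
    exact congr(j ≫ $h))
  have ua : IsUnit a := by
    have hψ' : IsFrame D.proj (j ≫ l ≫ L.proj) ψ := hψ
    rw [← isGen_sc_iff (isGen_of_isFrame hψ'), sc_frame hψ', mul_one]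
    have := gf.comp j
    rwa [← ha] at this
  have e1 := key (𝟙 _) a (by
    rw [ha, Category.id_comp, Category.assoc, Category.assoc]
    exact congr(j ≫ $h))
  have e2 : app e.map (j ≫ f) (j ≫ l) (by
      rw [Category.assoc, Category.assoc]
      exact congr(j ≫ $h)) = M.sc a m := by
    refine Eq.trans ?_ (e1.trans (by rw [Category.id_comp]))
    exact app_congr e.map ha.symm (Category.id_comp _).symm _
  exact e2 ▸ (isGen_sc_iff gm a).2 ua

end LineBundle

end

section

namespace LineBundle

variable {X : Over (Spec (.of k))}

/-! ### The trivial line bundle -/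

/-- `f` is an isomorphism of the trivial line bundle with `O`. -/
structure IsTriv (O : LineBundle X) (f : X ⊗ A1 k ≅ O.tot) : Prop where
  proj : f.hom ≫ O.proj = fst _ _
  smul : ∀ {T : Over (Spec (.of k))} (t : T ⟶ Gm k) (x : T ⟶ X) (a : T ⟶ A1 k),
    lift x (A1.scale t a) ≫ f.hom = t • (lift x a ≫ f.hom)

variable (X) in
lemma exists_isTriv : ∃ (O : LineBundle X) (f : X ⊗ A1 k ≅ O.tot), IsTriv O f := by
  obtain ⟨i, hi⟩ := exists_modObj (M := Gm k) (E := X ⊗ A1 k)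
    (fun T t x ↦ lift (x ≫ fst _ _) (Gm.val t * x ≫ snd _ _))
    (fun T T' f t x ↦ by
      rw [comp_lift, A1.comp_mul, Gm.comp_val, Category.assoc, Category.assoc])
    (fun T x ↦ by
      rw [Gm.val_one, one_mul]
      exact CartesianMonoidalCategory.hom_ext _ _ (by simp) (by simp))
    (fun T t s x ↦ by
      rw [lift_fst, lift_snd, Gm.val_mul, mul_assoc])
  have h {T : Over (Spec (.of k))} (t : T ⟶ Gm k) (x : T ⟶ X) (a : T ⟶ A1 k) :
      lift x (A1.scale t a) = t • lift x a := by
    rw [hi, lift_fst, lift_snd, A1.scale_eq]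
  refine ⟨⟨X ⊗ A1 k, fst _ _, fun t l ↦ by rw [hi, lift_fst], fun x ↦ ⟨⊤, trivial, ⟨?_⟩⟩⟩,
    Iso.refl _, by simp, fun t x a ↦ by simpa using h t x a⟩
  refine IsFrame.trivialization (ψ := opnι X ⊤ ▷ A1 k) ⟨by simp, fun T' t s a ↦ ?_, fun T' s l h ↦
    ⟨l ≫ snd _ _, ?_, fun b hb ↦ ?_⟩⟩
  · rw [lift_whiskerRight, lift_whiskerRight, ← h, A1.scale_eq]
  · exact CartesianMonoidalCategory.hom_ext _ _ (by simp [h]) (by simp)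
  · rw [← hb]
    simp

namespace IsTriv

variable {O : LineBundle X} {f : X ⊗ A1 k ≅ O.tot} (h : IsTriv O f)
include h

lemma isFrame : IsFrame O.proj (𝟙 X) f.hom where
  proj := by rw [h.proj, Category.comp_id]
  smul T' t s a := by rw [← A1.scale_eq, h.smul]
  bij T' s l hl := by
    rw [Category.comp_id] at hl
    refine ⟨l ≫ f.inv ≫ snd _ _, ?_, fun a ha ↦ ?_⟩
    · dsimp only
      rw [← cancel_mono f.inv, Category.assoc, f.hom_inv_id, Category.comp_id]
      refine CartesianMonoidalCategory.hom_ext _ _ ?_ (by simp)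
      rw [lift_fst, ← hl, ← h.proj]
      simp
    · rw [← ha]
      simp

lemma isGen {T : Over (Spec (.of k))} (x : T ⟶ X) : IsGen (lift x 1 ≫ f.hom) := by
  have := (isGen_of_isFrame h.isFrame).comp x
  rwa [comp_lift_assoc, Category.comp_id, A1.comp_one] at this

lemma sc_one {T : Over (Spec (.of k))} (x : T ⟶ X) (a : T ⟶ A1 k) :
    O.sc a (lift x 1 ≫ f.hom) = lift x a ≫ f.hom := by
  rw [sc_frame h.isFrame, mul_one]

lemma lift_proj {T : Over (Spec (.of k))} (x : T ⟶ X) (a : T ⟶ A1 k) :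
    (lift x a ≫ f.hom) ≫ O.proj = x := by
  rw [Category.assoc, h.proj, lift_fst]

/-- The coordinate of a point of the trivial line bundle. -/
lemma sc_coord {T : Over (Spec (.of k))} (o : T ⟶ O.tot) :
    O.sc (o ≫ f.inv ≫ snd _ _) (lift (o ≫ O.proj) 1 ≫ f.hom) = o := by
  rw [h.sc_one, ← cancel_mono f.inv, Category.assoc, f.hom_inv_id, Category.comp_id]
  refine CartesianMonoidalCategory.hom_ext _ _ ?_ (by simp)
  rw [lift_fst, ← h.proj]
  simp

lemma coord_sc {T : Over (Spec (.of k))} (a : T ⟶ A1 k) (o : T ⟶ O.tot) :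
    O.sc a o ≫ f.inv ≫ snd _ _ = a * o ≫ f.inv ≫ snd _ _ := by
  refine (h.isGen (o ≫ O.proj)).sc_injective ?_
  rw [← sc_sc, h.sc_coord]
  have := h.sc_coord (O.sc a o)
  rwa [sc_proj] at this

lemma isUnit_coord {T : Over (Spec (.of k))} {o : T ⟶ O.tot} (ho : IsGen o) :
    IsUnit (o ≫ f.inv ≫ snd X (A1 k)) := by
  rw [← isGen_sc_iff (h.isGen (o ≫ O.proj)), h.sc_coord]
  exact ho

end IsTriv

/-! ### Tensor products -/

lemma loc_gen₂ (L M : LineBundle X) {T : Over (Spec (.of k))} (x : T ⟶ X) :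
    Loc T fun T' j ↦ ∃ (l : T' ⟶ L.tot) (m : T' ⟶ M.tot),
      l ≫ L.proj = j ≫ x ∧ m ≫ M.proj = j ≫ x ∧ IsGen l ∧ IsGen m :=
  ((L.loc_gen x).and (M.loc_gen x) (L.stab_gen _) (M.stab_gen _)).mono
    fun _ _ ⟨⟨l, h, g⟩, m, h', g'⟩ ↦ ⟨l, m, h, h', g, g'⟩

/-- The tensor product is built as `Hom(L^∨, M)` with `L^∨ = Hom(L, 𝒪)`: the point `l ⊗ m` is the
homomorphism `d ↦ d(l) • m`. Only the construction of quotients is required. -/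
theorem exists_isPairing (L M : LineBundle X) :
    ∃ (N : LineBundle X) (β : pullback L.proj M.proj ⟶ N.tot), IsPairing L M N β := by
  obtain ⟨O, f, hf⟩ := exists_isTriv X
  obtain ⟨D, β₀, h₀, -⟩ := exists_div L O
  obtain ⟨N, β₁, h₁, H⟩ := exists_div D M
  let c {T : Over (Spec (.of k))} (d : T ⟶ D.tot) (l : T ⟶ L.tot) (h : d ≫ D.proj = l ≫ L.proj) :
    T ⟶ A1 k := app β₀ d l h ≫ f.inv ≫ snd _ _
  have hc {T T' : Over (Spec (.of k))} (s : T' ⟶ T) (d : T ⟶ D.tot) (l : T ⟶ L.tot)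
      (h : d ≫ D.proj = l ≫ L.proj) :
      s ≫ c d l h = c (s ≫ d) (s ≫ l) (by simp [h]) := by
    dsimp only [c]
    rw [← Category.assoc, comp_app]
  have cl {T : Over (Spec (.of k))} (t : T ⟶ Gm k) (d : T ⟶ D.tot) (l : T ⟶ L.tot)
      (h : d ≫ D.proj = l ≫ L.proj) (h' : (t • d) ≫ D.proj = l ≫ L.proj) :
      c (t • d) l h' = Gm.val t * c d l h := by
    dsimp only [c]
    rw [h₀.smul_left t d l h, ← sc_val, hf.coord_sc]
  have cr {T : Over (Spec (.of k))} (t : T ⟶ Gm k) (d : T ⟶ D.tot) (l : T ⟶ L.tot)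
      (h : d ≫ D.proj = l ≫ L.proj) (h' : d ≫ D.proj = (t • l) ≫ L.proj) :
      c d (t • l) h' = Gm.val t * c d l h := by
    dsimp only [c]
    rw [h₀.smul_right t d l h, ← sc_val, hf.coord_sc]
  have cc {T : Over (Spec (.of k))} {d d' : T ⟶ D.tot} {l l' : T ⟶ L.tot} (hd : d = d')
      (hl : l = l') (h : d ≫ D.proj = l ≫ L.proj) : c d l h = c d' l' (by rw [← hd, ← hl, h]) := by
    subst hd hl
    rfl
  -- A homomorphism out of the dual bundle is determined by its values at local generators of that
  -- bundle.
  have ext {T : Over (Spec (.of k))} (n n' : T ⟶ N.tot) (hb : n ≫ N.proj = n' ≫ N.proj)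
      (h : ∀ ⦃T' : Over (Spec (.of k))⦄ (s : T' ⟶ T) (d : T' ⟶ D.tot)
        (h₁ : (s ≫ n) ≫ N.proj = d ≫ D.proj) (h₂ : (s ≫ n') ≫ N.proj = d ≫ D.proj),
        app β₁ (s ≫ n) d h₁ = app β₁ (s ≫ n') d h₂) : n = n' := by
    refine hom_ext_loc ((D.loc_gen (n ≫ N.proj)).mono fun T' j ⟨d, hd, gd⟩ ↦ ?_)
    have e₁ : (j ≫ n) ≫ N.proj = d ≫ D.proj := by rw [hd, Category.assoc]
    have e₂ : (j ≫ n') ≫ N.proj = d ≫ D.proj := by rw [hd, hb, Category.assoc]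
    exact h₁.left_injective gd e₁ e₂ (h j d e₁ e₂)
  have ex (T : Over (Spec (.of k))) (l : T ⟶ L.tot) (m : T ⟶ M.tot)
      (h : l ≫ L.proj = m ≫ M.proj) :=
    H (l ≫ L.proj) ⟨fun T' s d hd ↦ M.sc (c d (s ≫ l) (by simpa using hd)) (s ≫ m),
      fun T₁ T₂ f s d hd ↦ by
        rw [comp_sc, hc]
        exact congrArg₂ _ (cc rfl (Category.assoc _ _ _).symm _) (Category.assoc _ _ _).symm,
      fun T' s d hd ↦ by rw [sc_proj, Category.assoc, h],
      fun T' s t d hd h' ↦ by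
        rw [cl t d (s ≫ l) (by simpa using hd), ← sc_sc, sc_val]⟩
  choose τ hτ hτu using ex
  have τp {T : Over (Spec (.of k))} (l : T ⟶ L.tot) (m : T ⟶ M.tot)
      (h : l ≫ L.proj = m ≫ M.proj) : τ T l m h ≫ N.proj = l ≫ L.proj := (hτ T l m h).1
  have τv {T T' : Over (Spec (.of k))} (l : T ⟶ L.tot) (m : T ⟶ M.tot)
      (h : l ≫ L.proj = m ≫ M.proj) (s : T' ⟶ T) (d : T' ⟶ D.tot)
      (h' : (s ≫ τ T l m h) ≫ N.proj = d ≫ D.proj) :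
      app β₁ (s ≫ τ T l m h) d h' = M.sc (c d (s ≫ l) (by
        rw [← h', Category.assoc, τp, Category.assoc])) (s ≫ m) :=
    (hτ T l m h).2 s d (by rw [← h', Category.assoc, τp]) h'
  have τv' {T : Over (Spec (.of k))} (l : T ⟶ L.tot) (m : T ⟶ M.tot)
      (h : l ≫ L.proj = m ≫ M.proj) (d : T ⟶ D.tot)
      (h' : τ T l m h ≫ N.proj = d ≫ D.proj) :
      app β₁ (τ T l m h) d h' = M.sc (c d l (by rw [← h', τp])) m := by
    refine (app_congr _ (Category.id_comp _).symm rfl _).trans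
      ((τv l m h (𝟙 T) d (by simpa using h')).trans ?_)
    exact congrArg₂ _ (cc rfl (Category.id_comp _) _) (Category.id_comp _)
  obtain ⟨β, hβ⟩ := exists_app (p := L.proj) (q := M.proj) (Z := N.tot) (fun T l m h ↦ τ T l m h)
    (fun T T' s l m h ↦ ext _ _ (by rw [Category.assoc, τp, τp, Category.assoc])
      fun T'' r d e₁ e₂ ↦ by
        refine (app_congr _ (Category.assoc _ _ _).symm rfl _).trans ((τv _ _ _ _ _ _).trans
          (Eq.trans ?_ (τv _ _ _ _ _ _).symm))
        exact congrArg₂ _ (cc rfl (Category.assoc _ _ _) _) (Category.assoc _ _ _))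
  refine ⟨N, β, fun T l m h ↦ by rw [hβ, τp], fun T t l m h ↦ ?_, fun T t l m h ↦ ?_,
    fun T l m h hl hm ↦ ?_⟩
  · rw [hβ, hβ]
    refine ext _ _ (by rw [τp, N.smul_proj, τp, L.smul_proj]) fun T' s d e₁ e₂ ↦ ?_
    have e₃ : d ≫ D.proj = (s ≫ l) ≫ L.proj := by
      rw [← e₁, Category.assoc, τp, L.smul_proj, Category.assoc]
    have e₄ : (s ≫ τ T l m h) ≫ N.proj = d ≫ D.proj := by rw [e₃, Category.assoc, τp, Category.assoc]
    have e₅ : s ≫ (t • l) = (s ≫ t) • (s ≫ l) := ModObj.comp_smul _ _ _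
    rw [τv, app_congr β₁ (ModObj.comp_smul (X := N.tot) s t (τ T l m h)) rfl,
      h₁.smul_left _ _ _ e₄, τv, cc rfl e₅, cr (s ≫ t) d (s ≫ l) e₃, ← sc_sc, sc_val]
  · rw [hβ, hβ]
    refine ext _ _ (by rw [τp, N.smul_proj, τp]) fun T' s d e₁ e₂ ↦ ?_
    have e₃ : d ≫ D.proj = (s ≫ l) ≫ L.proj := by rw [← e₁, Category.assoc, τp, Category.assoc]
    have e₄ : (s ≫ τ T l m h) ≫ N.proj = d ≫ D.proj := by rw [e₃, Category.assoc, τp, Category.assoc]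
    rw [τv, app_congr β₁ (ModObj.comp_smul (X := N.tot) s t (τ T l m h)) rfl,
      h₁.smul_left _ _ _ e₄, τv, ModObj.comp_smul (X := M.tot), ← sc_val (s ≫ t) (s ≫ m),
      ← sc_val (s ≫ t) (M.sc _ _), sc_sc, sc_sc,
      mul_comm]
  · rw [hβ]
    -- On a generator `d` of the dual, `l ⊗ m` takes the value `d(l) • m`, where `d(l)` is a unit.
    -- The value is a generator, and therefore so is `l ⊗ m`.
    refine isGen_of_loc ((D.loc_gen (l ≫ L.proj)).mono fun T' j ⟨d, hd, gd⟩ ↦ ?_)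
    have e₃ : d ≫ D.proj = (j ≫ l) ≫ L.proj := by rw [hd, Category.assoc]
    have e₄ : (j ≫ τ T l m h) ≫ N.proj = d ≫ D.proj := by rw [e₃, Category.assoc, τp, Category.assoc]
    refine h₁.swap.isGen_of_isGen_app e₄.symm ?_ gd
    rw [app_swap, τv, isGen_sc_iff (hm.comp j)]
    exact hf.isUnit_coord (h₀.gen _ _ e₃ gd (hl.comp j))

end LineBundle

end

/-! ### Lifts of automorphisms of the base -/

section

open LineBundle

section

variable {A Z T : Over (Spec (.of k))} [GrpObj A] [ModObj A Z]

lemma hom_one_smul (z : T ⟶ Z) : (1 : T ⟶ A) • z = z :=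
  one_smul _ _

lemma hom_inv_smul_smul (t : T ⟶ A) (z : T ⟶ Z) : t⁻¹ • t • z = z := by
  rw [← hom_mul_smul, inv_mul_cancel, hom_one_smul]

lemma hom_smul_inv_smul (t : T ⟶ A) (z : T ⟶ Z) : t • t⁻¹ • z = z := by
  rw [← hom_mul_smul, mul_inv_cancel, hom_one_smul]

lemma hom_smul_injective {t : T ⟶ A} {z z' : T ⟶ Z} (h : t • z = t • z') : z = z' := by
  rw [← hom_inv_smul_smul t z, h, hom_inv_smul_smul]

end

section

variable {G X T : Over (Spec (.of k))} [GrpObj G] [ModObj G X] {L M N : LineBundle X} {g : T ⟶ G}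

namespace IsLift

variable {φ : T ⊗ L.tot ⟶ L.tot}

/-- A morphism which covers an automorphism as a family of maps. -/
def fam (hp : ∀ ⦃T' : Over (Spec (.of k))⦄ (s : T' ⟶ T) (l : T' ⟶ L.tot),
      (lift s l ≫ φ) ≫ L.proj = (s ≫ g) • (l ≫ L.proj))
    (hs : ∀ ⦃T' : Over (Spec (.of k))⦄ (s : T' ⟶ T) (t : T' ⟶ Gm k) (l : T' ⟶ L.tot),
      lift s (t • l) ≫ φ = t • (lift s l ≫ φ)) :
    EqFam L.proj L.proj (snd T X) ((fst T X ≫ g) • snd T X) where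
  val T' z l _ := lift (z ≫ fst _ _) l ≫ φ
  nat T₁ T₂ f z l h := by rw [comp_lift_assoc, Category.assoc]
  proj T' z l h := by rw [hp, ModObj.comp_smul (X := X), h, Category.assoc]
  smul T' z t l h h' := hs _ _ _

/-- Equivariant morphisms which cover an automorphism of `X` and preserve generators are lifts. -/
lemma of_gen (hp : ∀ ⦃T' : Over (Spec (.of k))⦄ (s : T' ⟶ T) (l : T' ⟶ L.tot),
      (lift s l ≫ φ) ≫ L.proj = (s ≫ g) • (l ≫ L.proj))
    (hs : ∀ ⦃T' : Over (Spec (.of k))⦄ (s : T' ⟶ T) (t : T' ⟶ Gm k) (l : T' ⟶ L.tot),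
      lift s (t • l) ≫ φ = t • (lift s l ≫ φ))
    (hg : ∀ ⦃T' : Over (Spec (.of k))⦄ (s : T' ⟶ T) (l : T' ⟶ L.tot),
      IsGen l → IsGen (lift s l ≫ φ)) : IsLift L g φ := by
  have H {T' : Over (Spec (.of k))} (z : T' ⟶ T ⊗ X) : Loc T' fun _ j ↦ ∃ l,
      ∃ h : l ≫ L.proj = (j ≫ z) ≫ snd _ _, IsGen l ∧ IsGen ((fam hp hs).val (j ≫ z) l h) :=
    (L.loc_gen (z ≫ snd _ _)).mono fun T'' j ⟨l, h, gl⟩ ↦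
      ⟨l, by rw [h, Category.assoc], gl, hg _ _ gl⟩
  refine ⟨?_, fun {Z} s t l ↦ hs s t l, isIso_of_loc _ (fun T' a b hab ↦ ?_)
    (Loc.of_forall ?_ fun T₁ T₂ j i ⟨y, hy⟩ ↦ ⟨i ≫ y,
      (Category.assoc _ _ _).trans (congrArg _ hy)⟩)⟩
  · have := hp (fst T L.tot) (snd T L.tot)
    rwa [lift_fst_snd, Category.id_comp] at this
  · have e₁ : a ≫ fst _ _ = b ≫ fst _ _ := by simpa using congr($hab ≫ fst _ _)
    have e₂ : a ≫ φ = b ≫ φ := by simpa using congr($hab ≫ snd _ _)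
    have e₃ (c : T' ⟶ T ⊗ L.tot) : c = lift (c ≫ fst _ _) (c ≫ snd _ _) := by
      rw [← comp_lift, lift_fst_snd, Category.comp_id]
    rw [e₃ a, e₃ b, e₁] at e₂
    have e₄ := congr($e₂ ≫ L.proj)
    rw [hp, hp] at e₄
    refine CartesianMonoidalCategory.hom_ext _ _ e₁ ?_
    refine (fam hp hs).injective (lift (b ≫ fst _ _) (b ≫ snd _ _ ≫ L.proj)) (H _) ?_ (by simp) ?_
    · rw [lift_snd, hom_smul_injective e₄, Category.assoc]
    · change lift _ _ ≫ φ = lift _ _ ≫ φ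
      rw [lift_fst, e₂]
  -- For surjectivity, the tautological point of the total space needs a preimage; it lies over its
  -- image in `X` translated by the inverse of `g`.
  · obtain ⟨l, h, e⟩ := (fam hp hs).exists_val_eq
      (lift (fst T L.tot) ((fst T L.tot ≫ g)⁻¹ • (snd T L.tot ≫ L.proj))) (H _) (snd T L.tot) (by
        rw [ModObj.comp_smul (X := X), lift_fst_assoc, lift_snd, hom_smul_inv_smul])
    change lift _ _ ≫ φ = _ at e
    rw [lift_fst] at e
    refine ⟨lift (fst _ _) l, CartesianMonoidalCategory.hom_ext _ _ (by simp) ?_⟩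
    simpa using e

variable (hφ : IsLift L g φ)
include hφ

lemma proj {T' : Over (Spec (.of k))} (s : T' ⟶ T) (l : T' ⟶ L.tot) :
    (lift s l ≫ φ) ≫ L.proj = (s ≫ g) • (l ≫ L.proj) := by
  rw [Category.assoc, hφ.covers, ModObj.comp_smul, lift_fst_assoc, lift_snd_assoc]

lemma sc {T' : Over (Spec (.of k))} (s : T' ⟶ T) (a : T' ⟶ A1 k) (l : T' ⟶ L.tot) :
    lift s (L.sc a l) ≫ φ = L.sc a (lift s l ≫ φ) := by
  have := (fam (fun T' s l ↦ hφ.proj s l) (fun T' s t l ↦ hφ.smul s t l)).map_sc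
    (lift s (l ≫ L.proj)) a l (by simp)
  change lift _ _ ≫ φ = L.sc a (lift _ _ ≫ φ) at this
  rwa [lift_fst] at this

/-- The automorphism is inverted: the preimage of a point over the image of `φ(l)` lies over the
image of `l` because `g` acts injectively, hence is a unique multiple of `l`, and `φ` is linear. -/
lemma gen {T' : Over (Spec (.of k))} (s : T' ⟶ T) {l : T' ⟶ L.tot} (hl : IsGen l) :
    IsGen (lift s l ≫ φ) := by
  intro T'' f m hm
  have := hφ.isIso
  let z := lift (f ≫ s) m ≫ inv (lift (fst T L.tot) φ)
  have hz : z ≫ lift (fst T L.tot) φ = lift (f ≫ s) m := by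
    rw [Category.assoc, IsIso.inv_hom_id, Category.comp_id]
  have z₁ : z ≫ fst _ _ = f ≫ s := by simpa using congr($hz ≫ fst _ _)
  have z₂ : lift (f ≫ s) (z ≫ snd _ _) ≫ φ = m := by
    rw [← z₁, ← comp_lift, lift_fst_snd, Category.comp_id]
    simpa using congr($hz ≫ snd _ _)
  have z₃ : (z ≫ snd _ _) ≫ L.proj = (f ≫ l) ≫ L.proj := by
    have h := hφ.proj (f ≫ s) (z ≫ snd _ _)
    rw [z₂, hm, hφ.proj, ModObj.comp_smul, ← Category.assoc, ← Category.assoc] at h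
    exact (hom_smul_injective h).symm
  obtain ⟨a, ha, hu⟩ := (hl.comp f).exists_sc z₃
  refine ⟨a, ?_, fun b hb ↦ hu b ?_⟩
  · dsimp only
    rw [comp_lift_assoc, ← hφ.sc, ha, z₂]
  · dsimp only at hb ⊢
    rw [comp_lift_assoc, ← hφ.sc] at hb
    have h₁ : lift (f ≫ s) (L.sc b (f ≫ l)) = z := by
      rw [← cancel_mono (lift (fst T L.tot) φ), hz]
      exact CartesianMonoidalCategory.hom_ext _ _ (by simp) (by simpa using hb)
    rw [← h₁, lift_snd]

/-- The restriction of a lift. -/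
lemma restrict {T' : Over (Spec (.of k))} (f : T' ⟶ T) : IsLift L (f ≫ g) (f ▷ L.tot ≫ φ) :=
  of_gen (fun T'' s l ↦ by rw [lift_whiskerRight_assoc, hφ.proj, Category.assoc])
    (fun T'' s t l ↦ by rw [lift_whiskerRight_assoc, hφ.smul, lift_whiskerRight_assoc])
    (fun T'' s l hl ↦ by
      rw [lift_whiskerRight_assoc]
      exact hφ.gen _ hl)

/-- The transport of a lift along an isomorphism of line bundles. -/
lemma transport {f : L.tot ≅ M.tot} (hf : IsBundleIso L M f) :
    IsLift M g (T ◁ f.inv ≫ φ ≫ f.hom) :=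
  of_gen (fun T' s l ↦ by
      rw [lift_whiskerLeft_assoc, ← Category.assoc, hf.comp_proj, hφ.proj, Category.assoc,
        (Iso.inv_comp_eq f).2 hf.proj.symm])
    (fun T' s t l ↦ by
      have : (t • l) ≫ f.inv = t • (l ≫ f.inv) := hf.symm.smul t l
      rw [lift_whiskerLeft_assoc, lift_whiskerLeft_assoc, this, ← Category.assoc, hφ.smul, hf.smul,
        Category.assoc])
    (fun T' s l hl ↦ by
      rw [lift_whiskerLeft_assoc, ← Category.assoc]
      exact hf.gen (hφ.gen _ (hf.symm.gen hl)))

end IsLift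

/-- Lifts may be defined on generators, locally. -/
lemma exists_isLift (R : ∀ ⦃T' : Over (Spec (.of k))⦄, (T' ⟶ T) → (T' ⟶ L.tot) →
      (T' ⟶ L.tot) → Prop)
    (gen : ∀ ⦃T' : Over (Spec (.of k))⦄ (s : T' ⟶ T) (l m : T' ⟶ L.tot),
      R s l m → IsGen l ∧ IsGen m ∧ m ≫ L.proj = (s ≫ g) • (l ≫ L.proj))
    (stab : ∀ ⦃T' T'' : Over (Spec (.of k))⦄ (s : T' ⟶ T) (l m : T' ⟶ L.tot) (f : T'' ⟶ T'),
      R s l m → R (f ≫ s) (f ≫ l) (f ≫ m))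
    (uniq : ∀ ⦃T' : Over (Spec (.of k))⦄ (s : T' ⟶ T) (l l' m m' : T' ⟶ L.tot),
      R s l m → R s l' m' → l' ≫ L.proj = l ≫ L.proj → ∃ t : T' ⟶ Gm k, l' = t • l ∧ m' = t • m)
    (ex : ∀ ⦃T' : Over (Spec (.of k))⦄ (s : T' ⟶ T) (x : T' ⟶ X),
      Loc T' fun _ j ↦ ∃ l m, R (j ≫ s) l m ∧ l ≫ L.proj = j ≫ x) :
    ∃ φ : T ⊗ L.tot ⟶ L.tot, IsLift L g φ ∧ ∀ ⦃T' : Over (Spec (.of k))⦄ (s : T' ⟶ T)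
      (l m : T' ⟶ L.tot), R s l m → lift s l ≫ φ = m := by
  obtain ⟨ψ, hψ⟩ := exists_eqFam (L := L) (M := L) (snd T X) ((fst T X ≫ g) • snd T X)
    (fun T' z l m ↦ R (z ≫ fst _ _) l m ∧ l ≫ L.proj = z ≫ snd _ _)
    (fun T' z l m ⟨h, e⟩ ↦ ⟨(gen _ _ _ h).1, e, by
      rw [(gen _ _ _ h).2.2, ModObj.comp_smul (X := X), e, Category.assoc]⟩)
    (fun T₁ T₂ z l m f ⟨h, e⟩ ↦ ⟨by simpa using stab _ _ _ f h, by simp [e]⟩)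
    (fun T' z l l' m m' ⟨h, e⟩ ⟨h', e'⟩ ↦ uniq _ _ _ _ _ h h' (by rw [e, e']))
    (ex (fst _ _) (snd _ _))
  have hv {T' : Over (Spec (.of k))} (s : T' ⟶ T) (l m : T' ⟶ L.tot) (x : T' ⟶ X)
      (hx : l ≫ L.proj = lift s x ≫ snd _ _) (h : R s l m) : ψ.val (lift s x) l hx = m :=
    hψ _ _ _ hx ⟨by simpa using h, hx⟩
  have hl {T' : Over (Spec (.of k))} (s : T' ⟶ T) (l : T' ⟶ L.tot) :
      lift s l ≫ ψ.val (lift (fst _ _) (snd _ _ ≫ L.proj)) (snd T L.tot) (by simp) =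
        ψ.val (lift s (l ≫ L.proj)) l (by simp) :=
    (ψ.nat _ _ _ _).trans (ψ.val_congr (by simp [comp_lift]) (by simp) _)
  refine ⟨ψ.val (lift (fst _ _) (snd _ _ ≫ L.proj)) (snd T L.tot) (by simp),
    IsLift.of_gen (fun T' s l ↦ ?_) (fun T' s t l ↦ ?_) (fun T' s l hg ↦ ?_), fun T' s l m h ↦ ?_⟩
  · rw [hl, ψ.proj, ModObj.comp_smul (X := X), lift_fst_assoc, lift_snd]
  · rw [hl, hl, ← ψ.smul _ _ _ _ (by rw [L.smul_proj, lift_snd])]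
    exact ψ.val_congr (by rw [L.smul_proj]) rfl _
  · rw [hl]
    refine isGen_of_loc ((ex s (l ≫ L.proj)).mono fun T'' j ⟨l₀, m₀, h, e⟩ ↦ ?_)
    rw [ψ.nat]
    refine ψ.isGen_of_isGen (l := l₀) _ (by simp [e, comp_lift]) _ (gen _ _ _ h).1 (hg.comp j) ?_
    have := hv (j ≫ s) l₀ m₀ (j ≫ l ≫ L.proj) (by simp [e]) h
    rw [(ψ.val_congr (comp_lift _ _ _) rfl (by simp [e])).trans this]
    exact (gen _ _ _ h).2.1
  · rw [hl, hv _ _ _ _ _ h]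

end

end

/-! ### Lifts and tensor products -/

section

open LineBundle

section

variable {G X T : Over (Spec (.of k))} [GrpObj G] [ModObj G X] {L M N : LineBundle X} {g : T ⟶ G}

/-- Lifts to `L`, `M` and `N` are compatible with the pairing `β`. -/
def LiftCompat (β : pullback L.proj M.proj ⟶ N.tot) (φ : T ⊗ L.tot ⟶ L.tot) (ψ : T ⊗ M.tot ⟶ M.tot)
    (χ : T ⊗ N.tot ⟶ N.tot) : Prop :=
  ∀ ⦃T' : Over (Spec (.of k))⦄ (s : T' ⟶ T) (l : T' ⟶ L.tot) (m : T' ⟶ M.tot)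
    (h : l ≫ L.proj = m ≫ M.proj) (h' : (lift s l ≫ φ) ≫ L.proj = (lift s m ≫ ψ) ≫ M.proj),
    app β (lift s l ≫ φ) (lift s m ≫ ψ) h' = lift s (app β l m h) ≫ χ

lemma IsLift.proj_eq {φ : T ⊗ L.tot ⟶ L.tot} (hφ : IsLift L g φ) {ψ : T ⊗ M.tot ⟶ M.tot}
    (hψ : IsLift M g ψ) {T' : Over (Spec (.of k))} (s : T' ⟶ T) {l : T' ⟶ L.tot} {m : T' ⟶ M.tot}
    (h : l ≫ L.proj = m ≫ M.proj) : (lift s l ≫ φ) ≫ L.proj = (lift s m ≫ ψ) ≫ M.proj := by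
  rw [hφ.proj, hψ.proj, h]

namespace LineBundle.IsPairing

variable {β : pullback L.proj M.proj ⟶ N.tot} (hβ : IsPairing L M N β)
include hβ

lemma loc_app {T : Over (Spec (.of k))} (n : T ⟶ N.tot) : Loc T fun T' j ↦
    ∃ (l : T' ⟶ L.tot) (m : T' ⟶ M.tot) (h : l ≫ L.proj = m ≫ M.proj), IsGen m ∧
      j ≫ n = app β l m h :=
  (M.loc_gen (n ≫ N.proj)).mono fun T' j ⟨m, h, gm⟩ ↦ by
    obtain ⟨l, hl, e⟩ := hβ.left_surjective gm (j ≫ n) (by rw [h, Category.assoc])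
    exact ⟨l, m, hl, gm, e.symm⟩

/-- Both sides are linear in `l` and in `m`, so agreement at one local pair of generators forces
agreement everywhere. -/
lemma liftCompat_of_gen {φ : T ⊗ L.tot ⟶ L.tot} (hφ : IsLift L g φ) {ψ : T ⊗ M.tot ⟶ M.tot}
    (hψ : IsLift M g ψ) {χ : T ⊗ N.tot ⟶ N.tot} (hχ : IsLift N g χ)
    (H : ∀ ⦃T' : Over (Spec (.of k))⦄ (s : T' ⟶ T) (x : T' ⟶ X), Loc T' fun T'' j ↦
      ∃ (l : T'' ⟶ L.tot) (m : T'' ⟶ M.tot) (h : l ≫ L.proj = m ≫ M.proj),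
        IsGen l ∧ IsGen m ∧ l ≫ L.proj = j ≫ x ∧
        app β (lift (j ≫ s) l ≫ φ) (lift (j ≫ s) m ≫ ψ) (hφ.proj_eq hψ _ h) =
          lift (j ≫ s) (app β l m h) ≫ χ) : LiftCompat β φ ψ χ := by
  intro T' s l m h h'
  refine hom_ext_loc ((H s (l ≫ L.proj)).mono fun T'' j ⟨l₀, m₀, h₀, gl, gm, hx, e⟩ ↦ ?_)
  obtain ⟨a, ha, -⟩ := gl.exists_sc (l' := j ≫ l) (by rw [hx, Category.assoc])
  obtain ⟨b, hb, -⟩ := gm.exists_sc (l' := j ≫ m) (by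
    rw [← h₀, hx, Category.assoc, h])
  have e₁ : j ≫ lift s l ≫ φ = L.sc a (lift (j ≫ s) l₀ ≫ φ) := by
    rw [comp_lift_assoc, ← ha, hφ.sc]
  have e₂ : j ≫ lift s m ≫ ψ = M.sc b (lift (j ≫ s) m₀ ≫ ψ) := by
    rw [comp_lift_assoc, ← hb, hψ.sc]
  have e₃ := hφ.proj_eq hψ (j ≫ s) h₀
  refine (comp_app _ _ _ _ _).trans ((app_congr β e₁ e₂ _).trans ?_)
  rw [comp_lift_assoc j s (app β l m h) χ, comp_app, app_congr β ha.symm hb.symm]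
  have e₄ := hβ.sc_left a _ _ (e₃.trans (sc_proj b _).symm)
  have e₅ := hβ.sc_left a _ _ (h₀.trans (sc_proj b _).symm)
  rw [e₄, e₅, hβ.sc_right b _ _ e₃, hβ.sc_right b _ _ h₀, e, hχ.sc, hχ.sc]

/-- The lift sends `l ⊗ m` to `φ(l) ⊗ ψ(m)` on generators. Replacing `l` and `m` by multiples by
units `t` and `r` scales source and target alike by `t * r`. -/
lemma exists_lift_tensor {φ : T ⊗ L.tot ⟶ L.tot} (hφ : IsLift L g φ) {ψ : T ⊗ M.tot ⟶ M.tot}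
    (hψ : IsLift M g ψ) : ∃ χ : T ⊗ N.tot ⟶ N.tot, IsLift N g χ ∧ LiftCompat β φ ψ χ := by
  have app_smul_smul {T' : Over (Spec (.of k))} (t r : T' ⟶ Gm k) (l : T' ⟶ L.tot)
      (m : T' ⟶ M.tot) (h : l ≫ L.proj = m ≫ M.proj)
      (h' : (t • l) ≫ L.proj = (r • m) ≫ M.proj) : app β (t • l) (r • m) h' =
        (t * r) • app β l m h := by
    rw [hom_mul_smul, ← hβ.smul_right, ← hβ.smul_left]
  obtain ⟨χ, hχ, H⟩ := exists_isLift (L := N) (g := g)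
    (fun T' s n n' ↦ ∃ (l : T' ⟶ L.tot) (m : T' ⟶ M.tot) (h : l ≫ L.proj = m ≫ M.proj),
      IsGen l ∧ IsGen m ∧ n = app β l m h ∧
        n' = app β (lift s l ≫ φ) (lift s m ≫ ψ) (hφ.proj_eq hψ _ h))
    (by
      rintro T' s _ _ ⟨l, m, h, gl, gm, rfl, rfl⟩
      exact ⟨hβ.gen _ _ _ gl gm, hβ.gen _ _ _ (hφ.gen _ gl) (hψ.gen _ gm), by
        rw [hβ.proj, hβ.proj, hφ.proj]⟩)
    (by
      rintro T' T'' s _ _ f ⟨l, m, h, gl, gm, rfl, rfl⟩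
      refine ⟨f ≫ l, f ≫ m, by simp [h], gl.comp f, gm.comp f, comp_app _ _ _ _ _, ?_⟩
      exact (comp_app _ _ _ _ _).trans (app_congr _ (comp_lift_assoc _ _ _ _)
        (comp_lift_assoc _ _ _ _) _))
    (by
      rintro T' s _ _ _ _ ⟨l, m, h, gl, gm, rfl, rfl⟩ ⟨l', m', h', gl', gm', rfl, rfl⟩ e
      rw [hβ.proj, hβ.proj] at e
      obtain ⟨t, rfl, -⟩ := gl.exists_smul gl' e
      obtain ⟨r, rfl, -⟩ := gm.exists_smul gm' (by rw [← h', e, h])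
      refine ⟨t * r, app_smul_smul _ _ _ _ _ _, ?_⟩
      rw [app_congr β (hφ.smul s t l) (hψ.smul s r m)]
      exact app_smul_smul _ _ _ _ _ _)
    (fun T' s x ↦ (loc_gen₂ L M x).mono fun T'' j ⟨l, m, hl, hm, gl, gm⟩ ↦
      ⟨_, _, ⟨l, m, hl.trans hm.symm, gl, gm, rfl, rfl⟩, by rw [hβ.proj, hl]⟩)
  refine ⟨χ, hχ, hβ.liftCompat_of_gen hφ hψ hχ fun T' s x ↦ (loc_gen₂ L M x).mono
    fun T'' j ⟨l, m, hl, hm, gl, gm⟩ ↦ ⟨l, m, hl.trans hm.symm, gl, gm, hl, ?_⟩⟩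
  rw [H _ _ _ ⟨l, m, hl.trans hm.symm, gl, gm, rfl, rfl⟩]

/-- The image of a generator `m` is the unique solution `m'` of `φ(l) ⊗ m' = χ(l ⊗ m)`; it exists
because `φ(l)` is a generator. A unit scaling `l` appears on both sides, so the choice of `l` does
not matter. -/
lemma exists_lift_div {φ : T ⊗ L.tot ⟶ L.tot} (hφ : IsLift L g φ) {χ : T ⊗ N.tot ⟶ N.tot}
    (hχ : IsLift N g χ) : ∃ ψ : T ⊗ M.tot ⟶ M.tot, IsLift M g ψ ∧ LiftCompat β φ ψ χ := by
  have ex {T' : Over (Spec (.of k))} (s : T' ⟶ T) (x : T' ⟶ X) : Loc T' fun T'' j ↦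
      ∃ (l : T'' ⟶ L.tot) (m m' : T'' ⟶ M.tot) (h : l ≫ L.proj = m ≫ M.proj)
        (h' : (lift (j ≫ s) l ≫ φ) ≫ L.proj = m' ≫ M.proj),
        IsGen l ∧ IsGen m ∧ m ≫ M.proj = j ≫ x ∧
        app β (lift (j ≫ s) l ≫ φ) m' h' = lift (j ≫ s) (app β l m h) ≫ χ :=
    (loc_gen₂ L M x).mono fun T'' j ⟨l, m, hl, hm, gl, gm⟩ ↦ by
      obtain ⟨m', h', e⟩ := hβ.right_surjective (hφ.gen (j ≫ s) gl)
        (lift (j ≫ s) (app β l m (hl.trans hm.symm)) ≫ χ) (by rw [hχ.proj, hβ.proj, hφ.proj])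
      exact ⟨l, m, m', _, h', gl, gm, hm, e⟩
  obtain ⟨ψ, hψ, H⟩ := exists_isLift (L := M) (g := g)
    (fun T' s m m' ↦ ∃ (l : T' ⟶ L.tot) (h : l ≫ L.proj = m ≫ M.proj)
      (h' : (lift s l ≫ φ) ≫ L.proj = m' ≫ M.proj),
      IsGen l ∧ IsGen m ∧ app β (lift s l ≫ φ) m' h' = lift s (app β l m h) ≫ χ)
    (by
      rintro T' s m m' ⟨l, h, h', gl, gm, e⟩
      exact ⟨gm, hβ.isGen_of_isGen_app h' (by rw [e]; exact hχ.gen _ (hβ.gen _ _ _ gl gm))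
        (hφ.gen _ gl), by rw [← h', hφ.proj, h]⟩)
    (by
      rintro T' T'' s m m' f ⟨l, h, h', gl, gm, e⟩
      have h'' : (lift (f ≫ s) (f ≫ l) ≫ φ) ≫ L.proj = (f ≫ m') ≫ M.proj := by
        rw [← comp_lift_assoc, Category.assoc, h', Category.assoc]
      refine ⟨f ≫ l, by simp [h], h'', gl.comp f, gm.comp f, ?_⟩
      rw [← comp_app β f l m h, ← comp_lift_assoc f s (app β l m h) χ, ← e, comp_app]
      exact app_congr β (comp_lift_assoc _ _ _ _).symm rfl _)
    (by
      rintro T' s m₁ m₂ m₁' m₂' ⟨l, h, h', gl, gm, e⟩ ⟨l₂, h₂, h₂', gl₂, gm₂, e₂⟩ hm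
      obtain ⟨t, rfl, -⟩ := gm.exists_smul gm₂ hm
      obtain ⟨r, rfl, -⟩ := gl.exists_smul gl₂ (by rw [h₂, hm, h])
      have h₃ : (r • l) ≫ L.proj = m₁ ≫ M.proj := by rw [h₂, hm]
      have h₄ : (r • (lift s l ≫ φ)) ≫ L.proj = m₁' ≫ M.proj := by rw [L.smul_proj, h']
      have h₅ : (r • (lift s l ≫ φ)) ≫ L.proj = m₂' ≫ M.proj := by rw [← hφ.smul, h₂']
      refine ⟨t, rfl, hβ.right_injective (l := r • (lift s l ≫ φ)) ((hφ.gen s gl).smul r) h₅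
        (h₄.trans (M.smul_proj _ _).symm) ?_⟩
      rw [hβ.smul_right t _ _ h₄, hβ.smul_left r _ _ h', e, ← hχ.smul, ← hχ.smul,
        ← hβ.smul_left r _ _ h, ← hβ.smul_right t _ _ h₃, ← e₂]
      exact app_congr β (hφ.smul s r l).symm rfl _)
    (fun T' s x ↦ (ex s x).mono fun T'' j ⟨l, m, m', h, h', gl, gm, hm, e⟩ ↦
      ⟨m, m', ⟨l, h, h', gl, gm, e⟩, hm⟩)
  refine ⟨ψ, hψ, hβ.liftCompat_of_gen hφ hψ hχ fun T' s x ↦ (ex s x).mono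
    fun T'' j ⟨l, m, m', h, h', gl, gm, hm, e⟩ ↦ ⟨l, m, h, gl, gm, h.trans hm, ?_⟩⟩
  rw [← e]
  exact app_congr β rfl (H _ _ _ ⟨l, h, h', gl, gm, e⟩) _

end LineBundle.IsPairing

namespace LineBundle.IsTriv

variable {O : LineBundle X} {f : X ⊗ A1 k ≅ O.tot} (hf : IsTriv O f)
include hf

lemma eq_lift {T : Over (Spec (.of k))} (o : T ⟶ O.tot) :
    o = lift (o ≫ O.proj) (o ≫ f.inv ≫ snd _ _) ≫ f.hom := by
  rw [← hf.sc_one, hf.sc_coord]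

lemma coord_lift {T : Over (Spec (.of k))} (x : T ⟶ X) (a : T ⟶ A1 k) :
    (lift x a ≫ f.hom) ≫ f.inv ≫ snd _ _ = a := by
  rw [Category.assoc, f.hom_inv_id_assoc, lift_snd]

lemma coord_smul {T : Over (Spec (.of k))} (t : T ⟶ Gm k) (o : T ⟶ O.tot) :
    (t • o) ≫ f.inv ≫ snd _ _ = Gm.val t * o ≫ f.inv ≫ snd _ _ := by
  rw [← sc_val, hf.coord_sc]

/-- The lift of an automorphism to the trivial line bundle, twisted by a unit. -/
lemma isLift (g : T ⟶ G) (u : T ⟶ Gm k) : IsLift O g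
    (lift ((fst T O.tot ≫ g) • (snd T O.tot ≫ O.proj))
      (Gm.val (fst T O.tot ≫ u) * snd T O.tot ≫ f.inv ≫ snd _ _) ≫ f.hom) := by
  have h {T' : Over (Spec (.of k))} (s : T' ⟶ T) (o : T' ⟶ O.tot) :
      lift s o ≫ lift ((fst T O.tot ≫ g) • (snd T O.tot ≫ O.proj))
        (Gm.val (fst T O.tot ≫ u) * snd T O.tot ≫ f.inv ≫ snd _ _) ≫ f.hom =
      lift ((s ≫ g) • (o ≫ O.proj)) (Gm.val (s ≫ u) * o ≫ f.inv ≫ snd _ _) ≫ f.hom := by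
    rw [comp_lift_assoc, ModObj.comp_smul (X := X), A1.comp_mul, Gm.comp_val, lift_fst_assoc,
      lift_fst_assoc, lift_snd_assoc, lift_snd_assoc]
  refine IsLift.of_gen (fun T' s o ↦ ?_) (fun T' s t o ↦ ?_) (fun T' s o ho ↦ ?_)
  · rw [h, hf.lift_proj]
  · rw [h, h, ← hf.smul, O.smul_proj, hf.coord_smul, A1.scale_eq, mul_left_comm]
  · rw [h, ← hf.sc_one, isGen_sc_iff (hf.isGen _)]
    exact (Gm.isUnit_val _).mul (hf.isUnit_coord ho)

end LineBundle.IsTriv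

/-! ### Invariant line bundles -/

lemma isInvariant_iff : IsInvariant G L ↔ ∀ (T : Over (Spec (.of k))) (g : T ⟶ G),
    Loc T fun T' j ↦ ∃ φ : T' ⊗ L.tot ⟶ L.tot, IsLift L (j ≫ g) φ := Iff.rfl

lemma stab_isLift (L : LineBundle X) (g : T ⟶ G) :
    Stab fun T' (j : T' ⟶ T) ↦ ∃ φ : T' ⊗ L.tot ⟶ L.tot, IsLift L (j ≫ g) φ := by
  rintro T₁ T₂ j i ⟨φ, hφ⟩
  rw [Category.assoc]
  exact ⟨_, hφ.restrict i⟩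

lemma IsInvariant.congr (hL : IsInvariant G L) {f : L.tot ≅ M.tot} (hf : IsBundleIso L M f) :
    IsInvariant G M := isInvariant_iff.2 fun T g ↦
  ((isInvariant_iff.1 hL T g).mono fun T' j ⟨_, hφ⟩ ↦ ⟨_, hφ.transport hf⟩)

lemma IsInvariant.tensor (hL : IsInvariant G L) (hM : IsInvariant G M)
    {β : pullback L.proj M.proj ⟶ N.tot} (hβ : IsPairing L M N β) :
    IsInvariant G N := isInvariant_iff.2 fun T g ↦
  ((isInvariant_iff.1 hL T g).and (isInvariant_iff.1 hM T g) (stab_isLift L g) (stab_isLift M g)).mono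
    fun T' j ⟨⟨_, hφ⟩, _, hψ⟩ ↦ by
      obtain ⟨χ, hχ, -⟩ := hβ.exists_lift_tensor hφ hψ
      exact ⟨χ, hχ⟩

lemma IsInvariant.div (hL : IsInvariant G L) (hN : IsInvariant G N)
    {β : pullback L.proj M.proj ⟶ N.tot} (hβ : IsPairing L M N β) :
    IsInvariant G M := isInvariant_iff.2 fun T g ↦
  ((isInvariant_iff.1 hL T g).and (isInvariant_iff.1 hN T g) (stab_isLift L g) (stab_isLift N g)).mono
    fun T' j ⟨⟨_, hφ⟩, _, hχ⟩ ↦ by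
      obtain ⟨ψ, hψ, -⟩ := hβ.exists_lift_div hφ hχ
      exact ⟨ψ, hψ⟩

lemma LineBundle.IsTriv.isInvariant {O : LineBundle X} {f : X ⊗ A1 k ≅ O.tot} (hf : IsTriv O f) :
    IsInvariant G O := isInvariant_iff.2 fun _ _ ↦ Loc.of_forall ⟨_, hf.isLift _ 1⟩ fun _ _ _ i ⟨_, hφ⟩ ↦ by
      rw [Category.assoc]
      exact ⟨_, hφ.restrict i⟩

end

end

section

open LineBundle

section

variable {G X : Over (Spec (.of k))} [GrpObj G] [ModObj G X]

/-! ### Linearizations as lifts -/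

lemma LinLineBundle.lift_act (L : LinLineBundle G X) {T T' : Over (Spec (.of k))} (g : T ⟶ G)
    (s : T' ⟶ T) (l : T' ⟶ L.tot) :
    lift s l ≫ ((fst T L.tot ≫ g) • snd T L.tot) = (s ≫ g) • l := by
  rw [ModObj.comp_smul, lift_fst_assoc, lift_snd]

lemma LinLineBundle.isLift (L : LinLineBundle G X) {T : Over (Spec (.of k))} (g : T ⟶ G) :
    IsLift L.toLineBundle g ((fst T L.tot ≫ g) • snd T L.tot) where
  covers := L.equivariant _ _
  smul s t l := by
    rw [L.lift_act, L.lift_act, L.linear]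
  isIso := by
    refine ⟨lift (fst _ _) ((fst T L.tot ≫ g⁻¹) • snd T L.tot), ?_, ?_⟩
    · refine CartesianMonoidalCategory.hom_ext _ _ (by simp) ?_
      rw [Category.assoc, lift_snd, L.lift_act, GrpObj.comp_inv, hom_inv_smul_smul, Category.id_comp]
    · refine CartesianMonoidalCategory.hom_ext _ _ (by simp) ?_
      rw [Category.assoc, lift_snd, L.lift_act, GrpObj.comp_inv, hom_smul_inv_smul, Category.id_comp]

lemma LinLineBundle.smul_sc (L : LinLineBundle G X) {T : Over (Spec (.of k))} (g : T ⟶ G)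
    (a : T ⟶ A1 k) (l : T ⟶ L.tot) : g • L.sc a l = L.sc a (g • l) := by
  have := (L.isLift g).sc (𝟙 T) a l
  rwa [L.lift_act, L.lift_act, Category.id_comp] at this

lemma LinLineBundle.isGen_smul (L : LinLineBundle G X) {T : Over (Spec (.of k))} (g : T ⟶ G)
    {l : T ⟶ L.tot} (hl : IsGen l) : IsGen (g • l) := by
  have := (L.isLift g).gen (𝟙 T) hl
  rwa [L.lift_act, Category.id_comp] at this

/-- A lift of the universal point of `G` which is an action is a linearization. -/
lemma exists_linearization {N : LineBundle X} {χ : G ⊗ N.tot ⟶ N.tot} (hχ : IsLift N (𝟙 G) χ)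
    (one : ∀ ⦃T : Over (Spec (.of k))⦄ (n : T ⟶ N.tot), lift 1 n ≫ χ = n)
    (mul : ∀ ⦃T : Over (Spec (.of k))⦄ (a b : T ⟶ G) (n : T ⟶ N.tot),
      lift (a * b) n ≫ χ = lift a (lift b n ≫ χ) ≫ χ) :
    ∃ i : ModObj G N.tot,
      (∀ {T : Over (Spec (.of k))} (g : T ⟶ G) (n : T ⟶ N.tot), g • n = lift g n ≫ χ) ∧
      (∀ {T : Over (Spec (.of k))} (g : T ⟶ G) (n : T ⟶ N.tot),
        (g • n) ≫ N.proj = g • (n ≫ N.proj)) ∧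
      ∀ {T : Over (Spec (.of k))} (g : T ⟶ G) (t : T ⟶ Gm k) (n : T ⟶ N.tot),
        g • (t • n) = t • (g • n) := by
  obtain ⟨i, hi⟩ := exists_modObj (M := G) (E := N.tot) (fun T g n ↦ lift g n ≫ χ)
    (fun T T' f g n ↦ comp_lift_assoc _ _ _ _) one mul
  refine ⟨i, fun g n ↦ hi g n, fun g n ↦ ?_, fun g t n ↦ ?_⟩
  · rw [hi, hχ.proj, Category.comp_id]
  · rw [hi, hi, hχ.smul]

/-- The lifts of the universal point of `G` to both bundles induce one to the tensor product. The
laws of an action need checking only on products `l ⊗ m`, since locally every point is one. -/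
lemma exists_linTensor (L M : LinLineBundle G X) : ∃ N, LinLineBundle.IsTensor L M N := by
  obtain ⟨N, β, hβ⟩ := exists_isPairing L.toLineBundle M.toLineBundle
  obtain ⟨χ, hχ, H⟩ := hβ.exists_lift_tensor (L.isLift (𝟙 G)) (M.isLift (𝟙 G))
  have H' {T : Over (Spec (.of k))} (g : T ⟶ G) (l : T ⟶ L.tot) (m : T ⟶ M.tot)
      (h : l ≫ L.proj = m ≫ M.proj) (h' : (g • l) ≫ L.proj = (g • m) ≫ M.proj) :
      app β (g • l) (g • m) h' = lift g (app β l m h) ≫ χ := by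
    rw [← H g l m h ((L.isLift _).proj_eq (M.isLift _) _ h)]
    refine app_congr β ?_ ?_ _
    · rw [L.lift_act, Category.comp_id]
    · rw [M.lift_act, Category.comp_id]
  have H'' {T : Over (Spec (.of k))} (g : T ⟶ G) {l : T ⟶ L.tot} {m : T ⟶ M.tot}
      (h : l ≫ L.proj = m ≫ M.proj) : (g • l) ≫ L.proj = (g • m) ≫ M.proj := by
    rw [L.equivariant, M.equivariant, h]
  obtain ⟨i, hi, hp, hs⟩ := exists_linearization hχ
    (fun T n ↦ hom_ext_loc ((hβ.loc_app n).mono fun T' j ⟨l, m, h, _, e⟩ ↦ by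
      rw [comp_lift_assoc, MonObj.comp_one, e, ← H' _ _ _ h (H'' _ h)]
      exact app_congr β (hom_one_smul _) (hom_one_smul _) _))
    (fun T a b n ↦ hom_ext_loc ((hβ.loc_app n).mono fun T' j ⟨l, m, h, _, e⟩ ↦ by
      rw [comp_lift_assoc, comp_lift_assoc, comp_lift_assoc, MonObj.comp_mul, e,
        ← H' _ _ _ h (H'' _ h), ← H' _ _ _ h (H'' _ h), ← H' _ _ _ (H'' _ h) (H'' _ (H'' _ h))]
      exact app_congr β (hom_mul_smul _ _ _) (hom_mul_smul _ _ _) _))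
  exact ⟨{ N with action := i, equivariant := hp, linear := hs }, β, hβ.isTensorMap,
    fun g l m h ↦ (H' g l m h _).trans (hi _ _).symm⟩

/-- The action on `Hom(L, N)` is forced by compatibility with evaluation. Its laws follow by pairing
with a local generator of `L`, moved by the group element in question, and cancelling. -/
lemma exists_linDiv (L N : LinLineBundle G X) : ∃ M, LinLineBundle.IsTensor M L N := by
  obtain ⟨M, β', hβ', -⟩ := exists_div L.toLineBundle N.toLineBundle
  have hβ := hβ'.swap
  obtain ⟨ψ, hψ, H⟩ := hβ.exists_lift_div (L.isLift (𝟙 G)) (N.isLift (𝟙 G))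
  have H' {T : Over (Spec (.of k))} (g : T ⟶ G) (l : T ⟶ L.tot) (m : T ⟶ M.tot)
      (h : l ≫ L.proj = m ≫ M.proj) (h' : (g • l) ≫ L.proj = (lift g m ≫ ψ) ≫ M.proj) :
      app (swap β') (g • l) (lift g m ≫ ψ) h' = g • app (swap β') l m h := by
    have e : g • app (swap β') l m h = lift g (app (swap β') l m h) ≫
        ((fst G N.tot ≫ 𝟙 G) • snd G N.tot) := by rw [N.lift_act, Category.comp_id]
    refine Eq.trans ?_ ((H g l m h ((L.isLift _).proj_eq hψ _ h)).trans e.symm)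
    refine app_congr _ ?_ rfl _
    rw [L.lift_act, Category.comp_id]
  have H'' {T : Over (Spec (.of k))} (g : T ⟶ G) {l : T ⟶ L.tot} {m : T ⟶ M.tot}
      (h : l ≫ L.proj = m ≫ M.proj) : (g • l) ≫ L.proj = (lift g m ≫ ψ) ≫ M.proj := by
    rw [L.equivariant, hψ.proj, h, Category.comp_id]
  obtain ⟨i, hi, hp, hs⟩ := exists_linearization hψ
    (fun T m ↦ hom_ext_loc ((L.loc_gen (m ≫ M.proj)).mono fun T' j ⟨l, hl, gl⟩ ↦ by
      have h : l ≫ L.proj = (j ≫ m) ≫ M.proj := by rw [hl, Category.assoc]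
      rw [comp_lift_assoc, MonObj.comp_one]
      refine hβ.right_injective (l := (1 : T' ⟶ G) • l) (L.isGen_smul 1 gl) (H'' _ h)
        (by rw [hom_one_smul, h]) ?_
      rw [H' _ _ _ h, hom_one_smul]
      exact app_congr _ (hom_one_smul _).symm rfl _))
    (fun T a b m ↦ hom_ext_loc ((L.loc_gen (m ≫ M.proj)).mono fun T' j ⟨l, hl, gl⟩ ↦ by
      have h : l ≫ L.proj = (j ≫ m) ≫ M.proj := by rw [hl, Category.assoc]
      rw [comp_lift_assoc, comp_lift_assoc, comp_lift_assoc, MonObj.comp_mul]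
      refine hβ.right_injective (l := ((j ≫ a) * (j ≫ b)) • l) (L.isGen_smul _ gl) (H'' _ h)
        (by rw [hom_mul_smul, H'' _ (H'' _ h)]) ?_
      rw [H' _ _ _ h, hom_mul_smul, ← H' _ _ _ h (H'' _ h), ← H' _ _ _ (H'' _ h) (H'' _ (H'' _ h))]
      exact app_congr _ (hom_mul_smul _ _ _).symm rfl _))
  refine ⟨{ M with action := i, equivariant := hp, linear := hs }, β', ?_, fun g m l h ↦ ?_⟩
  · exact hβ'.isTensorMap
  · have e := H' g l m h.symm (H'' g h.symm)
    rw [app_swap, app_swap] at e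
    exact (app_congr β' (hi g m) rfl _).trans e

/-- The trivial line bundle with the linearization given by a character. -/
lemma exists_isTrivialTwist (χ : G ⟶ Gm k)
    (one : ∀ T : Over (Spec (.of k)), (1 : T ⟶ G) ≫ χ = 1)
    (mul : ∀ ⦃T : Over (Spec (.of k))⦄ (a b : T ⟶ G), (a * b) ≫ χ = (a ≫ χ) * (b ≫ χ)) :
    ∃ (L : LinLineBundle G X) (f : X ⊗ A1 k ≅ L.tot), IsTriv L.toLineBundle f ∧
      ∀ {T : Over (Spec (.of k))} (g : T ⟶ G) (x : T ⟶ X) (a : T ⟶ A1 k),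
        lift (g • x) (A1.scale (g ≫ χ) a) ≫ f.hom = g • (lift x a ≫ f.hom) := by
  obtain ⟨O, f, hf⟩ := exists_isTriv X
  have h {T : Over (Spec (.of k))} (g : T ⟶ G) (o : T ⟶ O.tot) :
      lift g o ≫ lift ((fst G O.tot ≫ 𝟙 _) • (snd G O.tot ≫ O.proj))
        (Gm.val (fst G O.tot ≫ χ) * snd G O.tot ≫ f.inv ≫ snd _ _) ≫ f.hom =
      lift (g • (o ≫ O.proj)) (Gm.val (g ≫ χ) * o ≫ f.inv ≫ snd _ _) ≫ f.hom := by
    rw [comp_lift_assoc, ModObj.comp_smul (X := X), A1.comp_mul, Gm.comp_val, lift_fst_assoc,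
      lift_fst_assoc, lift_snd_assoc, lift_snd_assoc, Category.comp_id]
  obtain ⟨i, hi, hp, hs⟩ := exists_linearization (hf.isLift (𝟙 G) χ)
    (fun T o ↦ by rw [h, one, Gm.val_one, one_mul, hom_one_smul, ← hf.eq_lift])
    (fun T a b o ↦ by
      rw [h, h, h, hf.lift_proj, hf.coord_lift, mul, Gm.val_mul, hom_mul_smul, mul_assoc])
  refine ⟨{ O with action := i, equivariant := hp, linear := hs }, f, hf, fun g x a ↦ ?_⟩
  refine Eq.trans ?_ (hi _ _).symm
  rw [h, hf.lift_proj, hf.coord_lift, A1.scale_eq]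

end

/-! ### Isomorphisms -/

section

variable {X : Over (Spec (.of k))}

/-- A relation between generators which defines an isomorphism of line bundles. -/
structure IsIsoRel (L M : LineBundle X)
    (R : ∀ ⦃T : Over (Spec (.of k))⦄, (T ⟶ L.tot) → (T ⟶ M.tot) → Prop) : Prop where
  gen : ∀ ⦃T : Over (Spec (.of k))⦄ (l : T ⟶ L.tot) (m : T ⟶ M.tot),
    R l m → IsGen l ∧ IsGen m ∧ m ≫ M.proj = l ≫ L.proj
  stab : ∀ ⦃T T' : Over (Spec (.of k))⦄ (l : T ⟶ L.tot) (m : T ⟶ M.tot)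
    (f : T' ⟶ T), R l m → R (f ≫ l) (f ≫ m)
  uniq : ∀ ⦃T : Over (Spec (.of k))⦄ (l l' : T ⟶ L.tot) (m m' : T ⟶ M.tot),
    R l m → R l' m' → l' ≫ L.proj = l ≫ L.proj → ∃ t : T ⟶ Gm k, l' = t • l ∧ m' = t • m
  ex : Loc X fun _ j ↦ ∃ l m, R l m ∧ l ≫ L.proj = j

lemma IsIsoRel.exists_bundleIso {L M : LineBundle X}
    {R : ∀ ⦃T : Over (Spec (.of k))⦄, (T ⟶ L.tot) → (T ⟶ M.tot) → Prop} (h : IsIsoRel L M R) :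
    ∃ f : L.tot ≅ M.tot, IsBundleIso L M f ∧ ∀ ⦃T : Over (Spec (.of k))⦄ (l : T ⟶ L.tot)
      (m : T ⟶ M.tot), R l m → l ≫ f.hom = m :=
  LineBundle.exists_bundleIso R h.gen h.stab h.uniq h.ex

/-- Stability of the relation under `G` gives equivariance on related generators. Group elements act
linearly on the fibres, so it spreads to all their multiples, that is, locally to all points. -/
lemma IsIsoRel.exists_linIso {G : Over (Spec (.of k))} [GrpObj G] [ModObj G X]
    {L M : LinLineBundle G X}
    {R : ∀ ⦃T : Over (Spec (.of k))⦄, (T ⟶ L.tot) → (T ⟶ M.tot) → Prop}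
    (h : IsIsoRel L.toLineBundle M.toLineBundle R)
    (act : ∀ ⦃T : Over (Spec (.of k))⦄ (g : T ⟶ G) (l : T ⟶ L.tot) (m : T ⟶ M.tot),
      R l m → R (g • l) (g • m)) : ∃ f : L.tot ≅ M.tot, LinLineBundle.IsLinIso L M f := by
  obtain ⟨f, hf, H⟩ := h.exists_bundleIso
  refine ⟨f, hf, fun {T} g l ↦ hom_ext_loc ((Loc.pullback h.ex (fun T₁ T₂ j i ⟨l, m, h', e⟩ ↦
    ⟨i ≫ l, i ≫ m, h.stab _ _ _ h', by rw [Category.assoc, e]⟩) (l ≫ L.proj)).mono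
    fun T' j ⟨l₀, m₀, h₀, e⟩ ↦ ?_)⟩
  obtain ⟨a, ha, -⟩ := (h.gen _ _ h₀).1.exists_sc (l' := j ≫ l) (by rw [e, Category.assoc])
  rw [← Category.assoc, ModObj.comp_smul, ModObj.comp_smul, ← Category.assoc, ← ha, L.smul_sc,
    hf.sc, hf.sc, M.smul_sc, H _ _ h₀, H _ _ (act _ _ _ h₀)]

/-- The relation which defines the isomorphism of tensor products. -/
def tensorRel {L M N L' M' N' : LineBundle X} (β : pullback L.proj M.proj ⟶ N.tot)
    (β' : pullback L'.proj M'.proj ⟶ N'.tot) (f : L.tot ≅ L'.tot) (e : M.tot ≅ M'.tot)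
    ⦃T : Over (Spec (.of k))⦄ (n : T ⟶ N.tot) (n' : T ⟶ N'.tot) : Prop :=
  ∃ (l : T ⟶ L.tot) (m : T ⟶ M.tot) (h : l ≫ L.proj = m ≫ M.proj)
    (h' : (l ≫ f.hom) ≫ L'.proj = (m ≫ e.hom) ≫ M'.proj), IsGen l ∧ IsGen m ∧
    n = app β l m h ∧ n' = app β' (l ≫ f.hom) (m ≫ e.hom) h'

lemma LineBundle.IsPairing.smul_smul {L M N : LineBundle X} {β : pullback L.proj M.proj ⟶ N.tot}
    (hβ : IsPairing L M N β) {T : Over (Spec (.of k))} (t r : T ⟶ Gm k) (l : T ⟶ L.tot)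
    (m : T ⟶ M.tot) (h : l ≫ L.proj = m ≫ M.proj) (h' : (t • l) ≫ L.proj = (r • m) ≫ M.proj) :
    app β (t • l) (r • m) h' = (t * r) • app β l m h := by
  rw [hom_mul_smul, ← hβ.smul_right, ← hβ.smul_left]

lemma isIsoRel_tensorRel {L M N L' M' N' : LineBundle X} {β : pullback L.proj M.proj ⟶ N.tot}
    {β' : pullback L'.proj M'.proj ⟶ N'.tot} {f : L.tot ≅ L'.tot} {e : M.tot ≅ M'.tot}
    (hβ : IsPairing L M N β) (hβ' : IsPairing L' M' N' β') (hf : IsBundleIso L L' f)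
    (he : IsBundleIso M M' e) : IsIsoRel N N' (tensorRel β β' f e) where
  gen := by
    rintro T _ _ ⟨l, m, h, h', gl, gm, rfl, rfl⟩
    exact ⟨hβ.gen _ _ _ gl gm, hβ'.gen _ _ _ (hf.gen gl) (he.gen gm), by
      rw [hβ.proj, hβ'.proj, hf.comp_proj]⟩
  stab := by
    rintro T T' _ _ i ⟨l, m, h, h', gl, gm, rfl, rfl⟩
    refine ⟨i ≫ l, i ≫ m, by simp [h], ?_, gl.comp i, gm.comp i, comp_app _ _ _ _ _, ?_⟩
    · rw [hf.comp_proj, he.comp_proj, Category.assoc, h, Category.assoc]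
    · exact (comp_app _ _ _ _ _).trans (app_congr _ (Category.assoc _ _ _).symm
        (Category.assoc _ _ _).symm _)
  uniq := by
    rintro T _ _ _ _ ⟨l, m, h, h', gl, gm, rfl, rfl⟩ ⟨l₂, m₂, h₂, h₂', gl₂, gm₂, rfl, rfl⟩ e₁
    rw [hβ.proj, hβ.proj] at e₁
    obtain ⟨t, rfl, -⟩ := gl.exists_smul gl₂ e₁
    obtain ⟨r, rfl, -⟩ := gm.exists_smul gm₂ (by rw [← h₂, e₁, h])
    refine ⟨t * r, hβ.smul_smul _ _ _ _ _ _, ?_⟩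
    rw [app_congr β' (hf.smul t l) (he.smul r m)]
    exact hβ'.smul_smul _ _ _ _ _ _
  ex := (loc_gen₂ L M (𝟙 X)).mono fun T j ⟨l, m, hl, hm, gl, gm⟩ ↦ by
    rw [Category.comp_id] at hl hm
    exact ⟨_, _, ⟨l, m, hl.trans hm.symm, by rw [hf.comp_proj, he.comp_proj, hl, hm], gl, gm, rfl,
      rfl⟩, by rw [hβ.proj, hl]⟩

/-- The relation which defines the associativity isomorphism of tensor products. -/
def assocRel {A B C P Q R S : LineBundle X} (β₁ : pullback A.proj B.proj ⟶ P.tot)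
    (β₂ : pullback P.proj C.proj ⟶ Q.tot) (β₃ : pullback B.proj C.proj ⟶ R.tot)
    (β₄ : pullback A.proj R.proj ⟶ S.tot) ⦃T : Over (Spec (.of k))⦄ (q : T ⟶ Q.tot)
    (s : T ⟶ S.tot) : Prop :=
  ∃ (a : T ⟶ A.tot) (b : T ⟶ B.tot) (c : T ⟶ C.tot) (h₁ : a ≫ A.proj = b ≫ B.proj)
    (h₂ : app β₁ a b h₁ ≫ P.proj = c ≫ C.proj) (h₃ : b ≫ B.proj = c ≫ C.proj)
    (h₄ : a ≫ A.proj = app β₃ b c h₃ ≫ R.proj), IsGen a ∧ IsGen b ∧ IsGen c ∧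
    q = app β₂ (app β₁ a b h₁) c h₂ ∧ s = app β₄ a (app β₃ b c h₃) h₄

/-- Changing the three generators by units `t`, `r`, `q` multiplies both triple products by `t * r *
q`, so the matching of one with the other is independent of the choices. -/
lemma isIsoRel_assocRel {A B C P Q R S : LineBundle X} {β₁ : pullback A.proj B.proj ⟶ P.tot}
    {β₂ : pullback P.proj C.proj ⟶ Q.tot} {β₃ : pullback B.proj C.proj ⟶ R.tot}
    {β₄ : pullback A.proj R.proj ⟶ S.tot} (h₁ : IsPairing A B P β₁) (h₂ : IsPairing P C Q β₂)
    (h₃ : IsPairing B C R β₃) (h₄ : IsPairing A R S β₄) : IsIsoRel Q S (assocRel β₁ β₂ β₃ β₄) where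
  gen := by
    rintro T _ _ ⟨a, b, c, e₁, e₂, e₃, e₄, ga, gb, gc, rfl, rfl⟩
    exact ⟨h₂.gen _ _ _ (h₁.gen _ _ _ ga gb) gc, h₄.gen _ _ _ ga (h₃.gen _ _ _ gb gc), by
      rw [h₂.proj, h₁.proj, h₄.proj]⟩
  stab := by
    rintro T T' _ _ i ⟨a, b, c, e₁, e₂, e₃, e₄, ga, gb, gc, rfl, rfl⟩
    have f₁ : (i ≫ a) ≫ A.proj = (i ≫ b) ≫ B.proj := by simp [e₁]
    have f₃ : (i ≫ b) ≫ B.proj = (i ≫ c) ≫ C.proj := by simp [e₃]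
    refine ⟨i ≫ a, i ≫ b, i ≫ c, f₁, by rw [h₁.proj, f₁, f₃], f₃, by rw [h₃.proj, f₁], ga.comp i,
      gb.comp i, gc.comp i, ?_, ?_⟩
    · exact (comp_app _ _ _ _ _).trans (app_congr _ (comp_app _ _ _ _ _) rfl _)
    · exact (comp_app _ _ _ _ _).trans (app_congr _ rfl (comp_app _ _ _ _ _) _)
  uniq := by
    rintro T _ _ _ _ ⟨a, b, c, e₁, e₂, e₃, e₄, ga, gb, gc, rfl, rfl⟩
      ⟨a', b', c', e₁', e₂', e₃', e₄', ga', gb', gc', rfl, rfl⟩ e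
    rw [h₂.proj, h₂.proj, h₁.proj, h₁.proj] at e
    obtain ⟨t, rfl, -⟩ := ga.exists_smul ga' e
    obtain ⟨r, rfl, -⟩ := gb.exists_smul gb' (by rw [← e₁', e, e₁])
    obtain ⟨q, rfl, -⟩ := gc.exists_smul gc' (by rw [← e₃', ← e₁', e, e₁, e₃])
    refine ⟨t * r * q, ?_, ?_⟩
    · rw [← h₂.smul_smul (t * r) q _ _ e₂ (by rw [P.smul_proj, C.smul_proj, e₂])]
      exact app_congr _ (h₁.smul_smul _ _ _ _ _ _) rfl _
    · rw [mul_assoc, ← h₄.smul_smul t (r * q) _ _ e₄ (by rw [A.smul_proj, R.smul_proj, e₄])]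
      exact app_congr _ rfl (h₃.smul_smul _ _ _ _ _ _) _
  ex := ((loc_gen₂ A B (𝟙 X)).and (C.loc_gen (𝟙 X)) (fun T T' j i ⟨l, m, hl, hm, gl, gm⟩ ↦
      ⟨i ≫ l, i ≫ m, by simp [hl], by simp [hm], gl.comp i, gm.comp i⟩) (C.stab_gen _)).mono
    fun T j ⟨⟨a, b, ha, hb, ga, gb⟩, c, hc, gc⟩ ↦ by
      rw [Category.comp_id] at ha hb hc
      have f₁ := ha.trans hb.symm
      have f₃ := hb.trans hc.symm
      exact ⟨_, _, ⟨a, b, c, f₁, by rw [h₁.proj, ha, hc], f₃, by rw [h₃.proj, ha, hb], ga, gb, gc,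
        rfl, rfl⟩, by rw [h₂.proj, h₁.proj, ha]⟩

/-- The relation which defines the isomorphism of a tensor product with the trivial line bundle. -/
def unitRel {O A B : LineBundle X} (β : pullback O.proj A.proj ⟶ B.tot) (f : X ⊗ A1 k ≅ O.tot)
    ⦃T : Over (Spec (.of k))⦄ (b : T ⟶ B.tot) (a : T ⟶ A.tot) : Prop :=
  ∃ h : (lift (a ≫ A.proj) 1 ≫ f.hom) ≫ O.proj = a ≫ A.proj, IsGen a ∧
    b = app β (lift (a ≫ A.proj) 1 ≫ f.hom) a h

lemma isIsoRel_unitRel {O A B : LineBundle X} {β : pullback O.proj A.proj ⟶ B.tot}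
    {f : X ⊗ A1 k ≅ O.tot} (hβ : IsPairing O A B β) (hf : IsTriv O f) :
    IsIsoRel B A (unitRel β f) where
  gen := by
    rintro T _ a ⟨h, ga, rfl⟩
    exact ⟨hβ.gen _ _ _ (hf.isGen _) ga, ga, by rw [hβ.proj, h]⟩
  stab := by
    rintro T T' _ a i ⟨h, ga, rfl⟩
    refine ⟨hf.lift_proj _ _, ga.comp i, (comp_app _ _ _ _ _).trans (app_congr _ ?_ rfl _)⟩
    rw [comp_lift_assoc, Category.assoc, A1.comp_one]
  uniq := by
    rintro T _ _ a _ ⟨h, ga, rfl⟩ ⟨h', ga', rfl⟩ e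
    rw [hβ.proj, hβ.proj, h, h'] at e
    obtain ⟨t, rfl, -⟩ := ga.exists_smul ga' e
    refine ⟨t, ?_, rfl⟩
    rw [← hβ.smul_right t _ _ h]
    exact app_congr _ (by rw [e]) rfl _
  ex := (A.loc_gen (𝟙 X)).mono fun T j ⟨a, ha, ga⟩ ↦ by
    rw [Category.comp_id] at ha
    exact ⟨_, _, ⟨hf.lift_proj _ _, ga, rfl⟩, by rw [hβ.proj, hf.lift_proj, ha]⟩

end

end

/-! ### The Picard groups and the subgroup of invariant classes -/

section

open LineBundle

section

variable {X : Over (Spec (.of k))}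

lemma LineBundle.IsTriv.isBundleIso {O O' : LineBundle X} {f : X ⊗ A1 k ≅ O.tot}
    {f' : X ⊗ A1 k ≅ O'.tot} (hf : IsTriv O f) (hf' : IsTriv O' f') :
    IsBundleIso O O' (f.symm ≪≫ f') where
  proj := by simp [hf'.proj, ← hf.proj]
  smul t o := by
    have h {T : Over (Spec (.of k))} (o : T ⟶ O.tot) : o ≫ (f.symm ≪≫ f').hom =
        lift (o ≫ O.proj) (o ≫ f.inv ≫ snd _ _) ≫ f'.hom := by
      nth_rw 1 [hf.eq_lift o]
      simp
    rw [h, h, O.smul_proj, hf.coord_smul, ← A1.scale_eq, hf'.smul]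

variable (X) in
/-- The group structure of the Picard group. -/
theorem exists_commGroup_pic : ∃ _ : CommGroup (Pic X),
    (∀ L M N : LineBundle X, LineBundle.IsTensor L M N → Pic.mk L * Pic.mk M = Pic.mk N) ∧
    ∀ (O : LineBundle X) (f : X ⊗ A1 k ≅ O.tot), IsTriv O f → 1 = Pic.mk O := by
  obtain ⟨O, f, hf⟩ := exists_isTriv X
  obtain ⟨i, h, h'⟩ := exists_commGroup (LineBundle.setoid X) LineBundle.IsTensor
    (fun L M ↦ by
      obtain ⟨N, β, hβ⟩ := exists_isPairing L M
      exact ⟨N, β, hβ.isTensorMap⟩)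
    (by
      rintro L L' M M' N N' ⟨f, hf⟩ ⟨e, he⟩ ⟨β, hβ⟩ ⟨β', hβ'⟩
      obtain ⟨h, hh, -⟩ :=
        (isIsoRel_tensorRel hβ.isPairing hβ'.isPairing hf he).exists_bundleIso
      exact ⟨h, hh⟩)
    (by
      rintro L M N ⟨β, hβ⟩
      exact ⟨_, hβ.isPairing.swap.isTensorMap⟩)
    (by
      rintro A B C P Q R S ⟨β₁, h₁⟩ ⟨β₂, h₂⟩ ⟨β₃, h₃⟩ ⟨β₄, h₄⟩
      obtain ⟨h, hh, -⟩ := (isIsoRel_assocRel h₁.isPairing h₂.isPairing h₃.isPairing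
        h₄.isPairing).exists_bundleIso
      exact ⟨h, hh⟩)
    O
    (by
      rintro A B ⟨β, hβ⟩
      obtain ⟨h, hh, -⟩ := (isIsoRel_unitRel hβ.isPairing hf).exists_bundleIso
      exact ⟨h, hh⟩)
    (fun L ↦ by
      -- The inverse of `L` is its dual `Hom(L, 𝒪)`, with evaluation as the pairing.
      obtain ⟨D, β, hβ, -⟩ := exists_div L O
      exact ⟨D, β, hβ.isTensorMap⟩)
  exact ⟨i, h, fun O' f' hf' ↦ h'.trans (Quotient.sound ⟨_, hf.isBundleIso hf'⟩)⟩

variable (G X : Over (Spec (.of k))) [GrpObj G] [ModObj G X]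

/-- The group structure of the equivariant Picard group. -/
theorem exists_commGroup_picG : ∃ _ : CommGroup (PicG G X),
    ∀ L M N : LinLineBundle G X, LinLineBundle.IsTensor L M N →
      PicG.mk L * PicG.mk M = PicG.mk N := by
  -- The neutral element is the trivial bundle with the linearization by the trivial character.
  obtain ⟨O, f, hf, hO⟩ := exists_isTrivialTwist (X := X) (1 : G ⟶ Gm k)
    (fun T ↦ by rw [MonObj.comp_one]) (fun T a b ↦ by simp [MonObj.comp_one])
  obtain ⟨i, h, -⟩ := exists_commGroup (LinLineBundle.setoid G X) LinLineBundle.IsTensor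
    exists_linTensor
    (by
      rintro L L' M M' N N' ⟨f, hf⟩ ⟨e, he⟩ ⟨β, hβ, hg⟩ ⟨β', hβ', hg'⟩
      refine (isIsoRel_tensorRel hβ.isPairing hβ'.isPairing hf.bundle he.bundle).exists_linIso ?_
      rintro T g _ _ ⟨l, m, h, h', gl, gm, rfl, rfl⟩
      have e₁ : ((g • l) ≫ f.hom) ≫ L'.proj = ((g • m) ≫ e.hom) ≫ M'.proj := by
        rw [hf.action, he.action, L'.equivariant, M'.equivariant, h']
      exact ⟨g • l, g • m, by rw [L.equivariant, M.equivariant, h], e₁, L.isGen_smul g gl,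
        M.isGen_smul g gm, (hg g l m h).symm,
        (hg' g _ _ h').symm.trans (app_congr β' (hf.action g l).symm (he.action g m).symm _)⟩)
    (by
      rintro L M N ⟨β, hβ, hg⟩
      refine ⟨_, hβ.isPairing.swap.isTensorMap, fun g l m h ↦ ?_⟩
      refine (app_swap β (g • l) (g • m) _).trans ((hg g m l h.symm).trans ?_)
      exact congrArg _ (app_swap β l m h).symm)
    (by
      rintro A B C P Q R S ⟨β₁, h₁, g₁⟩ ⟨β₂, h₂, g₂⟩ ⟨β₃, h₃, g₃⟩ ⟨β₄, h₄, g₄⟩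
      refine (isIsoRel_assocRel h₁.isPairing h₂.isPairing h₃.isPairing
        h₄.isPairing).exists_linIso ?_
      rintro T g _ _ ⟨a, b, c, e₁, e₂, e₃, e₄, ga, gb, gc, rfl, rfl⟩
      have f₁ : (g • a) ≫ A.proj = (g • b) ≫ B.proj := by rw [A.equivariant, B.equivariant, e₁]
      have f₃ : (g • b) ≫ B.proj = (g • c) ≫ C.proj := by rw [B.equivariant, C.equivariant, e₃]
      exact ⟨g • a, g • b, g • c, f₁, by rw [h₁.isPairing.proj, f₁, f₃], f₃,
        by rw [h₃.isPairing.proj, f₁], A.isGen_smul g ga, B.isGen_smul g gb, C.isGen_smul g gc,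
        (g₂ g _ c e₂).symm.trans (app_congr β₂ (g₁ g a b e₁).symm rfl _),
        (g₄ g a _ e₄).symm.trans (app_congr β₄ rfl (g₃ g b c e₃).symm _)⟩)
    O
    (by
      rintro A B ⟨β, hβ, hg⟩
      refine (isIsoRel_unitRel hβ.isPairing hf).exists_linIso ?_
      rintro T g _ a ⟨h, ga, rfl⟩
      refine ⟨hf.lift_proj _ _, A.isGen_smul g ga, (hg g _ a h).symm.trans (app_congr β ?_ rfl _)⟩
      rw [← hO, A.equivariant, MonObj.comp_one, A1.scale_eq, Gm.val_one, one_mul])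
    (fun L ↦ exists_linDiv L O)
  exact ⟨i, h⟩

end

section

variable {G X : Over (Spec (.of k))} [GrpObj G] [ModObj G X] [CommGroup (Pic X)]

/-- The subgroup of the classes of invariant line bundles. -/
theorem exists_picInv
    (hm : ∀ L M N : LineBundle X, LineBundle.IsTensor L M N → Pic.mk L * Pic.mk M = Pic.mk N)
    (h1 : ∀ (O : LineBundle X) (f : X ⊗ A1 k ≅ O.tot), IsTriv O f → 1 = Pic.mk O) :
    ∃ P : Subgroup (Pic X), ∀ L : LineBundle X, Pic.mk L ∈ P ↔ IsInvariant G L := by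
  obtain ⟨O, f, hf⟩ := exists_isTriv X
  have hc {L M : LineBundle X} (h : Pic.mk L = Pic.mk M) (hL : IsInvariant G L) :
      IsInvariant G M := by
    obtain ⟨f, hf⟩ : L ≈ M := Quotient.exact h
    exact hL.congr hf
  have ht {L M N : LineBundle X} (hL : IsInvariant G L) (hM : IsInvariant G M)
      (h : Pic.mk L * Pic.mk M = Pic.mk N) : IsInvariant G N := by
    obtain ⟨N', β, hβ⟩ := exists_isPairing L M
    exact hc ((hm _ _ _ ⟨β, hβ.isTensorMap⟩).symm.trans h) (hL.tensor hM hβ)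
  let P : Subgroup (Pic X) :=
    -- One invariant representative suffices in the definition, as `hc` transports invariance along
    -- isomorphisms.
    { carrier := {c | ∃ L, Pic.mk L = c ∧ IsInvariant G L}
      mul_mem' := by
        rintro _ _ ⟨L, rfl, hL⟩ ⟨M, rfl, hM⟩
        obtain ⟨N, hN⟩ := Quotient.exists_rep (Pic.mk L * Pic.mk M)
        exact ⟨N, hN, ht hL hM hN.symm⟩
      one_mem' := ⟨O, (h1 O f hf).symm, hf.isInvariant⟩
      inv_mem' := by
        rintro _ ⟨L, rfl, hL⟩
        obtain ⟨D, β, hβ, -⟩ := exists_div L O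
        refine ⟨D, eq_inv_of_mul_eq_one_left ?_, hL.div hf.isInvariant hβ.swap⟩
        rw [hm _ _ _ ⟨β, hβ.isTensorMap⟩, ← h1 O f hf] }
  exact ⟨P, fun L ↦ ⟨fun ⟨M, hM, h⟩ ↦ hc hM h, fun h ↦ ⟨L, rfl, h⟩⟩⟩

end

end

section

/-! ### Functions on products -/

lemma laurent_hom_ext {R S : Type*} [CommRing R] [CommRing S] {f g : R[T;T⁻¹] →+* S}
    (hC : ∀ a, f (LaurentPolynomial.C a) = g (LaurentPolynomial.C a))
    (hT : f (LaurentPolynomial.T 1) = g (LaurentPolynomial.T 1)) : f = g := by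
  refine IsLocalization.ringHom_ext (Submonoid.powers (Polynomial.X : Polynomial R)) ?_
  refine Polynomial.ringHom_ext (fun c ↦ ?_) ?_
  · simpa using hC c
  · simpa using hT

section

variable {E T T' : Over (Spec (.of k))}

/-- The value of a Laurent polynomial, with functions on `E` as coefficients, at a point of
`E × 𝔾ₘ`. -/
def evLaurent (e : T ⟶ E) (t : T ⟶ Gm k) : (E ⟶ A1 k)[T;T⁻¹] →+* (T ⟶ A1 k) :=
  LaurentPolynomial.eval₂ (A1.pullback e) (Gm.isUnit_val t).unit

@[simp]
lemma evLaurent_C (e : T ⟶ E) (t : T ⟶ Gm k) (a : E ⟶ A1 k) :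
    evLaurent e t (LaurentPolynomial.C a) = e ≫ a := by
  simp [evLaurent, A1.pullback_apply]

@[simp]
lemma evLaurent_T (e : T ⟶ E) (t : T ⟶ Gm k) :
    evLaurent e t (LaurentPolynomial.T 1) = Gm.val t := by
  simp [evLaurent]

lemma comp_evLaurent (f : T' ⟶ T) (e : T ⟶ E) (t : T ⟶ Gm k) (p : (E ⟶ A1 k)[T;T⁻¹]) :
    f ≫ evLaurent e t p = evLaurent (f ≫ e) (f ≫ t) p := by
  have : (A1.pullback f).comp (evLaurent e t) = evLaurent (f ≫ e) (f ≫ t) :=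
    laurent_hom_ext (by simp [A1.pullback_apply]) (by simp [A1.pullback_apply, Gm.comp_val])
  rw [← this, RingHom.comp_apply, A1.pullback_apply]

/-- The scheme `W` is `Spec S`, with `c` the identification of its functions with `S`: into the
affine schemes `E` and `𝔾ₘ`, ring homomorphisms are points. -/
lemma exists_specPoint [IsAffine E.left] {S : Type u} [CommRing S] (ψ : (E ⟶ A1 k) →+* S) (t : Sˣ) :
    ∃ (W : Over (Spec (.of k))) (e : W ⟶ E) (r : W ⟶ Gm k) (c : (W ⟶ A1 k) →+* S),
      (∀ a, c (e ≫ a) = ψ a) ∧ c (Gm.val r) = t := by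
  let ψ' : Γ(E.left, ⊤) →+* S := ψ.comp (A1.ringEquiv E).symm.toRingHom
  let w : Spec (.of S) ⟶ E.left := Spec.map (CommRingCat.ofHom ψ') ≫ E.left.isoSpec.inv
  let W : Over (Spec (.of k)) := Over.mk (w ≫ E.hom)
  obtain ⟨r, hr⟩ := Gm.exists_coord_eq (T := W) ((Scheme.ΓSpecIso (.of S)).inv t)
    (t.isUnit.map (Scheme.ΓSpecIso (.of S)).inv.hom)
  refine ⟨W, Over.homMk w, r,
    (Scheme.ΓSpecIso (.of S)).hom.hom.comp (A1.ringEquiv W).toRingHom, fun a ↦ ?_, ?_⟩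
  · have h₁ : (E.left.isoSpec.inv).appTop = (Scheme.ΓSpecIso Γ(E.left, ⊤)).inv := by
      rw [← cancel_mono (Scheme.ΓSpecIso Γ(E.left, ⊤)).hom, Iso.inv_hom_id,
        ← Scheme.toSpecΓ_appTop, ← Scheme.isoSpec_hom, ← Scheme.Hom.comp_appTop, Iso.hom_inv_id,
        Scheme.Hom.id_appTop]
    have h₂ : w.appTop ≫ (Scheme.ΓSpecIso (.of S)).hom = CommRingCat.ofHom ψ' := by
      rw [Scheme.Hom.comp_appTop, h₁, ← Scheme.ΓSpecIso_inv_naturality, Category.assoc, Iso.inv_hom_id,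
        Category.comp_id]
    have h₃ : (Scheme.ΓSpecIso (.of S)).hom (w.appTop (A1.coord a)) = ψ' (A1.coord a) :=
      congr($h₂ (A1.coord a))
    refine congr((Scheme.ΓSpecIso (.of S)).hom $(A1.coord_comp (Over.homMk w : W ⟶ E) a)).trans
      (h₃.trans ?_)
    simp [ψ', ← A1.ringEquiv_apply]
  · refine congr((Scheme.ΓSpecIso (.of S)).hom $((Gm.coord_val r).trans hr)).trans ?_
    simp

/-- The expansion of a function on `E × 𝔾ₘ` is unique. -/
lemma evLaurent_injective [IsAffine E.left] :
    Function.Injective (evLaurent (fst E (Gm k)) (snd E (Gm k))) := by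
  -- The test point takes values in the Laurent polynomials over the functions on `E`, with unit
  -- `T`. Evaluation there gives back the polynomial itself.
  obtain ⟨W, e, r, c, hc, hr⟩ := exists_specPoint (E := E) (LaurentPolynomial.C (R := E ⟶ A1 k))
    (LaurentPolynomial.isUnit_T 1).unit
  intro p q h
  have key : c.comp (evLaurent e r) = RingHom.id _ :=
    laurent_hom_ext (fun a ↦ by simp [hc]) (by simp [hr])
  have h' := congr(lift e r ≫ $h)
  rw [comp_evLaurent, comp_evLaurent, lift_fst, lift_snd] at h'
  rw [← RingHom.id_apply p, ← RingHom.id_apply q, ← key, RingHom.comp_apply, h',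
    RingHom.comp_apply]

/-- Functions on a fibre product of affine schemes are sums of products. -/
lemma pullback_function_induction {P Y Z B : Over (Spec (.of k))} {p : P ⟶ Y} {q : P ⟶ Z}
    {f : Y ⟶ B} {g : Z ⟶ B} (h : IsPullback p q f g) [IsAffine Y.left] [IsAffine Z.left]
    [IsAffine B.left] {Q : (P ⟶ A1 k) → Prop} (add : ∀ a b, Q a → Q b → Q (a + b))
    (mul : ∀ a b, Q ((p ≫ a) * (q ≫ b))) (a : P ⟶ A1 k) : Q a := by
  -- On global sections the fibre product becomes a tensor product, whose elements are sums of pure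
  -- tensors.
  have h₁ : IsPushout f.left.appTop g.left.appTop p.left.appTop q.left.appTop :=
    isPushout_appTop_of_isPullback (X := Y.left) (Y := Z.left) (Z := B.left)
      (h.map (Over.forget _))
  letI := f.left.appTop.hom.toAlgebra
  letI := g.left.appTop.hom.toAlgebra
  have h₂ := CommRingCat.isPushout_tensorProduct Γ(B.left, ⊤) Γ(Y.left, ⊤) Γ(Z.left, ⊤)
  let i := h₂.isoIsPushout _ _ h₁
  let e : TensorProduct Γ(B.left, ⊤) Γ(Y.left, ⊤) Γ(Z.left, ⊤) →+* (P ⟶ A1 k) :=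
    (A1.ringEquiv P).symm.toRingHom.comp i.hom.hom
  have he (y : Y ⟶ A1 k) (z : Z ⟶ A1 k) : e (A1.coord y ⊗ₜ A1.coord z) = (p ≫ y) * (q ≫ z) := by
    have e₁ : i.hom (A1.coord y ⊗ₜ 1) = A1.coord (p ≫ y) :=
      congr($(h₂.inl_isoIsPushout_hom _ _ h₁) (A1.coord y)).trans (A1.coord_comp _ _).symm
    have e₂ : i.hom (1 ⊗ₜ A1.coord z) = A1.coord (q ≫ z) :=
      congr($(h₂.inr_isoIsPushout_hom _ _ h₁) (A1.coord z)).trans (A1.coord_comp _ _).symm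
    apply (A1.ringEquiv P).injective
    rw [map_mul, A1.ringEquiv_apply (p ≫ y), A1.ringEquiv_apply (q ≫ z), ← e₁, ← e₂]
    refine ((A1.ringEquiv P).apply_symm_apply _).trans ?_
    refine Eq.trans ?_ (map_mul i.hom.hom _ _)
    rw [Algebra.TensorProduct.tmul_mul_tmul, one_mul, mul_one]
  have key (x : TensorProduct Γ(B.left, ⊤) Γ(Y.left, ⊤) Γ(Z.left, ⊤)) : Q (e x) := by
    induction x using TensorProduct.induction_on with
    | zero =>
      have := mul 0 0
      rwa [A1.comp_zero, zero_mul, ← map_zero e] at this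
    | add x y hx hy =>
      rw [map_add]
      exact add _ _ hx hy
    | tmul x y =>
      have := mul (A1.ofFun x) (A1.ofFun y)
      rwa [← he, A1.coord_ofFun, A1.coord_ofFun] at this
  have := key (i.inv (A1.coord a))
  have h₃ : e (i.inv (A1.coord a)) = a :=
    (congr((A1.ringEquiv P).symm $(congr($(i.inv_hom_id) (A1.coord a))))).trans
      ((A1.ringEquiv P).symm_apply_apply a)
  rwa [h₃] at this

lemma isPullback_tensor (Y Z : Over (Spec (.of k))) :
    IsPullback (fst Y Z) (snd Y Z) (toUnit Y) (toUnit Z) :=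
  ⟨⟨toUnit_unique _ _⟩, ⟨PullbackCone.IsLimit.mk _ (fun s ↦ lift s.fst s.snd)
    (fun s ↦ lift_fst _ _) (fun s ↦ lift_snd _ _) fun s m h₁ h₂ ↦
      CartesianMonoidalCategory.hom_ext _ _ (by rw [h₁, lift_fst]) (by rw [h₂, lift_snd])⟩⟩

instance : IsAffine (𝟙_ (Over (Spec (.of k)))).left := inferInstanceAs (IsAffine (Spec (.of k)))

/-- Functions on a product of affine schemes are sums of products. -/
lemma tensor_function_induction {Y Z : Over (Spec (.of k))} [IsAffine Y.left] [IsAffine Z.left]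
    {Q : (Y ⊗ Z ⟶ A1 k) → Prop} (add : ∀ a b, Q a → Q b → Q (a + b))
    (mul : ∀ a b, Q ((fst _ _ ≫ a) * (snd _ _ ≫ b))) (a : Y ⊗ Z ⟶ A1 k) : Q a :=
  pullback_function_induction (isPullback_tensor Y Z) add mul a

/-- A function on `𝔾ₘ` is a Laurent polynomial over `k`; its coefficients are reinterpreted as
constant functions on `E`. The point `1` used in `χ` merely provides the map from `k` to those
constants. -/
lemma exists_evLaurent_eq (b : Gm k ⟶ A1 k) :
    ∃ p, evLaurent (fst E (Gm k)) (snd E (Gm k)) p = snd E (Gm k) ≫ b := by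
  let ι₁ (T : Over (Spec (.of k))) (t : T ⟶ Gm k) : k[T;T⁻¹] →+* (T ⟶ A1 k) :=
    (A1.ringEquiv T).symm.toRingHom.comp (Gm.ringHom t)
  have hb : snd E (Gm k) ≫ b = ι₁ _ (snd E (Gm k)) ((Scheme.ΓSpecIso (.of k[T;T⁻¹])).hom
      (A1.coord b)) := by
    apply (A1.ringEquiv _).injective
    refine Eq.trans ?_ ((A1.ringEquiv _).apply_symm_apply _).symm
    refine (A1.coord_comp _ _).trans ?_
    refine congr((snd E (Gm k)).left.appTop $(congr($(Iso.hom_inv_id (Scheme.ΓSpecIso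
      (.of k[T;T⁻¹]))) (A1.coord b)))).symm
  have hC {T T' : Over (Spec (.of k))} (f : T' ⟶ T) (t : T ⟶ Gm k) (t' : T' ⟶ Gm k) (c : k) :
      f ≫ ι₁ T t (algebraMap k _ c) = ι₁ T' t' (algebraMap k _ c) := by
    apply (A1.ringEquiv _).injective
    refine Eq.trans ?_ ((A1.ringEquiv _).apply_symm_apply _).symm
    refine (A1.coord_comp _ _).trans ?_
    rw [← A1.ringEquiv_apply]
    refine congr(f.left.appTop $((A1.ringEquiv _).apply_symm_apply _)).trans ?_
    rw [Gm.ringHom_algebraMap, Gm.ringHom_algebraMap, ← Over.w f, Scheme.Hom.comp_appTop]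
    rfl
  let χ : k[T;T⁻¹] →+* (E ⟶ A1 k)[T;T⁻¹] := LaurentPolynomial.eval₂
    (LaurentPolynomial.C.comp ((ι₁ E 1).comp (algebraMap k k[T;T⁻¹])))
    (LaurentPolynomial.isUnit_T 1).unit
  have h : (evLaurent (fst E (Gm k)) (snd E (Gm k))).comp χ = ι₁ _ (snd E (Gm k)) := by
    refine laurent_hom_ext (fun c ↦ ?_) ?_
    · simp only [χ, RingHom.comp_apply, LaurentPolynomial.eval₂_C, evLaurent_C]
      exact hC _ _ _ _
    · simp only [χ, RingHom.comp_apply, LaurentPolynomial.eval₂_T, zpow_one, IsUnit.unit_spec,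
        evLaurent_T]
      apply (A1.ringEquiv _).injective
      refine Eq.trans ?_ ((A1.ringEquiv _).apply_symm_apply _).symm
      exact Gm.coord_val _
  exact ⟨χ _, by rw [hb, ← h]; rfl⟩

/-- The expansion of a function on `E × 𝔾ₘ`. -/
lemma evLaurent_surjective [IsAffine E.left] :
    Function.Surjective (evLaurent (fst E (Gm k)) (snd E (Gm k))) := by
  have : IsAffine (Gm k).left := inferInstanceAs (IsAffine (Spec _))
  refine fun a ↦ tensor_function_induction
    (Q := fun a ↦ ∃ p, evLaurent (fst E (Gm k)) (snd E (Gm k)) p = a) ?_ ?_ a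
  · rintro _ _ ⟨p, rfl⟩ ⟨q, rfl⟩
    exact ⟨p + q, map_add _ _ _⟩
  · intro a b
    obtain ⟨p, hp⟩ := exists_evLaurent_eq (E := E) b
    exact ⟨LaurentPolynomial.C a * p, by rw [map_mul, hp, evLaurent_C]⟩

end

end

section

open LineBundle

/-! ### Weights of functions -/

section

variable {R S : Type*} [CommRing R] [CommRing S]

lemma coeff_C_mul (a : R) (p : R[T;T⁻¹]) (n : ℤ) :
    (LaurentPolynomial.C a * p).coeff n = a * p.coeff n := by
  rw [← LaurentPolynomial.smul_eq_C_mul, AddMonoidAlgebra.coeff_smul_apply, smul_eq_mul]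

lemma coeff_C_mul_T (a : R) (m n : ℤ) :
    (LaurentPolynomial.C a * LaurentPolynomial.T m).coeff n = if m = n then a else 0 := by
  rw [coeff_C_mul, LaurentPolynomial.T_apply, mul_ite, mul_one, mul_zero]

lemma coeff_mul_T (p : R[T;T⁻¹]) (m n : ℤ) :
    (p * LaurentPolynomial.T m).coeff n = p.coeff (n - m) := by
  induction p using LaurentPolynomial.induction_on' with
  | add p q hp hq => rw [add_mul, AddMonoidAlgebra.coeff_add, AddMonoidAlgebra.coeff_add,
      Finsupp.add_apply, Finsupp.add_apply, hp, hq]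
  | C_mul_T l a =>
    rw [mul_assoc, ← LaurentPolynomial.T_add, coeff_C_mul_T, coeff_C_mul_T]
    simp only [eq_sub_iff_add_eq]

/-- The homomorphism `a T ↦ f(a) u T`. -/
def twistLaurent (f : R →+* S) (u : Sˣ) : R[T;T⁻¹] →+* S[T;T⁻¹] :=
  LaurentPolynomial.eval₂ (LaurentPolynomial.C.comp f)
    (Units.map (LaurentPolynomial.C (R := S)).toMonoidHom u * (LaurentPolynomial.isUnit_T 1).unit)

lemma coeff_twistLaurent (f : R →+* S) (u : Sˣ) (p : R[T;T⁻¹]) (n : ℤ) :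
    (twistLaurent f u p).coeff n = f (p.coeff n) * (u ^ n : Sˣ) := by
  induction p using LaurentPolynomial.induction_on' with
  | add p q hp hq => rw [map_add, AddMonoidAlgebra.coeff_add, AddMonoidAlgebra.coeff_add,
      Finsupp.add_apply, Finsupp.add_apply, hp, hq, map_add, add_mul]
  | C_mul_T l a =>
    have h : (((LaurentPolynomial.isUnit_T 1).unit ^ l : (S[T;T⁻¹])ˣ) : S[T;T⁻¹]) =
        LaurentPolynomial.T l := by
      have := LaurentPolynomial.eval₂_T (LaurentPolynomial.C (R := S))
        (LaurentPolynomial.isUnit_T 1).unit l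
      rw [← this]
      exact congr($(laurent_hom_ext (g := RingHom.id (S[T;T⁻¹])) (by simp) (by simp)) _)
    rw [twistLaurent, LaurentPolynomial.eval₂_C_mul_T, mul_zpow, Units.val_mul, h, ← map_zpow,
      RingHom.comp_apply, ← mul_assoc]
    have e : LaurentPolynomial.C (f a) * ((Units.map (LaurentPolynomial.C (R := S)).toMonoidHom
        (u ^ l) : (S[T;T⁻¹])ˣ) : S[T;T⁻¹]) = LaurentPolynomial.C (f a * (u ^ l : Sˣ)) :=
      (map_mul _ _ _).symm
    rw [e, coeff_C_mul_T, coeff_C_mul_T]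
    split_ifs with e
    · rw [e]
    · simp

end

section

variable {E G : Over (Spec (.of k))}

/-- Evaluation at the unit `u(e) t` is the substitution of `u T` for `T` followed by evaluation at
`t`. -/
lemma evLaurent_twist {E' T : Over (Spec (.of k))} (e : T ⟶ E') (t r : T ⟶ Gm k) (f : E' ⟶ E)
    (u : (E' ⟶ A1 k)ˣ) (hr : Gm.val r = (e ≫ u.1) * Gm.val t) (p : (E ⟶ A1 k)[T;T⁻¹]) :
    evLaurent e t (twistLaurent (A1.pullback f) u p) = evLaurent (e ≫ f) r p := by
  have : (evLaurent e t).comp (twistLaurent (A1.pullback f) u) = evLaurent (e ≫ f) r :=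
    laurent_hom_ext (fun a ↦ by simp [twistLaurent, A1.pullback_apply])
      (by simp [twistLaurent, hr])
  rw [← this, RingHom.comp_apply]

instance (Y Z : Over (Spec (.of k))) [IsAffine Y.left] [IsAffine Z.left] : IsAffine (Y ⊗ Z).left :=
  inferInstanceAs (IsAffine (pullback Y.hom Z.hom))

instance : IsAffine (Gm k).left := inferInstanceAs (IsAffine (Spec _))

variable [ModObj (Gm k) E]

/-- A function of weight `n` under the action of `𝔾ₘ`. -/
def IsWeight (n : ℤ) (b : E ⟶ A1 k) : Prop :=
  ∀ ⦃T : Over (Spec (.of k))⦄ (e : T ⟶ E) (t : T ⟶ Gm k), (t • e) ≫ b =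
    evLaurent e t (LaurentPolynomial.C b * LaurentPolynomial.T n)

/-- The function `b(t • e)` on `E × 𝔾ₘ` is a Laurent polynomial in `t`. Associativity of the action
makes its `n`-th coefficient a function of weight `n`: this is the grading by weights. -/
lemma exists_expansion [IsAffine E.left] (b : E ⟶ A1 k) : ∃ p : (E ⟶ A1 k)[T;T⁻¹],
    (∀ ⦃T : Over (Spec (.of k))⦄ (e : T ⟶ E) (t : T ⟶ Gm k), (t • e) ≫ b = evLaurent e t p) ∧
    ∀ n, IsWeight n (p.coeff n) := by
  obtain ⟨p, hp⟩ := evLaurent_surjective ((snd E (Gm k) • fst E (Gm k)) ≫ b)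
  have h ⦃T : Over (Spec (.of k))⦄ (e : T ⟶ E) (t : T ⟶ Gm k) : (t • e) ≫ b = evLaurent e t p := by
    have := congr(lift e t ≫ $hp)
    rw [comp_evLaurent, ← Category.assoc, ModObj.comp_smul, lift_fst, lift_snd] at this
    exact this.symm
  refine ⟨p, h, fun n ↦ ?_⟩
  let u : (E ⊗ Gm k ⟶ A1 k)ˣ := (Gm.isUnit_val (snd E (Gm k))).unit
  have hu : u.1 = Gm.val (snd E (Gm k)) := rfl
  -- At a point `((e, t), s)` the two sides are `b(s • (t • e))` and `b((s t) • e)`. Equality of the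
  -- coefficients of `T ^ n` gives `p_n(t • e) = p_n(e) t ^ n`.
  have key : twistLaurent (A1.pullback (snd E (Gm k) • fst E (Gm k))) 1 p =
      twistLaurent (A1.pullback (fst E (Gm k))) u p := by
    apply evLaurent_injective
    rw [evLaurent_twist _ _ (snd _ _) _ _ (by simp),
      evLaurent_twist _ _ (snd _ _ * fst _ _ ≫ snd _ _) _ _ (by
        rw [Gm.val_mul, hu, Gm.comp_val, mul_comm]), ← h, ← h, ModObj.comp_smul, hom_mul_smul]
  have key' := congr(($key).coeff n)
  rw [coeff_twistLaurent, coeff_twistLaurent, one_zpow, Units.val_one, mul_one, A1.pullback_apply,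
    A1.pullback_apply] at key'
  intro T e t
  have := congr(lift e t ≫ $key')
  rw [← Category.assoc, ModObj.comp_smul, lift_fst, lift_snd] at this
  rw [this, A1.comp_mul, lift_fst_assoc, evLaurent, LaurentPolynomial.eval₂_C_mul_T,
    A1.pullback_apply]
  congr 1
  have h₁ : A1.pullback (lift e t) (u ^ n : (E ⊗ Gm k ⟶ A1 k)ˣ) =
      ((Units.map (A1.pullback (lift e t)).toMonoidHom u ^ n : (T ⟶ A1 k)ˣ) : T ⟶ A1 k) := by
    rw [← map_zpow]
    rfl
  rw [← A1.pullback_apply, h₁]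
  congr 2
  ext1
  change A1.pullback (lift e t) u.1 = Gm.val t
  rw [A1.pullback_apply, hu, Gm.comp_val, lift_snd]

/-- A scheme with a simply transitive action of `𝔾ₘ` on the fibres. -/
structure IsPseudoTorsor (p : E ⟶ G) : Prop where
  smul_proj : ∀ ⦃T : Over (Spec (.of k))⦄ (t : T ⟶ Gm k) (e : T ⟶ E), (t • e) ≫ p = e ≫ p
  trans : ∀ ⦃T : Over (Spec (.of k))⦄ (e e' : T ⟶ E), e ≫ p = e' ≫ p → ∃! t : T ⟶ Gm k, t • e = e'

variable {p : E ⟶ G}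

lemma IsPseudoTorsor.isPullback (hp : IsPseudoTorsor p) :
    IsPullback (fst E (Gm k)) (snd E (Gm k) • fst E (Gm k)) p p := by
  refine ⟨⟨(hp.smul_proj _ _).symm⟩, ⟨PullbackCone.IsLimit.mk _
    (fun s ↦ lift s.fst (hp.trans _ _ s.condition).choose) (fun s ↦ lift_fst _ _) (fun s ↦ ?_)
    fun s m h₁ h₂ ↦ ?_⟩⟩
  · rw [ModObj.comp_smul, lift_fst, lift_snd]
    exact (hp.trans _ _ s.condition).choose_spec.1
  · refine CartesianMonoidalCategory.hom_ext _ _ (by rw [h₁, lift_fst]) ?_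
    rw [lift_snd]
    refine (hp.trans _ _ s.condition).choose_spec.2 _ ?_
    dsimp only
    rw [ModObj.comp_smul, h₁] at h₂
    exact h₂

/-- The products of functions of weight `-1` and `1` generate the unit ideal. -/
lemma IsPseudoTorsor.span_eq_top (hp : IsPseudoTorsor p) [IsAffine E.left] [IsAffine G.left] :
    Ideal.span {w : E ⟶ A1 k | ∃ v u, IsWeight (-1) v ∧ IsWeight 1 u ∧ w = v * u} = ⊤ := by
  choose ρ hρ hw using exists_expansion (E := E)
  -- Since `E × 𝔾ₘ` is `E ×_G E`, the coordinate `t` is a sum of products `a(e) b(t • e)`. The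
  -- coefficient of `T` in such a product is `a` times the part of `b` of weight one, whereas in `t`
  -- it is `1`.
  have one : (1 : E ⟶ A1 k) ∈ Ideal.span {u : E ⟶ A1 k | IsWeight 1 u} := by
    have H (F : E ⊗ Gm k ⟶ A1 k) : ∃ q, evLaurent (fst E (Gm k)) (snd E (Gm k)) q = F ∧
        q.coeff 1 ∈ Ideal.span {u : E ⟶ A1 k | IsWeight 1 u} := by
      refine pullback_function_induction hp.isPullback (Q := fun F ↦ ∃ q,
        evLaurent (fst E (Gm k)) (snd E (Gm k)) q = F ∧
        q.coeff 1 ∈ Ideal.span {u : E ⟶ A1 k | IsWeight 1 u}) ?_ ?_ F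
      · rintro _ _ ⟨q, rfl, h⟩ ⟨r, rfl, h'⟩
        exact ⟨q + r, map_add _ _ _, Ideal.add_mem _ h h'⟩
      · intro a b
        refine ⟨LaurentPolynomial.C a * ρ b, by rw [map_mul, evLaurent_C, hρ], ?_⟩
        rw [coeff_C_mul]
        exact Ideal.mul_mem_left _ _ (Ideal.subset_span (hw b 1))
    obtain ⟨q, hq, hq'⟩ := H (Gm.val (snd E (Gm k)))
    rw [← evLaurent_T (fst E (Gm k)) (snd E (Gm k))] at hq
    rwa [evLaurent_injective hq, LaurentPolynomial.T_apply, if_pos rfl] at hq'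
  have ρ_mul (a b : E ⟶ A1 k) : ρ (a * b) = ρ a * ρ b := by
    apply evLaurent_injective
    rw [map_mul, ← hρ, ← hρ, ← hρ, A1.comp_mul]
  have ρ_add (a b : E ⟶ A1 k) : ρ (a + b) = ρ a + ρ b := by
    apply evLaurent_injective
    rw [map_add, ← hρ, ← hρ, ← hρ, A1.comp_add]
  have ρ_zero : ρ 0 = 0 := by
    apply evLaurent_injective
    rw [map_zero, ← hρ, A1.comp_zero]
  have ρ_one : ρ 1 = 1 := by
    apply evLaurent_injective
    rw [map_one, ← hρ, A1.comp_one]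
  have ρ_weight (u : E ⟶ A1 k) (n : ℤ) (hu : IsWeight n u) :
      ρ u = LaurentPolynomial.C u * LaurentPolynomial.T n := by
    apply evLaurent_injective
    rw [← hρ, hu]
  -- For `u` of weight one, the part of weight zero of `a u` is the part of `a` of weight `-1`
  -- multiplied by `u`. The factor `a` is kept arbitrary to let the induction pass through
  -- multiples.
  have key (x : E ⟶ A1 k) (hx : x ∈ Ideal.span {u : E ⟶ A1 k | IsWeight 1 u}) :
      ∀ a, (ρ (a * x)).coeff 0 ∈
      Ideal.span {w : E ⟶ A1 k | ∃ v u, IsWeight (-1) v ∧ IsWeight 1 u ∧ w = v * u} := by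
    induction hx using Submodule.span_induction with
    | mem u hu =>
      intro a
      rw [ρ_mul, ρ_weight u 1 hu, mul_left_comm, coeff_C_mul, coeff_mul_T, mul_comm]
      exact Ideal.subset_span ⟨_, _, hw a _, hu, rfl⟩
    | zero =>
      intro a
      rw [mul_zero, ρ_zero]
      exact Ideal.zero_mem _
    | add x y _ _ hx hy =>
      intro a
      rw [mul_add, ρ_add]
      exact Ideal.add_mem _ (hx a) (hy a)
    | smul b x _ hx =>
      intro a
      rw [smul_eq_mul, ← mul_assoc]
      exact hx _
  have := key 1 one 1
  rw [mul_one, ρ_one, ← LaurentPolynomial.T_zero, LaurentPolynomial.T_apply, if_pos rfl] at this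
  rwa [Ideal.eq_top_iff_one]

lemma isUnit_of_isUnit_germ {T : Over (Spec (.of k))} (a : T ⟶ A1 k)
    (h : ∀ s : T.left, s ∈ T.left.basicOpen (A1.coord a)) : IsUnit a := by
  have : IsUnit (A1.ringEquiv T a) :=
    T.left.toRingedSpace.isUnit_of_isUnit_germ ⊤ _ fun s _ ↦
      (Scheme.mem_basicOpen_top _ _ _).1 (h s)
  have := this.map (A1.ringEquiv T).symm
  rwa [RingEquiv.symm_apply_apply] at this

lemma comp_mem_basicOpen {T T' : Over (Spec (.of k))} (f : T' ⟶ T) (a : T ⟶ A1 k) (s : T'.left) :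
    f.left s ∈ T.left.basicOpen (A1.coord a) ↔ s ∈ T'.left.basicOpen (A1.coord (f ≫ a)) := by
  rw [A1.coord_comp, ← Scheme.preimage_basicOpen_top]
  rfl

/-- Torsors under `𝔾ₘ` have sections, Zariski locally. -/
theorem IsPseudoTorsor.loc_section (hp : IsPseudoTorsor p) [IsAffine E.left] [IsAffine G.left]
    [Flat p.left] [Surjective p.left] : Loc G fun T j ↦ ∃ x : T ⟶ E, x ≫ p = j := by
  intro s
  obtain ⟨e, rfl⟩ := p.left.surjective s
  -- a function of weight one which does not vanish at `e`
  obtain ⟨v, u, hv, hu, he⟩ : ∃ v u : E ⟶ A1 k, IsWeight (-1) v ∧ IsWeight 1 u ∧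
      e ∈ E.left.basicOpen (A1.coord (v * u)) := by
    -- If all products of weights `-1` and `1` vanished at `e`, the ideal they generate would map
    -- into the maximal ideal of the stalk, although it is the unit ideal.
    by_contra! H
    let φ : (E ⟶ A1 k) →+* E.left.presheaf.stalk e :=
      (E.left.presheaf.germ ⊤ e trivial).hom.comp (A1.ringEquiv E).toRingHom
    have h : Ideal.span {w : E ⟶ A1 k | ∃ v u, IsWeight (-1) v ∧ IsWeight 1 u ∧ w = v * u} ≤
        (IsLocalRing.maximalIdeal (E.left.presheaf.stalk e)).comap φ := by
      refine Ideal.span_le.2 ?_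
      rintro _ ⟨v, u, hv, hu, rfl⟩
      refine (IsLocalRing.mem_maximalIdeal _).2 fun h ↦ H v u hv hu ?_
      exact (Scheme.mem_basicOpen_top _ _ _).2 h
    rw [hp.span_eq_top, top_le_iff, Ideal.comap_eq_top_iff] at h
    exact (IsLocalRing.maximalIdeal.isMaximal _).ne_top h
  have smul_u {T : Over (Spec (.of k))} (e : T ⟶ E) (t : T ⟶ Gm k) :
      (t • e) ≫ u = Gm.val t * (e ≫ u) := by
    rw [hu, map_mul, evLaurent_C, evLaurent_T, mul_comm]
  have smul_w {T : Over (Spec (.of k))} (e : T ⟶ E) (t : T ⟶ Gm k) :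
      (t • e) ≫ (v * u) = e ≫ (v * u) := by
    rw [A1.comp_mul, A1.comp_mul, hu, hv, ← map_mul, mul_mul_mul_comm, ← LaurentPolynomial.T_add,
      neg_add_cancel, LaurentPolynomial.T_zero, mul_one, map_mul, evLaurent_C, evLaurent_C]
  -- The product has weight zero, so it is constant on the fibres and descends to `G`. The section
  -- is constructed over the open set where the descended function is invertible.
  obtain ⟨f, hf⟩ := exists_desc p (v * u) fun T a b hab ↦ by
    obtain ⟨t, rfl, -⟩ := hp.trans a b hab
    exact (smul_w _ _).symm
  refine ⟨G.left.basicOpen (A1.coord f), (comp_mem_basicOpen p f e).2 (by rwa [hf]), ?_⟩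
  set U := G.left.basicOpen (A1.coord f)
  have hf' : IsUnit (opnι G U ≫ f) := isUnit_of_isUnit_germ _ fun s ↦
    (comp_mem_basicOpen (opnι G U) f s).1 (opnι_mem U s)
  let P := pullback (opnι G U) p
  let q : P ⟶ opn G U := pullback.fst _ _
  let d : P ⟶ E := pullback.snd _ _
  have hq : q ≫ opnι G U = d ≫ p := pullback.condition
  have hPB := (IsPullback.of_hasPullback (opnι G U) p).map (Over.forget _)
  have : Flat q.left := MorphismProperty.of_isPullback (P := @Flat) hPB.flip
    (inferInstanceAs (Flat p.left))
  have : Surjective q.left := MorphismProperty.of_isPullback (P := @Surjective) hPB.flip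
    (inferInstanceAs (Surjective p.left))
  have : QuasiCompact q.left := MorphismProperty.of_isPullback (P := @QuasiCompact) hPB.flip
    (inferInstanceAs (QuasiCompact p.left))
  have hd : IsUnit (d ≫ u) := by
    have := hf'.map (A1.pullback q)
    rw [A1.pullback_apply, ← Category.assoc, hq, Category.assoc, hf, A1.comp_mul] at this
    exact isUnit_of_mul_isUnit_right this
  obtain ⟨r, hr⟩ := Gm.exists_val_eq hd
  -- Over this open set `u` is invertible with value `r`. Scaling by `r⁻¹` moves a point to the one
  -- in its fibre where `u` is `1`; that point depends only on the fibre and thus descends to a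
  -- section.
  obtain ⟨x, hx⟩ := exists_desc q (r⁻¹ • d) fun T a b hab ↦ by
    obtain ⟨t, ht, -⟩ := hp.trans (a ≫ d) (b ≫ d) (by
      rw [Category.assoc, Category.assoc, ← hq, reassoc_of% hab])
    have h : b ≫ r = t * (a ≫ r) := by
      apply Gm.val_injective
      rw [← Gm.comp_val, hr, ← Category.assoc, ← ht, smul_u, Category.assoc, ← hr, Gm.val_mul,
        Gm.comp_val]
    rw [ModObj.comp_smul, ModObj.comp_smul, GrpObj.comp_inv, GrpObj.comp_inv, ← ht, h,
      ← hom_mul_smul, mul_inv_rev, inv_mul_cancel_right]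
  refine ⟨x, ?_⟩
  have := epi_of_flat q
  rw [← cancel_epi q, ← Category.assoc, hx, hp.smul_proj, hq]

end

end

section

open LineBundle

/-! ### Torsors under the multiplicative group -/

section

variable {E G : Over (Spec (.of k))} [ModObj (Gm k) E]

/-- A torsor under `𝔾ₘ`, locally trivial for the Zariski topology. -/
structure IsTorsor (p : E ⟶ G) : Prop extends IsPseudoTorsor p where
  loc_section : Loc G fun T j ↦ ∃ x : T ⟶ E, x ≫ p = j

lemma stab_section (p : E ⟶ G) : Stab fun T (j : T ⟶ G) ↦ ∃ x : T ⟶ E, x ≫ p = j :=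
  fun _ _ _ f ⟨x, hx⟩ ↦ ⟨f ≫ x, by rw [Category.assoc, hx]⟩

namespace IsTorsor

variable {p : E ⟶ G} (hp : IsTorsor p)
include hp

lemma loc_lift {T : Over (Spec (.of k))} (g : T ⟶ G) :
    Loc T fun T' j ↦ ∃ x : T' ⟶ E, x ≫ p = j ≫ g :=
  hp.loc_section.pullback (stab_section p) g

lemma smul_injective {T : Over (Spec (.of k))} {t r : T ⟶ Gm k} {e : T ⟶ E}
    (h : t • e = r • e) : t = r :=
  (hp.trans e (r • e) (hp.smul_proj _ _).symm).unique h rfl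

lemma isPullback_section {T : Over (Spec (.of k))} {j : T ⟶ G} {x : T ⟶ E} (hx : x ≫ p = j) :
    IsPullback (snd T (Gm k) • (fst T (Gm k) ≫ x)) (fst T (Gm k)) p j := by
  have h (s : PullbackCone p j) : (s.snd ≫ x) ≫ p = s.fst ≫ p := by
    rw [s.condition, Category.assoc, hx]
  refine ⟨⟨by rw [hp.smul_proj, Category.assoc, hx]⟩, ⟨PullbackCone.IsLimit.mk _
    (fun s ↦ lift s.snd (hp.trans (s.snd ≫ x) s.fst (h s)).choose) (fun s ↦ ?_)
    (fun s ↦ lift_fst _ _) fun s m h₁ h₂ ↦ ?_⟩⟩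
  · rw [ModObj.comp_smul (X := E), lift_snd, lift_fst_assoc]
    exact (hp.trans (s.snd ≫ x) s.fst (h s)).choose_spec.1
  · refine CartesianMonoidalCategory.hom_ext _ _ (by rw [h₂, lift_fst]) ?_
    rw [lift_snd]
    refine (hp.trans (s.snd ≫ x) s.fst (h s)).choose_spec.2 _ ?_
    dsimp only
    rw [ModObj.comp_smul (X := E), reassoc_of% h₂] at h₁
    exact h₁

/-- Over the opens carrying a section, the torsor is the projection of a product with `𝔾ₘ`, which is
all that a property local on the target needs to be tested on. -/
lemma of_local {P : MorphismProperty Scheme.{u}} [IsZariskiLocalAtTarget P]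
    (h : ∀ Y : Over (Spec (.of k)), P (fst Y (Gm k)).left) : P p.left := by
  choose U hU x hx using hp.loc_section
  refine IsZariskiLocalAtTarget.of_openCover (nhdCover U hU) fun i ↦ ?_
  have hPB : IsPullback (snd (opn G (U i)) (Gm k) • (fst _ (Gm k) ≫ x i)).left
      (fst _ (Gm k)).left p.left
    (U i).ι := (hp.isPullback_section (hx i)).map (Over.forget _)
  change P (pullback.snd p.left (U i).ι)
  have e : hPB.isoPullback.hom ≫ pullback.snd p.left (U i).ι = (fst (opn G (U i)) (Gm k)).left :=
    hPB.isoPullback_hom_snd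
  rw [← P.cancel_left_of_respectsIso hPB.isoPullback.hom, e]
  exact h _

lemma flat : Flat p.left :=
  have : IsZariskiLocalAtTarget @Flat.{u} := HasRingHomProperty.instIsZariskiLocalAtTarget _
  hp.of_local (P := @Flat) fun _ ↦ inferInstance

lemma isAffineHom : IsAffineHom p.left :=
  have : IsZariskiLocalAtTarget @IsAffineHom.{u} :=
    @HasAffineProperty.instIsZariskiLocalAtTarget _ _ instHasAffinePropertyIsAffineHomIsAffine
  hp.of_local (P := @IsAffineHom) fun Y ↦
    isAffineHom_isStableUnderBaseChange.of_isPullback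
      (IsPullback.of_hasPullback Y.hom (Gm k).hom).flip (inferInstanceAs (IsAffineHom (Spec.map _)))

lemma surjective : Surjective p.left := by
  refine ⟨fun s ↦ ?_⟩
  obtain ⟨U, hU, x, hx⟩ := hp.loc_section s
  refine ⟨x.left ⟨s, hU⟩, ?_⟩
  have := congr(($hx).left ⟨s, hU⟩)
  exact this

end IsTorsor

/-- Equivariant maps between torsors are isomorphisms. -/
lemma IsTorsor.isIso {E' : Over (Spec (.of k))} [ModObj (Gm k) E'] {p : E ⟶ G} {p' : E' ⟶ G}
    (hp : IsTorsor p) (hp' : IsTorsor p') (f : E ⟶ E') (hf : f ≫ p' = p)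
    (smul : ∀ ⦃T : Over (Spec (.of k))⦄ (t : T ⟶ Gm k) (e : T ⟶ E), (t • e) ≫ f = t • (e ≫ f)) :
    IsIso f := by
  refine isIso_of_loc f (fun T a b h ↦ ?_) ?_
  · obtain ⟨t, rfl, -⟩ := hp.trans a b (by rw [← hf, reassoc_of% h])
    rw [smul] at h
    rw [hp'.smul_injective (t := t) (r := 1) (e := a ≫ f) (by rw [hom_one_smul, ← h]), hom_one_smul]
  · refine (hp.loc_lift p').mono fun T j ⟨x, hx⟩ ↦ ?_
    obtain ⟨t, ht, -⟩ := hp'.trans (x ≫ f) j (by rw [Category.assoc, hf, hx])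
    exact ⟨t • x, by rw [smul, ht]⟩

end

section

variable {B P Z : Over (Spec (.of k))} [ModObj (Gm k) P] [ModObj (Gm k) Z] (p : P ⟶ B)
  (K : ∀ ⦃T : Over (Spec (.of k))⦄, (T ⟶ P) → (T ⟶ Z) → Prop)

/-- A family of equivariant maps from the fibres of `P` at the points `s ≫ b`, with values
restricted by a relation. -/
structure RelFam {T : Over (Spec (.of k))} (b : T ⟶ B) where
  /-- The value of the map at the point `q` of the fibre. -/
  val : ∀ ⦃T' : Over (Spec (.of k))⦄ (s : T' ⟶ T) (q : T' ⟶ P), q ≫ p = s ≫ b → (T' ⟶ Z)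
  nat : ∀ ⦃T' T'' : Over (Spec (.of k))⦄ (f : T'' ⟶ T') (s : T' ⟶ T) (q : T' ⟶ P)
    (h : q ≫ p = s ≫ b), f ≫ val s q h = val (f ≫ s) (f ≫ q) (by simp [h])
  smul : ∀ ⦃T' : Over (Spec (.of k))⦄ (s : T' ⟶ T) (t : T' ⟶ Gm k) (q : T' ⟶ P)
    (h : q ≫ p = s ≫ b) (h' : (t • q) ≫ p = s ≫ b), val s (t • q) h' = t • val s q h
  rel : ∀ ⦃T' : Over (Spec (.of k))⦄ (s : T' ⟶ T) (q : T' ⟶ P) (h : q ≫ p = s ≫ b),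
    K q (val s q h)

variable {p K}

namespace RelFam

variable {T : Over (Spec (.of k))} {b : T ⟶ B} (φ : RelFam p K b)

lemma val_congr {T' : Over (Spec (.of k))} {s s' : T' ⟶ T} {q q' : T' ⟶ P} (hs : s = s')
    (hq : q = q') (h : q ≫ p = s ≫ b) : φ.val s q h = φ.val s' q' (by rw [← hs, ← hq, h]) := by
  subst hs hq
  rfl

/-- The base change of a family. -/
def res {T' : Over (Spec (.of k))} (f : T' ⟶ T) : RelFam p K (f ≫ b) where
  val _ s q h := φ.val (s ≫ f) q (by simpa using h)
  nat _ _ g s q h := (φ.nat _ _ _ _).trans (φ.val_congr (Category.assoc _ _ _).symm rfl _)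
  smul _ _ _ _ _ _ := φ.smul _ _ _ _ _
  rel _ _ _ _ := φ.rel _ _ _

/-- The family over an equal point. -/
def cast {b' : T ⟶ B} (hb : b = b') : RelFam p K b' where
  val _ s q h := φ.val s q (by rw [h, hb])
  nat _ _ g s q h := φ.nat _ _ _ _
  smul _ _ _ _ _ _ := φ.smul _ _ _ _ _
  rel _ _ _ _ := φ.rel _ _ _

/-- The product of a family with an invertible function. -/
def scale (hK : ∀ ⦃T : Over (Spec (.of k))⦄ (q : T ⟶ P) (z : T ⟶ Z) (t : T ⟶ Gm k),
    K q z → K q (t • z)) (t : T ⟶ Gm k) : RelFam p K b where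
  val _ s q h := (s ≫ t) • φ.val s q h
  nat _ _ g s q h := by
    rw [ModObj.comp_smul (X := Z), φ.nat, ← Category.assoc g s t]
  smul _ s r q h h' := by
    rw [φ.smul s r q h h', smul_smul_comm]
  rel _ _ _ _ := hK _ _ _ (φ.rel _ _ _)

/-- The family of the values of a point of the universal object. -/
def ofPt {hp : ∀ ⦃T : Over (Spec (.of k))⦄ (t : T ⟶ Gm k) (q : T ⟶ P), (t • q) ≫ p = q ≫ p}
    (x : EquivPt p hp K T) : RelFam p K x.base where
  val _ s q h := app x.map s q h.symm
  nat _ _ _ _ _ _ := comp_app _ _ _ _ _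
  smul _ _ _ _ _ _ := x.smul _ _ _ _
  rel _ _ _ _ := x.rel _ _ _

end RelFam

/-- If the families form a torsor under the invertible functions, then they are represented by a
torsor under `𝔾ₘ`. -/
theorem exists_torsor
    (hp : ∀ ⦃T : Over (Spec (.of k))⦄ (t : T ⟶ Gm k) (q : T ⟶ P), (t • q) ≫ p = q ≫ p)
    (loc : ∀ ⦃T : Over (Spec (.of k))⦄ (q : T ⟶ P) (z : T ⟶ Z),
      Loc T (fun _ j ↦ K (j ≫ q) (j ≫ z)) → K q z)
    (hK : ∀ ⦃T : Over (Spec (.of k))⦄ (q : T ⟶ P) (z : T ⟶ Z) (t : T ⟶ Gm k),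
      K q z → K q (t • z))
    (ex : Loc B fun _ j ↦ Nonempty (RelFam p K j))
    (tr : ∀ ⦃T : Over (Spec (.of k))⦄ (b : T ⟶ B) (φ ψ : RelFam p K b), ∃! t : T ⟶ Gm k,
      ∀ ⦃T' : Over (Spec (.of k))⦄ (s : T' ⟶ T) (q : T' ⟶ P) (h : q ≫ p = s ≫ b),
        ψ.val s q h = (s ≫ t) • φ.val s q h) :
    ∃ (E : Over (Spec (.of k))) (_ : ModObj (Gm k) E) (c : E ⟶ B) (e : RelFam p K c), IsTorsor c ∧
      (∀ ⦃T : Over (Spec (.of k))⦄ (t : T ⟶ Gm k) (f : T ⟶ E) (q : T ⟶ P) (h : q ≫ p = f ≫ c)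
        (h' : q ≫ p = (t • f) ≫ c), e.val (t • f) q h' = t • e.val f q h) ∧
      ∀ ⦃T : Over (Spec (.of k))⦄ (b : T ⟶ B) (φ : RelFam p K b), ∃! f : T ⟶ E, f ≫ c = b ∧
        ∀ ⦃T' : Over (Spec (.of k))⦄ (s : T' ⟶ T) (q : T' ⟶ P) (h : q ≫ p = s ≫ b)
          (h' : q ≫ p = (s ≫ f) ≫ c), e.val (s ≫ f) q h' = φ.val s q h := by
  obtain ⟨E, e₀, H₀⟩ := exists_universal (p := p) (hp := hp) (K := K) loc fun b ↦ by
    obtain ⟨U, hU, ⟨φ⟩⟩ := ex b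
    -- A family `φ` over `U` gives the chart `U × 𝔾ₘ`, with `φ` scaled by the coordinate as its
    -- universal family: every family there is a unique multiple of `φ`.
    let ψ := (φ.res (fst (opn B U) (Gm k))).scale hK (snd _ _)
    obtain ⟨y, hy, Hy⟩ := EquivPt.exists_of_values (hp := hp) _ (fun T' s q h ↦ ψ.val s q h.symm)
      (fun _ _ _ _ _ _ ↦ ψ.nat _ _ _ _) (fun _ _ _ _ _ ↦ ψ.smul _ _ _ _ _)
      (fun _ _ _ _ ↦ ψ.rel _ _ _)
    refine ⟨U, hU, _, fst _ _, y, hy, fun T x u hx ↦ ?_⟩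
    have hyv {T' : Over (Spec (.of k))} (s : T' ⟶ opn B U ⊗ Gm k) (s' : T' ⟶ opn B U)
        (hs : s ≫ fst _ _ = s') (q : T' ⟶ P) (h : q ≫ p = s' ≫ opnι B U)
        (h' : s ≫ y.base = q ≫ p) :
        app y.map s q h' = (s ≫ snd _ _) • φ.val s' q h := by
      subst hs
      exact Hy s q (by rw [h, Category.assoc]) h'
    obtain ⟨t, ht, hu⟩ := tr (u ≫ opnι B U) (φ.res u) ((RelFam.ofPt x).cast hx)
    have hxv {T' : Over (Spec (.of k))} (s : T' ⟶ T) (q : T' ⟶ P)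
        (h : q ≫ p = s ≫ u ≫ opnι B U) (h' : s ≫ x.base = q ≫ p) :
        ((RelFam.ofPt x).cast hx).val s q h = app x.map s q h' := rfl
    refine ⟨lift u t, ⟨lift_fst _ _, fun T' s q h h' ↦ ?_⟩, fun f ⟨hf, hf'⟩ ↦ ?_⟩
    · have h₁ : q ≫ p = s ≫ u ≫ opnι B U := by rw [← h, hx]
      rw [hyv (s ≫ lift u t) (s ≫ u) (by simp) q (by simpa using h₁), ← hxv s q h₁ h, ht s q h₁,
        Category.assoc, lift_snd]
      rfl
    · refine CartesianMonoidalCategory.hom_ext _ _ (by rw [hf, lift_fst]) ?_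
      rw [lift_snd]
      refine hu _ fun T' s q h ↦ ?_
      have h₁ : (s ≫ f) ≫ y.base = q ≫ p := by
        rw [hy, h, ← hf]
        simp
      have h₂ : s ≫ x.base = q ≫ p := by rw [hx, h]
      rw [hxv s q h h₂, ← hf' s q h₂ h₁,
        hyv (s ≫ f) (s ≫ u) (by rw [Category.assoc, hf]) q (by simpa using h), Category.assoc]
      rfl
  let c := e₀.base
  let e : RelFam p K c := RelFam.ofPt e₀
  have H ⦃T : Over (Spec (.of k))⦄ (b : T ⟶ B) (φ : RelFam p K b) : ∃! f : T ⟶ E, f ≫ c = b ∧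
      ∀ ⦃T' : Over (Spec (.of k))⦄ (s : T' ⟶ T) (q : T' ⟶ P) (h : q ≫ p = s ≫ b)
        (h' : q ≫ p = (s ≫ f) ≫ c), e.val (s ≫ f) q h' = φ.val s q h := by
    obtain ⟨f, ⟨hf, hf'⟩, hu⟩ := H₀ b (fun T' s q h ↦ φ.val s q h.symm)
      (fun _ _ _ _ _ _ ↦ φ.nat _ _ _ _) (fun _ _ _ _ _ ↦ φ.smul _ _ _ _ _)
      (fun _ _ _ _ ↦ φ.rel _ _ _)
    exact ⟨f, ⟨hf, fun T' s q h h' ↦ hf' s q h.symm h'.symm⟩, fun g ⟨hg, hg'⟩ ↦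
      hu g ⟨hg, fun T' s q h h' ↦ hg' s q h.symm h'.symm⟩⟩
  have Hext ⦃T : Over (Spec (.of k))⦄ (f g : T ⟶ E) (hc : f ≫ c = g ≫ c)
      (h : ∀ ⦃T' : Over (Spec (.of k))⦄ (s : T' ⟶ T) (q : T' ⟶ P) (h : q ≫ p = (s ≫ f) ≫ c)
        (h' : q ≫ p = (s ≫ g) ≫ c), e.val (s ≫ f) q h = e.val (s ≫ g) q h') : f = g :=
    (H _ (e.res g)).unique ⟨hc, fun T' s q h₁ h₂ ↦ h s q h₂ (by simpa using h₁)⟩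
      ⟨rfl, fun T' s q h₁ h₂ ↦ rfl⟩
  -- The scalar multiple of a point is the point which represents the scaled family.
  choose a ha using fun (T : Over (Spec (.of k))) (t : T ⟶ Gm k) (f : T ⟶ E) ↦
    (H _ ((e.res f).scale hK t)).exists
  have hac {T : Over (Spec (.of k))} (t : T ⟶ Gm k) (f : T ⟶ E) : a T t f ≫ c = f ≫ c := (ha T t f).1
  have hav {T T' : Over (Spec (.of k))} (s : T' ⟶ T) (t : T ⟶ Gm k) (f : T ⟶ E) (q : T' ⟶ P)
      (h : q ≫ p = (s ≫ f) ≫ c) (h' : q ≫ p = (s ≫ a T t f) ≫ c) :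
      e.val (s ≫ a T t f) q h' = (s ≫ t) • e.val (s ≫ f) q h :=
    (ha T t f).2 s q (by simpa using h) h'
  obtain ⟨i, hi⟩ := exists_modObj (M := Gm k) (E := E) a
    (fun T T' f t x ↦ Hext _ _ (by rw [hac, Category.assoc, hac, Category.assoc])
      fun T'' s q h h' ↦ by
        have h₁ : q ≫ p = ((s ≫ f) ≫ x) ≫ c := by simpa [hac] using h
        refine (e.val_congr (Category.assoc _ _ _).symm rfl _).trans ((hav (s ≫ f) t x q h₁
          (by simpa using h)).trans (Eq.symm ((hav s (f ≫ t) (f ≫ x) q (by simpa using h₁) h').trans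
          ?_)))
        rw [← Category.assoc s f t]
        exact congrArg _ (e.val_congr (Category.assoc _ _ _).symm rfl _))
    (fun T x ↦ Hext _ _ (hac _ _) fun T' s q h h' ↦ by
      rw [hav s 1 x q h', MonObj.comp_one, hom_one_smul])
    (fun T t r x ↦ Hext _ _ (by rw [hac, hac, hac]) fun T' s q h h' ↦ by
      have h₁ : q ≫ p = (s ≫ x) ≫ c := by simpa [hac] using h
      have h₂ : q ≫ p = (s ≫ a T r x) ≫ c := by simpa [hac] using h
      rw [hav s _ x q h₁, hav s t (a T r x) q h₂, hav s r x q h₁, MonObj.comp_mul, hom_mul_smul])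
  have smul_c {T : Over (Spec (.of k))} (t : T ⟶ Gm k) (f : T ⟶ E) : (t • f) ≫ c = f ≫ c := by
    rw [hi, hac]
  have smul_val {T T' : Over (Spec (.of k))} (s : T' ⟶ T) (t : T ⟶ Gm k) (f : T ⟶ E) (q : T' ⟶ P)
      (h : q ≫ p = (s ≫ f) ≫ c) (h' : q ≫ p = (s ≫ (t • f)) ≫ c) :
      e.val (s ≫ (t • f)) q h' = (s ≫ t) • e.val (s ≫ f) q h :=
    (e.val_congr (by rw [hi]) rfl _).trans (hav s t f q h (by rw [h', hi]))
  refine ⟨E, i, c, e, ⟨⟨fun _ _ _ ↦ smul_c _ _, fun T f f' hf ↦ ?_⟩, ?_⟩,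
    fun T t f q h h' ↦ ?_, H⟩
  -- Simple transitivity on points over one base point is the hypothesis `tr` applied to the
  -- families which the points represent.
  · obtain ⟨t, ht, hu⟩ := tr (f ≫ c) (e.res f) ((e.res f').cast hf.symm)
    have hv {T' : Over (Spec (.of k))} (s : T' ⟶ T) (q : T' ⟶ P) (h : q ≫ p = s ≫ f ≫ c)
        (h' : q ≫ p = (s ≫ f') ≫ c) :
        ((e.res f').cast hf.symm).val s q h = e.val (s ≫ f') q h' := rfl
    refine ⟨t, Hext _ _ (by rw [smul_c, hf]) fun T' s q h h' ↦ ?_, fun r hr ↦ hu r fun T' s q h ↦ ?_⟩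
    · have h₁ : q ≫ p = (s ≫ f) ≫ c := by rw [h', Category.assoc, Category.assoc, hf]
      rw [smul_val s t f q h₁, ← hv s q (by rw [h', Category.assoc, hf]) h',
        ht s q (by simpa using h₁)]
      rfl
    · have h₁ : q ≫ p = (s ≫ f') ≫ c := by rw [h, Category.assoc, hf]
      rw [hv s q h h₁]
      have h₂ : q ≫ p = (s ≫ f) ≫ c := by rw [h, Category.assoc]
      dsimp only at hr
      exact (e.val_congr (by rw [hr]) rfl _).trans (smul_val s r f q h₂ (by rw [hr, h₁]))
  · refine ex.mono fun T j ⟨φ⟩ ↦ ?_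
    obtain ⟨f, hf, -⟩ := (H j φ).exists
    exact ⟨f, hf⟩
  · have := smul_val (𝟙 T) t f q (by simpa using h) (by simpa using h')
    exact (e.val_congr (Category.id_comp _).symm rfl _).trans (this.trans
      (congrArg₂ _ (Category.id_comp t) (e.val_congr (Category.id_comp _) rfl _)))

end

end

section

open LineBundle

/-! ### Group schemes from operations on points -/

lemma exists_grpObj {E : Over (Spec (.of k))} (m : E ⊗ E ⟶ E) (e : 𝟙_ _ ⟶ E) (i : E ⟶ E)
    (assoc : ∀ ⦃T : Over (Spec (.of k))⦄ (a b c : T ⟶ E),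
      lift (lift a b ≫ m) c ≫ m = lift a (lift b c ≫ m) ≫ m)
    (one_mul : ∀ ⦃T : Over (Spec (.of k))⦄ (a : T ⟶ E), lift (toUnit T ≫ e) a ≫ m = a)
    (mul_one : ∀ ⦃T : Over (Spec (.of k))⦄ (a : T ⟶ E), lift a (toUnit T ≫ e) ≫ m = a)
    (inv_mul : ∀ ⦃T : Over (Spec (.of k))⦄ (a : T ⟶ E), lift (a ≫ i) a ≫ m = toUnit T ≫ e) :
    ∃ _ : GrpObj E, ∀ ⦃T : Over (Spec (.of k))⦄ (a b : T ⟶ E), a * b = lift a b ≫ m := by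
  let i₀ : MonObj E :=
    { one := e
      mul := m
      one_mul := by
        have h : e ▷ E = lift (toUnit _ ≫ e) (snd _ _) := by
          ext1
          · rw [whiskerRight_fst, lift_fst]
            congr 1
          · simp
        rw [h, one_mul, leftUnitor_hom]
      mul_one := by
        have h : E ◁ e = lift (fst _ _) (toUnit _ ≫ e) := by
          ext1
          · simp
          · rw [whiskerLeft_snd, lift_snd]
            congr 1
            exact toUnit_unique _ _
        rw [h, mul_one, rightUnitor_hom]
      mul_assoc := by
        have h₁ : m ▷ E = lift (lift (fst _ _ ≫ fst _ _) (fst _ _ ≫ snd _ _) ≫ m) (snd _ _) := by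
          ext1
          · rw [whiskerRight_fst, lift_fst, ← comp_lift, lift_fst_snd, Category.comp_id]
          · simp
        have h₂ : (α_ E E E).hom ≫ E ◁ m =
            lift (fst _ _ ≫ fst _ _) (lift (fst _ _ ≫ snd _ _) (snd _ _) ≫ m) := by
          ext1
          · simp
          · rw [Category.assoc, whiskerLeft_snd, lift_snd, ← Category.assoc]
            congr 1
            ext1 <;> simp
        rw [h₁, assoc, ← Category.assoc, h₂] }
  have h₀ ⦃T : Over (Spec (.of k))⦄ (a : T ⟶ E) : (a ≫ i) * a = 1 := inv_mul a
  -- Applying `i` twice returns `a`: both are inverses of `a ≫ i`, one on the left and one on the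
  -- right. Hence left inverses are two-sided.
  have h₁ ⦃T : Over (Spec (.of k))⦄ (a : T ⟶ E) : a * (a ≫ i) = 1 := by
    have := left_inv_eq_right_inv (h₀ (a ≫ i)) (h₀ a)
    nth_rw 1 [← this]
    exact h₀ _
  refine ⟨{ i₀ with
    inv := i
    left_inv := ?_
    right_inv := ?_ }, fun _ _ _ ↦ rfl⟩
  · have := h₀ (𝟙 E)
    rwa [Category.id_comp] at this
  · have := h₁ (𝟙 E)
    rwa [Category.id_comp] at this

/-- Preservation of the unit is automatic between group objects, by cancellation. -/
lemma isMonHom_of_mul {M N : Over (Spec (.of k))} [GrpObj M] [GrpObj N] (f : M ⟶ N)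
    (h : ∀ ⦃T : Over (Spec (.of k))⦄ (a b : T ⟶ M), (a * b) ≫ f = (a ≫ f) * (b ≫ f)) :
    IsMonHom f where
  one_hom := by
    rw [MonObj.one_eq_one, MonObj.one_eq_one]
    have := h (1 : 𝟙_ _ ⟶ M) 1
    rwa [one_mul, left_eq_mul] at this
  mul_hom := by
    rw [MonObj.mul_eq_mul, h, MonObj.mul_eq_mul, MonObj.comp_mul]
    simp

/-! ### Extensions as torsors -/

namespace GmExt

variable {G : Over (Spec (.of k))} [GrpObj G] (A : GmExt G)

lemma exists_scalar : ∃ _ : ModObj (Gm k) A.E, ∀ ⦃T : Over (Spec (.of k))⦄ (t : T ⟶ Gm k)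
    (e : T ⟶ A.E), t • e = (t ≫ A.incl) * e :=
  exists_modObj _ (fun _ _ f t e ↦ by rw [MonObj.comp_mul, Category.assoc])
    (fun _ e ↦ by rw [MonObj.one_comp, one_mul])
    fun _ t r e ↦ by rw [MonObj.mul_comp, mul_assoc]

/-- The action of `𝔾ₘ` on the extension by multiplication. -/
instance scalar : ModObj (Gm k) A.E := A.exists_scalar.choose

variable {A} {T : Over (Spec (.of k))}

lemma smul_eq (t : T ⟶ Gm k) (e : T ⟶ A.E) : t • e = (t ≫ A.incl) * e :=
  A.exists_scalar.choose_spec t e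

lemma smul_mul (t : T ⟶ Gm k) (a b : T ⟶ A.E) : (t • a) * b = t • (a * b) := by
  rw [smul_eq, smul_eq, mul_assoc]

lemma mul_smul (t : T ⟶ Gm k) (a b : T ⟶ A.E) : a * (t • b) = t • (a * b) := by
  rw [smul_eq, smul_eq, ← mul_assoc, ← A.central, mul_assoc]

lemma smul_one (t : T ⟶ Gm k) : t • (1 : T ⟶ A.E) = t ≫ A.incl := by
  rw [smul_eq, mul_one]

lemma incl_quot (t : T ⟶ Gm k) : (t ≫ A.incl) ≫ A.quot = 1 := by
  rw [Category.assoc, A.isKernel.w, Hom.one_def, ← Category.assoc]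
  congr 1
  exact toUnit_unique _ _

lemma smul_quot (t : T ⟶ Gm k) (e : T ⟶ A.E) : (t • e) ≫ A.quot = e ≫ A.quot := by
  rw [smul_eq, MonObj.mul_comp, incl_quot, one_mul]

lemma existsUnique_incl (e : T ⟶ A.E) (h : e ≫ A.quot = 1) :
    ∃! t : T ⟶ Gm k, t ≫ A.incl = e := by
  refine ⟨A.isKernel.lift e (toUnit T) h, A.isKernel.lift_fst _ _ _, fun t ht ↦ ?_⟩
  refine A.isKernel.hom_ext ?_ ?_
  · rw [ht, A.isKernel.lift_fst]
  · exact toUnit_unique _ _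

variable (A) in
lemma isPseudoTorsor : IsPseudoTorsor A.quot where
  smul_proj _ := smul_quot
  trans T a b h := by
    obtain ⟨t, ht, hu⟩ := existsUnique_incl (b * a⁻¹) (by
      rw [MonObj.mul_comp, GrpObj.inv_comp, h, mul_inv_cancel])
    refine ⟨t, ?_, fun r hr ↦ hu r ?_⟩
    · dsimp only
      rw [smul_eq, ht, inv_mul_cancel_right]
    · dsimp only at hr ⊢
      rw [← hr, smul_eq, mul_inv_cancel_right]

variable (A) in
-- Faithful flatness alone provides sections after a flat cover; Zariski local ones come from
-- `IsPseudoTorsor.loc_section`, a form of Hilbert 90.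
lemma isTorsor [IsAffine G.left] : IsTorsor A.quot where
  toIsPseudoTorsor := A.isPseudoTorsor
  loc_section :=
    have := A.flat
    have := A.surjective
    A.isPseudoTorsor.loc_section

end GmExt

section

variable {G : Over (Spec (.of k))} [GrpObj G] [IsAffine G.left]

/-- A torsor with an associative multiplication which is compatible with the scalars and the
multiplication of the base is an extension. -/
theorem exists_gmExt {E : Over (Spec (.of k))} [ModObj (Gm k) E] {q : E ⟶ G} (hq : IsTorsor q)
    (m : E ⊗ E ⟶ E)
    (hm : ∀ ⦃T : Over (Spec (.of k))⦄ (a b : T ⟶ E), (lift a b ≫ m) ≫ q = (a ≫ q) * (b ≫ q))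
    (smul_left : ∀ ⦃T : Over (Spec (.of k))⦄ (t : T ⟶ Gm k) (a b : T ⟶ E),
      lift (t • a) b ≫ m = t • (lift a b ≫ m))
    (smul_right : ∀ ⦃T : Over (Spec (.of k))⦄ (t : T ⟶ Gm k) (a b : T ⟶ E),
      lift a (t • b) ≫ m = t • (lift a b ≫ m))
    (assoc : ∀ ⦃T : Over (Spec (.of k))⦄ (a b c : T ⟶ E),
      lift (lift a b ≫ m) c ≫ m = lift a (lift b c ≫ m) ≫ m) :
    ∃ (A : GmExt G) (f : A.E ≅ E), f.hom ≫ q = A.quot ∧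
      (∀ ⦃T : Over (Spec (.of k))⦄ (a b : T ⟶ A.E),
        (a * b) ≫ f.hom = lift (a ≫ f.hom) (b ≫ f.hom) ≫ m) ∧
      ∀ ⦃T : Over (Spec (.of k))⦄ (t : T ⟶ Gm k) (a : T ⟶ A.E),
        (t • a) ≫ f.hom = t • (a ≫ f.hom) := by
  have hn {T T' : Over (Spec (.of k))} (f : T' ⟶ T) (a b : T ⟶ E) :
      f ≫ lift a b ≫ m = lift (f ≫ a) (f ≫ b) ≫ m := by rw [← Category.assoc, comp_lift]
  -- Cancellation holds in the group `G`, so `a` and `a'` differ by a scalar, which freeness of the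
  -- action shows to be trivial.
  have inj_left {T : Over (Spec (.of k))} {a a' b : T ⟶ E} (h : lift a b ≫ m = lift a' b ≫ m) :
      a = a' := by
    have h' := congr($h ≫ q)
    rw [hm, hm, mul_left_inj] at h'
    obtain ⟨t, rfl, -⟩ := hq.trans a a' h'
    rw [smul_left] at h
    rw [← hq.smul_injective (t := 1) (r := t) (e := lift a b ≫ m) (by rwa [hom_one_smul]),
      hom_one_smul]
  have inj_right {T : Over (Spec (.of k))} {a b b' : T ⟶ E} (h : lift a b ≫ m = lift a b' ≫ m) :
      b = b' := by
    have h' := congr($h ≫ q)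
    rw [hm, hm, mul_right_inj] at h'
    obtain ⟨t, rfl, -⟩ := hq.trans b b' h'
    rw [smul_right] at h
    rw [← hq.smul_injective (t := 1) (r := t) (e := lift a b ≫ m) (by rwa [hom_one_smul]),
      hom_one_smul]
  -- A local lift of the quotient of `c` by `b` in `G` solves the equation up to a scalar, which is
  -- then corrected. Solutions are unique by cancellation, so they glue.
  have div {T : Over (Spec (.of k))} (b c : T ⟶ E) : ∃ a, lift a b ≫ m = c := by
    obtain ⟨a, ha⟩ := exists_glue (T := T) (Z := E) (fun T' j a ↦ lift a (j ≫ b) ≫ m = j ≫ c)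
      (fun T' T'' f h g e ↦ by rw [Category.assoc, Category.assoc, ← e, hn])
      (fun T' f h h' e e' ↦ inj_left (e.trans e'.symm))
      ((hq.loc_lift ((c ≫ q) * (b ≫ q)⁻¹)).mono fun T' j ⟨a, ha⟩ ↦ by
        obtain ⟨t, ht, -⟩ := hq.trans (lift a (j ≫ b) ≫ m) (j ≫ c) (by
          rw [hm, ha, MonObj.comp_mul, GrpObj.comp_inv]
          simp)
        exact ⟨t • a, by rw [smul_left, ht]⟩)
    refine ⟨a, hom_ext_loc ((hq.loc_lift ((c ≫ q) * (b ≫ q)⁻¹)).mono fun T' j ⟨x, hx⟩ ↦ ?_)⟩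
    obtain ⟨t, ht, -⟩ := hq.trans (lift x (j ≫ b) ≫ m) (j ≫ c) (by
      rw [hm, hx, MonObj.comp_mul, GrpObj.comp_inv]
      simp)
    have h : lift (t • x) (j ≫ b) ≫ m = j ≫ c := by rw [smul_left, ht]
    rw [hn, ha j _ h, h]
  have idem {T : Over (Spec (.of k))} {a : T ⟶ E} (ha : lift a a ≫ m = a) (b : T ⟶ E) :
      lift a b ≫ m = b := inj_right (a := a) (by rw [← assoc, ha])
  have idem' {T : Over (Spec (.of k))} {a : T ⟶ E} (ha : lift a a ≫ m = a) (b : T ⟶ E) :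
      lift b a ≫ m = b := inj_left (b := a) (by rw [assoc, ha])
  -- A solution of `a b = b` is idempotent, since `(a a) b = b = a b`. Idempotents are neutral by
  -- cancellation, therefore unique, so the local ones glue to the unit.
  have exId : Loc (𝟙_ (Over (Spec (.of k)))) fun T _ ↦ ∃ a : T ⟶ E, lift a a ≫ m = a :=
    (hq.loc_lift 1).mono fun T j ⟨b, _⟩ ↦ by
      obtain ⟨a, ha⟩ := div b b
      exact ⟨a, inj_left (b := b) (by rw [assoc, ha, ha])⟩
  have stabId {T T' : Over (Spec (.of k))} (g : T' ⟶ T) {a : T ⟶ E} (ha : lift a a ≫ m = a) :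
      lift (g ≫ a) (g ≫ a) ≫ m = g ≫ a := by rw [← hn, ha]
  obtain ⟨e, he⟩ := exists_glue (T := 𝟙_ _) (Z := E) (fun T' _ a ↦ lift a a ≫ m = a)
    (fun T' T'' f h g e ↦ stabId g e)
    (fun T' f h h' e e' ↦ (idem' e' h).symm.trans (idem e h')) exId
  have he' : lift e e ≫ m = e := hom_ext_loc (exId.mono fun T j ⟨a, ha⟩ ↦ by
    rw [hn, he j a ha, ha])
  have one_mul {T : Over (Spec (.of k))} (a : T ⟶ E) : lift (toUnit T ≫ e) a ≫ m = a :=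
    idem (stabId _ he') a
  obtain ⟨i, hi⟩ := div (𝟙 E) (toUnit E ≫ e)
  obtain ⟨grp, hmul⟩ := exists_grpObj m e i assoc (fun _ ↦ one_mul) (fun _ ↦ idem' (stabId _ he'))
    (fun T a ↦ by
      have := congr(a ≫ $hi)
      rw [hn, Category.comp_id, ← Category.assoc] at this
      rw [this]
      congr 1
      exact toUnit_unique _ _)
  have mul_left' {T : Over (Spec (.of k))} (t : T ⟶ Gm k) (a b : T ⟶ E) :
      (t • a) * b = t • (a * b) := by rw [hmul, smul_left, hmul]
  have mul_right' {T : Over (Spec (.of k))} (t : T ⟶ Gm k) (a b : T ⟶ E) :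
      a * (t • b) = t • (a * b) := by rw [hmul, smul_right, hmul]
  -- Scalars embed as their multiples of the unit element; simple transitivity of the action over
  -- the unit of `G` makes this the kernel.
  let incl : Gm k ⟶ E := 𝟙 (Gm k) • (1 : Gm k ⟶ E)
  have hincl {T : Over (Spec (.of k))} (t : T ⟶ Gm k) : t ≫ incl = t • (1 : T ⟶ E) := by
    rw [ModObj.comp_smul (X := E), Category.comp_id, MonObj.comp_one]
  have hincl' {T : Over (Spec (.of k))} (t : T ⟶ Gm k) (a : T ⟶ E) : (t ≫ incl) * a = t • a := by
    rw [hincl, mul_left', _root_.one_mul]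
  have hom_q : IsMonHom q := isMonHom_of_mul q fun T a b ↦ by rw [hmul, hm]
  let A : GmExt G :=
    { E := E
      grp := grp
      affine := by
        have := hq.isAffineHom
        exact isAffine_of_isAffineHom q.left
      incl := incl
      incl_hom := isMonHom_of_mul _ fun T s t ↦ by
        rw [hincl (s * t), hincl', hincl, hom_mul_smul]
      quot := q
      quot_hom := hom_q
      central := fun t a ↦ by rw [hincl', hincl, mul_right', mul_one]
      isKernel := by
        have h1 {T : Over (Spec (.of k))} (a : T ⟶ E) (b : T ⟶ 𝟙_ _) (h : a ≫ q = b ≫ η[G]) :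
            ∃! t : T ⟶ Gm k, t • (1 : T ⟶ E) = a := hq.trans 1 a (by
          rw [h, MonObj.one_comp, Hom.one_def]
          congr 1
          exact toUnit_unique _ _)
        refine ⟨⟨?_⟩, ⟨PullbackCone.IsLimit.mk _ (fun s ↦ (h1 _ _ s.condition).choose)
          (fun s ↦ ?_) (fun s ↦ toUnit_unique _ _) fun s t ht _ ↦ ?_⟩⟩
        · rw [hq.smul_proj, MonObj.one_comp, Hom.one_def]
        · rw [hincl]
          exact (h1 _ _ s.condition).choose_spec.1
        · exact (h1 _ _ s.condition).choose_spec.2 t (by rw [← ht, hincl])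
      flat := hq.flat
      surjective := hq.surjective }
  refine ⟨A, Iso.refl _, Category.id_comp _, fun T a b ↦ ?_, fun T t a ↦ ?_⟩
  · simp only [Iso.refl_hom, Category.comp_id]
    exact hmul _ _
  · rw [Iso.refl_hom, Category.comp_id, Category.comp_id, GmExt.smul_eq]
    exact hincl' _ _

/-- Isomorphisms of extensions may be defined locally, by relations between points. -/
theorem exists_extIso {A B : GmExt G}
    (R : ∀ ⦃T : Over (Spec (.of k))⦄, (T ⟶ A.E) → (T ⟶ B.E) → Prop)
    (stab : ∀ ⦃T T' : Over (Spec (.of k))⦄ (a : T ⟶ A.E) (b : T ⟶ B.E) (f : T' ⟶ T),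
      R a b → R (f ≫ a) (f ≫ b))
    (uniq : ∀ ⦃T : Over (Spec (.of k))⦄ (a : T ⟶ A.E) (b b' : T ⟶ B.E), R a b → R a b' → b = b')
    (ex : ∀ ⦃T : Over (Spec (.of k))⦄ (a : T ⟶ A.E), Loc T fun _ j ↦ ∃ b, R (j ≫ a) b)
    (mul : ∀ ⦃T : Over (Spec (.of k))⦄ (a a' : T ⟶ A.E) (b b' : T ⟶ B.E),
      R a b → R a' b' → R (a * a') (b * b'))
    (incl : ∀ ⦃T : Over (Spec (.of k))⦄ (t : T ⟶ Gm k), R (t ≫ A.incl) (t ≫ B.incl))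
    (quot : ∀ ⦃T : Over (Spec (.of k))⦄ (a : T ⟶ A.E) (b : T ⟶ B.E),
      R a b → b ≫ B.quot = a ≫ A.quot) : Ext1.mk A = Ext1.mk B := by
  obtain ⟨f, hf⟩ := exists_glue (T := A.E) (Z := B.E) (fun T a b ↦ R a b)
    (fun _ _ a b g h ↦ stab a b g h) (fun _ a b b' ↦ uniq a b b') (by simpa using ex (𝟙 A.E))
  have hmul ⦃T : Over (Spec (.of k))⦄ (a a' : T ⟶ A.E) : (a * a') ≫ f = (a ≫ f) * (a' ≫ f) :=
    hom_ext_loc (((ex a).and (ex a') (fun _ _ j g ⟨b, hb⟩ ↦ ⟨g ≫ b, by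
      rw [Category.assoc]; exact stab _ _ _ hb⟩) (fun _ _ j g ⟨b, hb⟩ ↦ ⟨g ≫ b, by
      rw [Category.assoc]; exact stab _ _ _ hb⟩)).mono fun T' j ⟨⟨b, hb⟩, b', hb'⟩ ↦ by
        rw [MonObj.comp_mul, ← Category.assoc, MonObj.comp_mul, hf _ _ (mul _ _ _ _ hb hb'),
          ← Category.assoc, ← Category.assoc, hf _ _ hb, hf _ _ hb'])
  have hincl ⦃T : Over (Spec (.of k))⦄ (t : T ⟶ Gm k) : (t ≫ A.incl) ≫ f = t ≫ B.incl :=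
    hf _ _ (incl t)
  have hquot : f ≫ B.quot = A.quot := hom_ext_loc ((ex (𝟙 A.E)).mono fun T j ⟨b, hb⟩ ↦ by
    rw [← Category.assoc, ← Category.comp_id j, ← quot _ _ hb, ← hf _ _ hb])
  have : IsIso f := A.isTorsor.isIso B.isTorsor f hquot fun T t a ↦ by
    rw [GmExt.smul_eq, GmExt.smul_eq, hmul, hincl]
  refine Quotient.sound ⟨asIso f, isMonHom_of_mul f hmul, ?_, hquot⟩
  simpa using hincl (𝟙 _)

end

end

section

open LineBundle

/-! ### Sums of extensions -/

namespace GmExt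

section

variable {G : Over (Spec (.of k))} [GrpObj G] {A B C : GmExt G}

lemma smul_mul_smul {T : Over (Spec (.of k))} (t r : T ⟶ Gm k) (a b : T ⟶ A.E) :
    (t • a) * (r • b) = (t * r) • (a * b) := by
  rw [smul_mul, mul_smul, hom_mul_smul]

/-- A relation which expresses that the points of `C` are the sums of points of `A` and `B`. -/
structure IsSum (A B C : GmExt G) (R : ∀ ⦃T : Over (Spec (.of k))⦄,
    (T ⟶ A.E) → (T ⟶ B.E) → (T ⟶ C.E) → Prop) : Prop where
  comp : ∀ ⦃T T' : Over (Spec (.of k))⦄ {a : T ⟶ A.E} {b : T ⟶ B.E} {c : T ⟶ C.E} (f : T' ⟶ T),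
    R a b c → R (f ≫ a) (f ≫ b) (f ≫ c)
  mul : ∀ ⦃T : Over (Spec (.of k))⦄ {a a' : T ⟶ A.E} {b b' : T ⟶ B.E} {c c' : T ⟶ C.E},
    R a b c → R a' b' c' → R (a * a') (b * b') (c * c')
  incl : ∀ ⦃T : Over (Spec (.of k))⦄ (s t : T ⟶ Gm k),
    R (s ≫ A.incl) (t ≫ B.incl) ((s * t) ≫ C.incl)
  left : ∀ ⦃T : Over (Spec (.of k))⦄ {a : T ⟶ A.E} {b : T ⟶ B.E} {c : T ⟶ C.E},
    R a b c → a ≫ A.quot = c ≫ C.quot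
  right : ∀ ⦃T : Over (Spec (.of k))⦄ {a : T ⟶ A.E} {b : T ⟶ B.E} {c : T ⟶ C.E},
    R a b c → b ≫ B.quot = c ≫ C.quot
  uniq : ∀ ⦃T : Over (Spec (.of k))⦄ {a : T ⟶ A.E} {b : T ⟶ B.E} {c c' : T ⟶ C.E},
    R a b c → R a b c' → c = c'
  ex : ∀ ⦃T : Over (Spec (.of k))⦄ (a : T ⟶ A.E) (b : T ⟶ B.E), a ≫ A.quot = b ≫ B.quot →
    ∃ c, R a b c

/-- The relation is the graph of the map out of `A ×_G B`; conversely existence and uniqueness of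
the value make it a natural operation on points. Relations are more convenient because they need no
proofs that points lie over the same point of `G`. -/
lemma isBaerSum_iff : IsBaerSum A B C ↔ ∃ R, IsSum A B C R := by
  constructor
  · rintro ⟨β, hq, hm, hi⟩
    refine ⟨fun T a b c ↦ ∃ h, app β a b h = c, ?_, ?_, ?_, ?_, ?_, ?_, fun T a b h ↦ ⟨_, h, rfl⟩⟩
    · rintro T T' a b _ f ⟨h, rfl⟩
      exact ⟨by simp [h], (comp_app _ _ _ _ _).symm⟩
    · rintro T a a' b b' _ _ ⟨h, rfl⟩ ⟨h', rfl⟩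
      exact ⟨_, hm a a' b b' h h'⟩
    · exact fun T s t ↦ ⟨_, hi s t⟩
    · rintro T a b _ ⟨h, rfl⟩
      rw [app, Category.assoc, hq, pullback.lift_fst_assoc]
    · rintro T a b _ ⟨h, rfl⟩
      rw [app, Category.assoc, hq, pullback.lift_fst_assoc, h]
    · rintro T a b _ _ ⟨h, rfl⟩ ⟨h', rfl⟩
      rfl
  · rintro ⟨R, hR⟩
    choose φ hφ using hR.ex
    obtain ⟨β, hβ⟩ := exists_app φ fun T T' f a b h ↦
      hR.uniq (hR.comp f (hφ a b h)) (hφ (f ≫ a) (f ≫ b) _)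
    have hβR ⦃T : Over (Spec (.of k))⦄ (a : T ⟶ A.E) (b : T ⟶ B.E) (h : a ≫ A.quot = b ≫ B.quot) :
        R a b (app β a b h) := by
      rw [hβ]
      exact hφ a b h
    refine ⟨β, ?_, fun a a' b b' h h' ↦ hR.uniq (hβR _ _ _) (hR.mul (hβR _ _ h) (hβR _ _ h')),
      fun s t ↦ hR.uniq (hβR _ _ _) (hR.incl s t)⟩
    have := hR.left (hβR (pullback.fst A.quot B.quot) (pullback.snd _ _) pullback.condition)
    rw [this, app]
    congr 1
    exact (Category.id_comp _).symm.trans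
      (congrArg (· ≫ β) (pullback.hom_ext (by simp) (by simp)))

namespace IsSum

variable {R : ∀ ⦃T : Over (Spec (.of k))⦄, (T ⟶ A.E) → (T ⟶ B.E) → (T ⟶ C.E) → Prop}
  (h : IsSum A B C R) {T : Over (Spec (.of k))}
include h

lemma swap : IsSum B A C (fun _ b a c ↦ R a b c) where
  comp _ _ _ _ _ f h' := h.comp f h'
  mul _ _ _ _ _ _ _ h₁ h₂ := h.mul h₁ h₂
  incl _ s t := by
    rw [mul_comm]
    exact h.incl t s
  left _ _ _ _ h' := h.right h'
  right _ _ _ _ h' := h.left h'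
  uniq _ _ _ _ _ h₁ h₂ := h.uniq h₁ h₂
  ex _ b a h' := h.ex a b h'.symm

lemma smul {a : T ⟶ A.E} {b : T ⟶ B.E} {c : T ⟶ C.E} (h' : R a b c) (t r : T ⟶ Gm k) :
    R (t • a) (r • b) ((t * r) • c) := by
  rw [smul_eq, smul_eq, smul_eq]
  exact h.mul (h.incl t r) h'

/-- Scaling the two summands by `t` and `r` scales the sum by `t * r`. The sum is unchanged, so `r`
is the inverse of `t`. -/
lemma inj {a a' : T ⟶ A.E} {b b' : T ⟶ B.E} {c : T ⟶ C.E} (h₁ : R a b c) (h₂ : R a' b' c) :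
    ∃ t : T ⟶ Gm k, a' = t • a ∧ b' = t⁻¹ • b := by
  obtain ⟨t, rfl, -⟩ := A.isPseudoTorsor.trans a a' ((h.left h₁).trans (h.left h₂).symm)
  obtain ⟨r, rfl, -⟩ := B.isPseudoTorsor.trans b b' ((h.right h₁).trans (h.right h₂).symm)
  refine ⟨t, rfl, ?_⟩
  have e := h.uniq h₂ (h.smul h₁ t r)
  have := (C.isPseudoTorsor.trans c c rfl).unique (hom_one_smul c) e.symm
  rw [eq_inv_of_mul_eq_one_right this.symm]

lemma cancel {a a' : T ⟶ A.E} {b : T ⟶ B.E} {c : T ⟶ C.E} (h₁ : R a b c) (h₂ : R a' b c) :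
    a = a' := by
  obtain ⟨t, rfl, ht⟩ := h.inj h₁ h₂
  have := (B.isPseudoTorsor.trans b b rfl).unique (hom_one_smul b) ht.symm
  rw [eq_inv_iff_mul_eq_one, one_mul] at this
  rw [this, hom_one_smul]

variable [IsAffine G.left]

lemma loc (c : T ⟶ C.E) : Loc T fun _ j ↦ ∃ a b, R a b (j ≫ c) := by
  refine ((A.isTorsor.loc_lift (c ≫ C.quot)).and (B.isTorsor.loc_lift (c ≫ C.quot)) ?_ ?_).mono ?_
  · exact fun _ _ j g ⟨a, ha⟩ ↦ ⟨g ≫ a, by rw [Category.assoc, ha, Category.assoc]⟩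
  · exact fun _ _ j g ⟨a, ha⟩ ↦ ⟨g ≫ a, by rw [Category.assoc, ha, Category.assoc]⟩
  · rintro T' j ⟨⟨a, ha⟩, b, hb⟩
    obtain ⟨c', hc'⟩ := h.ex a b (ha.trans hb.symm)
    obtain ⟨t, ht, -⟩ := C.isPseudoTorsor.trans c' (j ≫ c) (by
      rw [← h.left hc', ha, Category.assoc])
    refine ⟨t • a, (1 : T' ⟶ Gm k) • b, ?_⟩
    have := h.smul hc' t 1
    rwa [mul_one, ht] at this

/-- In a sum, the first summand exists if the second one and the sum are given. -/
lemma exists_left (b : T ⟶ B.E) (c : T ⟶ C.E) (hbc : b ≫ B.quot = c ≫ C.quot) :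
    ∃ a, R a b c := by
  have loc : Loc T fun _ j ↦ ∃ a, R a (j ≫ b) (j ≫ c) := (h.loc c).mono fun T' j ⟨a, b', hab⟩ ↦ by
    obtain ⟨t, ht, -⟩ := B.isPseudoTorsor.trans b' (j ≫ b) (by
      rw [h.right hab, Category.assoc, Category.assoc, hbc])
    refine ⟨t⁻¹ • a, ?_⟩
    have := h.smul hab t⁻¹ t
    rwa [inv_mul_cancel, hom_one_smul, ht] at this
  obtain ⟨a, ha⟩ := exists_glue (T := T) (Z := A.E) (fun T' j a ↦ R a (j ≫ b) (j ≫ c))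
    (fun T' T'' f a g e ↦ by
      rw [Category.assoc, Category.assoc]
      exact h.comp g e)
    (fun T' f a a' e e' ↦ h.cancel e e') loc
  obtain ⟨c', hc'⟩ := h.ex a b (by
    rw [hbc]
    refine hom_ext_loc (loc.mono fun T' j ⟨a', ha'⟩ ↦ ?_)
    rw [← Category.assoc, ha j a' ha', h.left ha', Category.assoc])
  have : c' = c := hom_ext_loc (loc.mono fun T' j ⟨a', ha'⟩ ↦ by
    refine h.uniq (h.comp j hc') ?_
    rwa [ha j a' ha'])
  exact ⟨a, this ▸ hc'⟩

end IsSum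

end

section

variable {G : Over (Spec (.of k))} [GrpObj G] [IsAffine G.left]

/-- A family of equivariant maps is given by its value at a section. -/
lemma exists_relFam {A B : GmExt G} {T : Over (Spec (.of k))} (a : T ⟶ A.E) (b : T ⟶ B.E)
    (hab : a ≫ A.quot = b ≫ B.quot) {g : T ⟶ G} (hg : a ≫ A.quot = g) :
    ∃ φ : RelFam A.quot (fun T (a : T ⟶ A.E) (b : T ⟶ B.E) ↦ a ≫ A.quot = b ≫ B.quot) g,
      ∀ h, φ.val (𝟙 T) a h = b := by
  subst hg
  have ex ⦃T' : Over (Spec (.of k))⦄ (s : T' ⟶ T) (q : T' ⟶ A.E) (h : q ≫ A.quot = s ≫ a ≫ A.quot) :=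
    A.isPseudoTorsor.trans (s ≫ a) q (by rw [h, Category.assoc])
  choose t ht hu using ex
  dsimp only at hu ht
  refine ⟨⟨fun T' s q h ↦ t s q h • (s ≫ b), fun T' T'' f s q h ↦ ?_, fun T' s r q h h' ↦ ?_,
    fun T' s q h ↦ ?_⟩, fun h ↦ ?_⟩
  -- The point `q` is a unique multiple `t • a`, and its value is declared to be `t • b`; uniqueness
  -- of `t` yields naturality here and equivariance next.
  · rw [ModObj.comp_smul (X := B.E), ← Category.assoc f s b]
    congr 1
    refine hu _ _ _ _ ?_
    conv_rhs => rw [← ht s q h, ModObj.comp_smul (X := A.E), ← Category.assoc f s a]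
  · rw [← hom_mul_smul]
    congr 1
    refine (hu _ _ _ _ ?_).symm
    rw [hom_mul_smul, ht]
  · rw [h, smul_quot, Category.assoc, hab]
  · dsimp only
    rw [← hu (𝟙 T) a h 1 (by rw [hom_one_smul, Category.id_comp]), hom_one_smul, Category.id_comp]

/-- The difference of extensions. -/
theorem exists_sub (A B : GmExt G) : ∃ C R, IsSum C A B R := by
  -- The fibre of the difference over a point of `G` consists of the equivariant maps from the fibre
  -- of `A` to that of `B`.
  let K : ∀ ⦃T : Over (Spec (.of k))⦄, (T ⟶ A.E) → (T ⟶ B.E) → Prop :=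
    fun T a b ↦ a ≫ A.quot = b ≫ B.quot
  obtain ⟨E, i, c, e, hc, smul_val, H⟩ := exists_torsor (p := A.quot) (K := K)
    (fun _ _ _ ↦ smul_quot _ _)
    (fun T a b h ↦ hom_ext_loc (h.mono fun T' j hj ↦ by simpa [K] using hj))
    (fun T a b t h ↦ h.trans (smul_quot _ _).symm)
    (((A.isTorsor.loc_section).and B.isTorsor.loc_section (stab_section _) (stab_section _)).mono
      fun T j ⟨⟨a, ha⟩, b, hb⟩ ↦ by
        obtain ⟨φ, -⟩ := exists_relFam a b (ha.trans hb.symm) ha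
        exact ⟨φ⟩)
    (fun T g φ ψ ↦ by
      -- The ratio of two such maps does not depend on the point of the fibre, so the local ratios
      -- glue to a scalar on `T`.
      have key {T' : Over (Spec (.of k))} (s : T' ⟶ T) (a a' : T' ⟶ A.E) (h : a ≫ A.quot = s ≫ g)
          (h' : a' ≫ A.quot = s ≫ g) (t : T' ⟶ Gm k) (ht : t • φ.val s a h = ψ.val s a h) :
          t • φ.val s a' h' = ψ.val s a' h' := by
        obtain ⟨r, rfl, -⟩ := A.isPseudoTorsor.trans a a' (h.trans h'.symm)
        rw [φ.smul s r a h, ψ.smul s r a h, smul_smul_comm, ht]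
      have ex {T' : Over (Spec (.of k))} (s : T' ⟶ T) (a : T' ⟶ A.E) (h : a ≫ A.quot = s ≫ g) :=
        B.isPseudoTorsor.trans (φ.val s a h) (ψ.val s a h) ((φ.rel s a h).symm.trans (ψ.rel s a h))
      obtain ⟨t, ht⟩ := exists_glue (T := T) (Z := Gm k)
        (fun T' j t ↦ ∃ a h, t • φ.val j a h = ψ.val j a h)
        (fun T' T'' f t g' ⟨a, h, e⟩ ↦ ⟨g' ≫ a, by rw [Category.assoc, h, Category.assoc], by
          rw [← φ.nat g' f a h, ← ψ.nat g' f a h, ← e, ModObj.comp_smul (X := B.E)]⟩)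
        (fun T' f t t' ⟨a, h, e⟩ ⟨a', h', e'⟩ ↦ (ex f a h).unique e (key f a' a h' h t' e'))
        ((A.isTorsor.loc_lift g).mono fun T' j ⟨a, h⟩ ↦ ⟨_, a, h, (ex j a h).choose_spec.1⟩)
      refine ⟨t, fun T' s a h ↦ ?_, fun t' ht' ↦ ?_⟩
      · obtain ⟨r, hr, -⟩ := ex s a h
        rw [ht s r ⟨a, h, hr⟩, hr]
      · refine hom_ext_loc ((A.isTorsor.loc_lift g).mono fun T' j ⟨a, h⟩ ↦ ?_)
        exact (ht j _ ⟨a, h, (ht' j a h).symm⟩).symm)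
  let R : ∀ ⦃T : Over (Spec (.of k))⦄, (T ⟶ E) → (T ⟶ A.E) → (T ⟶ B.E) → Prop :=
    fun T x a b ↦ ∃ h, e.val x a h = b
  have Rcomp ⦃T T' : Over (Spec (.of k))⦄ {x : T ⟶ E} {a : T ⟶ A.E} {b : T ⟶ B.E} (f : T' ⟶ T) :
      R x a b → R (f ≫ x) (f ≫ a) (f ≫ b) := by
    rintro ⟨h, rfl⟩
    exact ⟨by simp [h], (e.nat f x a h).symm⟩
  have Rleft ⦃T : Over (Spec (.of k))⦄ {x : T ⟶ E} {a : T ⟶ A.E} {b : T ⟶ B.E} :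
      R x a b → a ≫ A.quot = x ≫ c := fun ⟨h, _⟩ ↦ h
  have Rright ⦃T : Over (Spec (.of k))⦄ {x : T ⟶ E} {a : T ⟶ A.E} {b : T ⟶ B.E} :
      R x a b → b ≫ B.quot = x ≫ c := by
    rintro ⟨h, rfl⟩
    rw [← h, e.rel x a h]
  have Rsmul ⦃T : Over (Spec (.of k))⦄ {x : T ⟶ E} {a : T ⟶ A.E} {b : T ⟶ B.E} (r t : T ⟶ Gm k) :
      R x a b → R (r • x) (t • a) ((r * t) • b) := by
    rintro ⟨h, rfl⟩
    have h₁ : (t • a) ≫ A.quot = x ≫ c := (smul_quot _ _).trans h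
    refine ⟨h₁.trans (hc.smul_proj _ _).symm, ?_⟩
    rw [smul_val r x (t • a) h₁, e.smul x t a h, hom_mul_smul]
  have Runiq ⦃T : Over (Spec (.of k))⦄ {x x' : T ⟶ E} {a : T ⟶ A.E} {b : T ⟶ B.E} (h : R x a b)
      (h' : R x' a b) : x = x' := by
    obtain ⟨t, rfl, -⟩ := hc.trans x x' ((Rleft h).symm.trans (Rleft h'))
    obtain ⟨_, e₁⟩ := Rsmul t 1 h
    obtain ⟨_, e₂⟩ := h'
    rw [e.val_congr rfl (hom_one_smul a), e₂, mul_one] at e₁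
    rw [B.isTorsor.smul_injective (t := t) (r := 1) (e := b) (by rw [← e₁, hom_one_smul]),
      hom_one_smul]
  have Rex ⦃T : Over (Spec (.of k))⦄ (a : T ⟶ A.E) (b : T ⟶ B.E) (h : a ≫ A.quot = b ≫ B.quot) :
      ∃ x, R x a b := by
    obtain ⟨φ, hφ⟩ := exists_relFam a b h rfl
    obtain ⟨f, ⟨hf, hf'⟩, -⟩ := H _ φ
    refine ⟨f, hf.symm, ?_⟩
    rw [e.val_congr (Category.id_comp f).symm rfl hf.symm, hf' (𝟙 T) a (by simp), hφ]
  have Rinj ⦃T : Over (Spec (.of k))⦄ {x : T ⟶ E} {a a' : T ⟶ A.E} {b b' : T ⟶ B.E} (h : R x a b)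
      (h' : R x a' b') : ∃ t : T ⟶ Gm k, a' = t • a ∧ b' = t • b := by
    obtain ⟨t, rfl, -⟩ := A.isPseudoTorsor.trans a a' ((Rleft h).trans (Rleft h').symm)
    refine ⟨t, rfl, ?_⟩
    obtain ⟨h₁, rfl⟩ := h
    obtain ⟨h₂, rfl⟩ := h'
    exact e.smul x t a h₁ h₂
  have Rloc ⦃T : Over (Spec (.of k))⦄ (x : T ⟶ E) : Loc T fun _ j ↦ ∃ a b, R (j ≫ x) a b :=
    (A.isTorsor.loc_lift (x ≫ c)).mono fun T j ⟨a, ha⟩ ↦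
      ⟨a, _, by rw [ha, Category.assoc], rfl⟩
  have Rstab ⦃T : Over (Spec (.of k))⦄ (x : T ⟶ E) :
      Stab fun T' (j : T' ⟶ T) ↦ ∃ a b, R (j ≫ x) a b := fun _ _ j g ⟨a, b, hab⟩ ↦
    ⟨g ≫ a, g ≫ b, by rw [Category.assoc]; exact Rcomp g hab⟩
  -- The product of the maps `a ↦ b` and `a' ↦ b'` is the map `a a' ↦ b b'`. Other representatives
  -- scale source and target by the same unit, because the scalars are central.
  obtain ⟨m, hm⟩ := exists_glue (T := E ⊗ E) (Z := E)
    (fun T j x ↦ ∃ a b a' b', R (j ≫ fst _ _) a b ∧ R (j ≫ snd _ _) a' b' ∧ R x (a * a') (b * b'))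
    (fun T T' f x g ⟨a, b, a', b', h, h', h''⟩ ↦ ⟨g ≫ a, g ≫ b, g ≫ a', g ≫ b', by
      rw [Category.assoc]; exact Rcomp g h, by rw [Category.assoc]; exact Rcomp g h', by
      rw [← MonObj.comp_mul, ← MonObj.comp_mul]; exact Rcomp g h''⟩)
    (fun T f x x' ⟨a₁, b₁, a₂, b₂, h, h', h''⟩ ⟨_, _, _, _, i, i', i''⟩ ↦ by
      obtain ⟨t, rfl, rfl⟩ := Rinj h i
      obtain ⟨r, rfl, rfl⟩ := Rinj h' i'
      have := Rsmul 1 (t * r) h''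
      rw [hom_one_smul, one_mul, ← smul_mul_smul, ← smul_mul_smul] at this
      exact Runiq this i'')
    (((Rloc (fst E E)).and (Rloc (snd E E)) (Rstab _) (Rstab _)).mono
      fun T j ⟨⟨a, b, h⟩, a', b', h'⟩ ↦ by
        obtain ⟨x, hx⟩ := Rex (a * a') (b * b') (by
          rw [MonObj.mul_comp, MonObj.mul_comp, Rleft h, Rleft h', Rright h, Rright h'])
        exact ⟨x, a, b, a', b', h, h', hx⟩)
  have Rmul ⦃T : Over (Spec (.of k))⦄ {x x' : T ⟶ E} {a a' : T ⟶ A.E} {b b' : T ⟶ B.E}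
      (h : R x a b) (h' : R x' a' b') : R (lift x x' ≫ m) (a * a') (b * b') := by
    obtain ⟨y, hy⟩ := Rex (a * a') (b * b') (by
      rw [MonObj.mul_comp, MonObj.mul_comp, Rleft h, Rleft h', Rright h, Rright h'])
    rwa [hm (lift x x') y ⟨a, b, a', b', by rwa [lift_fst], by rwa [lift_snd], hy⟩]
  have hn {T T' : Over (Spec (.of k))} (f : T' ⟶ T) (a b : T ⟶ E) :
      f ≫ lift a b ≫ m = lift (f ≫ a) (f ≫ b) ≫ m := by rw [← Category.assoc, comp_lift]
  obtain ⟨C, f, hfq, hfm, hfs⟩ := exists_gmExt hc m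
    (fun T x y ↦ hom_ext_loc (((Rloc x).and (Rloc y) (Rstab _) (Rstab _)).mono
      fun T' j ⟨⟨a, b, h⟩, a', b', h'⟩ ↦ by
        rw [← Category.assoc, hn, ← Rleft (Rmul h h'), MonObj.mul_comp, Rleft h, Rleft h',
          MonObj.comp_mul, Category.assoc, Category.assoc]))
    (fun T t x y ↦ hom_ext_loc (((Rloc x).and (Rloc y) (Rstab _) (Rstab _)).mono
      fun T' j ⟨⟨a, b, h⟩, a', b', h'⟩ ↦ by
        rw [hn, ModObj.comp_smul (X := E), ModObj.comp_smul (X := E), hn]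
        have := Rmul (Rsmul (j ≫ t) 1 h) h'
        rw [mul_one, hom_one_smul, smul_mul] at this
        refine Runiq this ?_
        have := Rsmul (j ≫ t) 1 (Rmul h h')
        rwa [mul_one, hom_one_smul] at this))
    (fun T t x y ↦ hom_ext_loc (((Rloc x).and (Rloc y) (Rstab _) (Rstab _)).mono
      fun T' j ⟨⟨a, b, h⟩, a', b', h'⟩ ↦ by
        rw [hn, ModObj.comp_smul (X := E), ModObj.comp_smul (X := E), hn]
        have := Rmul h (Rsmul (j ≫ t) 1 h')
        rw [mul_one, hom_one_smul, mul_smul] at this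
        refine Runiq this ?_
        have := Rsmul (j ≫ t) 1 (Rmul h h')
        rwa [mul_one, hom_one_smul] at this))
    (fun T x y z ↦ hom_ext_loc (((Rloc x).and ((Rloc y).and (Rloc z) (Rstab _) (Rstab _)) (Rstab _)
      fun _ _ j g h ↦ ⟨Rstab _ _ _ h.1, Rstab _ _ _ h.2⟩).mono
      fun T' j ⟨⟨a, b, h⟩, ⟨a', b', h'⟩, a'', b'', h''⟩ ↦ by
        rw [hn, hn, hn, hn]
        have := Rmul (Rmul h h') h''
        rw [mul_assoc, mul_assoc] at this
        exact Runiq this (Rmul h (Rmul h' h''))))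
  have hfR ⦃T : Over (Spec (.of k))⦄ (x : T ⟶ C.E) : (x ≫ f.hom) ≫ c = x ≫ C.quot := by
    rw [Category.assoc, hfq]
  refine ⟨C, fun T x a b ↦ R (x ≫ f.hom) a b, fun T T' x a b g h ↦ ?_, fun T x x' a a' b b' h h' ↦ ?_,
    fun T s t ↦ ?_, fun T x a b h ↦ ?_, fun T x a b h ↦ ?_, fun T x a b b' h h' ↦ ?_,
    fun T x a h ↦ ?_⟩
  · rw [Category.assoc]
    exact Rcomp g h
  · rw [hfm]
    exact Rmul h h'
  -- The map which sends `1` to `1` is idempotent for the multiplication, hence is the unit of the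
  -- group.
  · have h₁ : R ((1 : T ⟶ C.E) ≫ f.hom) 1 1 := by
      obtain ⟨x, hx⟩ := Rex (1 : T ⟶ A.E) (1 : T ⟶ B.E) (by
        rw [MonObj.one_comp, MonObj.one_comp])
      have hxx := Rmul hx hx
      rw [one_mul, one_mul] at hxx
      have h₂ : x ≫ f.inv = 1 := by
        have : x ≫ f.inv * x ≫ f.inv = x ≫ f.inv := by
          rw [← cancel_mono f.hom, hfm]
          simpa using Runiq hxx hx
        exact mul_eq_left.1 this
      rw [← h₂]
      simpa using hx
    rw [← smul_one, ← smul_one, ← smul_one, hfs]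
    exact Rsmul s t h₁
  · rw [← hfR, Rright h]
  · rw [Rleft h, Rright h]
  · obtain ⟨_, rfl⟩ := h
    obtain ⟨_, rfl⟩ := h'
    rfl
  · exact ⟨_, by rw [← h, hfR], rfl⟩

end

end GmExt

end

/-! ### The group of extensions -/

section

open LineBundle

namespace GmExt

section

variable {G : Over (Spec (.of k))} [GrpObj G]

/-- The extension with the inclusion of `𝔾ₘ` composed with the inversion. -/
def neg (A : GmExt G) : GmExt G where
  E := A.E
  incl := ι[Gm k] ≫ A.incl
  incl_hom := isMonHom_of_mul _ fun T s t ↦ by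
    simp only [← Category.assoc, ← Hom.inv_def]
    rw [mul_inv, MonObj.mul_comp]
  quot := A.quot
  central t e := by
    rw [← Category.assoc]
    exact A.central _ _
  isKernel := by
    refine ⟨⟨?_⟩, ⟨PullbackCone.IsLimit.mk _
      (fun s ↦ (A.isKernel.lift s.fst s.snd s.condition)⁻¹) (fun s ↦ ?_)
      (fun s ↦ toUnit_unique _ _) fun s t ht _ ↦ ?_⟩⟩
    · rw [Category.assoc, A.isKernel.w, ← Category.assoc]
      congr 1
      exact toUnit_unique _ _
    · rw [← Category.assoc, ← Hom.inv_def, inv_inv, A.isKernel.lift_fst]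
    · rw [← Category.assoc, ← Hom.inv_def] at ht
      rw [← inv_eq_iff_eq_inv]
      refine A.isKernel.hom_ext ?_ (toUnit_unique _ _)
      rw [ht, A.isKernel.lift_fst]
  flat := A.flat
  surjective := A.surjective

/-- A splitting of an extension, as a retraction of the inclusion of `𝔾ₘ`. -/
structure IsSplit (A : GmExt G) (σ : A.E ⟶ Gm k) : Prop where
  mul : ∀ ⦃T : Over (Spec (.of k))⦄ (a b : T ⟶ A.E), (a * b) ≫ σ = (a ≫ σ) * (b ≫ σ)
  incl : ∀ ⦃T : Over (Spec (.of k))⦄ (t : T ⟶ Gm k), (t ≫ A.incl) ≫ σ = t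

lemma IsSplit.smul {A : GmExt G} {σ : A.E ⟶ Gm k} (h : IsSplit A σ) {T : Over (Spec (.of k))}
    (t : T ⟶ Gm k) (a : T ⟶ A.E) : (t • a) ≫ σ = t * (a ≫ σ) := by
  rw [smul_eq, h.mul, h.incl]

lemma IsSplit.congr {A B : GmExt G} {σ : A.E ⟶ Gm k} (h : IsSplit A σ)
    (e : Ext1.mk A = Ext1.mk B) : ∃ τ, IsSplit B τ := by
  obtain ⟨f, hf, hi, hq⟩ := Quotient.exact e
  refine ⟨f.inv ≫ σ, fun T a b ↦ ?_, fun T t ↦ ?_⟩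
  · rw [← Category.assoc, MonObj.mul_comp, h.mul, Category.assoc, Category.assoc]
  · rw [← hi]
    simpa using h.incl t

variable [IsAffine G.left]

/-- The retraction together with the projection to `G` identifies a split extension with `𝔾ₘ × G`;
points with the same two components are matched. -/
lemma IsSplit.mk_eq {A B : GmExt G} {σ : A.E ⟶ Gm k} {τ : B.E ⟶ Gm k} (hA : IsSplit A σ)
    (hB : IsSplit B τ) : Ext1.mk A = Ext1.mk B := by
  refine exists_extIso (fun T a b ↦ b ≫ B.quot = a ≫ A.quot ∧ b ≫ τ = a ≫ σ)
    (fun T T' a b f ⟨h, h'⟩ ↦ ⟨by simp [h], by simp [h']⟩) (fun T a b b' ⟨h, h'⟩ ⟨i, i'⟩ ↦ ?_)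
    (fun T a ↦ (B.isTorsor.loc_lift (a ≫ A.quot)).mono fun T' j ⟨b, hb⟩ ↦ ?_)
    (fun T a a' b b' ⟨h, h'⟩ ⟨i, i'⟩ ↦ ?_) (fun T t ↦ ?_) fun T a b h ↦ h.1
  · obtain ⟨t, rfl, -⟩ := B.isPseudoTorsor.trans b b' (h.trans i.symm)
    rw [hB.smul, ← h', mul_eq_right] at i'
    rw [i', hom_one_smul]
  · refine ⟨((j ≫ a) ≫ σ * (b ≫ τ)⁻¹) • b, ?_, ?_⟩
    · rw [smul_quot, hb, Category.assoc]
    · rw [hB.smul, inv_mul_cancel_right]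
  · rw [MonObj.mul_comp, MonObj.mul_comp, h, i, hA.mul, hB.mul, h', i']
    exact ⟨rfl, rfl⟩
  · rw [incl_quot, incl_quot, hA.incl, hB.incl]
    exact ⟨rfl, rfl⟩

variable (G) in
lemma exists_isSplit : ∃ (O : GmExt G) (σ : O.E ⟶ Gm k), IsSplit O σ := by
  obtain ⟨i, hi⟩ := exists_modObj (M := Gm k) (E := Gm k ⊗ G)
    (fun T t x ↦ lift (t * x ≫ fst _ _) (x ≫ snd _ _))
    (fun T T' f t x ↦ by rw [comp_lift, MonObj.comp_mul, Category.assoc, Category.assoc])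
    (fun T x ↦ by
      rw [one_mul]
      exact CartesianMonoidalCategory.hom_ext _ _ (by simp) (by simp))
    (fun T s t x ↦ by rw [lift_fst, lift_snd, mul_assoc])
  have hq : IsTorsor (snd (Gm k) G) := by
    refine ⟨⟨fun T t x ↦ by rw [hi, lift_snd], fun T x y h ↦ ⟨(y ≫ fst _ _) * (x ≫ fst _ _)⁻¹, ?_,
      fun t ht ↦ ?_⟩⟩, Loc.of_forall ⟨lift 1 (𝟙 _), by simp⟩ (stab_section _)⟩
    · dsimp only
      rw [hi, inv_mul_cancel_right, h]
      exact CartesianMonoidalCategory.hom_ext _ _ (by simp) (by simp)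
    · dsimp only at ht
      rw [← ht, hi, lift_fst, mul_inv_cancel_right]
  let m : (Gm k ⊗ G) ⊗ (Gm k ⊗ G) ⟶ Gm k ⊗ G :=
    lift (fst _ _ ≫ fst _ _ * snd _ _ ≫ fst _ _) (fst _ _ ≫ snd _ _ * snd _ _ ≫ snd _ _)
  have hm ⦃T : Over (Spec (.of k))⦄ (a b : T ⟶ Gm k ⊗ G) : lift a b ≫ m =
      lift (a ≫ fst _ _ * b ≫ fst _ _) (a ≫ snd _ _ * b ≫ snd _ _) := by
    rw [comp_lift, MonObj.comp_mul, MonObj.comp_mul]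
    simp only [lift_fst_assoc, lift_snd_assoc]
  obtain ⟨O, f, hfq, hfm, hfs⟩ := exists_gmExt hq m (fun T a b ↦ by rw [hm, lift_snd])
    (fun T t a b ↦ by simp only [hm, hi, lift_fst, lift_snd, mul_assoc])
    (fun T t a b ↦ by simp only [hm, hi, lift_fst, lift_snd, mul_left_comm])
    (fun T a b c ↦ by simp only [hm, lift_fst, lift_snd, mul_assoc])
  have hmul ⦃T : Over (Spec (.of k))⦄ (a b : T ⟶ O.E) :
      (a * b) ≫ f.hom ≫ fst _ _ = (a ≫ f.hom ≫ fst _ _) * (b ≫ f.hom ≫ fst _ _) := by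
    rw [← Category.assoc, hfm, hm, lift_fst, Category.assoc, Category.assoc]
  refine ⟨O, f.hom ≫ fst _ _, hmul, fun T t ↦ ?_⟩
  have h₁ : (1 : T ⟶ O.E) ≫ f.hom ≫ fst _ _ = 1 := by
    have := hmul (1 : T ⟶ O.E) 1
    rwa [one_mul, left_eq_mul] at this
  rw [← smul_one, ← Category.assoc, hfs, hi, lift_fst, Category.assoc, h₁, mul_one]

/-- The sum of extensions. -/
theorem exists_add (A B : GmExt G) : ∃ C R, IsSum A B C R := by
  -- The sum is obtained as `B - (-A)`. Negation changes only the inclusion of `𝔾ₘ`, which is why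
  -- `s⁻¹` is inserted below.
  obtain ⟨C, R, h⟩ := exists_sub A.neg B
  refine ⟨C, fun _ a b c ↦ R c a b, fun _ _ _ _ _ f h' ↦ h.comp f h',
    fun _ _ _ _ _ _ _ h₁ h₂ ↦ h.mul h₁ h₂, fun T s t ↦ ?_,
    fun _ _ _ _ h' ↦ (h.right h').trans (h.left h').symm, fun _ _ _ _ h' ↦ (h.left h').symm,
    fun _ _ _ _ _ h₁ h₂ ↦ h.cancel h₁ h₂, fun _ a b h' ↦ h.exists_left a b h'⟩
  have := h.incl (s * t) s⁻¹
  have e : s⁻¹ ≫ A.neg.incl = s ≫ A.incl := by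
    change s⁻¹ ≫ ι[Gm k] ≫ A.incl = _
    rw [← Category.assoc, ← Hom.inv_def, inv_inv]
  rw [e, mul_comm s t, mul_inv_cancel_right] at this
  rw [mul_comm s t]
  exact this

lemma IsSum.mk_congr {A B C A' B' C' : GmExt G} {R R'} (h : IsSum A B C R)
    (h' : IsSum A' B' C' R') (eA : Ext1.mk A = Ext1.mk A') (eB : Ext1.mk B = Ext1.mk B') :
    Ext1.mk C = Ext1.mk C' := by
  obtain ⟨f, hf, fi, fq⟩ := Quotient.exact eA
  obtain ⟨g, hg, gi, gq⟩ := Quotient.exact eB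
  have fs {T : Over (Spec (.of k))} (t : T ⟶ Gm k) (a : T ⟶ A.E) :
      (t • a) ≫ f.hom = t • (a ≫ f.hom) := by
    rw [smul_eq, smul_eq, MonObj.mul_comp, Category.assoc, fi]
  have gs {T : Over (Spec (.of k))} (t : T ⟶ Gm k) (b : T ⟶ B.E) :
      (t • b) ≫ g.hom = t • (b ≫ g.hom) := by
    rw [smul_eq, smul_eq, MonObj.mul_comp, Category.assoc, gi]
  refine exists_extIso (fun T c c' ↦ ∃ a b, R a b c ∧ R' (a ≫ f.hom) (b ≫ g.hom) c')
    (fun T T' c c' j ⟨a, b, i, i'⟩ ↦ ⟨j ≫ a, j ≫ b, h.comp j i, by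
      rw [Category.assoc, Category.assoc]
      exact h'.comp j i'⟩)
    (fun T c c' c'' ⟨a, b, i, i'⟩ ⟨a₁, b₁, j, j'⟩ ↦ ?_)
    (fun T c ↦ (h.loc c).mono fun T' j ⟨a, b, i⟩ ↦ ?_)
    (fun T c c₁ c' c₁' ⟨a, b, i, i'⟩ ⟨a₁, b₁, j, j'⟩ ↦ ⟨_, _, h.mul i j, by
      rw [MonObj.mul_comp, MonObj.mul_comp]
      exact h'.mul i' j'⟩)
    (fun T t ↦ ⟨t ≫ A.incl, (1 : T ⟶ Gm k) ≫ B.incl, ?_, ?_⟩) fun T c c' ⟨a, b, i, i'⟩ ↦ ?_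
  · obtain ⟨t, rfl, rfl⟩ := h.inj i j
    rw [fs, gs] at j'
    refine h'.uniq ?_ j'
    have := h'.smul i' t t⁻¹
    rwa [mul_inv_cancel, hom_one_smul] at this
  · obtain ⟨c', hc'⟩ := h'.ex (a ≫ f.hom) (b ≫ g.hom) (by
      rw [Category.assoc, Category.assoc, fq, gq, h.left i, h.right i])
    exact ⟨c', a, b, i, hc'⟩
  · have := h.incl t 1
    rwa [mul_one] at this
  · rw [Category.assoc, Category.assoc, fi, gi]
    have := h'.incl t 1
    rwa [mul_one] at this
  · rw [← h'.left i', Category.assoc, fq, h.left i]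

/-- The decompositions `(a + b) + c` and `a + (b + c)` correspond. Two decompositions of the same
point differ by a unit `t` moved between the outer summands and a unit `r` moved between the inner
ones; both cancel in the other bracketing. -/
lemma IsSum.mk_assoc {A B C P Q D S : GmExt G} {R₁ R₂ R₃ R₄} (h₁ : IsSum A B P R₁)
    (h₂ : IsSum P C Q R₂) (h₃ : IsSum B C D R₃) (h₄ : IsSum A D S R₄) :
    Ext1.mk Q = Ext1.mk S := by
  refine exists_extIso
    (fun T q s ↦ ∃ a b c p d, R₁ a b p ∧ R₂ p c q ∧ R₃ b c d ∧ R₄ a d s)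
    (fun T T' q s f ⟨a, b, c, p, d, i₁, i₂, i₃, i₄⟩ ↦ ⟨_, _, _, _, _, h₁.comp f i₁, h₂.comp f i₂,
      h₃.comp f i₃, h₄.comp f i₄⟩)
    (fun T q s s' ⟨a, b, c, p, d, i₁, i₂, i₃, i₄⟩ ⟨a', b', c', p', d', j₁, j₂, j₃, j₄⟩ ↦ ?_)
    (fun T q ↦ (h₂.loc q).trans (fun T₁ T₂ f j ⟨s, a, b, c, p, d, i₁, i₂, i₃, i₄⟩ ↦
      ⟨_, _, _, _, _, _, h₁.comp j i₁, by
        rw [Category.assoc]; exact h₂.comp j i₂, h₃.comp j i₃, h₄.comp j i₄⟩)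
      fun T' f ⟨p, c, i₂⟩ ↦ (h₁.loc p).mono fun T'' j ⟨a, b, i₁⟩ ↦ ?_)
    (fun T q q' s s' ⟨a, b, c, p, d, i₁, i₂, i₃, i₄⟩ ⟨a', b', c', p', d', j₁, j₂, j₃, j₄⟩ ↦
      ⟨_, _, _, _, _, h₁.mul i₁ j₁, h₂.mul i₂ j₂, h₃.mul i₃ j₃, h₄.mul i₄ j₄⟩)
    (fun T t ↦ ⟨_, _, _, _, _, h₁.incl t 1, ?_, h₃.incl 1 1, ?_⟩)
    fun T q s ⟨a, b, c, p, d, i₁, i₂, i₃, i₄⟩ ↦ ?_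
  · obtain ⟨t, rfl, rfl⟩ := h₂.inj i₂ j₂
    have k₁ := h₁.smul i₁ t 1
    rw [mul_one, hom_one_smul] at k₁
    obtain ⟨r, rfl, rfl⟩ := h₁.inj k₁ j₁
    have k₃ := h₃.smul i₃ r⁻¹ t⁻¹
    obtain rfl := h₃.uniq k₃ j₃
    rw [← hom_mul_smul] at j₄
    have k₄ := h₄.smul i₄ (r * t) (r⁻¹ * t⁻¹)
    rw [← mul_inv, mul_inv_cancel, hom_one_smul, mul_inv] at k₄
    exact h₄.uniq k₄ j₄
  · have i₂' := h₂.comp j i₂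
    obtain ⟨d, i₃⟩ := h₃.ex b (j ≫ c) (by rw [h₁.right i₁, h₂.left i₂', h₂.right i₂'])
    obtain ⟨s, i₄⟩ := h₄.ex a d (by rw [h₁.left i₁, ← h₁.right i₁, h₃.left i₃])
    exact ⟨s, a, b, j ≫ c, j ≫ p, d, i₁, by rwa [Category.assoc], i₃, i₄⟩
  · have := h₂.incl (t * 1) 1
    rw [mul_one, mul_one] at this
    rwa [mul_one]
  · have := h₄.incl t (1 * 1)
    rw [mul_one, mul_one] at this
    rwa [mul_one]
  · rw [← h₄.left i₄, h₁.left i₁, h₂.left i₂]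

/-- A sum `o + a` with `o` in the split extension is sent to `σ(o) • a`; a scalar moved from one
summand to the other has no effect. -/
lemma IsSum.mk_one {O A B : GmExt G} {R σ} (h : IsSum O A B R) (hO : IsSplit O σ) :
    Ext1.mk B = Ext1.mk A := by
  refine exists_extIso (fun T b a' ↦ ∃ o a, R o a b ∧ a' = (o ≫ σ) • a)
    (fun T T' b a' f ⟨o, a, i, e⟩ ↦ ⟨_, _, h.comp f i, by
      rw [e, ModObj.comp_smul (X := A.E), Category.assoc]⟩)
    (fun T b a a' ⟨o, x, i, e⟩ ⟨o', x', i', e'⟩ ↦ ?_)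
    (fun T b ↦ (h.loc b).mono fun T' j ⟨o, a, i⟩ ↦ ⟨_, _, _, i, rfl⟩)
    (fun T b b' a a' ⟨o, x, i, e⟩ ⟨o', x', i', e'⟩ ↦ ⟨_, _, h.mul i i', by
      rw [e, e', smul_mul_smul, hO.mul]⟩)
    (fun T t ↦ ⟨1 ≫ O.incl, t ≫ A.incl, ?_, ?_⟩) fun T b a ⟨o, x, i, e⟩ ↦ ?_
  · obtain ⟨t, rfl, rfl⟩ := h.inj i i'
    rw [e, e', hO.smul, ← hom_mul_smul, mul_comm t, mul_inv_cancel_right]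
  · have := h.incl 1 t
    rwa [one_mul] at this
  · rw [hO.incl, hom_one_smul]
  · rw [e, smul_quot, h.right i]

variable (G) in
-- The neutral class is that of the split extension `O`, and the inverse of `A` is the difference `O
-- - A`. The description of the neutral class by splittings is what exactness uses.
theorem exists_commGroup_ext : ∃ _ : CommGroup (Ext1 G),
    (∀ A B C : GmExt G, IsBaerSum A B C → Ext1.mk A * Ext1.mk B = Ext1.mk C) ∧
    ∀ (A : GmExt G), Ext1.mk A = 1 ↔ ∃ σ, IsSplit A σ := by
  obtain ⟨O, σ, hO⟩ := exists_isSplit G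
  obtain ⟨i, hm, h1⟩ := exists_commGroup (GmExt.setoid G) IsBaerSum
    (fun A B ↦ by
      obtain ⟨C, R, h⟩ := exists_add A B
      exact ⟨C, isBaerSum_iff.2 ⟨R, h⟩⟩)
    (fun A A' B B' C C' eA eB h h' ↦ by
      obtain ⟨R, h⟩ := isBaerSum_iff.1 h
      obtain ⟨R', h'⟩ := isBaerSum_iff.1 h'
      exact Quotient.exact (h.mk_congr h' (Quotient.sound eA) (Quotient.sound eB)))
    (fun A B C h ↦ by
      obtain ⟨R, h⟩ := isBaerSum_iff.1 h
      exact isBaerSum_iff.2 ⟨_, h.swap⟩)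
    (fun A B C P Q D S h₁ h₂ h₃ h₄ ↦ by
      obtain ⟨R₁, h₁⟩ := isBaerSum_iff.1 h₁
      obtain ⟨R₂, h₂⟩ := isBaerSum_iff.1 h₂
      obtain ⟨R₃, h₃⟩ := isBaerSum_iff.1 h₃
      obtain ⟨R₄, h₄⟩ := isBaerSum_iff.1 h₄
      exact Quotient.exact (h₁.mk_assoc h₂ h₃ h₄))
    O (fun A B h ↦ by
      obtain ⟨R, h⟩ := isBaerSum_iff.1 h
      exact Quotient.exact (h.mk_one hO))
    (fun A ↦ by
      obtain ⟨C, R, h⟩ := exists_sub A O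
      exact ⟨C, isBaerSum_iff.2 ⟨R, h⟩⟩)
  refine ⟨i, hm, fun A ↦ ⟨fun h ↦ hO.congr (h1.symm.trans h.symm), fun ⟨τ, h⟩ ↦ ?_⟩⟩
  exact (h.mk_eq hO).trans h1.symm

end

end GmExt

end

section

open LineBundle

/-! ### Lifting groups -/

lemma LineBundle.sc_smul {X T : Over (Spec (.of k))} {L : LineBundle X} (a : T ⟶ A1 k)
    (t : T ⟶ Gm k) (l : T ⟶ L.tot) : L.sc a (t • l) = t • L.sc a l := by
  rw [← sc_val, ← sc_val, sc_sc, sc_sc, mul_comm]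

lemma LineBundle.IsGen.smul_injective {X T : Over (Spec (.of k))} {L : LineBundle X}
    {l : T ⟶ L.tot} (hl : IsGen l) {t r : T ⟶ Gm k} (h : t • l = r • l) : t = r :=
  (hl.exists_smul (hl.smul r) (L.smul_proj _ _)).unique h rfl

section

variable {G X : Over (Spec (.of k))} [GrpObj G] [ModObj G X] {L : LineBundle X}

lemma IsLift.comp_smul {T T' : Over (Spec (.of k))} {g : T ⟶ G} {φ : T ⊗ L.tot ⟶ L.tot}
    (hφ : IsLift L g φ) (s : T' ⟶ T) (t : T' ⟶ Gm k) (l : T' ⟶ L.tot) :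
    lift s (t • l) ≫ φ = t • (lift s l ≫ φ) :=
  hφ.smul s t l

section

variable [QuasiCompact X.hom] [Nonempty X.left] [QuasiSeparated X.hom] [IsIso X.hom.appTop]

omit [QuasiSeparated X.hom] [IsIso X.hom.appTop] in
variable (X) in
lemma epi_fst (T : Over (Spec (.of k))) : Epi (fst T X) :=
  have := surjective_of_nonempty X
  epi_of_flat _

/-- Both `c` and its inverse come from functions on `T`. Their product is `1` because `T × X ⟶ T` is
an epimorphism, so the first is a unit. -/
lemma exists_const_unit {T : Over (Spec (.of k))} (c : T ⊗ X ⟶ Gm k) :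
    ∃ t : T ⟶ Gm k, fst T X ≫ t = c := by
  obtain ⟨a, ha⟩ := exists_const T (Gm.val c)
  obtain ⟨b, hb⟩ := exists_const T (Gm.val c⁻¹)
  have := epi_fst X T
  have hab : a * b = 1 := by
    rw [← cancel_epi (fst T X), A1.comp_mul, ha, hb, ← Gm.val_mul, mul_inv_cancel, Gm.val_one,
      A1.comp_one]
  obtain ⟨t, rfl⟩ := Gm.exists_val_eq (IsUnit.of_mul_eq_one b hab)
  exact ⟨t, Gm.val_injective (by rw [← Gm.comp_val, ha])⟩

/-- Two lifts of the same point differ by an invertible function on the base. -/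
lemma IsLift.exists_unit {T : Over (Spec (.of k))} {g : T ⟶ G} {φ ψ : T ⊗ L.tot ⟶ L.tot}
    (hφ : IsLift L g φ) (hψ : IsLift L g ψ) : ∃! t : T ⟶ Gm k,
      ∀ ⦃T' : Over (Spec (.of k))⦄ (s : T' ⟶ T) (l : T' ⟶ L.tot),
        lift s l ≫ ψ = (s ≫ t) • (lift s l ≫ φ) := by
  have ex {T' : Over (Spec (.of k))} (s : T' ⟶ T) (l : T' ⟶ L.tot) (hl : IsGen l) :=
    (hφ.gen s hl).exists_smul (hψ.gen s hl) (by rw [hφ.proj, hψ.proj])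
  -- At a generator `l` the two lifts have a ratio in `𝔾ₘ`, the same for every generator over that
  -- point. The ratio is thus a unit on `T × X`, and it comes from `T` since `𝒪(X) = k`.
  obtain ⟨c, hc⟩ := exists_glue (T := T ⊗ X) (Z := Gm k)
    (fun T' j c ↦ ∃ l : T' ⟶ L.tot, IsGen l ∧ l ≫ L.proj = j ≫ snd _ _ ∧
      c • (lift (j ≫ fst _ _) l ≫ φ) = lift (j ≫ fst _ _) l ≫ ψ)
    (fun T' T'' f c g' ⟨l, hl, hp, h⟩ ↦ ⟨g' ≫ l, hl.comp g', by
      rw [Category.assoc, hp, Category.assoc], by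
      rw [Category.assoc, ← comp_lift, Category.assoc, Category.assoc, ← h,
        ModObj.comp_smul (X := L.tot)]⟩)
    (fun T' f c c' ⟨l, hl, hp, h⟩ ⟨l', hl', hp', h'⟩ ↦ by
      obtain ⟨r, rfl, -⟩ := hl.exists_smul hl' (hp'.trans hp.symm)
      refine (ex _ l hl).unique h ?_
      rw [hφ.comp_smul, hψ.comp_smul, smul_smul_comm] at h'
      exact hom_smul_injective h')
    ((L.loc_gen (snd T X)).mono fun T' j ⟨l, hp, hl⟩ ↦ ⟨_, l, hl, hp, (ex _ l hl).choose_spec.1⟩)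
  obtain ⟨t, rfl⟩ := exists_const_unit c
  refine ⟨t, fun T' s l ↦ ?_, fun t' ht' ↦ ?_⟩
  · refine hom_ext_loc ((L.loc_gen (l ≫ L.proj)).mono fun T'' j ⟨l₀, hp, hl⟩ ↦ ?_)
    obtain ⟨a, ha, -⟩ := hl.exists_sc (l' := j ≫ l) (by rw [hp, Category.assoc])
    obtain ⟨r, hr, -⟩ := ex (j ≫ s) l₀ hl
    have h := hc (lift (j ≫ s) (l₀ ≫ L.proj)) r
      ⟨l₀, hl, by rw [lift_snd], by rw [lift_fst]; exact hr⟩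
    rw [lift_fst_assoc] at h
    rw [ModObj.comp_smul (X := L.tot), ← Category.assoc j _ ψ, ← Category.assoc j _ φ, comp_lift,
      ← ha, hφ.sc, hψ.sc, ← hr, sc_smul, ← Category.assoc j s t, h]
  · have := epi_fst X T
    rw [← cancel_epi (fst T X)]
    refine hom_ext_loc ((L.loc_gen (snd T X)).mono fun T' j ⟨l, hp, hl⟩ ↦ ?_)
    rw [← Category.assoc, ← hc j _ ⟨l, hl, hp, (ht' _ l).symm⟩]

end

/-- The conditions on the values of a lift. -/
def LiftRel (G : Over (Spec (.of k))) [GrpObj G] {X : Over (Spec (.of k))} [ModObj G X]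
    (L : LineBundle X) ⦃T : Over (Spec (.of k))⦄ (q : T ⟶ G ⊗ L.tot) (z : T ⟶ L.tot) : Prop :=
  z ≫ L.proj = (q ≫ fst _ _) • (q ≫ snd _ _ ≫ L.proj) ∧ (IsGen (q ≫ snd _ _) → IsGen z)

/-- Invariant line bundles have universal lifts. -/
theorem exists_universal_lift [QuasiCompact X.hom] [Nonempty X.left] [QuasiSeparated X.hom]
    [IsIso X.hom.appTop] (hL : IsInvariant G L) :
    ∃ (E : Over (Spec (.of k))) (_ : ModObj (Gm k) E) (c : E ⟶ G) (Φ : E ⊗ L.tot ⟶ L.tot),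
      IsTorsor c ∧ IsLift L c Φ ∧
      (∀ ⦃T : Over (Spec (.of k))⦄ (t : T ⟶ Gm k) (f : T ⟶ E) (l : T ⟶ L.tot),
        lift (t • f) l ≫ Φ = t • (lift f l ≫ Φ)) ∧
      ∀ ⦃T : Over (Spec (.of k))⦄ (g : T ⟶ G) (φ : T ⊗ L.tot ⟶ L.tot), IsLift L g φ →
        ∃! f : T ⟶ E, f ≫ c = g ∧ ∀ ⦃T' : Over (Spec (.of k))⦄ (s : T' ⟶ T) (l : T' ⟶ L.tot),
          lift (s ≫ f) l ≫ Φ = lift s l ≫ φ := by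
  -- With `𝔾ₘ` acting on the second factor, a lift of `g` is an equivariant map from the fibre of `G
  -- × L` over `g` to `L`. This brings lifts within the scope of `exists_torsor`.
  obtain ⟨i, hi⟩ := exists_modObj (M := Gm k) (E := G ⊗ L.tot)
    (fun T t q ↦ lift (q ≫ fst _ _) (t • (q ≫ snd _ _)))
    (fun T T' f t q ↦ by
      rw [comp_lift, ModObj.comp_smul (X := L.tot), Category.assoc, Category.assoc])
    (fun T q ↦ by
      rw [hom_one_smul]
      exact CartesianMonoidalCategory.hom_ext _ _ (by simp) (by simp))
    (fun T s t q ↦ by rw [lift_fst, lift_snd, hom_mul_smul])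
  have smul_lift {T : Over (Spec (.of k))} (t : T ⟶ Gm k) (g : T ⟶ G) (l : T ⟶ L.tot) :
      t • lift g l = lift g (t • l) := by rw [hi, lift_fst, lift_snd]
  let F {T : Over (Spec (.of k))} {g : T ⟶ G} {φ : T ⊗ L.tot ⟶ L.tot} (hφ : IsLift L g φ) :
      RelFam (fst G L.tot) (LiftRel G L) g :=
    { val := fun T' s q _ ↦ lift s (q ≫ snd _ _) ≫ φ
      nat := fun T' T'' f s q h ↦ by
        rw [← Category.assoc, comp_lift, Category.assoc]
      smul := fun T' s t q h h' ↦ by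
        rw [hi, lift_snd, hφ.comp_smul]
      rel := fun T' s q h ↦ ⟨by rw [hφ.proj, h, Category.assoc], hφ.gen s⟩ }
  have lift_of {T : Over (Spec (.of k))} {g : T ⟶ G} (ψ : RelFam (fst G L.tot) (LiftRel G L) g) :
      ∃ φ, IsLift L g φ ∧ ∀ ⦃T' : Over (Spec (.of k))⦄ (s : T' ⟶ T) (q : T' ⟶ G ⊗ L.tot)
        (h : q ≫ fst _ _ = s ≫ g), ψ.val s q h = lift s (q ≫ snd _ _) ≫ φ := by
    let φ := ψ.val (fst T L.tot) (lift (fst T L.tot ≫ g) (snd _ _)) (by simp)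
    have hφ ⦃T' : Over (Spec (.of k))⦄ (s : T' ⟶ T) (q : T' ⟶ G ⊗ L.tot)
        (h : q ≫ fst _ _ = s ≫ g) : ψ.val s q h = lift s (q ≫ snd _ _) ≫ φ := by
      rw [ψ.nat]
      refine ψ.val_congr (by simp) ?_ _
      refine CartesianMonoidalCategory.hom_ext _ _ ?_ (by simp)
      rw [h]
      simp
    have hφ' ⦃T' : Over (Spec (.of k))⦄ (s : T' ⟶ T) (l : T' ⟶ L.tot) :
        lift s l ≫ φ = ψ.val s (lift (s ≫ g) l) (lift_fst _ _) := by
      rw [hφ, lift_snd]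
    refine ⟨φ, IsLift.of_gen (fun T' s l ↦ ?_) (fun T' s t l ↦ ?_) (fun T' s l hl ↦ ?_), hφ⟩
    · rw [hφ', (ψ.rel _ _ _).1, lift_fst, lift_snd_assoc]
    · rw [hφ', hφ', ← ψ.smul]
      · exact ψ.val_congr rfl (smul_lift _ _ _).symm _
    · rw [hφ']
      exact (ψ.rel _ _ _).2 (by rwa [lift_snd])
  obtain ⟨E, j, c, e, hc, smul_val, H⟩ := exists_torsor (p := fst G L.tot) (K := LiftRel G L)
    (fun T t q ↦ by rw [hi, lift_fst])
    (fun T q z h ↦ ⟨hom_ext_loc (h.mono fun T' j hj ↦ by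
      have := hj.1
      rw [ModObj.comp_smul (X := X)]
      simpa using this), fun hq ↦ isGen_of_loc (h.mono fun T' j hj ↦ hj.2 (by
        rw [Category.assoc]; exact hq.comp j))⟩)
    (fun T q z t h ↦ ⟨by rw [L.smul_proj, h.1], fun hq ↦ (h.2 hq).smul t⟩)
    -- Invariance at the universal point of `G` supplies the local families.
    ((isInvariant_iff.1 hL G (𝟙 G)).mono fun T j ⟨φ, hφ⟩ ↦ by
      rw [Category.comp_id] at hφ
      exact ⟨F hφ⟩)
    (fun T g ψ ψ' ↦ by
      obtain ⟨φ, hφ, hv⟩ := lift_of ψ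
      obtain ⟨φ', hφ', hv'⟩ := lift_of ψ'
      obtain ⟨t, ht, hu⟩ := hφ.exists_unit hφ'
      refine ⟨t, fun T' s q h ↦ by rw [hv, hv', ht], fun t' h' ↦ hu t' fun T' s l ↦ ?_⟩
      have := h' s (lift (s ≫ g) l) (lift_fst _ _)
      rwa [hv, hv', lift_snd] at this)
  obtain ⟨Φ, hΦ, hv⟩ := lift_of e
  refine ⟨E, j, c, Φ, hc, hΦ, fun T t f l ↦ ?_, fun T g φ hφ ↦ ?_⟩
  · have h₁ : lift (f ≫ c) l ≫ fst _ _ = f ≫ c := lift_fst _ _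
    have := smul_val t f (lift (f ≫ c) l) h₁ (h₁.trans (hc.smul_proj _ _).symm)
    rwa [hv, hv, lift_snd] at this
  · obtain ⟨f, ⟨hf, hf'⟩, hu⟩ := H g (F hφ)
    refine ⟨f, ⟨hf, fun T' s l ↦ ?_⟩, fun f' ⟨h₁, h₂⟩ ↦ hu f' ⟨h₁, fun T' s q h h' ↦ ?_⟩⟩
    · have h₁ : lift (s ≫ g) l ≫ fst _ _ = s ≫ g := lift_fst _ _
      have := hf' s (lift (s ≫ g) l) h₁ (by rw [h₁, Category.assoc, hf])
      rw [hv, lift_snd] at this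
      rw [this]
      change lift s (lift (s ≫ g) l ≫ snd _ _) ≫ φ = _
      rw [lift_snd]
    · rw [hv, h₂]

/-- Composition of lifts is classified by a morphism on the torsor of universal lifts. Its
compatibility with scalars and associativity are tested on the action on `L`, which separates points
over the same point of `G`. -/
theorem exists_isLiftingGroup [IsAffine G.left] [QuasiCompact X.hom] [Nonempty X.left]
    [QuasiSeparated X.hom] [IsIso X.hom.appTop] (hL : IsInvariant G L) :
    ∃ A : GmExt G, GmExt.IsLiftingGroup L A := by
  obtain ⟨E, i, c, Φ, hc, hΦ, Φ_smul, H⟩ := exists_universal_lift hL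
  have ext ⦃T : Over (Spec (.of k))⦄ (f f' : T ⟶ E) (h : f ≫ c = f' ≫ c)
      (h' : ∀ ⦃T' : Over (Spec (.of k))⦄ (s : T' ⟶ T) (l : T' ⟶ L.tot),
        lift (s ≫ f) l ≫ Φ = lift (s ≫ f') l ≫ Φ) : f = f' := by
    refine (H (f' ≫ c) (f' ▷ L.tot ≫ Φ) (hΦ.restrict f')).unique ⟨h, fun T' s l ↦ ?_⟩
      ⟨rfl, fun T' s l ↦ ?_⟩
    · rw [h', lift_whiskerRight_assoc]
    · rw [lift_whiskerRight_assoc]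
  let φ : (E ⊗ E) ⊗ L.tot ⟶ L.tot :=
    lift (fst _ _ ≫ fst _ _) (lift (fst _ _ ≫ snd _ _) (snd _ _) ≫ Φ) ≫ Φ
  have φ_eq ⦃T : Over (Spec (.of k))⦄ (s : T ⟶ E ⊗ E) (l : T ⟶ L.tot) :
      lift s l ≫ φ = lift (s ≫ fst _ _) (lift (s ≫ snd _ _) l ≫ Φ) ≫ Φ := by
    rw [← Category.assoc, comp_lift, lift_fst_assoc, ← Category.assoc, comp_lift, lift_fst_assoc,
      lift_snd]
  obtain ⟨m, ⟨hmc, hm⟩, -⟩ := H (fst E E ≫ c * snd E E ≫ c) φ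
    (IsLift.of_gen (fun T s l ↦ by
        rw [φ_eq, hΦ.proj, hΦ.proj, MonObj.comp_mul, hom_mul_smul]
        simp only [Category.assoc])
      (fun T s t l ↦ by rw [φ_eq, φ_eq, hΦ.comp_smul, hΦ.comp_smul])
      fun T s l hl ↦ by
        rw [φ_eq]
        exact hΦ.gen _ (hΦ.gen _ hl))
  have hn {T T' : Over (Spec (.of k))} (f : T' ⟶ T) (a b : T ⟶ E) :
      f ≫ lift a b ≫ m = lift (f ≫ a) (f ≫ b) ≫ m := by rw [← Category.assoc, comp_lift]
  have m_c ⦃T : Over (Spec (.of k))⦄ (a b : T ⟶ E) : (lift a b ≫ m) ≫ c = (a ≫ c) * (b ≫ c) := by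
    rw [Category.assoc, hmc, MonObj.comp_mul, lift_fst_assoc, lift_snd_assoc]
  have m_act ⦃T : Over (Spec (.of k))⦄ (a b : T ⟶ E) (l : T ⟶ L.tot) :
      lift (lift a b ≫ m) l ≫ Φ = lift a (lift b l ≫ Φ) ≫ Φ := by
    rw [hm, φ_eq, lift_fst, lift_snd]
  obtain ⟨A, f, hfq, hfm, hfs⟩ := exists_gmExt hc m m_c
    (fun T t a b ↦ ext _ _ (by rw [m_c, hc.smul_proj, hc.smul_proj, m_c]) fun T' s l ↦ by
      rw [hn, ModObj.comp_smul (X := E), ModObj.comp_smul (X := E), m_act, Φ_smul, Φ_smul, hn,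
        m_act])
    (fun T t a b ↦ ext _ _ (by rw [m_c, hc.smul_proj, hc.smul_proj, m_c]) fun T' s l ↦ by
      rw [hn, ModObj.comp_smul (X := E), ModObj.comp_smul (X := E), m_act, Φ_smul, Φ_smul, hn,
        m_act, hΦ.comp_smul])
    (fun T a b c ↦ ext _ _ (by rw [m_c, m_c, m_c, m_c, mul_assoc]) fun T' s l ↦ by
      rw [hn, hn, hn, hn, m_act, m_act, m_act, m_act])
  have one_act {T : Over (Spec (.of k))} (l : T ⟶ L.tot) :
      lift ((1 : T ⟶ A.E) ≫ f.hom) l ≫ Φ = l := by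
    obtain ⟨e, ⟨he, he'⟩, -⟩ := H (1 : T ⟶ G) (snd T L.tot)
      (IsLift.of_gen (fun T' s l ↦ by rw [lift_snd, MonObj.comp_one, hom_one_smul])
        (fun T' s t l ↦ by rw [lift_snd, lift_snd]) fun T' s l hl ↦ by rwa [lift_snd])
    -- The point which classifies the identity lift is idempotent, hence it is the unit of the
    -- group; so the unit acts trivially.
    have hee : lift e e ≫ m = e := ext _ _ (by rw [m_c, he, one_mul]) fun T' s l ↦ by
      rw [hn, m_act, he', he', lift_snd, lift_snd]
    have h₂ : e ≫ f.inv = 1 := by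
      have : e ≫ f.inv * e ≫ f.inv = e ≫ f.inv := by
        rw [← cancel_mono f.hom, hfm]
        simpa using hee
      exact mul_eq_left.1 this
    rw [← h₂]
    have := he' (𝟙 T) l
    simpa using this
  obtain ⟨i, hi⟩ := exists_modObj (M := A.E) (E := L.tot) (fun T a l ↦ lift (a ≫ f.hom) l ≫ Φ)
    (fun T T' s a l ↦ by rw [← Category.assoc, comp_lift, Category.assoc])
    (fun T l ↦ one_act l)
    (fun T a b l ↦ by rw [hfm, m_act])
  have hact {T : Over (Spec (.of k))} (e : T ⟶ A.E) :
      (fst T L.tot ≫ e) • snd T L.tot = (e ≫ f.hom) ▷ L.tot ≫ Φ := by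
    rw [hi]
    congr 1
  refine ⟨A, i, fun {T} t l ↦ ?_, fun {T} e ↦ ?_, fun {T} g φ hφ ↦ ?_⟩
  · rw [hi, ← GmExt.smul_one, hfs, Φ_smul, one_act]
  · rw [hact, ← hfq, ← Category.assoc]
    exact hΦ.restrict _
  · obtain ⟨e, ⟨he, he'⟩, hu⟩ := H g φ hφ
    refine ⟨e ≫ f.inv, ⟨by simp [← hfq, he], ?_⟩, fun e' ⟨h₁, h₂⟩ ↦ ?_⟩
    · rw [hi]
      have := he' (fst T L.tot) (snd _ _)
      simpa using this
    · rw [← cancel_mono f.hom, hu (e' ≫ f.hom) ⟨by rw [Category.assoc, hfq, h₁], fun T' s l ↦ by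
        rw [← h₂, hact, lift_whiskerRight_assoc]⟩]
      simp

end

end

/-! ### Lifting groups under isomorphisms and tensor products, and their splittings -/

section

open LineBundle

section

variable {G X : Over (Spec (.of k))} [GrpObj G] [ModObj G X]

/-- The action of a lifting group. -/
structure IsLiftingAction (L : LineBundle X) (A : GmExt G) [ModObj A.E L.tot] : Prop where
  incl_smul : ∀ ⦃T : Over (Spec (.of k))⦄ (t : T ⟶ Gm k) (l : T ⟶ L.tot),
    (t ≫ A.incl) • l = t • l
  isLift : ∀ ⦃T : Over (Spec (.of k))⦄ (e : T ⟶ A.E),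
    IsLift L (e ≫ A.quot) ((fst T L.tot ≫ e) • snd T L.tot)
  existsUnique : ∀ ⦃T : Over (Spec (.of k))⦄ (g : T ⟶ G) (φ : T ⊗ L.tot ⟶ L.tot), IsLift L g φ →
    ∃! e : T ⟶ A.E, e ≫ A.quot = g ∧ (fst T L.tot ≫ e) • snd T L.tot = φ

lemma isLiftingGroup_iff {L : LineBundle X} {A : GmExt G} :
    GmExt.IsLiftingGroup L A ↔ ∃ _ : ModObj A.E L.tot, IsLiftingAction L A :=
  ⟨fun ⟨i, h₁, h₂, h₃⟩ ↦ ⟨i, fun _ ↦ h₁, fun _ ↦ h₂, fun _ ↦ h₃⟩,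
    fun ⟨i, h⟩ ↦ ⟨i, @h.1, @h.2, @h.3⟩⟩

lemma lift_smul_snd {H Z T T' : Over (Spec (.of k))} [MonObj H] [ModObj H Z] (e : T ⟶ H)
    (s : T' ⟶ T) (z : T' ⟶ Z) : lift s z ≫ ((fst T Z ≫ e) • snd T Z) = (s ≫ e) • z := by
  rw [ModObj.comp_smul, lift_fst_assoc, lift_snd]

namespace IsLiftingAction

variable {L : LineBundle X} {A : GmExt G} [ModObj A.E L.tot] (hA : IsLiftingAction L A)
  {T : Over (Spec (.of k))}
include hA

lemma proj (e : T ⟶ A.E) (l : T ⟶ L.tot) : (e • l) ≫ L.proj = (e ≫ A.quot) • (l ≫ L.proj) := by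
  have := (hA.isLift e).proj (𝟙 T) l
  rwa [lift_smul_snd, Category.id_comp, Category.id_comp] at this

lemma ext {e e' : T ⟶ A.E} (hq : e ≫ A.quot = e' ≫ A.quot)
    (h : ∀ ⦃T' : Over (Spec (.of k))⦄ (s : T' ⟶ T) (l : T' ⟶ L.tot),
      (s ≫ e) • l = (s ≫ e') • l) : e = e' :=
  (hA.existsUnique _ _ (hA.isLift e')).unique ⟨hq, h _ _⟩ ⟨rfl, rfl⟩

lemma exists_eq {g : T ⟶ G} {φ : T ⊗ L.tot ⟶ L.tot} (hφ : IsLift L g φ) : ∃ e : T ⟶ A.E,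
    e ≫ A.quot = g ∧ ∀ ⦃T' : Over (Spec (.of k))⦄ (s : T' ⟶ T) (l : T' ⟶ L.tot),
      (s ≫ e) • l = lift s l ≫ φ := by
  obtain ⟨e, ⟨he, he'⟩, -⟩ := hA.existsUnique g φ hφ
  exact ⟨e, he, fun T' s l ↦ by rw [← he', lift_smul_snd]⟩

end IsLiftingAction

variable [IsAffine G.left]

/-- The lifting groups of isomorphic line bundles are isomorphic. -/
lemma GmExt.IsLiftingGroup.mk_eq {L M : LineBundle X} {A B : GmExt G} (hA : IsLiftingGroup L A)
    (hB : IsLiftingGroup M B) {f : L.tot ≅ M.tot} (hf : IsBundleIso L M f) :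
    Ext1.mk A = Ext1.mk B := by
  obtain ⟨_, hA⟩ := isLiftingGroup_iff.1 hA
  obtain ⟨_, hB⟩ := isLiftingGroup_iff.1 hB
  refine exists_extIso (fun T a b ↦ b ≫ B.quot = a ≫ A.quot ∧
      ∀ ⦃T' : Over (Spec (.of k))⦄ (s : T' ⟶ T) (l : T' ⟶ L.tot),
        ((s ≫ a) • l) ≫ f.hom = (s ≫ b) • (l ≫ f.hom))
    (fun T T' a b g ⟨h, h'⟩ ↦ ⟨by simp [h], fun T'' s l ↦ by
      rw [← Category.assoc s g a, h', Category.assoc]⟩)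
    (fun T a b b' ⟨h, h'⟩ ⟨j, j'⟩ ↦ hB.ext (h.trans j.symm) fun T' s m ↦ ?_)
    (fun T a s ↦ ⟨⊤, trivial, ?_⟩)
    (fun T a a' b b' ⟨h, h'⟩ ⟨j, j'⟩ ↦ ⟨?_, fun T' s l ↦ ?_⟩)
    (fun T t ↦ ⟨?_, fun T' s l ↦ ?_⟩) fun T a b h ↦ h.1
  · have := (h' s (m ≫ f.inv)).symm.trans (j' s (m ≫ f.inv))
    simpa using this
  · obtain ⟨b, hb, hb'⟩ := hB.exists_eq ((hA.isLift (opnι T ⊤ ≫ a)).transport hf)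
    refine ⟨b, hb, fun T' s l ↦ ?_⟩
    rw [hb', lift_whiskerLeft_assoc, ← Category.assoc (lift s _), lift_smul_snd, Category.assoc l,
      Iso.hom_inv_id, Category.comp_id]
  · rw [MonObj.mul_comp, MonObj.mul_comp, h, j]
  · rw [MonObj.comp_mul, MonObj.comp_mul, hom_mul_smul, hom_mul_smul, h', j']
  · rw [incl_quot, incl_quot]
  · rw [← Category.assoc, ← Category.assoc, hA.incl_smul, hB.incl_smul, hf.smul]

/-- The lifting group of a tensor product is the Baer sum of the lifting groups. -/
lemma GmExt.IsLiftingGroup.isBaerSum {L M N : LineBundle X} {A B C : GmExt G}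
    (hA : IsLiftingGroup L A) (hB : IsLiftingGroup M B) (hC : IsLiftingGroup N C)
    {β : pullback L.proj M.proj ⟶ N.tot} (hβ : IsPairing L M N β) : IsBaerSum A B C := by
  obtain ⟨_, hA⟩ := isLiftingGroup_iff.1 hA
  obtain ⟨_, hB⟩ := isLiftingGroup_iff.1 hB
  obtain ⟨_, hC⟩ := isLiftingGroup_iff.1 hC
  -- The point `c` is the sum of `a` and `b` when it acts on products as `c • (l ⊗ m) = (a • l) ⊗ (b
  -- • m)`.
  refine isBaerSum_iff.2 ⟨fun T a b c ↦ a ≫ A.quot = c ≫ C.quot ∧ b ≫ B.quot = c ≫ C.quot ∧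
    ∀ ⦃T' : Over (Spec (.of k))⦄ (s : T' ⟶ T) (l : T' ⟶ L.tot) (m : T' ⟶ M.tot)
      (h : l ≫ L.proj = m ≫ M.proj) (h' : ((s ≫ a) • l) ≫ L.proj = ((s ≫ b) • m) ≫ M.proj),
      app β ((s ≫ a) • l) ((s ≫ b) • m) h' = (s ≫ c) • app β l m h,
    fun T T' a b c f ⟨h₁, h₂, h₃⟩ ↦ ⟨by simp [h₁], by simp [h₂], fun T'' s l m h h' ↦ ?_⟩,
    fun T a a' b b' c c' ⟨h₁, h₂, h₃⟩ ⟨j₁, j₂, j₃⟩ ↦ ⟨?_, ?_, fun T'' s l m h h' ↦ ?_⟩,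
    fun T t r ↦ ⟨?_, ?_, fun T'' s l m h h' ↦ ?_⟩,
    fun T a b c h ↦ h.1, fun T a b c h ↦ h.2.1, fun T a b c c' ⟨h₁, h₂, h₃⟩ ⟨j₁, j₂, j₃⟩ ↦ ?_,
    fun T a b hab ↦ ?_⟩
  · have e (h'' : (((s ≫ f) ≫ a) • l) ≫ L.proj = (((s ≫ f) ≫ b) • m) ≫ M.proj) :=
      h₃ (s ≫ f) l m h h''
    simp only [Category.assoc] at e
    exact e h'
  · rw [MonObj.mul_comp, MonObj.mul_comp, h₁, j₁]
  · rw [MonObj.mul_comp, MonObj.mul_comp, h₂, j₂]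
  · have p₁ : ((s ≫ a') • l) ≫ L.proj = ((s ≫ b') • m) ≫ M.proj := by
      rw [hA.proj, hB.proj, Category.assoc, Category.assoc, j₁, j₂, h]
    have p₂ : ((s ≫ a) • (s ≫ a') • l) ≫ L.proj = ((s ≫ b) • (s ≫ b') • m) ≫ M.proj := by
      rw [hA.proj, hB.proj, Category.assoc, Category.assoc, h₁, h₂, p₁]
    rw [MonObj.comp_mul s c c', hom_mul_smul, ← j₃ s l m h p₁, ← h₃ s _ _ p₁ p₂]
    exact app_congr β (by rw [MonObj.comp_mul, hom_mul_smul])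
      (by rw [MonObj.comp_mul, hom_mul_smul]) _
  · rw [incl_quot, incl_quot]
  · rw [incl_quot, incl_quot]
  · rw [← Category.assoc s (t * r) C.incl, hC.incl_smul, MonObj.comp_mul,
      ← hβ.smul_smul (s ≫ t) (s ≫ r) l m h
      (by rw [L.smul_proj, M.smul_proj, h])]
    exact app_congr β (by rw [← Category.assoc, hA.incl_smul])
      (by rw [← Category.assoc, hB.incl_smul]) _
  -- Points of `N` are locally products, so their images determine the action, and the action
  -- determines the element of the lifting group.
  · refine hC.ext (h₁.symm.trans j₁) fun T' s n ↦ hom_ext_loc ((hβ.loc_app n).mono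
      fun T'' j ⟨l, m, h, _, hn⟩ ↦ ?_)
    have p : (((j ≫ s) ≫ a) • l) ≫ L.proj = (((j ≫ s) ≫ b) • m) ≫ M.proj := by
      rw [hA.proj, hB.proj, Category.assoc _ a, Category.assoc _ b, h₁, h₂, h]
    rw [ModObj.comp_smul (X := N.tot), ModObj.comp_smul (X := N.tot), hn, ← Category.assoc,
      ← Category.assoc, ← h₃ _ l m h p, ← j₃ _ l m h p]
  · have hb : IsLift M (a ≫ A.quot) ((fst T M.tot ≫ b) • snd T M.tot) := by
      rw [hab]
      exact hB.isLift b
    obtain ⟨χ, hχ, H⟩ := hβ.exists_lift_tensor (hA.isLift a) hb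
    obtain ⟨c, hc, hc'⟩ := hC.exists_eq hχ
    refine ⟨c, hc.symm, (hc.trans hab).symm, fun T' s l m h h' ↦ ?_⟩
    have := H s l m h ((hA.isLift a).proj_eq hb s h)
    rw [hc', ← this]
    exact app_congr β (lift_smul_snd _ _ _).symm (lift_smul_snd _ _ _).symm _

/-- The lifting group of a linearized line bundle splits. -/
lemma GmExt.IsLiftingGroup.exists_isSplit [QuasiCompact X.hom] [Nonempty X.left]
    [QuasiSeparated X.hom] [IsIso X.hom.appTop] {L : LinLineBundle G X} {A : GmExt G}
    (hA : IsLiftingGroup L.toLineBundle A) : ∃ σ, IsSplit A σ := by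
  obtain ⟨_, hA⟩ := isLiftingGroup_iff.1 hA
  -- The linearization and the action of `a` are lifts of the same point of `G`. Their ratio, a unit
  -- on `T`, is the value of the retraction at `a`.
  have ex {T : Over (Spec (.of k))} (a : T ⟶ A.E) : ∃! t : T ⟶ Gm k,
      ∀ ⦃T' : Over (Spec (.of k))⦄ (s : T' ⟶ T) (l : T' ⟶ L.tot),
        (s ≫ a) • l = (s ≫ t) • (s ≫ a ≫ A.quot) • l := by
    have := (L.isLift (a ≫ A.quot)).exists_unit (hA.isLift a)
    simpa only [lift_smul_snd] using this
  obtain ⟨σ, hσ, -⟩ := ex (𝟙 A.E)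
  have hσ' {T T' : Over (Spec (.of k))} (a : T ⟶ A.E) (s : T' ⟶ T) (l : T' ⟶ L.tot) :
      (s ≫ a) • l = (s ≫ a ≫ σ) • (s ≫ a ≫ A.quot) • l := by
    have := hσ (s ≫ a) l
    simpa only [Category.assoc, Category.comp_id, Category.id_comp] using this
  refine ⟨σ, fun T a b ↦ (ex (a * b)).unique (fun _ ↦ hσ' _) fun T' s l ↦ ?_,
    fun T t ↦ (ex (t ≫ A.incl)).unique (fun _ ↦ hσ' _) fun T' s l ↦ ?_⟩
  · rw [MonObj.comp_mul, hom_mul_smul, hσ' b s l, hσ' a s, L.linear, MonObj.mul_comp,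
      MonObj.comp_mul, MonObj.comp_mul, hom_mul_smul, hom_mul_smul]
  · rw [← Category.assoc, hA.incl_smul, incl_quot, MonObj.comp_one, hom_one_smul]

/-- A line bundle with a split lifting group can be linearized. -/
lemma GmExt.IsLiftingGroup.exists_linLineBundle {L : LineBundle X} {A : GmExt G}
    (hA : IsLiftingGroup L A) {σ : A.E ⟶ Gm k} (hσ : IsSplit A σ) :
    ∃ M : LinLineBundle G X, M.toLineBundle = L := by
  obtain ⟨_, hA⟩ := isLiftingGroup_iff.1 hA
  have uniq {T : Over (Spec (.of k))} {a b : T ⟶ A.E} (hq : a ≫ A.quot = b ≫ A.quot)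
      (hs : a ≫ σ = b ≫ σ) : a = b := by
    obtain ⟨t, rfl, -⟩ := A.isPseudoTorsor.trans a b hq
    rw [hσ.smul, right_eq_mul] at hs
    rw [hs, hom_one_smul]
  have loc : Loc G fun T j ↦ ∃ a : T ⟶ A.E, a ≫ A.quot = j ∧ a ≫ σ = 1 :=
    A.isTorsor.loc_section.mono fun T j ⟨a, ha⟩ ↦ ⟨(a ≫ σ)⁻¹ • a, by rw [smul_quot, ha], by
      rw [hσ.smul, inv_mul_cancel]⟩
  -- The kernel of the retraction meets each fibre in exactly one point. These points form the
  -- section `s`, multiplicative by that uniqueness, through which `G` acts on `L`.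
  obtain ⟨s, hs⟩ := exists_glue (T := G) (Z := A.E) (fun T j a ↦ a ≫ A.quot = j ∧ a ≫ σ = 1)
    (fun T T' f a g ⟨h, h'⟩ ↦ ⟨by rw [Category.assoc, h], by
      rw [Category.assoc, h', MonObj.comp_one]⟩)
    (fun T f a b ⟨h, h'⟩ ⟨j, j'⟩ ↦ uniq (h.trans j.symm) (h'.trans j'.symm)) loc
  have hsq : s ≫ A.quot = 𝟙 G := hom_ext_loc (loc.mono fun T j ⟨a, ha⟩ ↦ by
    rw [← Category.assoc, hs j a ha, ha.1, Category.comp_id])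
  have hsσ : s ≫ σ = 1 := hom_ext_loc (loc.mono fun T j ⟨a, ha⟩ ↦ by
    rw [← Category.assoc, hs j a ha, ha.2, MonObj.comp_one])
  have hmul {T : Over (Spec (.of k))} (a b : T ⟶ G) : (a * b) ≫ s = (a ≫ s) * (b ≫ s) :=
    uniq (by rw [MonObj.mul_comp (a ≫ s) (b ≫ s) A.quot]; simp [hsq])
      (by rw [hσ.mul]; simp [hsσ, MonObj.comp_one])
  have hone {T : Over (Spec (.of k))} : (1 : T ⟶ G) ≫ s = 1 := by
    have := hmul (1 : T ⟶ G) 1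
    rwa [one_mul, left_eq_mul] at this
  have hχ : IsLift L (𝟙 G) ((fst G L.tot ≫ s) • snd G L.tot) := hsq ▸ hA.isLift s
  obtain ⟨i, -, h₂, h₃⟩ := exists_linearization hχ
    (fun T n ↦ by rw [lift_smul_snd, hone, hom_one_smul])
    (fun T a b n ↦ by rw [lift_smul_snd, lift_smul_snd, lift_smul_snd, hmul, hom_mul_smul])
  exact ⟨{ toLineBundle := L, equivariant := h₂, linear := h₃ }, rfl⟩

end

end

section

open LineBundle

/-! ### Characters and linearizations of the trivial line bundle -/

variable {G X : Over (Spec (.of k))} [GrpObj G] [ModObj G X]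

/-- `σ` is a generating section of `L` on which `G` acts by the character `χ`. -/
structure IsCharSection (χ : G ⟶ Gm k) (L : LinLineBundle G X) (σ : X ⟶ L.tot) : Prop where
  proj : σ ≫ L.proj = 𝟙 X
  gen : IsGen σ
  smul : ∀ ⦃T : Over (Spec (.of k))⦄ (g : T ⟶ G) (x : T ⟶ X),
    g • (x ≫ σ) = (g ≫ χ) • ((g • x) ≫ σ)

namespace IsCharSection

variable {χ ψ : G ⟶ Gm k} {L M : LinLineBundle G X} {σ : X ⟶ L.tot} {τ : X ⟶ M.tot}

lemma comp_proj (h : IsCharSection χ L σ) {T : Over (Spec (.of k))} (x : T ⟶ X) :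
    (x ≫ σ) ≫ L.proj = x := by
  rw [Category.assoc, h.proj, Category.comp_id]

lemma mk_eq (h : IsCharSection χ L σ) (h' : IsCharSection χ M τ) : PicG.mk L = PicG.mk M := by
  have hR : IsIsoRel L.toLineBundle M.toLineBundle fun T l m ↦
      ∃ (x : T ⟶ X) (t : T ⟶ Gm k), l = t • (x ≫ σ) ∧ m = t • (x ≫ τ) :=
    { gen := by
        rintro T _ _ ⟨x, t, rfl, rfl⟩
        exact ⟨(h.gen.comp x).smul t, (h'.gen.comp x).smul t, by
          rw [M.smul_proj, L.smul_proj, h.comp_proj, h'.comp_proj]⟩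
      stab := by
        rintro T T' _ _ f ⟨x, t, rfl, rfl⟩
        exact ⟨f ≫ x, f ≫ t, by rw [ModObj.comp_smul, Category.assoc], by
          rw [ModObj.comp_smul, Category.assoc]⟩
      uniq := by
        rintro T _ _ _ _ ⟨x, t, rfl, rfl⟩ ⟨y, s, rfl, rfl⟩ e
        rw [L.smul_proj, L.smul_proj, h.comp_proj, h.comp_proj] at e
        subst e
        exact ⟨s * t⁻¹, by rw [← hom_mul_smul, inv_mul_cancel_right], by
          rw [← hom_mul_smul, inv_mul_cancel_right]⟩
      ex := fun s ↦ ⟨⊤, trivial, _, _, ⟨opnι X ⊤, 1, rfl, rfl⟩, by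
        rw [L.smul_proj, h.comp_proj]⟩ }
  refine Quotient.sound (hR.exists_linIso ?_)
  rintro T g _ _ ⟨x, t, rfl, rfl⟩
  exact ⟨g • x, t * (g ≫ χ), by rw [L.linear, h.smul, hom_mul_smul], by
    rw [M.linear, h'.smul, hom_mul_smul]⟩

lemma tensor (h : IsCharSection χ L σ) (h' : IsCharSection ψ M τ) {N : LinLineBundle G X}
    (hN : LinLineBundle.IsTensor L M N) : ∃ ρ, IsCharSection (χ * ψ) N ρ := by
  obtain ⟨β, hβ, hg⟩ := hN
  have hp := hβ.isPairing
  have e {T : Over (Spec (.of k))} (x : T ⟶ X) : (x ≫ σ) ≫ L.proj = (x ≫ τ) ≫ M.proj := by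
    rw [h.comp_proj, h'.comp_proj]
  have e₀ : σ ≫ L.proj = τ ≫ M.proj := by rw [h.proj, h'.proj]
  refine ⟨app β σ τ e₀, by rw [hp.proj, h.proj], hp.gen _ _ _ h.gen h'.gen, fun T g x ↦ ?_⟩
  rw [comp_app, comp_app, MonObj.comp_mul, ← hp.smul_smul _ _ _ _ (e (g • x)) (by
    rw [L.smul_proj, M.smul_proj, e])]
  exact (hg g _ _ (e x)).symm.trans (app_congr β (h.smul g x) (h'.smul g x) _)

/-- An isomorphism carries `σ` to a multiple of `τ` by a unit of `X`, which is constant because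
`𝒪(X) = k`. Constants are unaffected by the action, so both characters multiply the same generator
in the same way. -/
lemma congr [QuasiCompact X.hom] [Nonempty X.left] [QuasiSeparated X.hom] [IsIso X.hom.appTop]
    (h : IsCharSection χ L σ) (h' : IsCharSection ψ M τ) (e : PicG.mk L = PicG.mk M) : χ = ψ := by
  obtain ⟨f, hf⟩ : L ≈ M := Quotient.exact e
  have gσ : IsGen (σ ≫ f.hom) := hf.bundle.gen h.gen
  obtain ⟨c, hc, -⟩ := h'.gen.exists_smul gσ (by
    rw [Category.assoc, hf.bundle.proj, h.proj, h'.proj])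
  obtain ⟨t, ht⟩ := exists_const_unit (X := X) (snd (𝟙_ _) X ≫ c)
  have hc' {T : Over (Spec (.of k))} (x : T ⟶ X) :
      (x ≫ σ) ≫ f.hom = (toUnit T ≫ t) • (x ≫ τ) := by
    have := congr(lift (toUnit T) x ≫ $ht)
    rw [lift_fst_assoc, lift_snd_assoc] at this
    rw [Category.assoc, ← hc, ModObj.comp_smul, this]
  have := epi_fst X G
  rw [← cancel_epi (fst G X)]
  have key : (fst G X • (snd G X ≫ σ)) ≫ f.hom = fst G X • ((snd G X ≫ σ) ≫ f.hom) :=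
    hf.action _ _
  rw [h.smul, hf.bundle.smul, hc', hc', M.linear, h'.smul, ← hom_mul_smul, ← hom_mul_smul,
    mul_comm] at key
  exact mul_left_cancel ((h'.gen.comp _).smul_injective key)

end IsCharSection

lemma LineBundle.IsTriv.isCharSection {χ : G ⟶ Gm k} {L : LinLineBundle G X} {f : X ⊗ A1 k ≅ L.tot}
    (hf : IsTriv L.toLineBundle f)
    (h : ∀ {T : Over (Spec (.of k))} (g : T ⟶ G) (x : T ⟶ X) (a : T ⟶ A1 k),
      lift (g • x) (A1.scale (g ≫ χ) a) ≫ f.hom = g • (lift x a ≫ f.hom)) :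
    IsCharSection χ L (lift (𝟙 X) 1 ≫ f.hom) where
  proj := hf.lift_proj _ _
  gen := hf.isGen _
  smul T g x := by
    rw [comp_lift_assoc, comp_lift_assoc, Category.comp_id, Category.comp_id, A1.comp_one,
      A1.comp_one, ← hf.smul, h]

/-- The linearized trivial line bundle of a character. -/
lemma exists_isCharSection (χ : G ⟶ Gm k) [IsMonHom χ] : ∃ (L : LinLineBundle G X)
    (f : X ⊗ A1 k ≅ L.tot) (σ : X ⟶ L.tot), IsTriv L.toLineBundle f ∧
      LinLineBundle.IsTrivialTwist χ L ∧ IsCharSection χ L σ := by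
  obtain ⟨L, f, hf, h⟩ := exists_isTrivialTwist (X := X) χ (fun T ↦ MonObj.one_comp _)
    (fun T a b ↦ MonObj.mul_comp _ _ _)
  exact ⟨L, f, _, hf, ⟨f, hf.proj, hf.smul, h⟩, hf.isCharSection h⟩

/-- A linearization of a trivial line bundle is given by a character. -/
lemma LinLineBundle.exists_isCharSection [QuasiCompact X.hom] [Nonempty X.left]
    [QuasiSeparated X.hom] [IsIso X.hom.appTop] (L : LinLineBundle G X) {σ : X ⟶ L.tot}
    (hσ : σ ≫ L.proj = 𝟙 X) (gσ : IsGen σ) : ∃ χ : G ⟶ Gm k, IsMonHom χ ∧ IsCharSection χ L σ := by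
  have hp {T : Over (Spec (.of k))} (x : T ⟶ X) : (x ≫ σ) ≫ L.proj = x := by
    rw [Category.assoc, hσ, Category.comp_id]
  -- Both `g • σ(x)` and `σ(g x)` generate the fibre over `g x`. Their ratio on `G × X` depends on
  -- `g` alone and is the desired character.
  obtain ⟨c, hc, -⟩ := (gσ.comp (fst G X • snd G X)).exists_smul
    (L.isGen_smul (fst G X) (gσ.comp (snd G X))) (by rw [L.equivariant, hp, hp])
  obtain ⟨χ, rfl⟩ := exists_const_unit (X := X) c
  have hχ {T : Over (Spec (.of k))} (g : T ⟶ G) (x : T ⟶ X) :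
      g • (x ≫ σ) = (g ≫ χ) • ((g • x) ≫ σ) := by
    have := congr(lift g x ≫ $hc)
    rw [ModObj.comp_smul, ModObj.comp_smul, ← Category.assoc, ← Category.assoc, lift_fst,
      ← Category.assoc, lift_snd, ModObj.comp_smul (X := X), lift_fst, lift_snd] at this
    exact this.symm
  refine ⟨χ, isMonHom_of_mul χ fun T a b ↦ ?_, hσ, gσ, fun T ↦ hχ⟩
  have := epi_fst X T
  rw [← cancel_epi (fst T X), MonObj.comp_mul, ← Category.assoc, MonObj.comp_mul,
    ← Category.assoc, ← Category.assoc]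
  set a' := fst T X ≫ a
  set b' := fst T X ≫ b
  refine (gσ.comp ((a' * b') • snd T X)).smul_injective ?_
  rw [← hχ, hom_mul_smul, hχ b', L.linear, hχ a', hom_mul_smul, hom_mul_smul, smul_smul_comm]

end

section

open LineBundle

/-! ### The exact sequence -/

variable {G X : Over (Spec (.of k))} [GrpObj G] [ModObj G X]

lemma LinLineBundle.isInvariant (L : LinLineBundle G X) : IsInvariant G L.toLineBundle :=
  fun _ _ _ ↦ ⟨⊤, trivial, _, L.isLift _⟩

lemma LinLineBundle.IsTensor.isTensor {L M N : LinLineBundle G X} (h : LinLineBundle.IsTensor L M N) :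
    LineBundle.IsTensor L.toLineBundle M.toLineBundle N.toLineBundle :=
  h.imp fun _ h ↦ h.1

lemma LinLineBundle.mk_toLineBundle {L M : LinLineBundle G X} (h : L ≈ M) :
    Pic.mk L.toLineBundle = Pic.mk M.toLineBundle :=
  Quotient.sound (h.imp fun _ h ↦ h.bundle)

lemma exists_forget [CommGroup (PicG G X)] [CommGroup (Pic X)]
    (hG : ∀ L M N : LinLineBundle G X, LinLineBundle.IsTensor L M N →
      PicG.mk L * PicG.mk M = PicG.mk N)
    (hP : ∀ L M N : LineBundle X, LineBundle.IsTensor L M N → Pic.mk L * Pic.mk M = Pic.mk N)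
    {P : Subgroup (Pic X)} (hI : ∀ L : LineBundle X, Pic.mk L ∈ P ↔ IsInvariant G L) :
    ∃ α : PicG G X →* P, ∀ L : LinLineBundle G X, (α (PicG.mk L) : Pic X) = Pic.mk L.toLineBundle := by
  let α : PicG G X →* Pic X := MonoidHom.mk'
    (Quotient.lift (fun L ↦ Pic.mk L.toLineBundle) fun _ _ ↦ LinLineBundle.mk_toLineBundle) (by
      rintro ⟨L⟩ ⟨M⟩
      obtain ⟨N, hN⟩ := exists_linTensor L M
      exact (congrArg _ (hG _ _ _ hN)).trans (hP _ _ _ hN.isTensor).symm)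
  exact ⟨α.codRestrict P (by rintro ⟨L⟩; exact (hI _).2 L.isInvariant), fun L ↦ rfl⟩

section

variable [QuasiCompact X.hom] [Nonempty X.left] [QuasiSeparated X.hom] [IsIso X.hom.appTop]

lemma exists_charHom [CommGroup (PicG G X)]
    (hG : ∀ L M N : LinLineBundle G X, LinLineBundle.IsTensor L M N →
      PicG.mk L * PicG.mk M = PicG.mk N) :
    ∃ κ : GrpHom G →* PicG G X,
      (∀ χ : GrpHom G, ∃ (L : LinLineBundle G X) (f : X ⊗ A1 k ≅ L.tot) (σ : X ⟶ L.tot),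
        IsTriv L.toLineBundle f ∧ LinLineBundle.IsTrivialTwist χ.hom.hom L ∧
          IsCharSection χ.hom.hom L σ ∧ κ χ = PicG.mk L) ∧ Function.Injective κ := by
  choose L f σ hf hL hσ using fun χ : GrpHom G ↦ exists_isCharSection (X := X) χ.hom.hom
  refine ⟨MonoidHom.mk' (fun χ ↦ PicG.mk (L χ)) fun χ ψ ↦ ?_,
    fun χ ↦ ⟨L χ, f χ, σ χ, hf χ, hL χ, hσ χ, rfl⟩, fun χ ψ h ↦ ?_⟩
  · obtain ⟨N, hN⟩ := exists_linTensor (L χ) (L ψ)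
    obtain ⟨ρ, hρ⟩ := (hσ χ).tensor (hσ ψ) hN
    exact ((hσ (χ * ψ)).mk_eq hρ).trans (hG _ _ _ hN).symm
  · ext1
    exact (hσ χ).congr (hσ ψ) h

variable [IsAffine G.left]

/-- The map is defined by a chosen representative of each class and a chosen lifting group. Lifting
groups of isomorphic bundles are isomorphic extensions, so the choices do not matter, and tensor
products go to Baer sums. -/
lemma exists_liftingHom [CommGroup (Pic X)] [CommGroup (Ext1 G)]
    (hP : ∀ L M N : LineBundle X, LineBundle.IsTensor L M N → Pic.mk L * Pic.mk M = Pic.mk N)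
    (hE : ∀ A B C : GmExt G, GmExt.IsBaerSum A B C → Ext1.mk A * Ext1.mk B = Ext1.mk C)
    {P : Subgroup (Pic X)} (hI : ∀ L : LineBundle X, Pic.mk L ∈ P ↔ IsInvariant G L) :
    ∃ ε : P →* Ext1 G, ∀ (L : LineBundle X) (hL : Pic.mk L ∈ P) (A : GmExt G),
      GmExt.IsLiftingGroup L A → ε ⟨Pic.mk L, hL⟩ = Ext1.mk A := by
  choose R hR using fun p : P ↦ Quotient.exists_rep p.1
  choose E hE' using fun p : P ↦ exists_isLiftingGroup ((hI (R p)).1 (by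
    rw [Pic.mk, hR]
    exact p.2))
  have key (L : LineBundle X) (hL : Pic.mk L ∈ P) (A : GmExt G) (hA : GmExt.IsLiftingGroup L A) :
      Ext1.mk (E ⟨Pic.mk L, hL⟩) = Ext1.mk A := by
    obtain ⟨f, hf⟩ : R ⟨Pic.mk L, hL⟩ ≈ L := Quotient.exact (hR _)
    exact (hE' _).mk_eq hA hf
  refine ⟨MonoidHom.mk' (fun p ↦ Ext1.mk (E p)) fun p q ↦ ?_, key⟩
  obtain ⟨N, β, hβ⟩ := exists_isPairing (R p) (R q)
  have h : Pic.mk N = p * q := by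
    rw [← hP _ _ _ ⟨β, hβ.isTensorMap⟩]
    exact congrArg₂ (fun a b : Pic X ↦ a * b) (hR p) (hR q)
  have hN : Pic.mk N ∈ P := h ▸ (p * q).2
  obtain ⟨C, hC⟩ := exists_isLiftingGroup ((hI N).1 hN)
  rw [hE _ _ _ ((hE' p).isBaerSum (hE' q) hC hβ), ← key N hN C hC]
  exact congrArg (fun p ↦ Ext1.mk (E p)) (Subtype.ext h.symm)

variable (G X) in
-- The geometry of `X` enters only through its being quasi-compact, quasi-separated and nonempty
-- with `𝒪(X) = k`.
theorem exists_exact_sequence :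
    ∃ (_ : CommGroup (PicG G X)) (_ : CommGroup (Pic X)) (_ : CommGroup (Ext1 G)),
      ((∀ L M : LinLineBundle G X, ∃ N, LinLineBundle.IsTensor L M N) ∧
        ∀ L M N : LinLineBundle G X, LinLineBundle.IsTensor L M N →
          PicG.mk L * PicG.mk M = PicG.mk N) ∧
      ((∀ L M : LineBundle X, ∃ N, LineBundle.IsTensor L M N) ∧
        ∀ L M N : LineBundle X, LineBundle.IsTensor L M N →
          Pic.mk L * Pic.mk M = Pic.mk N) ∧
      ((∀ A B : GmExt G, ∃ C, GmExt.IsBaerSum A B C) ∧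
        ∀ A B C : GmExt G, GmExt.IsBaerSum A B C → Ext1.mk A * Ext1.mk B = Ext1.mk C) ∧
      ∃ PicInv : Subgroup (Pic X),
        (∀ L : LineBundle X, Pic.mk L ∈ PicInv ↔ IsInvariant G L) ∧
        ∃ (κ : GrpHom G →* PicG G X) (α : PicG G X →* PicInv) (ε : PicInv →* Ext1 G),
          (∀ χ : GrpHom G, ∃ L : LinLineBundle G X,
            LinLineBundle.IsTrivialTwist χ.hom.hom L ∧ κ χ = PicG.mk L) ∧
          (∀ L : LinLineBundle G X, (α (PicG.mk L) : Pic X) = Pic.mk L.toLineBundle) ∧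
          (∀ (L : LineBundle X) (hL : Pic.mk L ∈ PicInv),
            (∃ A : GmExt G, GmExt.IsLiftingGroup L A) ∧
            ∀ A : GmExt G, GmExt.IsLiftingGroup L A → ε ⟨Pic.mk L, hL⟩ = Ext1.mk A) ∧
          Function.Injective κ ∧ κ.range = α.ker ∧ α.range = ε.ker := by
  obtain ⟨_, hG⟩ := exists_commGroup_picG G X
  obtain ⟨_, hP, hO⟩ := exists_commGroup_pic X
  obtain ⟨_, hE, hS⟩ := GmExt.exists_commGroup_ext G
  obtain ⟨P, hI⟩ := exists_picInv (G := G) hP hO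
  obtain ⟨κ, hκ, κ_inj⟩ := exists_charHom hG
  obtain ⟨α, hα⟩ := exists_forget hG hP hI
  obtain ⟨ε, hε⟩ := exists_liftingHom hP hE hI
  refine ⟨_, _, _, ⟨exists_linTensor, hG⟩, ⟨fun L M ↦ ?_, hP⟩, ⟨fun A B ↦ ?_, hE⟩, P, hI, κ, α, ε,
    fun χ ↦ ?_, hα, fun L hL ↦ ⟨exists_isLiftingGroup ((hI L).1 hL), hε L hL⟩, κ_inj, ?_, ?_⟩
  · obtain ⟨N, β, hβ⟩ := exists_isPairing L M
    exact ⟨N, β, hβ.isTensorMap⟩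
  · obtain ⟨C, R, h⟩ := GmExt.exists_add A B
    exact ⟨C, GmExt.isBaerSum_iff.2 ⟨R, h⟩⟩
  · obtain ⟨L, -, -, -, h, -, e⟩ := hκ χ
    exact ⟨L, h, e⟩
  · ext c
    rw [MonoidHom.mem_range, MonoidHom.mem_ker]
    constructor
    · rintro ⟨χ, rfl⟩
      obtain ⟨L, f, σ, hf, -, -, e⟩ := hκ χ
      rw [e]
      exact Subtype.ext ((hα L).trans (hO _ f hf).symm)
    · obtain ⟨L, rfl⟩ := Quotient.exists_rep c
      intro h
      obtain ⟨O, e, he⟩ := exists_isTriv X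
      obtain ⟨f, hf⟩ : O ≈ L.toLineBundle :=
        Quotient.exact ((hO O e he).symm.trans ((congrArg Subtype.val h.symm).trans (hα L)))
      -- A trivialization of the underlying bundle carries the constant section `1` to a generating
      -- section, on which `G` acts by a character.
      obtain ⟨χ, hχ, H⟩ := L.exists_isCharSection (σ := (lift (𝟙 X) 1 ≫ e.hom) ≫ f.hom)
        (by rw [hf.comp_proj, he.lift_proj]) (hf.gen (he.isGen _))
      obtain ⟨M, -, τ, -, -, hτ, e⟩ := hκ (Grp.homMk χ)
      exact ⟨Grp.homMk χ, e.trans (hτ.mk_eq H)⟩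
  · ext ⟨c, hc⟩
    obtain ⟨L, rfl⟩ := Quotient.exists_rep c
    obtain ⟨A, hA⟩ := exists_isLiftingGroup ((hI L).1 hc)
    rw [MonoidHom.mem_range, MonoidHom.mem_ker]
    have e : ε ⟨_, hc⟩ = Ext1.mk A := hε L hc A hA
    -- The class vanishes exactly when the lifting group splits, which is equivalent to the
    -- existence of a linearization.
    rw [e, hS]
    constructor
    · rintro ⟨⟨M⟩, hM⟩
      obtain ⟨f, hf⟩ : M.toLineBundle ≈ L :=
        Quotient.exact ((hα M).symm.trans (congrArg Subtype.val hM))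
      obtain ⟨B, hB⟩ := exists_isLiftingGroup M.isInvariant
      obtain ⟨σ, hσ⟩ := hB.exists_isSplit
      exact hσ.congr (hB.mk_eq hA hf)
    · rintro ⟨σ, hσ⟩
      obtain ⟨M, rfl⟩ := hA.exists_linLineBundle hσ
      exact ⟨PicG.mk M, Subtype.ext (hα M)⟩

end

end

end EquivPic

end

open EquivPic in
theorem lemma3 {k : Type u} [Field k] (G X : Over (Spec (.of k)))
    [GrpObj G] [IsAffine G.left] [LocallyOfFiniteType G.hom]
    [IsIntegral X.left] [IsProper X.hom]
    (hnormal : ∀ x : X.left, IsIntegrallyClosed (X.left.presheaf.stalk x))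
    (hunits : ∀ f : Γ(X.left, ⊤), IsUnit f →
      ∃ c : k, f = X.hom.appTop ((Scheme.ΓSpecIso (.of k)).inv c))
    [ModObj G X] :
    ∃ (_ : CommGroup (PicG G X)) (_ : CommGroup (Pic X)) (_ : CommGroup (Ext1 G)),
      ((∀ L M : LinLineBundle G X, ∃ N, LinLineBundle.IsTensor L M N) ∧
        ∀ L M N : LinLineBundle G X, LinLineBundle.IsTensor L M N →
          PicG.mk L * PicG.mk M = PicG.mk N) ∧
      ((∀ L M : LineBundle X, ∃ N, LineBundle.IsTensor L M N) ∧
        ∀ L M N : LineBundle X, LineBundle.IsTensor L M N →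
          Pic.mk L * Pic.mk M = Pic.mk N) ∧
      ((∀ A B : GmExt G, ∃ C, GmExt.IsBaerSum A B C) ∧
        ∀ A B C : GmExt G, GmExt.IsBaerSum A B C → Ext1.mk A * Ext1.mk B = Ext1.mk C) ∧
      ∃ PicInv : Subgroup (Pic X),
        (∀ L : LineBundle X, Pic.mk L ∈ PicInv ↔ IsInvariant G L) ∧
        ∃ (κ : GrpHom G →* PicG G X) (α : PicG G X →* PicInv) (ε : PicInv →* Ext1 G),
          (∀ χ : GrpHom G, ∃ L : LinLineBundle G X,
            LinLineBundle.IsTrivialTwist χ.hom.hom L ∧ κ χ = PicG.mk L) ∧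
          (∀ L : LinLineBundle G X, (α (PicG.mk L) : Pic X) = Pic.mk L.toLineBundle) ∧
          (∀ (L : LineBundle X) (hL : Pic.mk L ∈ PicInv),
            (∃ A : GmExt G, GmExt.IsLiftingGroup L A) ∧
            ∀ A : GmExt G, GmExt.IsLiftingGroup L A → ε ⟨Pic.mk L, hL⟩ = Ext1.mk A) ∧
          Function.Injective κ ∧ κ.range = α.ker ∧ α.range = ε.ker := by
  have := isIso_appTop_of_units hunits
  exact exists_exact_sequence G X
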